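/- Let $F$ be a field and let $G$ be a finite simple cubic (3-regular) graph on the vertex set $\{1,\dots,n\}$, with a fixed planar embedding and with edge weights $w(e)\in F\setminus\{0\}$. Its undirected determinant is $$\operatorname{u-det} G=(-1)^n\sum_{c}(-1)^{|c|}\prod_{e\in c}w(e),$$ where $c$ runs over the cycle covers of $G$ (spanning subgraphs in which all vertices have degree $2$) and $|c|$ is the number of connected components of $c$. A cycle $c$ of $G$ is central if $G\setminus V(c)$ has a perfect matching. An even cycle is oddly oriented by an orientation of the edges of $G$ if, for either direction of traversal of the cycle, the number of its edges directed along the traversal is odd. The orientation is semi-Pfaffian if every central cycle of length $2k$ is oddly oriented if and only if $k$ is odd. A vertex $v$ of a cycle $c$ is an out-vertex if its edge that is not in $c$ lies on the unbounded side of $c$; the tension of an even cycle is the absolute value of the difference between the numbers of out-vertices in the two colour classes of the cycle. $G$ is without tension if every even central cycle has tension $0$. For an orientation of $G$ let $A$ be the skew-symmetric matrix with $a_{ij}=w(e)$, $a_{ji}=-w(e)$ for each edge $e$ directed from $i$ to $j$, and with all other entries $0$; let $A_{inv}$ be obtained from $A$ by inverting the nonzero entries; and let $p$ be the product of the weights of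 all the edges. (1) If $G$ is without tension and the orientation is semi-Pfaffian, then, up to sign, $$\operatorname{u-det} G = p\cdot\operatorname{Pf}(A_{inv}).$$ (2) There is a polynomial time algorithm which computes $\operatorname{u-det} G$ for every cubic planar graph $G$ without tension, with nonzero weights, given together with a semi-Pfaffian orientation. Here polynomial time means: over an arbitrary field, a number of steps (including arithmetic operations in $F$, at unit cost) that is polynomial in $n$; over $F=\mathbb Q$, also a bit cost that is polynomial in the bit length of the input. (3) Every bipartite cubic planar graph has a semi-Pfaffian orientation, and it is without tension for every planar embedding. There is an algorithm, polynomial time in the same sense, which computes $\operatorname{u-det} G$ for every bipartite cubic planar graph $G$ with nonzero weights, given the weighted graph alone. -/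

import Mathlib

noncomputable section

namespace UDet

/-! ## Weighted graphs, cycle covers, the undirected determinant

Graphs are simple graphs on the vertex set `Fin n`; a weight is a function on unordered pairs, of
which only the values on the edges of the graph matter. -/

/-- Every vertex has degree `3`. -/
def IsCubic {n : ℕ} (G : SimpleGraph (Fin n)) : Prop :=
  ∀ v, (G.neighborSet v).ncard = 3

/-- The finite set of edges of `G`. -/
def edges {n : ℕ} (G : SimpleGraph (Fin n)) : Finset (Sym2 (Fin n)) :=
  G.edgeSet.toFinite.toFinset

open scoped Classical in
/-- The cycle covers of `G`: spanning subgraphs (given by their edge sets) all of whose vertices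
have degree `2`. -/
def cycleCovers {n : ℕ} (G : SimpleGraph (Fin n)) : Finset (Finset (Sym2 (Fin n))) :=
  (edges G).powerset.filter fun c => ∀ v : Fin n, (c.filter fun e => v ∈ e).card = 2

/-- The number of connected components of the spanning subgraph with edge set `c`. -/
def numComponents {n : ℕ} (c : Finset (Sym2 (Fin n))) : ℕ :=
  Nat.card (SimpleGraph.fromEdgeSet (c : Set (Sym2 (Fin n)))).ConnectedComponent

/-- The undirected determinant. -/
def udet {F : Type*} [CommRing F] {n : ℕ} (G : SimpleGraph (Fin n)) (w : Sym2 (Fin n) → F) : F :=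
  (-1) ^ n * ∑ c ∈ cycleCovers G, (-1) ^ numComponents c * ∏ e ∈ c, w e

/-- All edges have nonzero weight. -/
def NonzeroWeights {F : Type*} [Zero F] {n : ℕ} (G : SimpleGraph (Fin n))
    (w : Sym2 (Fin n) → F) : Prop :=
  ∀ e ∈ G.edgeSet, w e ≠ 0

/-- The product of the weights of all the edges. -/
def weightProd {F : Type*} [CommMonoid F] {n : ℕ} (G : SimpleGraph (Fin n))
    (w : Sym2 (Fin n) → F) : F :=
  ∏ e ∈ edges G, w e

/-! ## Orientations, the skew symmetric adjacency matrix and its Pfaffian -/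

/-- An orientation of `G`: each edge `{u, v}` gets exactly one of the directions `u → v`,
`v → u`. -/
structure EdgeOrientation {n : ℕ} (G : SimpleGraph (Fin n)) where
  /-- `dir u v` : there is an edge directed from `u` to `v`. -/
  dir : Fin n → Fin n → Prop
  adj_iff : ∀ u v, G.Adj u v ↔ dir u v ∨ dir v u
  asymm : ∀ u v, dir u v → ¬ dir v u

open scoped Classical in
/-- The skew symmetric adjacency matrix of a weighted graph with an orientation. -/
def skewAdj {F : Type*} [Ring F] {n : ℕ} {G : SimpleGraph (Fin n)} (o : EdgeOrientation G)
    (w : Sym2 (Fin n) → F) : Matrix (Fin n) (Fin n) F :=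
  Matrix.of fun i j => if o.dir i j then w s(i, j) else if o.dir j i then - w s(i, j) else 0

open scoped Classical in
/-- The matrix whose nonzero entries are the inverses of the nonzero entries of `A`. -/
def entrywiseInv {F : Type*} [Field F] {n : ℕ} (A : Matrix (Fin n) (Fin n) F) :
    Matrix (Fin n) (Fin n) F :=
  Matrix.of fun i j => if A i j = 0 then 0 else (A i j)⁻¹

/-- The permutations that list a perfect matching `{i₁, j₁}, {i₂, j₂}, …` of `Fin n` (`n` even)
in the order `i₁, j₁, i₂, j₂, …`, normalized by `iₖ < jₖ` and `i₁ < i₂ < …`; each perfect matching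
of the complete graph is listed by exactly one of them. -/
def IsMatchingListing {n : ℕ} (σ : Equiv.Perm (Fin n)) : Prop :=
  (∀ k : Fin (n / 2), σ ⟨2 * k, by omega⟩ < σ ⟨2 * k + 1, by omega⟩) ∧
  (∀ k l : Fin (n / 2), k < l → σ ⟨2 * k, by omega⟩ < σ ⟨2 * l, by omega⟩)

open scoped Classical in
/-- The Pfaffian of a (skew symmetric) matrix: the signed sum over perfect matchings. -/
def pfaffian {R : Type*} [CommRing R] {n : ℕ} (A : Matrix (Fin n) (Fin n) R) : R :=
  if Even n then
    ∑ σ : Equiv.Perm (Fin n) with IsMatchingListing σ,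
      ((Equiv.Perm.sign σ : ℤ) : R) *
        ∏ k : Fin (n / 2), A (σ ⟨2 * k, by omega⟩) (σ ⟨2 * k + 1, by omega⟩)
  else 0

/-! ## Semi-Pfaffian orientations

A cycle is a closed walk without repetitions (`SimpleGraph.Walk.IsCycle`); every cycle is met once
for each choice of starting point and direction of traversal. -/

/-- A cycle is central if the graph without the vertices of the cycle has a perfect matching. -/
def IsCentral {n : ℕ} {G : SimpleGraph (Fin n)} {v : Fin n} (p : G.Walk v v) : Prop :=
  ∃ M : (G.induce {u | u ∉ p.support}).Subgraph, M.IsPerfectMatching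

open scoped Classical in
/-- The number of edges of a walk that are directed in the direction of the traversal. -/
def EdgeOrientation.forward {n : ℕ} {G : SimpleGraph (Fin n)} (o : EdgeOrientation G) {u v : Fin n}
    (p : G.Walk u v) : ℕ :=
  p.darts.countP fun d => decide (o.dir d.fst d.snd)

/-- For either direction of traversal, the number of edges directed in the direction of the
traversal is odd. -/
def EdgeOrientation.OddlyOriented {n : ℕ} {G : SimpleGraph (Fin n)} (o : EdgeOrientation G) {v : Fin n}
    (p : G.Walk v v) : Prop :=
  Odd (o.forward p) ∧ Odd (o.forward p.reverse)

/-- Every central cycle of length `2k` is oddly oriented if and only if `k` is odd. -/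
def EdgeOrientation.IsSemiPfaffian {n : ℕ} {G : SimpleGraph (Fin n)} (o : EdgeOrientation G) : Prop :=
  ∀ (v : Fin n) (p : G.Walk v v), p.IsCycle → IsCentral p →
    ∀ k : ℕ, p.length = 2 * k → (o.OddlyOriented p ↔ Odd k)

/-! ## Planar embeddings and tension -/

/-- The orbits of a permutation of the darts: the faces, when `f` is the face permutation. -/
def Faces {n : ℕ} {G : SimpleGraph (Fin n)} (f : Equiv.Perm G.Dart) : Type :=
  Quotient (Equiv.Perm.SameCycle.setoid f)

/-- An embedding of `G` in the oriented plane, up to homeomorphism, as a combinatorial map.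
`rot` sends a dart (an edge with a chosen tail) to the counterclockwise next dart with the
same tail; planarity is Euler's formula `V - E + F = 2 C` (each connected component has genus `0`),
where the faces are the orbits of "go to the other end, then rotate", and the sphere around an
isolated vertex, which carries no dart, has one face. -/
structure PlanarEmbedding {n : ℕ} (G : SimpleGraph (Fin n)) where
  /-- The rotation system. -/
  rot : Equiv.Perm G.Dart
  rot_fst : ∀ d, (rot d).fst = d.fst
  rot_cyclic : ∀ d e : G.Dart, d.fst = e.fst → rot.SameCycle d e
  euler : n + (Nat.card (Faces ((SimpleGraph.Dart.symm_involutive (G := G)).toPerm.trans rot)) +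
      {v | ∀ u, ¬ G.Adj v u}.ncard) =
    (edges G).card + 2 * Nat.card G.ConnectedComponent

/-- In a cubic graph with a planar embedding, the `i`-th vertex `v` of the cycle `p` (`i < p.length`)
has its third edge on the left of `p`: the counterclockwise next edge at `v` after the one
along which `p` leaves `v` is not the one along which `p` came to `v`. For one direction of
traversal of the cycle the left side is the bounded one, for the other it is the unbounded one. -/
def PlanarEmbedding.IsLeft {n : ℕ} {G : SimpleGraph (Fin n)} (m : PlanarEmbedding G) {v : Fin n}
    (p : G.Walk v v) (i : ℕ) : Prop :=
  ∃ d : G.Dart, d.fst = p.getVert i ∧ d.snd = p.getVert (i + 1) ∧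
    (m.rot d).snd ≠ p.getVert ((i + p.length - 1) % p.length)

open scoped Classical in
/-- The tension of an even cycle `p`: the absolute difference between the numbers of vertices in the
two colour classes of `p` (even and odd positions) whose third edge is on a given side of `p`.
Choosing the left side means taking the out-vertices for clockwise traversal and the in-vertices
for counterclockwise traversal, which gives the same number, as the colour classes have
the same size. -/
def PlanarEmbedding.tension {n : ℕ} {G : SimpleGraph (Fin n)} (m : PlanarEmbedding G) {v : Fin n}
    (p : G.Walk v v) : ℤ :=
  |(((Finset.range p.length).filter fun i => Even i ∧ m.IsLeft p i).card : ℤ) -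
    (((Finset.range p.length).filter fun i => Odd i ∧ m.IsLeft p i).card : ℤ)|

/-- The tension of every even central cycle is zero. -/
def PlanarEmbedding.WithoutTension {n : ℕ} {G : SimpleGraph (Fin n)} (m : PlanarEmbedding G) :
    Prop :=
  ∀ (v : Fin n) (p : G.Walk v v), p.IsCycle → Even p.length → IsCentral p → m.tension p = 0

/-! ## Algebraic random access machines

Programs with registers and indirectly addressed memory, both for natural numbers and for elements
of a field. The only arithmetic operations on natural numbers are addition and (truncated)
subtraction, so a number stays of polynomial bit length in polynomially many steps. All loops
are bounded by the value of a register, so every program halts, possibly after a very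
long time. The text of a program does not depend on the field, nor on the input. -/

/-- Programs. The arguments are names of registers, with the exception of `c` in `const a c`. -/
inductive Prog : Type
  /-- `a := c` for a constant `c` -/
  | const (a c : ℕ)
  /-- `a := b + c` -/
  | add (a b c : ℕ)
  /-- `a := b - c` (truncated) -/
  | sub (a b c : ℕ)
  /-- `a := memory[b]` -/
  | load (a b : ℕ)
  /-- `memory[a] := b` -/
  | store (a b : ℕ)
  /-- `a := 1` in the field -/
  | fone (a : ℕ)
  /-- `a := b + c` in the field -/
  | fadd (a b c : ℕ)
  /-- `a := b - c` in the field -/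
  | fsub (a b c : ℕ)
  /-- `a := b * c` in the field -/
  | fmul (a b c : ℕ)
  /-- `a := b / c` in the field -/
  | fdiv (a b c : ℕ)
  /-- `a := fieldMemory[b]`, the address `b` is a natural number register -/
  | fload (a b : ℕ)
  /-- `fieldMemory[a] := b`, the address `a` is a natural number register -/
  | fstore (a b : ℕ)
  /-- first `p`, then `q` -/
  | seq (p q : Prog)
  /-- if the natural number register `a` is zero then `p` else `q` -/
  | ifZero (a : ℕ) (p q : Prog)
  /-- if the field register `a` is zero then `p` else `q` -/
  | fifZero (a : ℕ) (p q : Prog)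
  /-- execute `p` as many times as the value of register `a` at the start of the loop -/
  | loop (a : ℕ) (p : Prog)

/-- The state of a machine, with the time elapsed so far. -/
structure State (F : Type*) where
  reg : ℕ → ℕ
  mem : ℕ → ℕ
  freg : ℕ → F
  fmem : ℕ → F
  time : ℕ

/-- Let `t` units of time pass. -/
def State.tick {F : Type*} (s : State F) (t : ℕ) : State F := { s with time := s.time + t }

/-- Write `x` to the field register `a`. -/
def State.setF {F : Type*} (s : State F) (a : ℕ) (x : F) : State F :=
  { s with freg := Function.update s.freg a x }

/-- Write `x` to the natural number register `a`. -/
def State.setN {F : Type*} (s : State F) (a x : ℕ) : State F :=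
  { s with reg := Function.update s.reg a x }

open scoped Classical in
/-- Execution. Each instruction takes one unit of time, and an instruction that handles field
elements takes in addition the sum of the sizes of the elements that it reads and writes. Each
test, each entry of a loop and each round of a loop also takes one unit of time. -/
def Prog.run {F : Type*} [Field F] (size : F → ℕ) : Prog → State F → State F
  | const a c, s => (s.setN a c).tick 1
  | add a b c, s => (s.setN a (s.reg b + s.reg c)).tick 1
  | sub a b c, s => (s.setN a (s.reg b - s.reg c)).tick 1
  | load a b, s => (s.setN a (s.mem (s.reg b))).tick 1
  | store a b, s => { s with mem := Function.update s.mem (s.reg a) (s.reg b) }.tick 1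
  | fone a, s => (s.setF a 1).tick (1 + size 1)
  | fadd a b c, s =>
    (s.setF a (s.freg b + s.freg c)).tick
      (1 + size (s.freg b) + size (s.freg c) + size (s.freg b + s.freg c))
  | fsub a b c, s =>
    (s.setF a (s.freg b - s.freg c)).tick
      (1 + size (s.freg b) + size (s.freg c) + size (s.freg b - s.freg c))
  | fmul a b c, s =>
    (s.setF a (s.freg b * s.freg c)).tick
      (1 + size (s.freg b) + size (s.freg c) + size (s.freg b * s.freg c))
  | fdiv a b c, s =>
    (s.setF a (s.freg b / s.freg c)).tick
      (1 + size (s.freg b) + size (s.freg c) + size (s.freg b / s.freg c))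
  | fload a b, s => (s.setF a (s.fmem (s.reg b))).tick (1 + size (s.fmem (s.reg b)))
  | fstore a b, s =>
    { s with fmem := Function.update s.fmem (s.reg a) (s.freg b) }.tick (1 + size (s.freg b))
  | seq p q, s => q.run size (p.run size s)
  | ifZero a p q, s =>
    if s.reg a = 0 then p.run size (s.tick 1) else q.run size (s.tick 1)
  | fifZero a p q, s =>
    if s.freg a = 0 then p.run size (s.tick (1 + size (s.freg a)))
    else q.run size (s.tick (1 + size (s.freg a)))
  | loop a p, s => (fun t => p.run size (t.tick 1))^[s.reg a] (s.tick 1)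

open scoped Classical in
/-- The initial state: register `0` holds `n`; for `i, j < n`, memory cell `i * n + j` holds `1` or
`0` according to whether `r i j` holds, and field memory cell `i * n + j` holds the weight of the
edge `{i, j}`, or `0` if there is no such edge. Everything else is `0`. -/
def input {F : Type*} [Field F] {n : ℕ} (G : SimpleGraph (Fin n)) (r : Fin n → Fin n → Prop)
    (w : Sym2 (Fin n) → F) : State F where
  reg := fun a => if a = 0 then n else 0
  mem := fun x => if ∃ i j : Fin n, x = i * n + j ∧ r i j then 1 else 0
  freg := fun _ => 0
  fmem := fun x => ∑ i : Fin n, ∑ j : Fin n,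
    if x = i * n + j ∧ G.Adj i j then w s(i, j) else 0
  time := 0

/-- The number of bits of a rational number (numerator and denominator in lowest terms). -/
def bitSize (x : ℚ) : ℕ := x.num.natAbs.size + x.den.size

/-- Given the graph `G` with arbitrary nonzero weights, and the relation `r` on its vertices (say, an
orientation of `G`), the program `P` leaves the undirected determinant of `G` in field register `0`.
The time is at most `q`, as a function of the number of vertices for arithmetic operations at
unit cost in an arbitrary field, and as a function of the bit length of the input for
bit costs in the field of rational numbers. -/
def ComputesUdetWithin.{u} (P : Prog) (q : Polynomial ℕ) {n : ℕ} (G : SimpleGraph (Fin n))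
    (r : Fin n → Fin n → Prop) : Prop :=
  (∀ (F : Type u) [Field F] (w : Sym2 (Fin n) → F), NonzeroWeights G w →
    (P.run (fun _ => 0) (input G r w)).freg 0 = udet G w ∧
    (P.run (fun _ => 0) (input G r w)).time ≤ q.eval n) ∧
  (∀ w : Sym2 (Fin n) → ℚ, NonzeroWeights G w →
    (P.run bitSize (input G r w)).freg 0 = udet G w ∧
    (P.run bitSize (input G r w)).time ≤ q.eval (n + ∑ e ∈ edges G, bitSize (w e)))

end UDet

end

open UDet

universe u

noncomputable section

namespace UDet

/-! ## Listings of perfect matchings -/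

section Listing

open Equiv Equiv.Perm

variable {n : ℕ}

/-! In a cubic graph the complement of a cycle cover is a perfect matching, and conversely. So
`udet` is a sum over perfect matchings `μ`, each with the sign `(-1) ^ (n + number of cycles of the
complement)`. Multiplying the term of `μ` in the Pfaffian of the inverted matrix by the product of
all weights cancels the inverse weights on `μ` and leaves the weight of the complementary cover. The
formula therefore says that the sign of the cover and the sign of the Pfaffian term agree up to a
factor that does not depend on `μ` (`sign_cover_mul_pfTerm`).

Any two perfect matchings are connected by switches along alternating cycles, one at a time
(`exists_isSwitch`), and each such cycle is central. Let its length be `2k`. A switch multiplies the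
sign of the Pfaffian term by `-(-1) ^ (number of forward edges)`, which is `(-1) ^ (k + 1)` for a
semi-Pfaffian orientation (`IsSwitch.pfTerm_switch`). It remains to see that the sign of the cover
changes by `(-1) ^ (k + 1)` as well (`IsSwitch.numComponents_switch`); here planarity and tension
enter.

The sign of a cover is the sign of a permutation that runs along its cycles, in arbitrary
directions. By Euler's formula every even edge set is the boundary of a set of faces
(`PlanarEmbedding.exists_dual_coloring`), so the directions can be chosen with the faces of colour
`1` on a fixed side. Adding the indicator of one side of the switching cycle to the colouring yields
a colouring for the other cover. Consequently the two runs agree on one side of the switching cycle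
and are opposite on the other side. In `switch_sign` the pieces of the runs off the cycle are closed
up by an involution `Θ` of the vertices of the cycle, which pairs the vertices where the run leaves
the cycle with those where it does not. The two closed permutations differ only by inversion on an
invariant set and so have equal signs. What remains are the products of `Θ` with the two matchings;
`Θ` cancels in their quotient, which is a rotation of the `k` even positions. For this `Θ` has to
stay on one side and to change the parity of positions, and tension zero is the counting condition
for such a `Θ` to exist.

For the algorithm the undetermined sign has to be found. Replacing a row of an alternating matrix,
and the column with it, changes the Pfaffian by a quotient of ordinary determinants
(`setRow_pfaffian_det`), without square roots. Keeping a single suitable entry in each row reduces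
the matrix to one perfect matching while the factor is recorded. The surviving matching has a
complementary cover whose signed weight is computed directly, and its multiple by the factor is
`udet`, sign included (`Reduced.udet_eq`). If the matrix is singular, the Pfaffian and `udet`
vanish. Determinants come from Bird's division free algorithm, which makes the intermediate
rationals short.

For bipartite graphs, directing all edges from one colour class to the other is semi-Pfaffian.
Tension zero is a count, with signs given by the colours, of the edges on one side of the cycle. The
algorithm for bipartite graphs finds such an orientation from connectivity by walks of even length.
-/

theorem perm_inv_apply {V : Type*} (σ : Perm V) (x : V) : σ⁻¹ (σ x) = x := σ.symm_apply_apply x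

theorem perm_apply_inv {V : Type*} (σ : Perm V) (x : V) : σ (σ⁻¹ x) = x := σ.apply_symm_apply x

/-- The positions `2 k` and `2 k + 1` as the pairs `(k, false)` and `(k, true)`. -/
def pairPos (n : ℕ) (x : Fin (n / 2) × Bool) : Fin n :=
  ⟨2 * x.1 + x.2.toNat, by have := x.1.2; have := Bool.toNat_lt x.2; omega⟩

theorem pairPos_injective (n : ℕ) : Function.Injective (pairPos n) := by
  rintro ⟨k, b⟩ ⟨l, c⟩ h
  have h := congrArg Fin.val h
  simp only [pairPos] at h
  have h1 := Bool.toNat_lt b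
  have h2 := Bool.toNat_lt c
  have h3 : k = l := Fin.ext (by omega)
  subst h3
  have h4 : b.toNat = c.toNat := by omega
  rw [show b = c by revert h4; cases b <;> cases c <;> simp]

/-- For even `n`, the pairing of the positions of a listing. -/
def pairEquiv (h : Even n) : Fin (n / 2) × Bool ≃ Fin n :=
  Equiv.ofBijective (pairPos n) ⟨pairPos_injective n, fun x => by
    have h2 : n / 2 * 2 = n := Nat.div_mul_cancel h.two_dvd
    refine ⟨(⟨x / 2, by have := x.2; omega⟩, decide (x.1 % 2 = 1)), Fin.ext ?_⟩
    simp only [pairPos]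
    rcases Nat.mod_two_eq_zero_or_one x.1 with h | h <;> simp [h] <;> omega⟩

theorem pairEquiv_apply (h : Even n) (x) : pairEquiv h x = pairPos n x := rfl

/-- The standard matching of the positions of a listing. -/
def stdMatching (h : Even n) : Perm (Fin n) :=
  (pairEquiv h).permCongr (Equiv.prodCongrRight fun _ => Equiv.boolNot)

theorem stdMatching_pairPos (h : Even n) (k b) :
    stdMatching h (pairPos n (k, b)) = pairPos n (k, !b) := by
  simp only [stdMatching, Equiv.permCongr_apply, ← pairEquiv_apply h, Equiv.symm_apply_apply]
  rfl

/-- The fixed point free involutions, that is the perfect matchings of the complete graph. -/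
def IsMatchingPerm {V : Type*} (μ : Perm V) : Prop := (∀ v, μ (μ v) = v) ∧ ∀ v, μ v ≠ v

theorem isMatchingPerm_std (h : Even n) : IsMatchingPerm (stdMatching h) := by
  refine ⟨fun v => ?_, fun v => ?_⟩ <;> obtain ⟨⟨k, b⟩, rfl⟩ := (pairEquiv h).surjective v
  · simp [pairEquiv_apply, stdMatching_pairPos]
  · rw [pairEquiv_apply, stdMatching_pairPos]
    exact fun h => by simpa using pairPos_injective n h

theorem IsMatchingPerm.conj {V : Type*} {μ : Perm V} (hμ : IsMatchingPerm μ) (σ : Perm V) :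
    IsMatchingPerm (σ * μ * σ⁻¹) := by
  refine ⟨fun v => ?_, fun v => ?_⟩
  · simp [hμ.1]
  · simp only [Perm.mul_apply]
    intro h
    exact hμ.2 (σ⁻¹ v) (by rw [Perm.eq_inv_iff_eq]; exact h)

variable {R : Type*} [CommRing R]

/-- The term of the Pfaffian that belongs to the listing `σ`. -/
def listTerm (A : Matrix (Fin n) (Fin n) R) (σ : Perm (Fin n)) : R :=
  ((sign σ : ℤ) : R) * ∏ k : Fin (n / 2), A (σ (pairPos n (k, false))) (σ (pairPos n (k, true)))

/-- A matrix is alternating. -/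
def IsAlt (A : Matrix (Fin n) (Fin n) R) : Prop := (∀ x y, A x y = - A y x) ∧ ∀ x, A x x = 0

/-- A permutation that commutes with the pairing of positions permutes the pairs and flips some of
them. Permuting the pairs moves both positions of a pair alike, so it is even and only reorders the
product; each flip changes both the sign of the permutation and the sign of one entry. -/
theorem listTerm_mul_of_commute (h : Even n) {A : Matrix (Fin n) (Fin n) R} (hA : IsAlt A)
    (σ ρ : Perm (Fin n)) (hρ : ∀ x, ρ (stdMatching h x) = stdMatching h (ρ x)) :
    listTerm A (σ * ρ) = listTerm A σ := by
  set e := pairEquiv h with he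
  set τ : Perm (Fin (n / 2) × Bool) := e.symm.permCongr ρ with hτ
  have hτe : ∀ x, e (τ x) = ρ (e x) := fun x => by simp [hτ, Equiv.permCongr_apply]
  have hτn : ∀ k b, τ (k, !b) = ((τ (k, b)).1, !(τ (k, b)).2) := fun k b => by
    apply e.injective
    rw [hτe, he, pairEquiv_apply, ← stdMatching_pairPos h, hρ, ← pairEquiv_apply h, ← he, ← hτe]
    exact stdMatching_pairPos h _ _
  set r : Fin (n / 2) → Fin (n / 2) := fun k => (τ (k, false)).1 with hr
  have hr1 : ∀ k b, (τ (k, b)).1 = r k := by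
    intro k b
    cases b
    · rfl
    · rw [show true = !false from rfl, hτn]
  have hrb : Function.Bijective r := by
    rw [← Finite.injective_iff_bijective]
    intro k l hkl
    by_cases hb : (τ (k, false)).2 = (τ (l, false)).2
    · exact (Prod.ext_iff.1 (τ.injective (Prod.ext hkl hb))).1
    · have : τ (k, false) = τ (l, true) := by
        rw [show true = !false from rfl, hτn]
        refine Prod.ext hkl ?_
        revert hb
        cases (τ (k, false)).2 <;> cases (τ (l, false)).2 <;> simp
      exact (Prod.ext_iff.1 (τ.injective this)).1
  set rr : Perm (Fin (n / 2)) := Equiv.ofBijective r hrb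
  set fl : Fin (n / 2) → Perm Bool := fun k => if (τ (k, false)).2 then Equiv.boolNot else 1
  -- Flips inside the pairs, followed by a permutation of the pairs; the latter acts once for each
  -- Boolean, so its sign is a square.
  have hdec : τ = Equiv.prodCongrLeft (fun _ : Bool => rr) * Equiv.prodCongrRight fl := by
    ext ⟨k, b⟩ : 1
    have : τ (k, b) = (r k, fl k b) := by
      refine Prod.ext (hr1 k b) ?_
      cases b
      · by_cases hb : (τ (k, false)).2 <;> simp [fl, hb]
      · rw [show true = !false from rfl, hτn]
        by_cases hb : (τ (k, false)).2 <;> simp [fl, hb]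
    rw [this]
    rfl
  have hsign : sign ρ = ∏ k, sign (fl k) := by
    rw [← sign_permCongr e.symm ρ, ← hτ, hdec, Perm.sign_mul, sign_prodCongrLeft, sign_prodCongrRight]
    simp [Int.units_sq]
  have hbn : sign Equiv.boolNot = -1 := by decide
  have hprod : ∏ k : Fin (n / 2), A ((σ * ρ) (pairPos n (k, false))) ((σ * ρ) (pairPos n (k, true)))
      = ∏ k, (((sign (fl k) : ℤ) : R) *
        A (σ (pairPos n (r k, false))) (σ (pairPos n (r k, true)))) := by
    refine Finset.prod_congr rfl fun k _ => ?_
    have h0 : ρ (pairPos n (k, false)) = e (τ (k, false)) := (hτe _).symm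
    have h1 : ρ (pairPos n (k, true)) = e (τ (k, !false)) := (hτe _).symm
    rw [Perm.mul_apply, Perm.mul_apply, h0, h1, hτn]
    have h2 : τ (k, false) = (r k, (τ (k, false)).2) := rfl
    rw [h2]
    by_cases hb : (τ (k, false)).2
    · simp only [hb, fl, if_true, hbn]
      rw [hA.1]
      simp [he, pairEquiv_apply]
    · simp [hb, fl, he, pairEquiv_apply]
  rw [listTerm, listTerm, hprod, Finset.prod_mul_distrib,
    hrb.prod_comp fun k => A (σ (pairPos n (k, false))) (σ (pairPos n (k, true))), Perm.sign_mul, hsign]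
  have h1 : (((∏ k, sign (fl k) : ℤˣ) : ℤ) : R) * ∏ k, ((sign (fl k) : ℤ) : R) = 1 := by
    have : ((∏ k, sign (fl k) : ℤˣ) : ℤ) * ((∏ k, sign (fl k) : ℤˣ) : ℤ) = 1 := by
      rw [← Units.val_mul, Int.units_mul_self]; rfl
    have h2 := congrArg (Int.cast : ℤ → R) this
    rw [Int.cast_mul, Int.cast_one] at h2
    calc _ = (((∏ k, sign (fl k) : ℤˣ) : ℤ) : R) * (((∏ k, sign (fl k) : ℤˣ) : ℤ) : R) := by
            congr 1; rw [Units.coe_prod, Int.cast_prod]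
      _ = 1 := h2
  rw [Units.val_mul, Int.cast_mul]
  linear_combination (((sign σ : ℤ) : R) *
    ∏ k : Fin (n / 2), A (σ (pairPos n (k, false))) (σ (pairPos n (k, true)))) * h1

/-- Two listings of the same matching differ by a permutation of the positions that commutes with
the standard pairing. -/
theorem listTerm_congr (h : Even n) {A : Matrix (Fin n) (Fin n) R} (hA : IsAlt A)
    {σ σ' : Perm (Fin n)}
    (hσ : σ * stdMatching h * σ⁻¹ = σ' * stdMatching h * σ'⁻¹) :
    listTerm A σ = listTerm A σ' := by
  have := listTerm_mul_of_commute h hA σ' (σ'⁻¹ * σ) fun x => by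
    have h1 := congrArg (fun τ : Perm (Fin n) => τ (σ x)) hσ
    simp only [Perm.mul_apply, perm_inv_apply] at h1
    simp only [Perm.mul_apply]
    rw [h1, perm_inv_apply]
  rwa [mul_inv_cancel_left] at this

/-- The normalization leaves one choice: the smaller ends of the pairs in increasing order, each
followed by its partner. -/
theorem exists_listing (h : Even n) {μ : Perm (Fin n)} (hμ : IsMatchingPerm μ) :
    ∃ σ : Perm (Fin n), IsMatchingListing σ ∧ σ * stdMatching h * σ⁻¹ = μ := by
  classical
  set S : Finset (Fin n) := Finset.univ.filter fun v => v < μ v with hS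
  have hcompl : Sᶜ = S.map μ.toEmbedding := by
    ext v
    simp only [hS, Finset.mem_compl, Finset.mem_filter, Finset.mem_univ, true_and,
      Finset.mem_map_equiv, not_lt]
    have hsym : μ.symm v = μ v := by rw [Equiv.symm_apply_eq, hμ.1]
    rw [hsym, hμ.1]
    exact ⟨fun h => lt_of_le_of_ne h (hμ.2 v), le_of_lt⟩
  have hcard : S.card = n / 2 := by
    have h1 := S.card_add_card_compl
    rw [hcompl, Finset.card_map, Fintype.card_fin] at h1
    omega
  set ι := S.orderEmbOfFin hcard with hι
  have hιS : ∀ k, ι k < μ (ι k) := fun k => by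
    have : ι k ∈ S := S.orderEmbOfFin_mem hcard k
    simpa [hS] using this
  set g : Fin (n / 2) × Bool → Fin n := fun x => if x.2 then μ (ι x.1) else ι x.1
  have hg : Function.Injective g := by
    rintro ⟨k, b⟩ ⟨l, c⟩ hkl
    have hk := hιS k
    have hl := hιS l
    cases b <;> cases c <;> simp only [g, if_true, if_false, Bool.false_eq_true] at hkl
    · rw [ι.injective hkl]
    · rw [hkl, hμ.1] at hk; exact absurd hk (lt_asymm hl)
    · rw [← hkl, hμ.1] at hl; exact absurd hl (lt_asymm hk)
    · rw [ι.injective (μ.injective hkl)]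
  have hbij : Function.Bijective (g ∘ (pairEquiv h).symm) :=
    Finite.injective_iff_bijective.1 (hg.comp (pairEquiv h).symm.injective)
  set σ : Perm (Fin n) := Equiv.ofBijective _ hbij
  have hσ : ∀ x, σ (pairPos n x) = g x := fun x => by
    show g ((pairEquiv h).symm (pairEquiv h x)) = g x
    rw [Equiv.symm_apply_apply]
  refine ⟨σ, ⟨fun k => ?_, fun k l hkl => ?_⟩, ?_⟩
  · have h0 := hσ (k, false)
    have h1 := hσ (k, true)
    simp only [pairPos, g, Bool.toNat_false, Bool.toNat_true, if_true, Bool.false_eq_true,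
      if_false, add_zero] at h0 h1
    rw [h0, h1]
    exact hιS k
  · have h0 := hσ (k, false)
    have h1 := hσ (l, false)
    simp only [pairPos, g, Bool.toNat_false, Bool.false_eq_true, if_false, add_zero] at h0 h1
    rw [h0, h1]
    exact ι.strictMono hkl
  · ext v : 1
    obtain ⟨u, rfl⟩ := σ.surjective v
    obtain ⟨⟨k, b⟩, rfl⟩ := (pairEquiv h).surjective u
    rw [Perm.mul_apply, Perm.mul_apply, perm_inv_apply, pairEquiv_apply, stdMatching_pairPos, hσ, hσ]
    cases b <;> simp [g, hμ.1]

/-- The first elements of the pairs form a strictly increasing sequence with range `{v | v < μ v}`,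
which determines them, and the matching determines the second elements. -/
theorem listing_unique (h : Even n) {σ σ' : Perm (Fin n)} (h1 : IsMatchingListing σ)
    (h2 : IsMatchingListing σ')
    (hσ : σ * stdMatching h * σ⁻¹ = σ' * stdMatching h * σ'⁻¹) : σ = σ' := by
  classical
  set μ := σ * stdMatching h * σ⁻¹ with hμ
  have key : ∀ τ : Perm (Fin n), IsMatchingListing τ → τ * stdMatching h * τ⁻¹ = μ →
      (∀ k, τ (pairPos n (k, true)) = μ (τ (pairPos n (k, false)))) ∧
      StrictMono (fun k => τ (pairPos n (k, false))) ∧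
      Set.range (fun k => τ (pairPos n (k, false))) = {v | v < μ v} := by
    intro τ hτ hτμ
    have e1 : ∀ k, τ (pairPos n (k, true)) = μ (τ (pairPos n (k, false))) := fun k => by
      rw [← hτμ]
      simp only [Perm.mul_apply, perm_inv_apply, stdMatching_pairPos]
      rfl
    have e2 : ∀ k, τ (pairPos n (k, false)) < μ (τ (pairPos n (k, false))) := fun k => by
      rw [← e1]; exact hτ.1 k
    have hμm : IsMatchingPerm μ := by rw [hμ]; exact (isMatchingPerm_std h).conj σ
    refine ⟨e1, fun k l hkl => hτ.2 k l hkl, ?_⟩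
    ext v
    simp only [Set.mem_range, Set.mem_ofPred_eq]
    constructor
    · rintro ⟨k, rfl⟩; exact e2 k
    · intro hv
      obtain ⟨u, rfl⟩ := τ.surjective v
      obtain ⟨⟨k, b⟩, rfl⟩ := (pairEquiv h).surjective u
      rw [pairEquiv_apply] at hv ⊢
      cases b
      · exact ⟨k, rfl⟩
      · rw [e1, hμm.1] at hv
        exact absurd hv (lt_asymm (e2 k))
  obtain ⟨a1, a2, a3⟩ := key σ h1 rfl
  obtain ⟨b1, b2, b3⟩ := key σ' h2 hσ.symm
  have hf : (fun k => σ (pairPos n (k, false))) = fun k => σ' (pairPos n (k, false)) :=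
    (StrictMono.range_inj a2 b2).1 (a3.trans b3.symm)
  ext v : 1
  obtain ⟨⟨k, b⟩, rfl⟩ := (pairEquiv h).surjective v
  rw [pairEquiv_apply]
  have := congrFun hf k
  cases b
  · exact this
  · rw [a1, b1]; exact congrArg μ this

open scoped Classical in
/-- The term of the Pfaffian that belongs to the matching `μ`. -/
def pfTerm (h : Even n) (A : Matrix (Fin n) (Fin n) R) (μ : Perm (Fin n)) : R :=
  if hμ : IsMatchingPerm μ then listTerm A (exists_listing h hμ).choose else 0

theorem pfTerm_eq (h : Even n) {A : Matrix (Fin n) (Fin n) R} (hA : IsAlt A)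
    (σ : Perm (Fin n)) : pfTerm h A (σ * stdMatching h * σ⁻¹) = listTerm A σ := by
  have hμ := (isMatchingPerm_std h).conj σ
  rw [pfTerm, dif_pos hμ]
  exact listTerm_congr h hA (exists_listing h hμ).choose_spec.2

-- Indexing the Pfaffian by involutions makes conjugation act on the summands and lets the same
-- index set serve for cycle covers.
open scoped Classical in
theorem pfaffian_eq_sum (h : Even n) {A : Matrix (Fin n) (Fin n) R} (hA : IsAlt A) :
    pfaffian A = ∑ μ : Perm (Fin n) with IsMatchingPerm μ, pfTerm h A μ := by
  rw [pfaffian, if_pos h]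
  refine Finset.sum_bij (fun σ _ => σ * stdMatching h * σ⁻¹) ?_ ?_ ?_ ?_
  · intro σ _
    simpa using (isMatchingPerm_std h).conj σ
  · intro σ hσ σ' hσ' e
    simp only [Finset.mem_filter, Finset.mem_univ, true_and] at hσ hσ'
    exact listing_unique h hσ hσ' e
  · intro μ hμ
    simp only [Finset.mem_filter, Finset.mem_univ, true_and] at hμ
    obtain ⟨σ, h1, h2⟩ := exists_listing h hμ
    exact ⟨σ, by simpa using h1, h2⟩
  · intro σ _
    rw [pfTerm_eq h hA]
    rfl

end Listing

end UDet

end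


noncomputable section

namespace UDet

/-! ## Row operations on the Pfaffian -/

section RowOperations

open Equiv Equiv.Perm Matrix

variable {n : ℕ} {R : Type*} [CommRing R]

/-- Replace row `i` by `b` and column `i` by `-b`. -/
def setRow (A : Matrix (Fin n) (Fin n) R) (i : Fin n) (b : Fin n → R) : Matrix (Fin n) (Fin n) R :=
  Matrix.of fun x y => if x = i then (if y = i then 0 else b y) else if y = i then - b x else A x y

theorem IsAlt.setRow {A : Matrix (Fin n) (Fin n) R} (hA : IsAlt A) (i : Fin n) (b : Fin n → R) :
    IsAlt (setRow A i b) := by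
  refine ⟨fun x y => ?_, fun x => ?_⟩
  · by_cases hx : x = i <;> by_cases hy : y = i <;> simp [UDet.setRow, hx, hy, hA.1 x y]
  · by_cases hx : x = i <;> simp [UDet.setRow, hx, hA.2]

theorem setRow_self {A : Matrix (Fin n) (Fin n) R} (hA : IsAlt A) (i : Fin n) :
    setRow A i (A i) = A := by
  ext x y
  by_cases hx : x = i <;> by_cases hy : y = i
  · simp [setRow, hx, hy, hA.2]
  · simp [setRow, hx, hy]
  · subst hy; simp [setRow, hx, hA.1 x y]
  · simp [setRow, hx, hy]

/-- The index `i` belongs to exactly one pair of the listing, so exactly one factor of the term sees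
the new row. -/
theorem listTerm_setRow (A : Matrix (Fin n) (Fin n) R) (h : Even n) (i : Fin n) (σ : Perm (Fin n)) :
    ∃ (y : Fin n) (C : R), ∀ b, listTerm (setRow A i b) σ = b y * C := by
  obtain ⟨⟨k₀, c⟩, hk⟩ := (pairEquiv h).surjective (σ.symm i)
  rw [pairEquiv_apply, Equiv.eq_symm_apply] at hk
  have hrest : ∀ k ∈ Finset.univ.erase k₀, ∀ b, setRow A i b (σ (pairPos n (k, false)))
      (σ (pairPos n (k, true))) = A (σ (pairPos n (k, false))) (σ (pairPos n (k, true))) := by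
    intro k hkk b
    have hne : ∀ d, σ (pairPos n (k, d)) ≠ i := fun d hd => by
      rw [← hk] at hd
      exact (Finset.mem_erase.1 hkk).1 (Prod.ext_iff.1 (pairPos_injective n (σ.injective hd))).1
    simp [setRow, hne]
  have hne : σ (pairPos n (k₀, !c)) ≠ i := fun hd => by
    rw [← hk] at hd
    have := (Prod.ext_iff.1 (pairPos_injective n (σ.injective hd))).2
    simp at this
  refine ⟨σ (pairPos n (k₀, !c)), ((sign σ : ℤ) : R) * ((if c then -1 else 1) *
    ∏ k ∈ Finset.univ.erase k₀, A (σ (pairPos n (k, false))) (σ (pairPos n (k, true)))), fun b => ?_⟩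
  rw [listTerm, ← Finset.mul_prod_erase _ _ (Finset.mem_univ k₀),
    Finset.prod_congr rfl fun k hkk => hrest k hkk b]
  cases c
  · simp only [Bool.not_false] at hne
    simp only [setRow, of_apply, hk, hne, Bool.not_false, Bool.false_eq_true, if_false, if_true]
    ring
  · simp only [Bool.not_true] at hne
    simp only [setRow, of_apply, hk, hne, Bool.not_true, if_false, if_true]
    ring

/-- The Pfaffian is a linear functional of one row when the mirrored column moves along; `C`
collects the coefficients. -/
theorem pfaffian_setRow (h : Even n) {A : Matrix (Fin n) (Fin n) R} (hA : IsAlt A) (i : Fin n) :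
    ∃ C : Fin n → R, ∀ b, pfaffian (setRow A i b) = b ⬝ᵥ C := by
  classical
  have key : ∀ μ : Perm (Fin n), ∃ C : Fin n → R, ∀ b,
      pfTerm h (setRow A i b) μ = b ⬝ᵥ C := fun μ => by
    by_cases hμ : IsMatchingPerm μ
    · obtain ⟨y, c, hy⟩ := listTerm_setRow A h i (exists_listing h hμ).choose
      refine ⟨Pi.single y c, fun b => ?_⟩
      rw [pfTerm, dif_pos hμ, hy, dotProduct_single]
    · exact ⟨0, fun b => by rw [pfTerm, dif_neg hμ, dotProduct_zero]⟩
  choose C hC using key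
  refine ⟨∑ μ : Perm (Fin n) with IsMatchingPerm μ, C μ, fun b => ?_⟩
  rw [pfaffian_eq_sum h (hA.setRow i b), dotProduct_sum]
  exact Finset.sum_congr rfl fun μ _ => hC μ b

/-- Conjugation by the transposition of `i` and `j` cancels the terms in pairs. The matchings that
it fixes pair `i` with `j`, and their terms contain the entry `A i j = 0`; hence the argument is
valid in characteristic two. -/
theorem pfaffian_eq_zero_of_row_eq (h : Even n) {A : Matrix (Fin n) (Fin n) R} (hA : IsAlt A)
    {i j : Fin n} (hij : i ≠ j) (hrow : A i = A j) : pfaffian A = 0 := by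
  classical
  set s := Equiv.swap i j with hs
  have hAij : A i j = 0 := by rw [hrow, hA.2]
  have hrow' : ∀ x y, A (s x) y = A x y := fun x y => by
    rcases eq_or_ne x i with rfl | hx
    · rw [hs, Equiv.swap_apply_left, hrow]
    · rcases eq_or_ne x j with rfl | hy
      · rw [hs, Equiv.swap_apply_right, hrow]
      · rw [hs, Equiv.swap_apply_of_ne_of_ne hx hy]
  have hA2 : ∀ x y, A (s x) (s y) = A x y := fun x y => by
    rw [hrow', hA.1, hrow', ← hA.1]
  have hss : s * s = 1 := Equiv.swap_mul_self i j
  have hterm : ∀ μ : Perm (Fin n), IsMatchingPerm μ →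
      pfTerm h A (s * μ * s) = - pfTerm h A μ := by
    intro μ hμ
    obtain ⟨σ, -, rfl⟩ := exists_listing h hμ
    have : s * (σ * stdMatching h * σ⁻¹) * s = (s * σ) * stdMatching h * (s * σ)⁻¹ := by
      rw [_root_.mul_inv_rev, hs, Equiv.swap_inv]; simp only [mul_assoc]
    rw [this, pfTerm_eq h hA, pfTerm_eq h hA, listTerm, listTerm, Perm.sign_mul, hs,
      sign_swap hij, ← hs]
    simp [hA2]
  rw [pfaffian_eq_sum h hA]
  refine Finset.sum_involution (fun μ _ => s * μ * s) ?_ ?_ ?_ ?_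
  · intro μ hμ
    rw [hterm μ (by simpa using hμ), add_neg_cancel]
  · intro μ hμ hne heq
    simp only [Finset.mem_filter, Finset.mem_univ, true_and] at hμ
    apply hne
    have h1 : μ i = j := by
      by_contra hij'
      have h2 := congrArg (fun τ : Perm (Fin n) => τ i) heq
      simp only [Perm.mul_apply, hs, Equiv.swap_apply_left] at h2
      have h3 : μ j ≠ j := hμ.2 j
      rcases eq_or_ne (μ j) i with h4 | h4
      · rw [← h4, hμ.1] at hij'; exact hij' rfl
      · rw [Equiv.swap_apply_of_ne_of_ne h4 h3] at h2
        exact hij (μ.injective h2).symm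
    obtain ⟨σ, -, rfl⟩ := exists_listing h hμ
    rw [pfTerm_eq h hA, listTerm]
    obtain ⟨⟨k₀, c⟩, hk⟩ := (pairEquiv h).surjective (σ.symm i)
    rw [pairEquiv_apply, Equiv.eq_symm_apply] at hk
    rw [← hk, Perm.mul_apply, Perm.mul_apply, perm_inv_apply, stdMatching_pairPos] at h1
    rw [Finset.prod_eq_zero (Finset.mem_univ k₀), mul_zero]
    cases c
    · rw [Bool.not_false] at h1
      rw [h1, hk, hAij]
    · rw [Bool.not_true] at h1
      rw [h1, hk, hA.1, hAij, neg_zero]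
  · intro μ hμ
    simp only [Finset.mem_filter, Finset.mem_univ, true_and] at hμ ⊢
    have := hμ.conj s
    rwa [hs, Equiv.swap_inv, ← hs] at this
  · intro μ _
    calc s * (s * μ * s) * s = (s * s) * μ * (s * s) := by simp only [mul_assoc]
      _ = μ := by rw [hss, one_mul, mul_one]

/-- The linear functional of row `i` vanishes on each other row of `A`, since it would produce two
equal rows. Only the coefficient of row `i` itself survives. -/
theorem pfaffian_setRow_vecMul (h : Even n) {A : Matrix (Fin n) (Fin n) R} (hA : IsAlt A)
    (i : Fin n) (u : Fin n → R) : pfaffian (setRow A i (u ᵥ* A)) = u i * pfaffian A := by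
  obtain ⟨C, hC⟩ := pfaffian_setRow h hA i
  have h1 : ∀ l, A l ⬝ᵥ C = if l = i then pfaffian A else 0 := fun l => by
    rw [← hC]
    split_ifs with hl
    · rw [hl, setRow_self hA]
    · refine pfaffian_eq_zero_of_row_eq h (hA.setRow i (A l)) (Ne.symm hl) ?_
      ext y
      by_cases hy : y = i <;> simp [setRow, hl, hy, hA.2]
  have h2 : u ᵥ* A ⬝ᵥ C = u ⬝ᵥ (A *ᵥ C) := (dotProduct_mulVec u A C).symm
  rw [hC, h2]
  have h3 : A *ᵥ C = Pi.single i (pfaffian A) := by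
    ext l
    rw [mulVec, h1, Pi.single_apply]
  rw [h3, dotProduct_single]

variable {F : Type*} [Field F]

/-- A left null vector `u` with `u i ≠ 0` replaces row `i` by zero, which multiplies the Pfaffian by
`u i`. -/
theorem pfaffian_eq_zero_of_det_eq_zero (h : Even n) {A : Matrix (Fin n) (Fin n) F} (hA : IsAlt A)
    (hd : A.det = 0) : pfaffian A = 0 := by
  obtain ⟨u, hu, hu0⟩ := exists_vecMul_eq_zero_iff.2 hd
  obtain ⟨i, hi⟩ := Function.ne_iff.1 hu
  have h1 := pfaffian_setRow_vecMul h hA i u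
  obtain ⟨C, hC⟩ := pfaffian_setRow h hA i
  rw [hu0, hC, zero_dotProduct] at h1
  exact (mul_eq_zero.1 h1.symm).resolve_left hi

/-- With `u = b A⁻¹` and `U` the identity matrix with row `i` replaced by `u`, the new matrix is `U
A Uᵀ`, and `U A` is `A` with only its row replaced. The Pfaffian is thus multiplied by `det U`, a
quotient of determinants, and the determinant by its square. This is how ratios of Pfaffians, with
their signs, become computable. -/
theorem setRow_pfaffian_det (h : Even n) {A : Matrix (Fin n) (Fin n) F} (hA : IsAlt A)
    (hd : A.det ≠ 0) (i : Fin n) (b : Fin n → F) :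
    pfaffian (setRow A i b) * A.det = (A.updateRow i b).det * pfaffian A ∧
    (setRow A i b).det * A.det = (A.updateRow i b).det ^ 2 := by
  set u := b ᵥ* A⁻¹ with hu
  have hub : u ᵥ* A = b := by
    rw [hu, vecMul_vecMul, nonsing_inv_mul A (isUnit_iff_ne_zero.2 hd), vecMul_one]
  set U := (1 : Matrix (Fin n) (Fin n) F).updateRow i u with hU
  have hUdet : U.det = u i := by
    have h2 := det_updateRow_sum (1 : Matrix (Fin n) (Fin n) F) i u
    rw [hU]
    have h3 : (∑ k, u k • (1 : Matrix (Fin n) (Fin n) F) k) = u := by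
      ext y
      rw [Finset.sum_apply, Finset.sum_eq_single y] <;> simp +contextual
    rw [h3] at h2
    simpa using h2
  have hUA : U * A = A.updateRow i b := by
    ext x y
    by_cases hx : x = i
    · subst hx
      rw [updateRow_self, ← hub]
      simp [hU, Matrix.mul_apply, vecMul, dotProduct]
    · rw [updateRow_ne hx, Matrix.mul_apply, hU]
      simp [updateRow_ne hx, Matrix.one_apply]
  have hN : (A.updateRow i b).det = u i * A.det := by rw [← hUA, det_mul, hUdet]
  have hS : setRow A i b = U * A * Uᵀ := by
    ext x y
    rw [hUA, Matrix.mul_apply]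
    by_cases hy : y = i
    · subst hy
      have h1 : ∀ z, Uᵀ z y = u z := fun z => by simp [hU]
      simp only [h1]
      by_cases hx : x = y
      · subst hx
        simp only [updateRow_self, setRow, of_apply, if_true]
        have h2 : ∑ z, b z * u z = b ⬝ᵥ u := rfl
        -- The terms at `(x, y)` and `(y, x)` cancel and the diagonal is zero, so no division by two
        -- is needed.
        have h3 : ∀ v : Fin n → F, (v ᵥ* A) ⬝ᵥ v = 0 := by
          intro v
          simp only [dotProduct, vecMul, Finset.sum_mul]
          have := Finset.sum_involution (s := (Finset.univ : Finset (Fin n × Fin n)))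
            (f := fun p => v p.1 * A p.1 p.2 * v p.2) (fun p _ => (p.2, p.1))
            (fun p _ => by
              show v p.1 * A p.1 p.2 * v p.2 + v p.2 * A p.2 p.1 * v p.1 = 0
              rw [hA.1 p.2 p.1]; ring)
            (fun p _ hp he => hp (by
              have : p.2 = p.1 := (Prod.ext_iff.1 he).1
              simp only [this, hA.2]; ring))
            (fun p _ => Finset.mem_univ _) (fun p _ => rfl)
          rw [← this, Fintype.sum_prod_type_right]
        rw [h2, ← hub, h3]
      · simp only [updateRow_ne hx, setRow, of_apply, hx, if_false, if_true]
        rw [← hub, vecMul, dotProduct, ← Finset.sum_neg_distrib]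
        exact Finset.sum_congr rfl fun z _ => by rw [hA.1 x z]; ring
    · have h1 : ∀ z, Uᵀ z y = if z = y then 1 else 0 := fun z => by
        simp [hU, updateRow_ne hy, Matrix.one_apply, eq_comm]
      simp only [h1, mul_ite, mul_one, mul_zero, Finset.sum_ite_eq', Finset.mem_univ, if_true]
      by_cases hx : x = i
      · subst hx; simp [setRow, hy]
      · simp [setRow, hx, hy]
  constructor
  · have := pfaffian_setRow_vecMul h hA i u
    rw [hub] at this
    rw [this, hN]; ring
  · rw [hS, det_mul, det_transpose, det_mul, hUdet, hN]; ring

end RowOperations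

end UDet

end


noncomputable section

namespace UDet

/-! ## Planarity: even edge sets are boundaries of sets of faces -/

section Planarity

open Matrix Module

variable {n : ℕ} {G : SimpleGraph (Fin n)}

theorem zmod_two_cases (a : ZMod 2) : a = 0 ∨ a = 1 := by revert a; decide

theorem zmod_two_add_self (a : ZMod 2) : a + a = 0 := by revert a; decide

theorem zmod_two_eq_of_add {a b : ZMod 2} (h : a + b = 0) : a = b := by revert a b; decide

theorem exists_dart_of_mem_edgeSet (e : G.edgeSet) : ∃ d : G.Dart, d.edge = e.1 := by
  obtain ⟨e, he⟩ := e
  induction e with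
  | _ u v => exact ⟨⟨(u, v), he⟩, rfl⟩

open scoped Classical in
theorem sum_darts_at (v : Fin n) (x : Sym2 (Fin n) → ZMod 2) :
    ∑ d : G.Dart with d.fst = v, x d.edge = ∑ e : G.edgeSet, if v ∈ e.1 then x e.1 else 0 := by
  rw [← Finset.sum_filter]
  refine Finset.sum_bij (fun d _ => ⟨d.edge, d.edge_mem⟩) ?_ ?_ ?_ ?_
  · intro d hd
    simp only [Finset.mem_filter, Finset.mem_univ, true_and] at hd ⊢
    rw [← hd]
    exact Sym2.mem_mk_left _ _
  · intro d hd d' hd' h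
    simp only [Finset.mem_filter, Finset.mem_univ, true_and] at hd hd'
    rcases (SimpleGraph.dart_edge_eq_iff d d').1 (congrArg Subtype.val h) with h | h
    · exact h
    · rw [h] at hd
      exact absurd (hd.trans hd'.symm) d'.adj.ne'
  · rintro ⟨e, he⟩ hv
    simp only [Finset.mem_filter, Finset.mem_univ, true_and] at hv
    obtain ⟨u, rfl⟩ := hv
    exact ⟨⟨(v, u), he⟩, by simp, rfl⟩
  · intros; rfl

-- Over the field with two elements, boundaries of sets of faces are even edge sets, and a count of
-- dimensions shows that all even edge sets arise. The space of even sets is the kernel of the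
-- incidence matrix. The kernel of the boundary map is no larger than the space of functions
-- constant on components permits, and Euler's formula makes the two dimensions meet.
open scoped Classical in
theorem PlanarEmbedding.exists_dual_coloring (m : PlanarEmbedding G) (x : Sym2 (Fin n) → ZMod 2)
    (hx : ∀ v, ∑ d : G.Dart with d.fst = v, x d.edge = 0) :
    ∃ ψ : G.Dart → ZMod 2, (∀ d, ψ (m.rot d.symm) = ψ d) ∧ ∀ d, ψ d + ψ d.symm = x d.edge := by
  classical
  set f := (SimpleGraph.Dart.symm_involutive (G := G)).toPerm.trans m.rot with hf
  have hfs : ∀ d : G.Dart, f d = m.rot d.symm := fun d => rfl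
  let face : G.Dart → Faces f := fun d => Quotient.mk (Equiv.Perm.SameCycle.setoid f) d
  have hface : ∀ d, face (f d) = face d := fun d =>
    Quotient.sound (s := Equiv.Perm.SameCycle.setoid f) (Equiv.Perm.SameCycle.refl f d).apply_left
  have hrot : ∀ d, face (m.rot d) = face d.symm := fun d => by
    rw [← hface d.symm, hfs, SimpleGraph.Dart.symm_symm]
  have : Finite (Faces f) := inferInstanceAs (Finite (Quotient _))
  have : Fintype (Faces f) := Fintype.ofFinite _
  choose D hD using exists_dart_of_mem_edgeSet (G := G)
  let bd : (Faces f → ZMod 2) →ₗ[ZMod 2] (G.edgeSet → ZMod 2) :=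
    { toFun := fun φ e => φ (face (D e)) + φ (face (D e).symm)
      map_add' := fun φ φ' => by ext e; simp only [Pi.add_apply]; ring
      map_smul' := fun a φ => by ext e; simp only [Pi.smul_apply, smul_eq_mul, RingHom.id_apply]; ring }
  have hbd : ∀ φ d, φ (face d) + φ (face d.symm) = bd φ ⟨d.edge, d.edge_mem⟩ := by
    intro φ d
    show _ = φ (face (D _)) + φ (face (D _).symm)
    rcases (SimpleGraph.dart_edge_eq_iff d (D ⟨d.edge, d.edge_mem⟩)).1
        (hD ⟨d.edge, d.edge_mem⟩).symm with h | h
    · rw [← h]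
    · rw [← show d.symm = D ⟨d.edge, d.edge_mem⟩ by
        conv_lhs => rw [h]
        rw [SimpleGraph.Dart.symm_symm], SimpleGraph.Dart.symm_symm, add_comm]
  let N : Matrix (Fin n) G.edgeSet (ZMod 2) := Matrix.of fun v e => if v ∈ e.1 then 1 else 0
  have hNx : ∀ (y : G.edgeSet → ZMod 2) (v : Fin n), (N *ᵥ y) v =
      ∑ e : G.edgeSet, if v ∈ e.1 then y e else 0 := fun y v => by
    simp [mulVec, dotProduct, N]
  have hNt : ∀ (h : Fin n → ZMod 2) (u v : Fin n) (huv : G.Adj u v),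
      (Nᵀ *ᵥ h) ⟨s(u, v), huv⟩ = h u + h v := fun h u v huv => by
    simp only [mulVec, dotProduct, N, transpose_apply, of_apply, Sym2.mem_iff, ite_mul, one_mul,
      zero_mul]
    rw [← Finset.sum_filter, Finset.filter_or, Finset.filter_eq' , Finset.filter_eq']
    simp [Finset.sum_pair huv.ne]
  -- the image of the boundary map consists of even sets
  have hle : LinearMap.range bd ≤ LinearMap.ker N.mulVecLin := by
    rintro _ ⟨φ, rfl⟩
    rw [LinearMap.mem_ker]
    ext v
    rw [mulVecLin_apply, hNx, Pi.zero_apply]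
    have h1 := sum_darts_at (G := G) v fun e => if he : e ∈ G.edgeSet then bd φ ⟨e, he⟩ else 0
    have h2 : ∀ e : G.edgeSet, (if he : e.1 ∈ G.edgeSet then bd φ ⟨e.1, he⟩ else 0) = bd φ e :=
      fun e => by rw [dif_pos e.2]
    simp only [h2] at h1
    rw [← h1]
    have h3 : ∀ d : G.Dart, (if he : d.edge ∈ G.edgeSet then bd φ ⟨d.edge, he⟩ else 0) =
        φ (face d) + φ (face (m.rot d)) := fun d => by
      rw [dif_pos d.edge_mem, ← hbd, hrot]
    rw [Finset.sum_congr rfl fun d _ => h3 d, Finset.sum_add_distrib]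
    have h4 : ∑ d : G.Dart with d.fst = v, φ (face (m.rot d)) =
        ∑ d : G.Dart with d.fst = v, φ (face d) :=
      Finset.sum_equiv m.rot (fun d => by simp [m.rot_fst]) fun _ _ => rfl
    rw [h4, zmod_two_add_self]
  -- dimensions
  have hK : finrank (ZMod 2) (LinearMap.ker Nᵀ.mulVecLin) ≤ Nat.card G.ConnectedComponent := by
    let T : LinearMap.ker Nᵀ.mulVecLin →ₗ[ZMod 2] (G.ConnectedComponent → ZMod 2) :=
      { toFun := fun h c => h.1 c.out
        map_add' := fun _ _ => rfl
        map_smul' := fun _ _ => rfl }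
    have hT : Function.Injective T := by
      have hconst : ∀ h ∈ LinearMap.ker Nᵀ.mulVecLin, ∀ u v, G.Reachable u v → h u = h v := by
        rintro h hh u v ⟨p⟩
        induction p with
        | nil => rfl
        | cons huv _ ih =>
          rw [← ih]
          apply zmod_two_eq_of_add
          rw [← hNt h _ _ huv]
          exact congrFun (LinearMap.mem_ker.1 hh) _
      intro h h' hhh
      ext v
      have hv : G.Reachable (G.connectedComponentMk v).out v :=
        SimpleGraph.ConnectedComponent.exact (Quot.out_eq _)
      rw [← hconst h.1 h.2 _ _ hv, ← hconst h'.1 h'.2 _ _ hv]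
      exact congrFun hhh (G.connectedComponentMk v)
    have := LinearMap.finrank_le_finrank_of_injective hT
    rwa [finrank_fintype_fun_eq_card, ← Nat.card_eq_fintype_card] at this
  let Iso : Set (Fin n) := {v | ∀ u, ¬ G.Adj v u}
  have hdart : ∀ v, v ∉ Iso → ∃ d : G.Dart, d.fst = v := fun v hv => by
    simp only [Iso, Set.mem_ofPred_eq, not_forall, not_not] at hv
    obtain ⟨u, hu⟩ := hv
    exact ⟨⟨(v, u), hu⟩, rfl⟩
  choose dt hdt using hdart
  have hconst : ∀ φ ∈ LinearMap.ker bd, ∀ d d' : G.Dart, d.fst = d'.fst →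
      φ (face d) = φ (face d') := by
    intro φ hφ d d' hdd
    have h1 : ∀ d, φ (face (m.rot d)) = φ (face d) := fun d => by
      rw [hrot]
      refine (zmod_two_eq_of_add ?_).symm
      rw [hbd]
      exact congrFun (LinearMap.mem_ker.1 hφ) _
    obtain ⟨i, hi⟩ := (m.rot_cyclic d d' hdd).exists_nat_pow_eq
    have h2 : ∀ i : ℕ, φ (face ((m.rot ^ i) d)) = φ (face d) := fun i => by
      induction i with
      | zero => rfl
      | succ i ih => rw [pow_succ', Equiv.Perm.mul_apply, h1, ih]
    rw [← hi, h2]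
  -- A face function without boundary does not change around a vertex or across an edge, so it
  -- descends to a function of the nonisolated vertices that is constant along edges. The values at
  -- isolated vertices, which carry no dart, are free.
  have hker : finrank (ZMod 2) (LinearMap.ker bd) + Iso.ncard ≤
      finrank (ZMod 2) (LinearMap.ker Nᵀ.mulVecLin) := by
    let T : (LinearMap.ker bd × (Iso → ZMod 2)) →ₗ[ZMod 2] (Fin n → ZMod 2) :=
      { toFun := fun p v => if hv : v ∈ Iso then p.2 ⟨v, hv⟩ else p.1.1 (face (dt v hv))
        map_add' := fun p q => by
          ext v; by_cases hv : v ∈ Iso <;> simp [hv]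
        map_smul' := fun a p => by
          ext v; by_cases hv : v ∈ Iso <;> simp [hv] }
    have hTd : ∀ p (d : G.Dart), T p d.fst = p.1.1 (face d) := fun p d => by
      have hv : d.fst ∉ Iso := fun h => h d.snd d.adj
      show dite _ _ _ = _
      rw [dif_neg hv]
      exact hconst _ p.1.2 _ _ (hdt _ hv)
    have hTi : Function.Injective T := by
      intro p q hpq
      refine Prod.ext (Subtype.ext (funext fun c => ?_)) (funext fun v => ?_)
      · induction c using Quotient.ind with
        | _ d => exact (hTd p d).symm.trans ((congrFun hpq d.fst).trans (hTd q d))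
      · have h1 : ∀ p, T p v.1 = p.2 v := fun p => by
          show dite _ _ _ = _
          rw [dif_pos v.2]
        rw [← h1, ← h1, hpq]
    have hTr : ∀ p, T p ∈ LinearMap.ker Nᵀ.mulVecLin := fun p => by
      rw [LinearMap.mem_ker]
      ext ⟨e, he⟩
      induction e with
      | _ u v =>
        rw [mulVecLin_apply, hNt _ _ _ he, Pi.zero_apply]
        let d : G.Dart := ⟨(u, v), he⟩
        have h1 : T p u = p.1.1 (face d) := hTd p d
        have h2 : T p v = p.1.1 (face d.symm) := hTd p d.symm
        rw [h1, h2, hbd]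
        exact congrFun (LinearMap.mem_ker.1 p.1.2) _
    have := LinearMap.finrank_le_finrank_of_injective
      (f := T.codRestrict (LinearMap.ker Nᵀ.mulVecLin) hTr)
      fun p q h => hTi (congrArg Subtype.val h)
    rwa [finrank_prod, finrank_fintype_fun_eq_card, ← Nat.card_eq_fintype_card,
      Nat.card_coe_set_eq] at this
  have hE : (edges G).card = Fintype.card G.edgeSet := by
    rw [edges, ← Set.ncard_eq_toFinset_card, ← Nat.card_coe_set_eq, Nat.card_eq_fintype_card]
  have hr1 := LinearMap.finrank_range_add_finrank_ker N.mulVecLin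
  have hr2 := LinearMap.finrank_range_add_finrank_ker Nᵀ.mulVecLin
  have hr3 := LinearMap.finrank_range_add_finrank_ker bd
  have hr4 : finrank (ZMod 2) (LinearMap.range Nᵀ.mulVecLin) =
      finrank (ZMod 2) (LinearMap.range N.mulVecLin) := rank_transpose N
  rw [finrank_fintype_fun_eq_card] at hr1 hr2 hr3
  rw [Fintype.card_fin] at hr2
  have heuler := m.euler
  rw [← hf, Nat.card_eq_fintype_card (α := Faces f), hE] at heuler
  change n + (_ + Iso.ncard) = _ at heuler
  -- Rank and nullity for the incidence matrix, its transpose and the boundary map, combined with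
  -- Euler's formula, give the missing inequality of dimensions.
  have heq : LinearMap.range bd = LinearMap.ker N.mulVecLin :=
    Submodule.eq_of_le_of_finrank_le hle (by omega)
  have hxm : (fun e : G.edgeSet => x e.1) ∈ LinearMap.range bd := by
    rw [heq, LinearMap.mem_ker]
    ext v
    rw [mulVecLin_apply, hNx, ← sum_darts_at]
    exact hx v
  obtain ⟨φ, hφ⟩ := hxm
  refine ⟨fun d => φ (face d), fun d => congrArg φ (hface d), fun d => ?_⟩
  rw [hbd, hφ]

end Planarity

end UDet

end


noncomputable section

namespace UDet

/-! ## Signs of permutations -/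

section PermSigns

open Equiv Equiv.Perm
open scoped Classical

variable {V : Type*}

/-- A cyclic sequence without repetitions. -/
structure IsCyclicSeq {V : Type*} (f : ℕ → V) (N : ℕ) : Prop where
  pos : 0 < N
  periodic : ∀ i, f (i + N) = f i
  inj : ∀ i < N, ∀ j < N, f i = f j → i = j

theorem IsCyclicSeq.apply_mod {V : Type*} {f : ℕ → V} {N : ℕ} (hf : IsCyclicSeq f N) (i : ℕ) :
    f (i % N) = f i := by
  conv_rhs => rw [← Nat.mod_add_div i N]
  generalize i / N = q
  induction q with
  | zero => simp
  | succ q ih => rw [Nat.mul_succ, ← add_assoc, hf.periodic, ih]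

theorem IsCyclicSeq.eq_iff {V : Type*} {f : ℕ → V} {N : ℕ} (hf : IsCyclicSeq f N) (i j : ℕ) :
    f i = f j ↔ i % N = j % N := by
  constructor
  · intro h
    rw [← hf.apply_mod i, ← hf.apply_mod j] at h
    exact hf.inj _ (Nat.mod_lt _ hf.pos) _ (Nat.mod_lt _ hf.pos) h
  · intro h
    rw [← hf.apply_mod i, h, hf.apply_mod]

theorem IsCyclicSeq.even_iff {V : Type*} {f : ℕ → V} {k : ℕ} (hf : IsCyclicSeq f (2 * k)) {i j : ℕ}
    (h : f i = f j) : Even i ↔ Even j := by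
  have := (hf.eq_iff i j).1 h
  rw [Nat.even_iff, Nat.even_iff, ← Nat.mod_mul_right_mod i 2 k, this, Nat.mod_mul_right_mod]

theorem IsCyclicSeq.exists_lt {V : Type*} {f : ℕ → V} {N : ℕ} (hf : IsCyclicSeq f N) {v : V}
    (hv : v ∈ Set.range f) : ∃ i < N, f i = v := by
  obtain ⟨i, rfl⟩ := hv
  exact ⟨i % N, Nat.mod_lt _ hf.pos, hf.apply_mod i⟩

/-- The enumeration of a cyclic sequence. -/
def IsCyclicSeq.equiv {V : Type*} {f : ℕ → V} {N : ℕ} (hf : IsCyclicSeq f N) :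
    Fin N ≃ {v // v ∈ Set.range f} :=
  Equiv.ofBijective (fun i => ⟨f i, i, rfl⟩)
    ⟨fun i j h => Fin.ext (hf.inj i i.2 j j.2 (congrArg Subtype.val h)), fun ⟨v, hv⟩ => by
      obtain ⟨i, hi, rfl⟩ := hf.exists_lt hv
      exact ⟨⟨i, hi⟩, rfl⟩⟩

theorem IsCyclicSeq.exists_rotation [Fintype V] {f : ℕ → V} {N : ℕ} (hf : IsCyclicSeq f N) :
    ∃ r : Perm V, (∀ i, r (f i) = f (i + 1)) ∧ (∀ v, v ∉ Set.range f → r v = v) ∧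
      sign r = (-1) ^ (N - 1) := by
  refine ⟨(finRotate N).extendDomain hf.equiv, fun i => ?_, fun v hv => ?_, ?_⟩
  · obtain ⟨M, rfl⟩ : ∃ M, N = M + 1 := ⟨N - 1, by have := hf.pos; omega⟩
    set j : Fin (M + 1) := ⟨i % (M + 1), Nat.mod_lt _ hf.pos⟩ with hj
    have h1 : f i = (hf.equiv j : V) := (hf.apply_mod i).symm
    rw [h1, Perm.extendDomain_apply_image]
    show f _ = _
    rw [hf.eq_iff]
    rcases eq_or_ne j (Fin.last M) with h | h
    · rw [h, finRotate_last]
      have h2 := congrArg Fin.val h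
      simp only [hj, Fin.val_last] at h2
      rw [Nat.add_mod, h2]
      rcases M.eq_zero_or_pos with h0 | h0
      · subst h0; simp
      · simp [Nat.mod_eq_of_lt (show 1 < M + 1 by omega)]
    · rw [coe_finRotate_of_ne_last h, hj]
      simp
  · exact Perm.extendDomain_apply_not_subtype _ _ hv
  · rw [sign_extendDomain, sign_finRotate]

theorem IsCyclicSeq.sign_rotation [Fintype V] {f : ℕ → V} {N : ℕ} (hf : IsCyclicSeq f N) {r : Perm V}
    (h1 : ∀ i, r (f i) = f (i + 1)) (h2 : ∀ v, v ∉ Set.range f → r v = v) :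
    sign r = (-1) ^ (N - 1) := by
  obtain ⟨r', h1', h2', hs⟩ := hf.exists_rotation
  rw [← hs]
  congr 1
  ext v : 1
  by_cases hv : v ∈ Set.range f
  · obtain ⟨i, rfl⟩ := hv
    rw [h1, h1']
  · rw [h2 v hv, h2' v hv]

/-- The permutation that agrees with `g` on the invariant set `S` and is the identity elsewhere. -/
def restr (g : Perm V) (S : Set V) (h : ∀ v, g v ∈ S ↔ v ∈ S) : Perm V :=
  ofSubtype (p := (· ∈ S)) (g.subtypePerm h)

theorem restr_of_mem {g : Perm V} {S : Set V} {h : ∀ v, g v ∈ S ↔ v ∈ S} {v : V} (hv : v ∈ S) :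
    restr g S h v = g v := ofSubtype_apply_of_mem (p := (· ∈ S)) _ hv

theorem restr_of_notMem {g : Perm V} {S : Set V} {h : ∀ v, g v ∈ S ↔ v ∈ S} {v : V} (hv : v ∉ S) :
    restr g S h v = v := ofSubtype_apply_of_not_mem (p := (· ∈ S)) _ hv

theorem sign_restr_union [Fintype V] {g : Perm V} {S T U : Set V} (hS : ∀ v, g v ∈ S ↔ v ∈ S)
    (hT : ∀ v, g v ∈ T ↔ v ∈ T) (hU : ∀ v, g v ∈ U ↔ v ∈ U) (hST : ∀ v ∈ S, v ∉ T)
    (hcov : ∀ v, v ∈ U ↔ v ∈ S ∨ v ∈ T) :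
    sign (restr g U hU) = sign (restr g S hS) * sign (restr g T hT) := by
  rw [← Perm.sign_mul]
  congr 1
  ext v : 1
  rw [Perm.mul_apply]
  by_cases h1 : v ∈ S
  · rw [restr_of_mem ((hcov v).2 (Or.inl h1)), restr_of_notMem (hST v h1), restr_of_mem h1]
  · by_cases h2 : v ∈ T
    · have h3 : g v ∉ S := fun h => h1 ((hS v).1 h)
      rw [restr_of_mem ((hcov v).2 (Or.inr h2)), restr_of_mem h2, restr_of_notMem h3]
    · rw [restr_of_notMem (fun h => ((hcov v).1 h).elim h1 h2), restr_of_notMem h2,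
        restr_of_notMem h1]

/-- Split `ρ` into its parts on `S` and off `S`; `ρ'` has the second part and the inverse of the
first. -/
theorem sign_eq_of_reverse_on [Fintype V] {ρ ρ' : Perm V} {S : Set V} (hS : ∀ v, ρ v ∈ S ↔ v ∈ S)
    (h0 : ∀ v, v ∉ S → ρ' v = ρ v) (h1 : ∀ v ∈ S, ρ' v ∈ S ∧ ρ (ρ' v) = v) : sign ρ' = sign ρ := by
  have hc : ∀ v, ρ v ∈ Sᶜ ↔ v ∈ Sᶜ := fun v => not_congr (hS v)
  have e1 : ρ = restr ρ Sᶜ hc * restr ρ S hS := by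
    ext v : 1
    rw [Perm.mul_apply]
    by_cases hv : v ∈ S
    · rw [restr_of_mem hv, restr_of_notMem]
      simpa using (hS v).2 hv
    · rw [restr_of_notMem hv, restr_of_mem (by simpa using hv)]
  have e2 : ρ' = restr ρ Sᶜ hc * (restr ρ S hS)⁻¹ := by
    ext v : 1
    rw [Perm.mul_apply]
    by_cases hv : v ∈ S
    · have h2 : (restr ρ S hS)⁻¹ v = ρ' v := by
        rw [Perm.inv_eq_iff_eq, restr_of_mem (h1 v hv).1, (h1 v hv).2]
      rw [h2, restr_of_notMem]
      simpa using (h1 v hv).1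
    · have h2 : (restr ρ S hS)⁻¹ v = v := by
        rw [Perm.inv_eq_iff_eq, restr_of_notMem hv]
      rw [h2, restr_of_mem (by simpa using hv), h0 v hv]
  conv_lhs => rw [e2]
  conv_rhs => rw [e1]
  rw [Perm.sign_mul, Perm.sign_mul, sign_inv]

theorem exists_perm_of_injective [Finite V] (g : V → V) (h : Function.Injective g) :
    ∃ ρ : Perm V, ∀ v, ρ v = g v :=
  ⟨Equiv.ofBijective g (Finite.injective_iff_bijective.1 h), fun _ => rfl⟩

/-- If two disjoint finite sets have equally many elements of every colour, there is an involution
that exchanges them and preserves the colours. -/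
theorem exists_exchange [Finite V] {K : Type*} (A B : Set V) (hAB : ∀ v ∈ A, v ∉ B) (a b : V → K)
    (hcard : ∀ κ, Nat.card {v : A // a v = κ} = Nat.card {v : B // b v = κ}) :
    ∃ Θ : Perm V, (∀ v, Θ (Θ v) = v) ∧ (∀ v ∈ A, Θ v ∈ B ∧ b (Θ v) = a v) ∧
      (∀ v ∈ B, Θ v ∈ A ∧ a (Θ v) = b v) := by
  have hf : ∀ κ, Nonempty ({v : A // a v = κ} ≃ {v : B // b v = κ}) := fun κ =>
    ⟨(Finite.card_eq.1 (hcard κ)).some⟩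
  let e : A ≃ B := Equiv.ofFiberEquiv (f := fun v : A => a v) (g := fun v : B => b v)
    fun κ => (hf κ).some
  have he : ∀ v : A, b (e v) = a v := fun v => Equiv.ofFiberEquiv_map
    (f := fun v : A => a v) (g := fun v : B => b v) (fun κ => (hf κ).some) v
  let g : V → V := fun v => if h : v ∈ A then e ⟨v, h⟩ else if h : v ∈ B then e.symm ⟨v, h⟩ else v
  have gA : ∀ v (h : v ∈ A), g v = e ⟨v, h⟩ := fun v h => dif_pos h
  have gB : ∀ v (h : v ∈ B), g v = e.symm ⟨v, h⟩ := fun v h => by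
    have h' : v ∉ A := fun h' => hAB v h' h
    simp only [g, dif_neg h', dif_pos h]
  have gg : Function.Involutive g := fun v => by
    by_cases hA : v ∈ A
    · rw [gA v hA, gB _ (e ⟨v, hA⟩).2]; simp
    · by_cases hB : v ∈ B
      · rw [gB v hB, gA _ (e.symm ⟨v, hB⟩).2]; simp
      · have : g v = v := by simp only [g, dif_neg hA, dif_neg hB]
        rw [this, this]
  refine ⟨gg.toPerm, gg, fun v hv => ?_, fun v hv => ?_⟩
  · show g v ∈ B ∧ b (g v) = a v
    rw [gA v hv]
    exact ⟨(e ⟨v, hv⟩).2, he _⟩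
  · show g v ∈ A ∧ a (g v) = b v
    rw [gB v hv]
    refine ⟨(e.symm ⟨v, hv⟩).2, ?_⟩
    rw [← he, Equiv.apply_symm_apply]

/-- The part of a permutation along the set `C`, compared with an exchange `Θ` of `S = Src` and
`C \ S`. -/
theorem sign_along [Fintype V] {π ρ Θ α : Perm V} {C S E : Set V} (hSC : S ⊆ C) (hEC : E ⊆ C)
    (hΘ : ∀ v, Θ (Θ v) = v) (hΘC : ∀ v, Θ v ∈ C ↔ v ∈ C)
    (hΘS : ∀ v ∈ C, Θ v ∈ S ↔ v ∉ S)
    (hα : ∀ v, α (α v) = v) (hαC : ∀ v, α v ∈ C ↔ v ∈ C)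
    (hαS : ∀ v ∈ C, α v ∈ S ↔ v ∉ S) (hαE : ∀ v ∈ C, α v ∈ E ↔ v ∉ E)
    (hπ : ∀ v ∈ C, v ∉ S → π v = α v)
    (hρ1 : ∀ v, v ∉ C ∨ v ∈ S → ρ v = π v) (hρ2 : ∀ v ∈ C, v ∉ S → ρ v = Θ v)
    (hgE : ∀ v, (Θ * α) v ∈ E ↔ v ∈ E) :
    sign π = sign ρ * sign (restr (Θ * α) E hgE) := by
  set g := Θ * α with hg
  have hgv : ∀ v, g v = Θ (α v) := fun v => rfl
  have hgC : ∀ v, g v ∈ C ↔ v ∈ C := fun v => by rw [hgv, hΘC, hαC]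
  have hgS : ∀ v ∈ C, g v ∈ S ↔ v ∈ S := fun v hv => by
    rw [hgv, hΘS _ ((hαC v).2 hv), hαS v hv, not_not]
  have hgS' : ∀ v, g v ∈ C \ S ↔ v ∈ C \ S := fun v => by
    simp only [Set.mem_sdiff, hgC]
    exact and_congr_right fun hv => not_congr (hgS v hv)
  -- Off `S`, the permutation `π` steps along `α`; applying `g = Θ α` and then `ρ = Θ` gives the
  -- same step because `Θ` is an involution.
  have hπκ : π = ρ * restr g (C \ S) hgS' := by
    ext v : 1
    rw [Perm.mul_apply]
    by_cases hv : v ∈ C \ S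
    · have h1 : α v ∈ S := (hαS v hv.1).2 hv.2
      have h2 : Θ (α v) ∈ C := (hΘC _).2 (hSC h1)
      have h3 : Θ (α v) ∉ S := fun h => (hΘS _ (hSC h1)).1 h h1
      rw [restr_of_mem hv, hgv, hρ2 _ h2 h3, hΘ, hπ v hv.1 hv.2]
    · rw [restr_of_notMem hv, hρ1]
      by_contra hcon
      rw [not_or, not_not] at hcon
      exact hv ⟨hcon.1, hcon.2⟩
  have hSE : ∀ v, g v ∈ S ∩ E ↔ v ∈ S ∩ E := fun v => by
    simp only [Set.mem_inter_iff, hgE]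
    exact and_congr_left fun h => hgS v (hEC h)
  have hCSE : ∀ v, g v ∈ (C \ S) ∩ E ↔ v ∈ (C \ S) ∩ E := fun v => by
    simp only [Set.mem_inter_iff, hgE, hgS']
  have hCSO : ∀ v, g v ∈ (C \ S) \ E ↔ v ∈ (C \ S) \ E := fun v =>
    and_congr (hgS' v) (not_congr (hgE v))
  have s1 := sign_restr_union hCSE hCSO hgS' (fun v h h' => h'.2 h.2) (fun v => by
    exact ⟨fun h => (em (v ∈ E)).imp (fun he => ⟨h, he⟩) fun he => ⟨h, he⟩,
      fun h => h.elim (fun h => h.1) fun h => h.1⟩)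
  have s2 := sign_restr_union hCSE hSE hgE (fun v h h' => h.1.2 h'.1) (fun v => by
    simp only [Set.mem_inter_iff, Set.mem_sdiff]
    exact ⟨fun h => (em (v ∈ S)).elim (fun hs => Or.inr ⟨hs, h⟩) fun hs => Or.inl ⟨⟨hEC h, hs⟩, h⟩,
      fun h => h.elim (fun h => h.2) fun h => h.2⟩)
  -- The involution `α` exchanges both `S` and `E` with their complements in `C`, and conjugates `Θ
  -- α` to its inverse. So the part of `g` at the odd positions off `S` has the same sign as the
  -- part at the even positions in `S`, and the two halves recombine to `g` on `E`.
  have hconj : restr g ((C \ S) \ E) hCSO = α * (restr g (S ∩ E) hSE)⁻¹ * α⁻¹ := by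
    have hαi : α⁻¹ = α := by
      rw [inv_eq_iff_mul_eq_one]; ext v : 1; exact hα v
    rw [hαi]
    ext v : 1
    rw [Perm.mul_apply, Perm.mul_apply]
    have hmem : v ∈ (C \ S) \ E ↔ α v ∈ S ∩ E := by
      constructor
      · rintro ⟨⟨h1, h2⟩, h3⟩
        exact ⟨(hαS v h1).2 h2, (hαE v h1).2 h3⟩
      · rintro ⟨h1, h2⟩
        have hv : v ∈ C := (hαC v).1 (hSC h1)
        exact ⟨⟨hv, (hαS v hv).1 h1⟩, (hαE v hv).1 h2⟩
    by_cases hv : v ∈ (C \ S) \ E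
    · rw [restr_of_mem hv]
      have h1 := hmem.1 hv
      have h2 : α (g v) ∈ S ∩ E := by
        have h3 := (hCSO v).2 hv
        exact ⟨(hαS _ h3.1.1).2 h3.1.2, (hαE _ h3.1.1).2 h3.2⟩
      have h3 : (restr g (S ∩ E) hSE)⁻¹ (α v) = α (g v) := by
        rw [Perm.inv_eq_iff_eq, restr_of_mem h2, hgv, hgv, hα, hΘ]
      rw [h3, hα]
    · rw [restr_of_notMem hv]
      have h3 : (restr g (S ∩ E) hSE)⁻¹ (α v) = α v := by
        rw [Perm.inv_eq_iff_eq, restr_of_notMem fun h => hv (hmem.2 h)]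
      rw [h3, hα]
  have s3 : sign (restr g ((C \ S) \ E) hCSO) = sign (restr g (S ∩ E) hSE) := by
    rw [hconj, Perm.sign_mul, Perm.sign_mul, sign_inv, sign_inv, mul_comm (sign α), mul_assoc,
      Int.units_mul_self, mul_one]
  conv_lhs => rw [hπκ, Perm.sign_mul, s1, s3, ← s2]

end PermSigns

end UDet

end


noncomputable section

namespace UDet

/-! ### The sign of a run along a cycle cover, before and after a switch. -/

section Switch

open Equiv Equiv.Perm
open scoped Classical

variable {V : Type*} [Fintype V]

-- Applied to one side of the switching cycle, with `p` for membership in `S` and `q` for an even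
-- position, it lets elements of `S` be matched with elements off `S` of opposite parity.
omit [Fintype V] in
theorem card_filter_of_balance (D : Finset V) (p q : V → Prop)
    (hp : (D.filter p).card = (D.filter fun v => ¬ p v).card)
    (hq : (D.filter q).card = (D.filter fun v => ¬ q v).card) :
    (D.filter fun v => p v ∧ q v).card = (D.filter fun v => ¬ p v ∧ ¬ q v).card ∧
    (D.filter fun v => p v ∧ ¬ q v).card = (D.filter fun v => ¬ p v ∧ q v).card := by
  have h1 := Finset.card_filter_add_card_filter_not (s := D.filter p) q
  have h2 := Finset.card_filter_add_card_filter_not (s := D.filter fun v => ¬ p v) q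
  have h3 := Finset.card_filter_add_card_filter_not (s := D.filter q) p
  have h4 := Finset.card_filter_add_card_filter_not (s := D.filter fun v => ¬ q v) p
  simp only [Finset.filter_filter] at h1 h2 h3 h4
  simp only [and_comm (a := q _), and_comm (a := ¬ q _)] at h3 h4
  omega

theorem IsCyclicSeq.card_even {f : ℕ → V} {k : ℕ} (hf : IsCyclicSeq f (2 * k)) (P : V → Prop)
    (Q : ℕ → Prop) (hQ : ∀ i j, f i = f j → (Q i ↔ Q j)) :
    (Finset.univ.filter fun v => P v ∧ ∃ i, f i = v ∧ Q i).card =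
      ((Finset.range (2 * k)).filter fun i => Q i ∧ P (f i)).card := by
  symm
  refine Finset.card_bij (fun i _ => f i) ?_ ?_ ?_
  · intro i hi
    simp only [Finset.mem_filter, Finset.mem_univ, true_and] at hi ⊢
    exact ⟨hi.2.2, i, rfl, hi.2.1⟩
  · intro i hi j hj h
    simp only [Finset.mem_filter, Finset.mem_range] at hi hj
    exact hf.inj i hi.1 j hj.1 h
  · intro v hv
    simp only [Finset.mem_filter, Finset.mem_univ, true_and] at hv
    obtain ⟨hP, i, rfl, hi⟩ := hv
    obtain ⟨j, hj, hji⟩ := hf.exists_lt ⟨i, rfl⟩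
    refine ⟨j, ?_, hji⟩
    simp only [Finset.mem_filter, Finset.mem_range]
    exact ⟨hj, (hQ _ _ hji).2 hi, hji ▸ hP⟩

/-- Replacing the edges of a matching `μ` along an alternating cycle `f` by those of `μ'` changes the
sign of the permutation that runs along the complementary cycle cover by `(-1) ^ (k + 1)`, if the
vertices of the cycle on each side of it are balanced. -/
theorem switch_sign {f : ℕ → V} {k : ℕ} (hf : IsCyclicSeq f (2 * k)) {μ μ' : Perm V}
    (hμ : ∀ v, μ (μ v) = v) (hμ' : ∀ v, μ' (μ' v) = v)
    (hμf : ∀ i, μ (f (2 * i)) = f (2 * i + 1)) (hμf' : ∀ i, μ' (f (2 * i + 1)) = f (2 * i + 2))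
    {π π' : Perm V} {C S S' D : Set V} (hC : C = Set.range f) (hSC : S ⊆ C) (hSC' : S' ⊆ C)
    (h1 : ∀ v, v ∉ C ∨ v ∈ S → (π v ∈ D ↔ v ∈ D) ∧ π v ∉ S)
    (h2 : ∀ v ∈ C, v ∉ S → π v = μ' v) (h2S : ∀ v ∈ C, μ' v ∈ S ↔ v ∉ S)
    (h2' : ∀ v ∈ C, v ∉ S' → π' v = μ v) (h2S' : ∀ v ∈ C, μ v ∈ S' ↔ v ∉ S')
    (hS0 : ∀ v ∈ C, v ∉ D → (v ∈ S' ↔ v ∈ S)) (hS1 : ∀ v ∈ C, v ∈ D → (v ∈ S' ↔ v ∉ S))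
    (h3 : ∀ v, v ∉ C ∨ v ∈ S → v ∉ D → π' v = π v)
    (h4 : ∀ v, v ∉ C ∨ v ∈ S → v ∈ D → π' (π v) = v)
    (hbal : ((Finset.range (2 * k)).filter fun i => Even i ∧ f i ∈ D).card =
      ((Finset.range (2 * k)).filter fun i => Odd i ∧ f i ∈ D).card) :
    sign π * sign π' = (-1) ^ (k + 1) := by
  -- In the application `C` is the set of vertices of the cycle, `S` and `S'` are the vertices from
  -- which `π` and `π'` leave the cycle, and `D` is one side of it. The runs agree off `D` and are
  -- opposite on `D`. `E` consists of the even positions, which both matchings exchange with the odd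
  -- ones.
  set E : Set V := {v | ∃ i, f i = v ∧ Even i} with hE
  have hEf : ∀ i, f i ∈ E ↔ Even i := fun i =>
    ⟨fun ⟨j, hj, he⟩ => (hf.even_iff hj).1 he, fun h => ⟨i, rfl, h⟩⟩
  have hfC : ∀ i, f i ∈ C := fun i => hC ▸ ⟨i, rfl⟩
  have hEC : E ⊆ C := by rintro _ ⟨i, rfl, -⟩; exact hfC i
  -- the two matchings on the cycle
  have hμo : ∀ i, μ (f (2 * i + 1)) = f (2 * i) := fun i => by rw [← hμf, hμ]
  have hμe' : ∀ i, μ' (f (2 * i + 2)) = f (2 * i + 1) := fun i => by rw [← hμf', hμ']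
  have hμE' : ∀ v ∈ C, μ' v ∈ C ∧ (μ' v ∈ E ↔ v ∉ E) := by
    rw [hC]
    rintro _ ⟨i, rfl⟩
    rw [← hC]
    rcases Nat.even_or_odd' i with ⟨j, rfl | rfl⟩
    · have h : f (2 * j) = f (2 * (j + k - 1) + 2) := by
        rw [← hf.periodic (2 * j)]; congr 1; have := hf.pos; omega
      rw [h, hμe', hEf, hEf]
      exact ⟨hfC _, by simp [parity_simps]⟩
    · rw [hμf', hEf, hEf]
      exact ⟨hfC _, by simp [parity_simps]⟩
  have hμE : ∀ v ∈ C, μ v ∈ C ∧ (μ v ∈ E ↔ v ∉ E) := by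
    rw [hC]
    rintro _ ⟨i, rfl⟩
    rw [← hC]
    rcases Nat.even_or_odd' i with ⟨j, rfl | rfl⟩
    · rw [hμf, hEf, hEf]
      exact ⟨hfC _, by simp [parity_simps]⟩
    · rw [hμo, hEf, hEf]
      exact ⟨hfC _, by simp [parity_simps]⟩
  have hμC' : ∀ v, μ' v ∈ C ↔ v ∈ C :=
    fun v => ⟨fun h => by have := (hμE' _ h).1; rwa [hμ'] at this, fun h => (hμE' v h).1⟩
  have hμC : ∀ v, μ v ∈ C ↔ v ∈ C :=
    fun v => ⟨fun h => by have := (hμE _ h).1; rwa [hμ] at this, fun h => (hμE v h).1⟩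
  -- cardinalities
  have hcardE : ∀ P : Prop, ((Finset.univ.filter fun v => v ∈ C ∧ (v ∈ D ↔ P)).filter (· ∈ E)).card =
      ((Finset.univ.filter fun v => v ∈ C ∧ (v ∈ D ↔ P)).filter fun v => ¬ v ∈ E).card := by
    have ce : ∀ P : V → Prop, (Finset.univ.filter fun v => P v ∧ v ∈ E).card =
        ((Finset.range (2 * k)).filter fun i => Even i ∧ P (f i)).card := fun P => by
      convert hf.card_even P Even fun i j => hf.even_iff
      rfl
    have co : ∀ P : V → Prop, (Finset.univ.filter fun v => P v ∧ v ∈ C ∧ v ∉ E).card =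
        ((Finset.range (2 * k)).filter fun i => Odd i ∧ P (f i)).card := fun P => by
      have h := hf.card_even P Odd fun i j h => by
        rw [← Nat.not_even_iff_odd, ← Nat.not_even_iff_odd, hf.even_iff h]
      refine Eq.trans (congrArg Finset.card ?_) (h.trans (by congr!))
      ext v
      simp only [Finset.mem_filter, Finset.mem_univ, true_and]
      refine and_congr_right fun _ => ⟨?_, ?_⟩
      · rw [hC]
        rintro ⟨⟨i, rfl⟩, h⟩
        exact ⟨i, rfl, by rwa [hEf, Nat.not_even_iff_odd] at h⟩
      · rintro ⟨i, rfl, h⟩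
        exact ⟨hfC i, by rwa [hEf, Nat.not_even_iff_odd]⟩
    have e1 := ce (fun v => v ∈ D)
    have e2 := ce (fun v => v ∉ D)
    have o1 := co (fun v => v ∈ D)
    have o2 := co (fun v => v ∉ D)
    -- `hbal` balances the parities inside `D`; since `μ` pairs even with odd positions on all of
    -- the cycle, they are balanced outside of `D` too.
    have hall : (Finset.univ.filter (· ∈ E)).card =
        (Finset.univ.filter fun v => v ∈ C ∧ v ∉ E).card := by
      refine Finset.card_bij (fun v _ => μ v) ?_ (fun v _ w _ h => μ.injective h) ?_
      · intro v hv
        simp only [Finset.mem_filter, Finset.mem_univ, true_and] at hv ⊢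
        have := hμE v (hEC hv)
        exact ⟨this.1, fun h => this.2.1 h hv⟩
      · intro v hv
        simp only [Finset.mem_filter, Finset.mem_univ, true_and] at hv
        exact ⟨μ v, by simpa using (hμE v hv.1).2.2 hv.2, hμ v⟩
    have a1 := Finset.card_filter_add_card_filter_not (s := Finset.univ.filter (· ∈ E)) (· ∈ D)
    have a2 := Finset.card_filter_add_card_filter_not
      (s := Finset.univ.filter fun v => v ∈ C ∧ v ∉ E) (· ∈ D)
    simp only [Finset.filter_filter] at a1 a2 ⊢
    simp only [and_comm (b := _ ∈ D), and_comm (b := ¬ _ ∈ D)] at a1 a2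
    intro P
    have hEC' : ∀ v, v ∈ E → v ∈ C := hEC
    by_cases hP : P
    · have x1 : (Finset.univ.filter fun v => (v ∈ C ∧ (v ∈ D ↔ P)) ∧ v ∈ E) =
          Finset.univ.filter fun v => v ∈ D ∧ v ∈ E := by
        ext v; have := hEC' v; simp only [Finset.mem_filter, hP, iff_true]; tauto
      have x2 : (Finset.univ.filter fun v => (v ∈ C ∧ (v ∈ D ↔ P)) ∧ ¬ v ∈ E) =
          Finset.univ.filter fun v => v ∈ D ∧ v ∈ C ∧ v ∉ E := by
        ext v; simp only [Finset.mem_filter, hP, iff_true]; tauto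
      rw [x1, x2]
      omega
    · have x1 : (Finset.univ.filter fun v => (v ∈ C ∧ (v ∈ D ↔ P)) ∧ v ∈ E) =
          Finset.univ.filter fun v => v ∉ D ∧ v ∈ E := by
        ext v; have := hEC' v; simp only [Finset.mem_filter, hP, iff_false]; tauto
      have x2 : (Finset.univ.filter fun v => (v ∈ C ∧ (v ∈ D ↔ P)) ∧ ¬ v ∈ E) =
          Finset.univ.filter fun v => v ∉ D ∧ v ∈ C ∧ v ∉ E := by
        ext v; simp only [Finset.mem_filter, hP, iff_false]; tauto
      rw [x1, x2]
      omega
  -- The run `π` injects `{v ∉ C or v ∈ S}` into `{v ∉ C or v ∉ S}` on each side, so `S` has at most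
  -- half of the vertices of the cycle on each side. As `μ'` exchanges `S` with its complement in
  -- `C`, equality holds on both sides.
  have hcardS : ∀ P : Prop, ((Finset.univ.filter fun v => v ∈ C ∧ (v ∈ D ↔ P)).filter (· ∈ S)).card =
      ((Finset.univ.filter fun v => v ∈ C ∧ (v ∈ D ↔ P)).filter fun v => ¬ v ∈ S).card := by
    have hle : ∀ P : Prop,
        ((Finset.univ.filter fun v => v ∈ C ∧ (v ∈ D ↔ P)).filter (· ∈ S)).card ≤
        ((Finset.univ.filter fun v => v ∈ C ∧ (v ∈ D ↔ P)).filter fun v => ¬ v ∈ S).card := by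
      intro P
      have hinj : (Finset.univ.filter fun v => (v ∉ C ∨ v ∈ S) ∧ (v ∈ D ↔ P)).card ≤
          (Finset.univ.filter fun v => (v ∉ C ∨ v ∉ S) ∧ (v ∈ D ↔ P)).card := by
        refine Finset.card_le_card_of_injOn π ?_ π.injective.injOn
        intro v hv
        simp only [Finset.coe_filter, Finset.mem_univ, true_and, Set.mem_ofPred_eq] at hv ⊢
        have := h1 v hv.1
        exact ⟨Or.inr this.2, this.1.trans hv.2⟩
      have a1 := Finset.card_filter_add_card_filter_not
        (s := Finset.univ.filter fun v => (v ∉ C ∨ v ∈ S) ∧ (v ∈ D ↔ P)) (· ∈ C)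
      have a2 := Finset.card_filter_add_card_filter_not
        (s := Finset.univ.filter fun v => (v ∉ C ∨ v ∉ S) ∧ (v ∈ D ↔ P)) (· ∈ C)
      simp only [Finset.filter_filter] at a1 a2 ⊢
      have x1 : (Finset.univ.filter fun v => ((v ∉ C ∨ v ∈ S) ∧ (v ∈ D ↔ P)) ∧ v ∈ C) =
          Finset.univ.filter fun v => (v ∈ C ∧ (v ∈ D ↔ P)) ∧ v ∈ S := by
        ext v; simp only [Finset.mem_filter]; tauto
      have x2 : (Finset.univ.filter fun v => ((v ∉ C ∨ v ∉ S) ∧ (v ∈ D ↔ P)) ∧ v ∈ C) =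
          Finset.univ.filter fun v => (v ∈ C ∧ (v ∈ D ↔ P)) ∧ ¬ v ∈ S := by
        ext v; simp only [Finset.mem_filter]; tauto
      have x3 : (Finset.univ.filter fun v => ((v ∉ C ∨ v ∈ S) ∧ (v ∈ D ↔ P)) ∧ ¬ v ∈ C) =
          Finset.univ.filter fun v => ((v ∉ C ∨ v ∉ S) ∧ (v ∈ D ↔ P)) ∧ ¬ v ∈ C := by
        ext v; simp only [Finset.mem_filter]; tauto
      rw [x1, x3] at a1
      rw [x2] at a2
      omega
    have hall : ((Finset.univ.filter (· ∈ C)).filter (· ∈ S)).card =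
        ((Finset.univ.filter (· ∈ C)).filter fun v => ¬ v ∈ S).card := by
      refine Finset.card_bij (fun v _ => μ' v) ?_ (fun v _ w _ h => μ'.injective h) ?_
      · intro v hv
        simp only [Finset.mem_filter, Finset.mem_univ, true_and] at hv ⊢
        exact ⟨(hμC' v).2 hv.1, fun h => (h2S v hv.1).1 h hv.2⟩
      · intro v hv
        simp only [Finset.mem_filter, Finset.mem_univ, true_and] at hv
        exact ⟨μ' v, by simpa using ⟨(hμC' v).2 hv.1, (h2S v hv.1).2 hv.2⟩, hμ' v⟩
    have hF : (Finset.univ.filter fun v => (v ∈ C ∧ v ∉ D) ∧ v ∈ S).card ≤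
        (Finset.univ.filter fun v => (v ∈ C ∧ v ∉ D) ∧ v ∉ S).card := by
      convert hle False using 2 <;> ext v <;> simp
    have hT : (Finset.univ.filter fun v => (v ∈ C ∧ v ∈ D) ∧ v ∈ S).card ≤
        (Finset.univ.filter fun v => (v ∈ C ∧ v ∈ D) ∧ v ∉ S).card := by
      convert hle True using 2 <;> ext v <;> simp
    have y : ∀ T : V → Prop, (Finset.univ.filter fun v => (v ∈ C ∧ v ∈ D) ∧ T v).card +
        (Finset.univ.filter fun v => (v ∈ C ∧ v ∉ D) ∧ T v).card =
        ((Finset.univ.filter (· ∈ C)).filter T).card := fun T => by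
      rw [← Finset.card_filter_add_card_filter_not (s := (Finset.univ.filter (· ∈ C)).filter T) (· ∈ D)]
      congr 2 <;> ext v <;> simp <;> tauto
    have y1 := y (· ∈ S)
    have y2 : (Finset.univ.filter fun v => (v ∈ C ∧ v ∈ D) ∧ v ∉ S).card +
        (Finset.univ.filter fun v => (v ∈ C ∧ v ∉ D) ∧ v ∉ S).card =
        ((Finset.univ.filter (· ∈ C)).filter fun v => ¬ v ∈ S).card := by
      convert y (· ∉ S)
    intro P
    by_cases hP : P
    · have x1 : ((Finset.univ.filter fun v => v ∈ C ∧ (v ∈ D ↔ P)).filter (· ∈ S)) =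
          Finset.univ.filter fun v => (v ∈ C ∧ v ∈ D) ∧ v ∈ S := by ext v; simp [hP]
      have x2 : ((Finset.univ.filter fun v => v ∈ C ∧ (v ∈ D ↔ P)).filter fun v => ¬ v ∈ S) =
          Finset.univ.filter fun v => (v ∈ C ∧ v ∈ D) ∧ v ∉ S := by ext v; simp [hP]
      rw [x1, x2]; omega
    · have x1 : ((Finset.univ.filter fun v => v ∈ C ∧ (v ∈ D ↔ P)).filter (· ∈ S)) =
          Finset.univ.filter fun v => (v ∈ C ∧ v ∉ D) ∧ v ∈ S := by ext v; simp [hP]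
      have x2 : ((Finset.univ.filter fun v => v ∈ C ∧ (v ∈ D ↔ P)).filter fun v => ¬ v ∈ S) =
          Finset.univ.filter fun v => (v ∈ C ∧ v ∉ D) ∧ v ∉ S := by ext v; simp [hP]
      rw [x1, x2]; omega
  -- the exchange of sources and sinks
  obtain ⟨Θ, hΘ, hΘA, hΘB⟩ := exists_exchange S (C \ S) (fun v h h' => h'.2 h)
    (fun v => ((v ∈ D : Prop), (v ∈ E : Prop))) (fun v => ((v ∈ D : Prop), (v ∉ E : Prop))) (by
      rintro ⟨P, Q⟩
      -- `P` tells the side and `Q` the parity: `Θ` is to exchange `S` with `C \ S`, to preserve the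
      -- side and to change the parity.
      have hk := card_filter_of_balance (Finset.univ.filter fun v => v ∈ C ∧ (v ∈ D ↔ P)) (· ∈ S)
        (· ∈ E) (hcardS P) (hcardE P)
      have conv : ∀ (A : Set V) (a : V → Prop × Prop),
          Nat.card {v : A // a v = (P, Q)} = (Finset.univ.filter fun v => v ∈ A ∧ a v = (P, Q)).card := by
        intro A a
        rw [← Fintype.card_subtype, ← Nat.card_eq_fintype_card]
        exact Nat.card_congr (Equiv.subtypeSubtypeEquivSubtypeInter (· ∈ A) fun v => a v = (P, Q))
      rw [conv S fun v => ((v ∈ D : Prop), (v ∈ E : Prop)),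
        conv (C \ S) fun v => ((v ∈ D : Prop), (v ∉ E : Prop))]
      simp only [Finset.filter_filter, Prod.mk.injEq, eq_iff_iff, Set.mem_sdiff] at hk ⊢
      by_cases hQ : Q
      · convert hk.1 using 2
        · ext v; have := @hSC v; simp only [Finset.mem_filter, hQ, iff_true]; tauto
        · ext v; simp only [Finset.mem_filter, hQ, iff_true]; tauto
      · convert hk.2 using 2
        · ext v; have := @hSC v; simp only [Finset.mem_filter, hQ, iff_false]; tauto
        · ext v; simp only [Finset.mem_filter, hQ, iff_false]; tauto)
  have hΘC1 : ∀ v ∈ C, Θ v ∈ C ∧ (Θ v ∈ D ↔ v ∈ D) ∧ (Θ v ∈ E ↔ v ∉ E) ∧ (Θ v ∈ S ↔ v ∉ S) := by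
    intro v hv
    by_cases hS : v ∈ S
    · obtain ⟨h, h'⟩ := hΘA v hS
      simp only [Prod.mk.injEq, eq_iff_iff] at h'
      exact ⟨h.1, h'.1, by tauto, iff_of_false h.2 (not_not.2 hS)⟩
    · obtain ⟨h, h'⟩ := hΘB v ⟨hv, hS⟩
      simp only [Prod.mk.injEq, eq_iff_iff] at h'
      exact ⟨hSC h, h'.1, h'.2, iff_of_true h hS⟩
  have hΘC : ∀ v, Θ v ∈ C ↔ v ∈ C :=
    fun v => ⟨fun h => by have := (hΘC1 _ h).1; rwa [hΘ] at this, fun h => (hΘC1 v h).1⟩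
  have hΘS' : ∀ v ∈ C, Θ v ∈ S' ↔ v ∉ S' := by
    intro v hv
    obtain ⟨a1, a2, -, a4⟩ := hΘC1 v hv
    by_cases hD : v ∈ D
    · rw [hS1 _ a1 (a2.2 hD), hS1 v hv hD, a4]
    · rw [hS0 _ a1 (fun h => hD (a2.1 h)), hS0 v hv hD, a4]
  -- the closed up permutations
  obtain ⟨ρ, hρ⟩ := exists_perm_of_injective (fun v => if v ∉ C ∨ v ∈ S then π v else Θ v) (by
    have key : ∀ v w, v ∉ C ∨ v ∈ S → ¬ (w ∉ C ∨ w ∈ S) → π v ≠ Θ w := by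
      intro v w hv hw h
      rw [not_or, not_not] at hw
      exact (h1 v hv).2 (h ▸ ((hΘC1 w hw.1).2.2.2.2 hw.2))
    intro v w hvw
    by_cases hv : v ∉ C ∨ v ∈ S <;> by_cases hw : w ∉ C ∨ w ∈ S <;>
      simp only [hv, hw, if_true, if_false] at hvw
    · exact π.injective hvw
    · exact absurd hvw (key v w hv hw)
    · exact absurd hvw.symm (key w v hw hv)
    · exact Θ.injective hvw)
  have hρ1 : ∀ v, v ∉ C ∨ v ∈ S → ρ v = π v := fun v hv => by rw [hρ]; exact if_pos hv
  have hρ2 : ∀ v ∈ C, v ∉ S → ρ v = Θ v := fun v hv hs => by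
    rw [hρ]; exact if_neg (by rw [not_or, not_not]; exact ⟨hv, hs⟩)
  have hπr : ∀ v, v ∉ C ∨ v ∉ S → π.symm v ∉ C ∨ π.symm v ∈ S := by
    intro v hv
    by_contra hcon
    rw [not_or, not_not] at hcon
    have a := h2 _ hcon.1 hcon.2
    rw [Equiv.apply_symm_apply] at a
    have b := (h2S _ hcon.1).2 hcon.2
    rw [← a] at b
    exact hv.elim (fun h => h (hSC b)) fun h => h b
  have hdec : ∀ v, v ∉ C ∨ v ∉ S' → v ∈ D → v ∉ C ∨ v ∈ S := by
    intro v hv hD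
    by_cases hc : v ∈ C
    · have := hS1 v hc hD; tauto
    · exact Or.inl hc
  obtain ⟨ρ', hρ'⟩ := exists_perm_of_injective
    (fun v => if v ∉ D then ρ v else ρ.symm v) (by
    have hρD : ∀ v, ρ v ∈ D ↔ v ∈ D := by
      intro v
      by_cases hv : v ∉ C ∨ v ∈ S
      · rw [hρ1 v hv, (h1 v hv).1]
      · rw [not_or, not_not] at hv
        rw [hρ2 v hv.1 hv.2, (hΘC1 v hv.1).2.1]
    have hρD' : ∀ v, ρ.symm v ∈ D ↔ v ∈ D := fun v => by rw [← hρD, Equiv.apply_symm_apply]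
    intro v w hvw
    by_cases hv : v ∈ D <;> by_cases hw : w ∈ D <;>
      simp only [hv, hw, not_true_eq_false, not_false_eq_true, if_true, if_false] at hvw
    · exact ρ.symm.injective hvw
    · exact absurd ((hρD w).1 (hvw ▸ (hρD' v).2 hv)) hw
    · exact absurd ((hρD v).1 (hvw ▸ (hρD' w).2 hw)) hv
    · exact ρ.injective hvw)
  have hρD : ∀ v, ρ v ∈ D ↔ v ∈ D := by
    intro v
    by_cases hv : v ∉ C ∨ v ∈ S
    · rw [hρ1 v hv, (h1 v hv).1]
    · rw [not_or, not_not] at hv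
      rw [hρ2 v hv.1 hv.2, (hΘC1 v hv.1).2.1]
  -- `Θ` respects the sides, so `D` is invariant under `ρ`, and `ρ'` arises by inverting `ρ` there.
  have hρρ' : sign ρ' = sign ρ := by
    refine sign_eq_of_reverse_on hρD (fun v hv => by rw [hρ']; exact if_pos hv) fun v hv => ?_
    have : ρ' v = ρ.symm v := by rw [hρ']; exact if_neg (not_not.2 hv)
    rw [this, Equiv.apply_symm_apply]
    exact ⟨by rw [← hρD, Equiv.apply_symm_apply]; exact hv, rfl⟩
  have hρ'1 : ∀ v, v ∉ C ∨ v ∈ S' → ρ' v = π' v := by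
    intro v hv
    rw [hρ']
    by_cases hD : v ∈ D
    · rw [if_neg (not_not.2 hD), Equiv.symm_apply_eq]
      have hv' : v ∉ C ∨ v ∉ S := by
        by_cases hc : v ∈ C
        · have := hS1 v hc hD; tauto
        · exact Or.inl hc
      have hu := hπr v hv'
      have huD : π.symm v ∈ D := by
        have := (h1 _ hu).1
        rw [Equiv.apply_symm_apply] at this
        exact this.1 hD
      have := h4 _ hu huD
      rw [Equiv.apply_symm_apply] at this
      rw [this, hρ1 _ hu, Equiv.apply_symm_apply]
    · have hv' : v ∉ C ∨ v ∈ S := by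
        by_cases hc : v ∈ C
        · have := hS0 v hc hD; tauto
        · exact Or.inl hc
      rw [if_pos hD, hρ1 v hv', h3 v hv' hD]
  have hρ'2 : ∀ v ∈ C, v ∉ S' → ρ' v = Θ v := by
    intro v hc hv
    rw [hρ']
    by_cases hD : v ∈ D
    · have hs : v ∈ S := by have := hS1 v hc hD; tauto
      obtain ⟨a1, a2, a3, a4⟩ := hΘC1 v hc
      rw [if_neg (not_not.2 hD), Equiv.symm_apply_eq, hρ2 _ a1 fun h => a4.1 h hs, hΘ]
    · have hs : v ∉ S := by have := hS0 v hc hD; tauto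
      rw [if_pos hD, hρ2 v hc hs]
  -- comparison along the cycle
  have hgE : ∀ α : Perm V, (∀ v ∈ C, α v ∈ C ∧ (α v ∈ E ↔ v ∉ E)) → (∀ v, α v ∈ C ↔ v ∈ C) →
      ∀ v, (Θ * α) v ∈ E ↔ v ∈ E := by
    intro α h hC' v
    rw [Perm.mul_apply]
    by_cases hv : v ∈ C
    · rw [(hΘC1 _ (h v hv).1).2.2.1, (h v hv).2, not_not]
    · exact iff_of_false (fun h' => hv ((hC' v).1 ((hΘC _).1 (hEC h')))) fun h' => hv (hEC h')
  have e1 := sign_along hSC hEC hΘ hΘC (fun v hv => (hΘC1 v hv).2.2.2) hμ' hμC' h2S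
    (fun v hv => (hμE' v hv).2) h2 hρ1 hρ2 (hgE μ' hμE' hμC')
  have e2 := sign_along hSC' hEC hΘ hΘC hΘS' hμ hμC h2S'
    (fun v hv => (hμE v hv).2) h2' hρ'1 hρ'2 (hgE μ hμE hμC)
  have hk : IsCyclicSeq (fun i => f (2 * i)) k := by
    refine ⟨by have := hf.pos; omega, fun i => ?_, fun i hi j hj h => ?_⟩
    · show f (2 * (i + k)) = _
      rw [mul_add, hf.periodic]
    · have := hf.inj _ (show 2 * i < 2 * k by omega) _ (show 2 * j < 2 * k by omega) h
      omega
  -- Both `Θ μ (f (2i))` and `Θ μ' (f (2i + 2))` are `Θ (f (2i + 1))`. Hence the quotient moves each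
  -- even position to the next one, whatever `Θ` is.
  have e3 := hk.sign_rotation
    (r := (restr (Θ * μ') E (hgE μ' hμE' hμC'))⁻¹ * restr (Θ * μ) E (hgE μ hμE hμC))
    (fun i => by
      have hm : ∀ j, f (2 * j) ∈ E := fun j => (hEf _).2 (even_two_mul j)
      rw [Perm.mul_apply, restr_of_mem (hm i), Perm.inv_eq_iff_eq, restr_of_mem (hm (i + 1)),
        Perm.mul_apply, Perm.mul_apply, hμf, show 2 * (i + 1) = 2 * i + 2 by ring, hμe'])
    (fun v hv => by
      have hvE : v ∉ E := by
        rintro ⟨i, rfl, j, rfl⟩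
        exact hv ⟨j, by show f _ = f _; congr 1; ring⟩
      rw [Perm.mul_apply, restr_of_notMem hvE, Perm.inv_eq_iff_eq, restr_of_notMem hvE])
  rw [Perm.sign_mul, sign_inv] at e3
  have hk1 := hk.pos
  calc sign π * sign π' = (sign ρ * sign ρ) *
        (sign (restr (Θ * μ') E (hgE μ' hμE' hμC')) * sign (restr (Θ * μ) E (hgE μ hμE hμC))) := by
        rw [e1, e2, hρρ']; exact mul_mul_mul_comm _ _ _ _
    _ = (-1) ^ (k - 1) := by rw [Int.units_mul_self, one_mul, e3]
    _ = (-1) ^ (k + 1) := by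
        rw [show k + 1 = (k - 1) + 2 by omega, pow_add, Int.units_sq, mul_one]

end Switch

end UDet

end


noncomputable section

namespace UDet

/-! ## Rotations at the vertices of a cubic graph -/

section Cubic

open Equiv Equiv.Perm
open scoped Classical

variable {n : ℕ} {G : SimpleGraph (Fin n)}

theorem dart_eq_of_fst_snd {d e : G.Dart} (h1 : d.fst = e.fst) (h2 : d.snd = e.snd) : d = e :=
  SimpleGraph.Dart.ext _ _ (Prod.ext h1 h2)

theorem card_darts_at (hG : IsCubic G) (v : Fin n) :
    (Finset.univ.filter fun d : G.Dart => d.fst = v).card = 3 := by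
  rw [← hG v, ← Nat.card_coe_set_eq, Nat.card_eq_fintype_card, ← Finset.card_univ]
  refine Finset.card_bij (fun d hd => ⟨d.snd, ?_⟩) (fun _ _ => Finset.mem_univ _) ?_ ?_
  · simp only [Finset.mem_filter, Finset.mem_univ, true_and] at hd
    rw [SimpleGraph.mem_neighborSet, ← hd]
    exact d.adj
  · intro d hd e he h
    simp only [Finset.mem_filter, Finset.mem_univ, true_and] at hd he
    exact dart_eq_of_fst_snd (hd.trans he.symm) (congrArg Subtype.val h)
  · rintro ⟨u, hu⟩ _
    exact ⟨⟨(v, u), hu⟩, by simp, rfl⟩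

/-- There are three darts at a vertex, and they form a single orbit of the rotation, so the rotation
is a 3-cycle on them. -/
theorem PlanarEmbedding.rot_cubic (m : PlanarEmbedding G) (hG : IsCubic G) (d : G.Dart) :
    m.rot d ≠ d ∧ m.rot (m.rot d) ≠ d ∧ m.rot (m.rot (m.rot d)) = d ∧
      ∀ e : G.Dart, e.fst = d.fst → e = d ∨ e = m.rot d ∨ e = m.rot (m.rot d) := by
  set A := Finset.univ.filter fun e : G.Dart => e.fst = d.fst with hA
  have hcard : A.card = 3 := card_darts_at hG d.fst
  have horb : ∀ e ∈ A, ∃ i : ℕ, (m.rot ^ i) d = e := fun e he => by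
    simp only [hA, Finset.mem_filter, Finset.mem_univ, true_and] at he
    exact (m.rot_cyclic d e he.symm).exists_nat_pow_eq
  have h1 : m.rot d ≠ d := fun h => by
    have : A ⊆ {d} := fun e he => by
      obtain ⟨i, rfl⟩ := horb e he
      rw [Finset.mem_singleton]
      induction i with
      | zero => rfl
      | succ i ih =>
        rw [pow_succ, Perm.mul_apply, h]
        exact ih (by simp only [hA, Finset.mem_filter, Finset.mem_univ, true_and] at he ⊢
                     rwa [pow_succ, Perm.mul_apply, h] at he)
    have := Finset.card_le_card this
    simp [hcard] at this
  have h2 : m.rot (m.rot d) ≠ d := fun h => by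
    have : A ⊆ {d, m.rot d} := fun e he => by
      obtain ⟨i, rfl⟩ := horb e he
      have : ∀ i : ℕ, (m.rot ^ i) d = d ∨ (m.rot ^ i) d = m.rot d := fun i => by
        induction i with
        | zero => exact Or.inl rfl
        | succ i ih =>
          rw [pow_succ', Perm.mul_apply]
          rcases ih with ih | ih
          · exact Or.inr (by rw [ih])
          · exact Or.inl (by rw [ih, h])
      simpa using this i
    have := Finset.card_le_card this
    have h3 : ({d, m.rot d} : Finset G.Dart).card ≤ 2 := Finset.card_le_two
    omega
  have hsub : ({d, m.rot d, m.rot (m.rot d)} : Finset G.Dart) ⊆ A := by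
    intro e he
    simp only [Finset.mem_insert, Finset.mem_singleton] at he
    rcases he with rfl | rfl | rfl <;> simp [hA, m.rot_fst]
  have hcard3 : ({d, m.rot d, m.rot (m.rot d)} : Finset G.Dart).card = 3 :=
    Finset.card_eq_three.2 ⟨_, _, _, h1.symm, h2.symm,
      fun h => h1 (m.rot.injective h).symm, rfl⟩
  have hA' : ({d, m.rot d, m.rot (m.rot d)} : Finset G.Dart) = A :=
    Finset.eq_of_subset_of_card_le hsub (by rw [hcard, hcard3])
  have hall : ∀ e : G.Dart, e.fst = d.fst → e = d ∨ e = m.rot d ∨ e = m.rot (m.rot d) := by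
    intro e he
    have : e ∈ A := by simpa [hA] using he
    rw [← hA'] at this
    simpa using this
  refine ⟨h1, h2, ?_, hall⟩
  rcases hall (m.rot (m.rot (m.rot d))) (by simp [m.rot_fst]) with h | h | h
  · exact h
  · exact absurd (m.rot.injective h) h2
  · exact absurd (m.rot.injective (m.rot.injective h)) h1

theorem PlanarEmbedding.sum_darts_cubic (m : PlanarEmbedding G) (hG : IsCubic G) (d : G.Dart)
    (y : G.Dart → ZMod 2) :
    ∑ e : G.Dart with e.fst = d.fst, y e = y d + (y (m.rot d) + y (m.rot (m.rot d))) := by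
  obtain ⟨h1, h2, -, h4⟩ := m.rot_cubic hG d
  have : (Finset.univ.filter fun e : G.Dart => e.fst = d.fst) =
      {d, m.rot d, m.rot (m.rot d)} := by
    ext e
    simp only [Finset.mem_filter, Finset.mem_univ, true_and, Finset.mem_insert,
      Finset.mem_singleton]
    refine ⟨h4 e, ?_⟩
    rintro (rfl | rfl | rfl) <;> simp [m.rot_fst]
  rw [this, Finset.sum_insert, Finset.sum_insert, Finset.sum_singleton]
  · rw [Finset.mem_singleton]
    exact fun h => h1 (m.rot.injective h).symm
  · simp [h1.symm, h2.symm]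

/-! ## Orientations of cycle covers -/

/-- A perfect matching of `G`, as an involution. -/
def IsMatchingOf (G : SimpleGraph (Fin n)) (μ : Perm (Fin n)) : Prop :=
  (∀ v, μ (μ v) = v) ∧ ∀ v, G.Adj v (μ v)

theorem IsMatchingOf.isMatchingPerm {μ : Perm (Fin n)} (hμ : IsMatchingOf G μ) :
    IsMatchingPerm μ := ⟨hμ.1, fun v => (hμ.2 v).ne'⟩

/-- The edges that do not belong to the matching. -/
def coverOf (G : SimpleGraph (Fin n)) (μ : Perm (Fin n)) : Finset (Sym2 (Fin n)) :=
  (edges G).filter fun e => ¬ ∃ v, e = s(v, μ v)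

theorem mem_edges {e : Sym2 (Fin n)} : e ∈ edges G ↔ e ∈ G.edgeSet := by simp [edges]

theorem mem_coverOf {μ : Perm (Fin n)} (hμ : ∀ v, μ (μ v) = v) {u v : Fin n} :
    s(u, v) ∈ coverOf G μ ↔ G.Adj u v ∧ μ u ≠ v := by
  rw [coverOf, Finset.mem_filter, mem_edges, SimpleGraph.mem_edgeSet]
  refine and_congr_right fun _ => not_congr ⟨?_, ?_⟩
  · rintro ⟨w, hw⟩
    rw [Sym2.eq_iff] at hw
    rcases hw with ⟨rfl, rfl⟩ | ⟨rfl, rfl⟩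
    · rfl
    · exact hμ _
  · rintro rfl
    exact ⟨u, rfl⟩

/-- `π` runs along the cycles of the cycle cover that is complementary to the matching `μ`, such that
the faces on one side of it have colour `1`. -/
structure RunsAlong (π μ : Perm (Fin n)) (ψ : G.Dart → ZMod 2) : Prop where
  adj : ∀ v, G.Adj v (π v)
  ne : ∀ v, μ v ≠ π v
  apply_eq : ∀ d : G.Dart, ψ d = 1 → μ d.fst ≠ d.snd → π d.fst = d.snd
  eq_one : ∀ d : G.Dart, π d.fst = d.snd → ψ d = 1

/-- Around a vertex the colour changes only across the edges of the cover. Hence of the two darts of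
the cover at each vertex exactly one has colour `1`, and this is the one to follow; the reverse of
the incoming dart has colour `0`. -/
theorem PlanarEmbedding.exists_runsAlong (m : PlanarEmbedding G) (hG : IsCubic G)
    {μ : Perm (Fin n)} (hμ : IsMatchingOf G μ) {ψ : G.Dart → ZMod 2}
    (h1 : ∀ d, ψ (m.rot d.symm) = ψ d)
    (h2 : ∀ d : G.Dart, ψ d + ψ d.symm = if μ d.fst = d.snd then 0 else 1) :
    ∃ π : Perm (Fin n), RunsAlong π μ ψ := by
  -- The dart after `d` in the rotation lies on the face of the reverse of `d`, that is, across the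
  -- edge.
  have h3 : ∀ d, ψ d + ψ (m.rot d) = if μ d.fst = d.snd then 0 else 1 := fun d => by
    rw [← h2, ← h1 d.symm, SimpleGraph.Dart.symm_symm]
  have key : ∀ v (t : ZMod 2), ∃ d : G.Dart, (d.fst = v ∧ μ v ≠ d.snd ∧ ψ d = t) ∧
      ∀ e : G.Dart, e.fst = v → μ v ≠ e.snd → ψ e = t → e = d := by
    intro v t
    set d₀ : G.Dart := ⟨(v, μ v), hμ.2 v⟩
    obtain ⟨a1, a2, a3, a4⟩ := m.rot_cubic hG d₀
    have hne : ∀ e : G.Dart, e.fst = v → e ≠ d₀ → μ v ≠ e.snd := fun e he hed h =>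
      hed (dart_eq_of_fst_snd he h.symm)
    have f1 : (m.rot d₀).fst = v := by rw [m.rot_fst]
    have f2 : (m.rot (m.rot d₀)).fst = v := by rw [m.rot_fst, m.rot_fst]
    have n1 := hne _ f1 a1
    have n2 := hne _ f2 a2
    have e0 : ψ d₀ + ψ (m.rot d₀) = 0 := by rw [h3, if_pos rfl]
    have e1 : ψ (m.rot d₀) + ψ (m.rot (m.rot d₀)) = 1 := by rw [h3, f1, if_neg n1]
    have hdich : ∀ a b t : ZMod 2, a + b = 1 → (a = t ∧ b ≠ t) ∨ (a ≠ t ∧ b = t) := by decide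
    have hcase : ∀ e : G.Dart, e.fst = v → μ v ≠ e.snd → e = m.rot d₀ ∨ e = m.rot (m.rot d₀) :=
      fun e he hme => (a4 e he).resolve_left fun h => hme (by rw [h])
    rcases hdich _ _ t e1 with ⟨b1, b2⟩ | ⟨b1, b2⟩
    · refine ⟨m.rot d₀, ⟨f1, n1, b1⟩, fun e he hme hte => ?_⟩
      rcases hcase e he hme with rfl | rfl
      · rfl
      · exact absurd hte b2
    · refine ⟨m.rot (m.rot d₀), ⟨f2, n2, b2⟩, fun e he hme hte => ?_⟩
      rcases hcase e he hme with rfl | rfl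
      · exact absurd hte b1
      · rfl
  choose out hout hout' using fun v => key v 1
  have hsymm : ∀ d : G.Dart, μ d.fst ≠ d.snd → μ d.snd ≠ d.fst := fun d h h' => h (by
    rw [← h', hμ.1])
  obtain ⟨π, hπ⟩ := exists_perm_of_injective (fun v => (out v).snd) (by
    intro v w hvw
    simp only at hvw
    -- Injectivity: the reverses of incoming darts are cover darts of colour `0`, and there is only
    -- one of these at the common head.
    obtain ⟨d, -, hd⟩ := key (out v).snd 0
    have h0 : ∀ w, (out w).snd = (out v).snd → (out w).symm = d := fun w hw => by
      obtain ⟨a1, a2, a3⟩ := hout w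
      refine hd _ hw ?_ ?_
      · rw [← hw]; exact hsymm _ (by rw [a1]; exact a2)
      · have := h2 (out w)
        rw [a3, a1, if_neg a2] at this
        simpa using this
    have h4 : (out v).symm = (out w).symm := (h0 v rfl).trans (h0 w hvw.symm).symm
    have h5 := congrArg (fun d : G.Dart => d.snd) h4
    change (out v).fst = (out w).fst at h5
    rwa [(hout v).1, (hout w).1] at h5)
  refine ⟨π, ⟨fun v => ?_, fun v => ?_, fun d hd hμd => ?_, fun d hd => ?_⟩⟩
  · rw [hπ]
    conv_lhs => rw [← (hout v).1]
    exact (out v).adj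
  · rw [hπ]; exact (hout v).2.1
  · rw [hπ, ← hout' d.fst d rfl hμd hd]
  · rw [hπ] at hd
    rw [show d = out d.fst from dart_eq_of_fst_snd (hout d.fst).1.symm hd.symm]
    exact (hout d.fst).2.2

theorem RunsAlong.dichotomy {π μ : Perm (Fin n)} {ψ : G.Dart → ZMod 2} (h : RunsAlong π μ ψ)
    (hμ : ∀ v, μ (μ v) = v)
    (h2 : ∀ d : G.Dart, ψ d + ψ d.symm = if μ d.fst = d.snd then 0 else 1) {u v : Fin n}
    (huv : G.Adj u v) (hne : μ u ≠ v) : (π u = v ∧ π v ≠ u) ∨ (π u ≠ v ∧ π v = u) := by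
  set d : G.Dart := ⟨(u, v), huv⟩
  have hd := h2 d
  rw [if_neg hne] at hd
  have hne' : μ v ≠ u := fun h' => hne (by rw [← h', hμ])
  have hdich : ∀ a b : ZMod 2, a + b = 1 → (a = 1 ∧ b ≠ 1) ∨ (a ≠ 1 ∧ b = 1) := by decide
  rcases hdich _ _ hd with ⟨b1, b2⟩ | ⟨b1, b2⟩
  · exact Or.inl ⟨h.apply_eq d b1 hne, fun h' => b2 (h.eq_one d.symm h')⟩
  · exact Or.inr ⟨fun h' => b1 (h.eq_one d h'), h.apply_eq d.symm b2 hne'⟩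

/-- The connected components are the orbits of `π`, and a permutation without fixed points has the
sign `(-1)` to the number of points plus the number of cycles. -/
theorem sign_eq_of_components (π : Perm (Fin n)) (hπ : ∀ v, π v ≠ v) (c : Finset (Sym2 (Fin n)))
    (hc : ∀ u v, s(u, v) ∈ c ↔ π u = v ∨ π v = u) : sign π = (-1) ^ (n + numComponents c) := by
  set H := SimpleGraph.fromEdgeSet (c : Set (Sym2 (Fin n))) with hH
  have hadj : ∀ u v, H.Adj u v ↔ π u = v ∨ π v = u := fun u v => by
    rw [hH, SimpleGraph.fromEdgeSet_adj, Finset.mem_coe, hc]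
    refine and_iff_left_of_imp ?_
    rintro (h | h) rfl <;> exact hπ _ h
  have hreach : ∀ u v, H.Reachable u v ↔ π.SameCycle u v := by
    intro u v
    constructor
    · rintro ⟨p⟩
      induction p with
      | nil => exact SameCycle.refl _ _
      | cons huv _ ih =>
        refine SameCycle.trans ?_ ih
        rcases (hadj _ _).1 huv with rfl | rfl
        · exact (SameCycle.refl π _).apply_right
        · exact (SameCycle.refl π _).apply_left
    · intro h
      obtain ⟨i, rfl⟩ := h.exists_nat_pow_eq
      clear h
      induction i with
      | zero => exact SimpleGraph.Reachable.refl _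
      | succ i ih =>
        refine ih.trans (SimpleGraph.Adj.reachable ?_)
        rw [hadj, pow_succ', Perm.mul_apply]
        exact Or.inl rfl
  have hsupp : ∀ v, v ∈ π.support := fun v => Perm.mem_support.2 (hπ v)
  let φ : H.ConnectedComponent → π.cycleFactorsFinset :=
    SimpleGraph.ConnectedComponent.lift
      (fun v => ⟨π.cycleOf v, cycleOf_mem_cycleFactorsFinset_iff.2 (hsupp v)⟩)
      fun u v p _ => Subtype.ext ((hreach u v).1 ⟨p⟩).cycleOf_eq
  have hφ : Function.Bijective φ := by
    constructor
    · intro C C'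
      induction C using SimpleGraph.ConnectedComponent.ind with
      | _ u =>
        induction C' using SimpleGraph.ConnectedComponent.ind with
        | _ v =>
          intro h
          rw [SimpleGraph.ConnectedComponent.eq, hreach]
          exact (sameCycle_iff_cycleOf_eq_of_mem_support (hsupp u) (hsupp v)).2
            (congrArg Subtype.val h)
    · rintro ⟨τ, hτ⟩
      obtain ⟨hcyc, hτ'⟩ := mem_cycleFactorsFinset_iff.1 hτ
      obtain ⟨v, hv⟩ := hcyc.nonempty_support
      exact ⟨H.connectedComponentMk v, Subtype.ext (cycle_is_cycleOf hv hτ).symm⟩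
  have hcard : numComponents c = Multiset.card π.cycleType := by
    rw [numComponents, Nat.card_eq_of_bijective φ hφ, cycleType_def, Multiset.card_map,
      Nat.card_eq_fintype_card, Fintype.card_coe]
    rfl
  have hsum : π.cycleType.sum = n := by
    rw [sum_cycleType, show π.support = Finset.univ from Finset.eq_univ_of_forall hsupp]
    simp
  rw [sign_of_cycleType, hsum, hcard]

/-- This turns the number of components of a cover, a global quantity, into the sign of a
permutation that can be compared locally. -/
theorem RunsAlong.sign_eq {π μ : Perm (Fin n)} {ψ : G.Dart → ZMod 2} (h : RunsAlong π μ ψ)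
    (hμ : ∀ v, μ (μ v) = v)
    (h2 : ∀ d : G.Dart, ψ d + ψ d.symm = if μ d.fst = d.snd then 0 else 1) :
    sign π = (-1) ^ (n + numComponents (coverOf G μ)) := by
  refine sign_eq_of_components π (fun v => (h.adj v).ne') _ fun u v => ?_
  rw [mem_coverOf hμ]
  constructor
  · rintro ⟨h3, h4⟩
    rcases h.dichotomy hμ h2 h3 h4 with h | h
    · exact Or.inl h.1
    · exact Or.inr h.2
  · rintro (rfl | rfl)
    · exact ⟨h.adj u, h.ne u⟩
    · exact ⟨(h.adj v).symm, fun h' => h.ne v (by have := hμ (π v); rwa [h'] at this)⟩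

end Cubic

end UDet

end


noncomputable section

namespace UDet

/-! ## The sides of a cycle -/

section Sides

open Equiv Equiv.Perm
open scoped Classical

variable {n : ℕ} {G : SimpleGraph (Fin n)}

/-- The edge `e` belongs to the cyclic sequence `f`. -/
def OnCycle (f : ℕ → Fin n) (e : Sym2 (Fin n)) : Prop := ∃ i, e = s(f i, f (i + 1))

theorem IsCyclicSeq.ne_add_two {f : ℕ → Fin n} {N : ℕ} (hf : IsCyclicSeq f N) (hN : 3 ≤ N) (i : ℕ) :
    f (i + 2) ≠ f i := by
  intro h
  rw [hf.eq_iff] at h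
  have h2 : (i + 2) ≡ i + 0 [MOD N] := h
  have h3 : 2 ≡ 0 [MOD N] := Nat.ModEq.add_left_cancel' i h2
  rw [Nat.ModEq, Nat.mod_eq_of_lt (by omega), Nat.zero_mod] at h3
  omega

theorem IsCyclicSeq.succ_congr {V : Type*} {f : ℕ → V} {N : ℕ} (hf : IsCyclicSeq f N) {i j : ℕ}
    (h : f i = f j) : f (i + 1) = f (j + 1) := by
  rw [hf.eq_iff] at h ⊢
  exact Nat.ModEq.add_right 1 h

theorem IsCyclicSeq.pred_congr {V : Type*} {f : ℕ → V} {N : ℕ} (hf : IsCyclicSeq f N) {i j : ℕ}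
    (h : f (i + 1) = f (j + 1)) : f i = f j := by
  rw [hf.eq_iff] at h ⊢
  exact Nat.ModEq.add_right_cancel' 1 h

theorem IsCyclicSeq.exists_succ {V : Type*} {f : ℕ → V} {N : ℕ} (hf : IsCyclicSeq f N) (i : ℕ) :
    ∃ j, f i = f (j + 1) :=
  ⟨i + N - 1, by rw [← hf.periodic i]; congr 1; have := hf.pos; omega⟩

theorem IsCyclicSeq.onCycle_iff {f : ℕ → Fin n} {N : ℕ} (hf : IsCyclicSeq f N) {i : ℕ} {v : Fin n} :
    OnCycle f s(f (i + 1), v) ↔ v = f (i + 2) ∨ v = f i := by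
  constructor
  · rintro ⟨j, hj⟩
    rw [Sym2.eq_iff] at hj
    rcases hj with ⟨h1, rfl⟩ | ⟨h1, rfl⟩
    · exact Or.inl (hf.succ_congr h1).symm
    · exact Or.inr (hf.pred_congr h1).symm
  · rintro (rfl | rfl)
    · exact ⟨i + 1, rfl⟩
    · exact ⟨i, Sym2.eq_swap⟩

theorem OnCycle.mem_range {f : ℕ → Fin n} {u v : Fin n} (h : OnCycle f s(u, v)) :
    u ∈ Set.range f := by
  obtain ⟨j, hj⟩ := h
  rw [Sym2.eq_iff] at hj
  rcases hj with ⟨rfl, rfl⟩ | ⟨rfl, rfl⟩ <;> exact ⟨_, rfl⟩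

/-- The third edge at `f (i + 1)` is on the left of the cycle `f`. -/
def PlanarEmbedding.LeftAt (m : PlanarEmbedding G) (f : ℕ → Fin n) (i : ℕ) : Prop :=
  ∃ d : G.Dart, d.fst = f (i + 1) ∧ d.snd = f (i + 2) ∧ (m.rot d).snd ≠ f i

/-- The darts at a vertex of a cycle in a cubic graph. -/
theorem PlanarEmbedding.darts_on_cycle (m : PlanarEmbedding G) (hG : IsCubic G) {f : ℕ → Fin n}
    {N : ℕ} (hf : IsCyclicSeq f N) (hN : 3 ≤ N) (hadj : ∀ i, G.Adj (f i) (f (i + 1))) (i : ℕ) :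
    ∃ q p t : G.Dart, (q.fst = f (i + 1) ∧ q.snd = f (i + 2)) ∧ (p.fst = f (i + 1) ∧ p.snd = f i) ∧
      t.fst = f (i + 1) ∧ ¬ OnCycle f t.edge ∧ OnCycle f q.edge ∧ OnCycle f p.edge ∧
      (∀ e : G.Dart, e.fst = f (i + 1) → e = q ∨ e = p ∨ e = t) ∧
      ((m.LeftAt f i ∧ m.rot q = t ∧ m.rot t = p ∧ m.rot p = q) ∨
        (¬ m.LeftAt f i ∧ m.rot q = p ∧ m.rot p = t ∧ m.rot t = q)) := by
  set q : G.Dart := ⟨(f (i + 1), f (i + 2)), hadj (i + 1)⟩ with hq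
  set p : G.Dart := ⟨(f (i + 1), f i), (hadj i).symm⟩ with hp
  have hqp : q ≠ p := fun h => hf.ne_add_two hN i (congrArg (fun d : G.Dart => d.snd) h)
  obtain ⟨a1, a2, a3, a4⟩ := m.rot_cubic hG q
  have hleft : m.LeftAt f i ↔ m.rot q ≠ p := by
    constructor
    · rintro ⟨d, h1, h2, h3⟩ h
      rw [show d = q from dart_eq_of_fst_snd h1 h2, h] at h3
      exact h3 rfl
    · intro h
      exact ⟨q, rfl, rfl, fun h' => h (dart_eq_of_fst_snd (by rw [m.rot_fst]) h')⟩
  have hon : ∀ d : G.Dart, d.fst = f (i + 1) → (OnCycle f d.edge ↔ d = q ∨ d = p) := by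
    intro d hd
    have : d.edge = s(f (i + 1), d.snd) := by rw [← hd]; rfl
    rw [this, hf.onCycle_iff]
    refine or_congr ⟨fun h => dart_eq_of_fst_snd hd h, fun h => by rw [h]⟩
      ⟨fun h => dart_eq_of_fst_snd hd h, fun h => by rw [h]⟩
  have honq := (hon q rfl).2 (Or.inl rfl)
  have honp := (hon p rfl).2 (Or.inr rfl)
  have fst1 : (m.rot q).fst = f (i + 1) := by rw [m.rot_fst]
  have fst2 : (m.rot (m.rot q)).fst = f (i + 1) := by rw [m.rot_fst, m.rot_fst]
  rcases a4 p rfl with h | h | h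
  · exact absurd h.symm hqp
  · refine ⟨q, p, m.rot p, ⟨rfl, rfl⟩, ⟨rfl, rfl⟩, by rw [m.rot_fst], ?_, honq, honp, ?_, Or.inr ?_⟩
    · rw [hon _ (by rw [m.rot_fst])]
      rintro (h' | h')
      · rw [h] at h'; exact a2 h'
      · exact (m.rot_cubic hG p).1 h'
    · intro e he; rw [h]; exact a4 e he
    · exact ⟨fun h' => hleft.1 h' h.symm, h.symm, rfl, by rw [h, a3]⟩
  · refine ⟨q, p, m.rot q, ⟨rfl, rfl⟩, ⟨rfl, rfl⟩, fst1, ?_, honq, honp, ?_, Or.inl ?_⟩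
    · rw [hon _ fst1]
      rintro (h' | h')
      · exact a1 h'
      · rw [h] at h'; exact a1 (m.rot.injective h').symm
    · intro e he; rw [h]
      rcases a4 e he with h | h | h
      · exact Or.inl h
      · exact Or.inr (Or.inr h)
      · exact Or.inr (Or.inl h)
    · refine ⟨hleft.2 fun h' => ?_, rfl, h.symm, by rw [h, a3]⟩
      rw [h] at h'; exact a1 (m.rot.injective h').symm

/-- A discrete Jordan curve theorem: the two sides of a cycle. -/
theorem PlanarEmbedding.exists_sides (m : PlanarEmbedding G) (hG : IsCubic G) {f : ℕ → Fin n}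
    {N : ℕ} (hf : IsCyclicSeq f N) (hN : 3 ≤ N) (hadj : ∀ i, G.Adj (f i) (f (i + 1))) :
    ∃ (χ : G.Dart → ZMod 2) (D : Set (Fin n)), (∀ d, χ (m.rot d.symm) = χ d) ∧
      (∀ d : G.Dart, χ d + χ d.symm = if OnCycle f d.edge then 1 else 0) ∧
      (∀ d : G.Dart, ¬ OnCycle f d.edge → (χ d = 1 ↔ d.fst ∈ D)) ∧
      (∀ d : G.Dart, ¬ OnCycle f d.edge → (d.snd ∈ D ↔ d.fst ∈ D)) ∧
      ∀ i, f (i + 1) ∈ D ↔ m.LeftAt f i := by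
  obtain ⟨χ₀, h1, h2⟩ := m.exists_dual_coloring
    (fun e => if OnCycle f e then 1 else 0) fun v => by
      by_cases hv : v ∈ Set.range f
      · obtain ⟨i, rfl⟩ := hv
        obtain ⟨j, hj⟩ := hf.exists_succ i
        rw [hj]
        obtain ⟨q, p, t, ⟨hq, -⟩, -, -, ht, hqc, hpc, -, hrot⟩ := m.darts_on_cycle hG hf hN hadj j
        rw [← hq, m.sum_darts_cubic hG q]
        rcases hrot with ⟨-, r1, r2, r3⟩ | ⟨-, r1, r2, r3⟩
        · rw [r1, r2, if_pos hqc, if_pos hpc, if_neg ht]; decide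
        · rw [r1, r2, if_pos hqc, if_pos hpc, if_neg ht]; decide
      · refine Finset.sum_eq_zero fun d hd => if_neg fun h => hv ?_
        simp only [Finset.mem_filter, Finset.mem_univ, true_and] at hd
        rw [← hd]
        exact OnCycle.mem_range (v := d.snd) h
  have key : ∀ (χ : G.Dart → ZMod 2), (∀ d, χ (m.rot d.symm) = χ d) →
      (∀ d : G.Dart, χ d + χ d.symm = if OnCycle f d.edge then 1 else 0) →
      ∀ d : G.Dart, χ d + χ (m.rot d) = if OnCycle f d.edge then 1 else 0 := fun χ h1 h2 d => by
    rw [← h2, ← h1 d.symm, SimpleGraph.Dart.symm_symm]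
  obtain ⟨q₀, hq₀⟩ : ∃ q₀ : G.Dart, q₀.fst = f 1 ∧ q₀.snd = f 2 :=
    ⟨⟨(f 1, f 2), hadj 1⟩, rfl, rfl⟩
  -- A colouring remains one after adding a constant; this choice makes the colour at the dart `f 1
  -- → f 2` zero, and the induction below carries it along the cycle.
  set χ : G.Dart → ZMod 2 := fun d => χ₀ d + χ₀ q₀ with hχ
  have g1 : ∀ d, χ (m.rot d.symm) = χ d := fun d => by simp only [hχ, h1]
  have g2 : ∀ d : G.Dart, χ d + χ d.symm = if OnCycle f d.edge then 1 else 0 := fun d => by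
    rw [← h2, hχ]
    have : ∀ a b c : ZMod 2, a + c + (b + c) = a + b := by decide
    exact this _ _ _
  have g3 := key χ g1 g2
  -- the colour to the right of the cycle
  have hq : ∀ i, ∀ q : G.Dart, q.fst = f (i + 1) → q.snd = f (i + 2) → χ q = 0 := by
    intro i
    induction i with
    | zero =>
      intro q e1 e2
      rw [dart_eq_of_fst_snd (e1.trans hq₀.1.symm) (e2.trans hq₀.2.symm)]
      exact zmod_two_add_self _
    | succ i ih =>
      intro q e1 e2
      obtain ⟨q', p, t, ⟨hq1, hq2⟩, ⟨hp1, hp2⟩, ht1, ht, hqc, hpc, -, hrot⟩ :=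
        m.darts_on_cycle hG hf hN hadj (i + 1)
      rw [dart_eq_of_fst_snd (e1.trans hq1.symm) (e2.trans hq2.symm)]
      have hp0 : χ p.symm = 0 := ih p.symm hp2 hp1
      have e3 := g2 p
      have e4 := g3 p
      have e5 := g3 t
      rw [if_pos hpc, hp0, add_zero] at e3
      rw [if_pos hpc, e3] at e4
      rw [if_neg ht] at e5
      have ha2 : ∀ a : ZMod 2, 1 + a = 1 → a = 0 := by decide
      rcases hrot with ⟨-, r1, r2, r3⟩ | ⟨-, r1, r2, r3⟩
      · rw [r3] at e4; exact ha2 _ e4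
      · rw [r2] at e4
        rw [r3, ha2 _ e4, zero_add] at e5
        exact e5
  set D : Set (Fin n) := {v | ∃ d : G.Dart, d.fst = v ∧ ¬ OnCycle f d.edge ∧ χ d = 1} with hD
  -- A vertex of the cycle has only its third edge off the cycle, and at any other vertex the colour
  -- does not change, so the colours of the darts off the cycle define a side for every vertex.
  have huniq : ∀ d e : G.Dart, d.fst = e.fst → ¬ OnCycle f d.edge → ¬ OnCycle f e.edge →
      χ d = χ e := by
    intro d e hde hd he
    by_cases hv : d.fst ∈ Set.range f
    · obtain ⟨i, hi⟩ := hv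
      obtain ⟨j, hj⟩ := hf.exists_succ i
      obtain ⟨q', p, t, -, -, -, -, hqc, hpc, hall, -⟩ := m.darts_on_cycle hG hf hN hadj j
      have : ∀ d : G.Dart, d.fst = f (j + 1) → ¬ OnCycle f d.edge → d = t := by
        intro d h1 h2
        rcases hall d h1 with rfl | rfl | rfl
        · exact absurd hqc h2
        · exact absurd hpc h2
        · rfl
      rw [this d (by rw [← hi, hj]) hd, this e (by rw [← hde, ← hi, hj]) he]
    · have hn : ∀ e : G.Dart, e.fst = d.fst → χ (m.rot e) = χ e := fun e he => by
        have := g3 e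
        rw [if_neg (show ¬ OnCycle f e.edge from
          fun h => hv (he ▸ OnCycle.mem_range (v := e.snd) h))] at this
        exact (zmod_two_eq_of_add this).symm
      rcases (m.rot_cubic hG d).2.2.2 e hde.symm with rfl | rfl | rfl
      · rfl
      · rw [hn d rfl]
      · rw [hn _ (by rw [m.rot_fst]), hn d rfl]
  have hDχ : ∀ d : G.Dart, ¬ OnCycle f d.edge → (χ d = 1 ↔ d.fst ∈ D) := fun d hd =>
    ⟨fun h => ⟨d, rfl, hd, h⟩, fun ⟨e, he, hec, he1⟩ => by rw [huniq d e he.symm hd hec, he1]⟩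
  refine ⟨χ, D, g1, g2, hDχ, fun d hd => ?_, fun i => ?_⟩
  · have hs : ¬ OnCycle f d.symm.edge := by rwa [SimpleGraph.Dart.edge_symm]
    have e1 := hDχ d.symm hs
    have e2 := g2 d
    rw [if_neg hd] at e2
    rw [← zmod_two_eq_of_add e2, hDχ d hd] at e1
    exact e1.symm
  · obtain ⟨q', p, t, ⟨hq1, hq2⟩, -, ht1, ht, hqc, hpc, -, hrot⟩ := m.darts_on_cycle hG hf hN hadj i
    have e1 := hDχ t ht
    rw [ht1] at e1
    rw [← e1]
    have e2 := g3 q'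
    have e3 := g3 t
    rw [if_pos hqc, hq i q' hq1 hq2, zero_add] at e2
    rw [if_neg ht] at e3
    rcases hrot with ⟨r, r1, r2, r3⟩ | ⟨r, r1, r2, r3⟩
    · rw [r1] at e2; exact iff_of_true e2 r
    · rw [r3, hq i q' hq1 hq2, add_zero] at e3
      rw [e3]; exact iff_of_false (by decide) r

end Sides

/-! ## Changing a matching along an alternating cycle -/

section CoverSwitch

open Equiv Equiv.Perm
open scoped Classical

variable {n : ℕ} {G : SimpleGraph (Fin n)}

/-- `f` is a cycle that alternates between the edges of `μ` and those of `μ'`; elsewhere the two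
matchings agree. -/
structure IsSwitch (f : ℕ → Fin n) (k : ℕ) (μ μ' : Perm (Fin n)) : Prop where
  seq : IsCyclicSeq f (2 * k)
  two_le : 2 ≤ k
  even : ∀ i, μ (f (2 * i)) = f (2 * i + 1)
  odd : ∀ i, μ' (f (2 * i + 1)) = f (2 * i + 2)
  agree : ∀ v, v ∉ Set.range f → μ' v = μ v

variable {f : ℕ → Fin n} {k : ℕ} {μ μ' : Perm (Fin n)}

theorem IsSwitch.neighbors (h : IsSwitch f k μ μ') (hμ : IsMatchingOf G μ)
    (hμ' : IsMatchingOf G μ') (i : ℕ) :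
    (μ (f (i + 1)) = f (i + 2) ∧ μ' (f (i + 1)) = f i) ∨
      (μ (f (i + 1)) = f i ∧ μ' (f (i + 1)) = f (i + 2)) := by
  rcases Nat.even_or_odd' i with ⟨j, rfl | rfl⟩
  · right
    exact ⟨by rw [← h.even, hμ.1], h.odd j⟩
  · left
    refine ⟨?_, ?_⟩
    · exact h.even (j + 1)
    · rw [show 2 * j + 1 + 1 = 2 * j + 2 by ring, ← h.odd, hμ'.1]

theorem IsSwitch.adj (h : IsSwitch f k μ μ') (hμ : IsMatchingOf G μ) (hμ' : IsMatchingOf G μ')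
    (i : ℕ) : G.Adj (f i) (f (i + 1)) := by
  obtain ⟨j, hj⟩ := h.seq.exists_succ i
  rw [hj, h.seq.succ_congr hj]
  rcases h.neighbors hμ hμ' j with ⟨h1, h2⟩ | ⟨h1, h2⟩
  · rw [show j + 1 + 1 = j + 2 from rfl, ← h1]; exact hμ.2 _
  · rw [show j + 1 + 1 = j + 2 from rfl, ← h2]; exact hμ'.2 _

theorem IsSwitch.onCycle_iff (h : IsSwitch f k μ μ') (hμ : IsMatchingOf G μ)
    (hμ' : IsMatchingOf G μ') {v : Fin n} (hv : v ∈ Set.range f) (u : Fin n) :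
    (OnCycle f s(v, u) ↔ u = μ v ∨ u = μ' v) ∧ μ v ≠ μ' v := by
  obtain ⟨i, rfl⟩ := hv
  obtain ⟨j, hj⟩ := h.seq.exists_succ i
  rw [hj, h.seq.onCycle_iff]
  have hne := h.seq.ne_add_two (by have := h.two_le; omega) j
  rcases h.neighbors hμ hμ' j with ⟨h1, h2⟩ | ⟨h1, h2⟩
  · rw [h1, h2]; exact ⟨Iff.rfl, hne⟩
  · rw [h1, h2]; exact ⟨or_comm, hne.symm⟩

/-- The cover complementary to `μ` contains exactly the `μ'`-edges of the alternating cycle. Each of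
them is traversed in one direction, so exactly one of its two ends is a vertex where the run leaves
the cycle. -/
theorem IsSwitch.sources (h : IsSwitch f k μ μ') (hμ : IsMatchingOf G μ) (hμ' : IsMatchingOf G μ')
    {ψ : G.Dart → ZMod 2} {π : Perm (Fin n)}
    (h2 : ∀ d : G.Dart, ψ d + ψ d.symm = if μ d.fst = d.snd then 0 else 1)
    (hπ : RunsAlong π μ ψ) {v : Fin n} (hv : v ∈ Set.range f) :
    (OnCycle f s(v, π v) → π v = μ' v) ∧
    (¬ OnCycle f s(μ' v, π (μ' v)) ↔ OnCycle f s(v, π v)) := by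
  have key : ∀ v ∈ Set.range f, (OnCycle f s(v, π v) ↔ π v = μ' v) := fun v hv => by
    rw [(h.onCycle_iff hμ hμ' hv _).1]
    exact or_iff_right (hπ.ne v).symm
  have hv' : μ' v ∈ Set.range f :=
    OnCycle.mem_range (v := v) (by
      rw [Sym2.eq_swap, (h.onCycle_iff hμ hμ' hv _).1]; exact Or.inr rfl)
  refine ⟨(key v hv).1, ?_⟩
  rw [key v hv, key _ hv', hμ'.1]
  rcases hπ.dichotomy hμ.1 h2 (hμ'.2 v) (h.onCycle_iff hμ hμ' hv v).2 with ⟨h3, h4⟩ | ⟨h3, h4⟩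
  · exact iff_of_true h4 h3
  · exact iff_of_false (not_not.2 h4) h3

/-- Starting the cycle one step later exchanges the roles of the two matchings, so that facts proved
for one of them serve for the other. -/
theorem IsSwitch.shift (h : IsSwitch f k μ μ') : IsSwitch (fun i => f (i + 1)) k μ' μ where
  seq := by
    refine ⟨h.seq.pos, fun i => ?_, fun i hi j hj hij => ?_⟩
    · rw [show i + 2 * k + 1 = i + 1 + 2 * k by ring, h.seq.periodic]
    · exact h.seq.inj i hi j hj (h.seq.pred_congr hij)
  two_le := h.two_le
  even := h.odd
  odd := fun i => h.even (i + 1)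
  agree := fun v hv => by
    refine (h.agree v fun ⟨i, hi⟩ => hv ?_).symm
    obtain ⟨j, hj⟩ := h.seq.exists_succ i
    exact ⟨j, by rw [← hi, hj]⟩

/-- Two colourings of the faces, one for the cover of `μ` and one for the sides of the switching
cycle, add up to a colouring for the cover of `μ'`. The runs determined by the two covers then agree
on one side of the cycle and are opposite on the other, which is the situation of `switch_sign`. -/
theorem IsSwitch.numComponents_switch (m : PlanarEmbedding G) (hG : IsCubic G)
    (h : IsSwitch f k μ μ') (hμ : IsMatchingOf G μ) (hμ' : IsMatchingOf G μ')
    (hbal : ((Finset.range (2 * k)).filter fun i => Even i ∧ m.LeftAt f (i + 2 * k - 1)).card =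
      ((Finset.range (2 * k)).filter fun i => Odd i ∧ m.LeftAt f (i + 2 * k - 1)).card) :
    (-1 : ℤˣ) ^ (n + numComponents (coverOf G μ)) * (-1) ^ (n + numComponents (coverOf G μ')) =
      (-1) ^ (k + 1) := by
  have hN : 3 ≤ 2 * k := by have := h.two_le; omega
  obtain ⟨χ, D, c1, c2, c3, c4, c5⟩ := m.exists_sides hG h.seq hN (h.adj hμ hμ')
  have hmatch : ∀ d : G.Dart, μ d.fst = d.snd → ∀ e : G.Dart, e.fst = d.fst → e ≠ d →
      μ e.fst ≠ e.snd := fun d hd e he hne h' => hne (dart_eq_of_fst_snd he (by rw [← h', he, hd]))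
  obtain ⟨ψ, p1, p2⟩ := m.exists_dual_coloring
    (fun e => if ∃ v, e = s(v, μ v) then 0 else 1) fun v => by
      set d : G.Dart := ⟨(v, μ v), hμ.2 v⟩
      have : v = d.fst := rfl
      rw [this, m.sum_darts_cubic hG d]
      obtain ⟨a1, a2, -, -⟩ := m.rot_cubic hG d
      have hne : ∀ e : G.Dart, e.fst = d.fst → e ≠ d → ¬ ∃ v, e.edge = s(v, μ v) := by
        rintro e he hed ⟨w, hw⟩
        have hw' : s(e.fst, e.snd) = s(w, μ w) := hw
        rw [Sym2.eq_iff] at hw'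
        rcases hw' with ⟨h1, h2⟩ | ⟨h1, h2⟩
        · exact hmatch d rfl e he hed (by rw [h1, h2])
        · exact hmatch d rfl e he hed (by rw [h1, h2, hμ.1])
      rw [if_pos ⟨v, rfl⟩, if_neg (hne _ (m.rot_fst d) a1),
        if_neg (hne _ (by rw [m.rot_fst, m.rot_fst]) a2)]
      decide
  have hedge : ∀ d : G.Dart, (∃ v, d.edge = s(v, μ v)) ↔ μ d.fst = d.snd := by
    intro d
    constructor
    · rintro ⟨w, hw⟩
      have hw' : s(d.fst, d.snd) = s(w, μ w) := hw
      rw [Sym2.eq_iff] at hw'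
      rcases hw' with ⟨h1, h2⟩ | ⟨h1, h2⟩
      · rw [h1, h2]
      · rw [h1, h2, hμ.1]
    · intro h'; exact ⟨d.fst, by rw [h']; rfl⟩
  replace p2 : ∀ d : G.Dart, ψ d + ψ d.symm = if μ d.fst = d.snd then 0 else 1 := fun d => by
    rw [p2]
    simp only [hedge]
  -- The covers of `μ` and `μ'` differ exactly in the edges of the cycle, which form the boundary of
  -- the set of faces with `χ = 1`.
  set ψ' : G.Dart → ZMod 2 := fun d => ψ d + χ d with hψ'
  have p1' : ∀ d, ψ' (m.rot d.symm) = ψ' d := fun d => by simp only [hψ', p1, c1]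
  have hoff : ∀ d : G.Dart, ¬ OnCycle f d.edge → (μ' d.fst = d.snd ↔ μ d.fst = d.snd) := by
    intro d hd
    by_cases hv : d.fst ∈ Set.range f
    · have h1 := (h.onCycle_iff hμ hμ' hv d.snd).1
      have h2 : ¬ OnCycle f s(d.fst, d.snd) := hd
      rw [h1, not_or] at h2
      exact iff_of_false (fun h => h2.2 h.symm) fun h => h2.1 h.symm
    · rw [h.agree _ hv]
  have hon : ∀ d : G.Dart, OnCycle f d.edge → (μ' d.fst = d.snd ↔ ¬ μ d.fst = d.snd) := by
    intro d hd
    have hv : d.fst ∈ Set.range f := OnCycle.mem_range (v := d.snd) hd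
    obtain ⟨h1, h2⟩ := h.onCycle_iff hμ hμ' hv d.snd
    rcases h1.1 hd with h3 | h3
    · rw [h3]; exact iff_of_false (fun h => h2 h.symm) (not_not.2 rfl)
    · rw [h3]; exact iff_of_true rfl h2
  have p2' : ∀ d : G.Dart, ψ' d + ψ' d.symm = if μ' d.fst = d.snd then 0 else 1 := fun d => by
    have e1 : ψ' d + ψ' d.symm = (ψ d + ψ d.symm) + (χ d + χ d.symm) := by
      simp only [hψ']; ring
    rw [e1, p2, c2]
    by_cases hd : OnCycle f d.edge
    · have := hon d hd
      by_cases h1 : μ d.fst = d.snd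
      · rw [if_pos hd, if_pos h1, if_neg (by tauto)]; decide
      · rw [if_pos hd, if_neg h1, if_pos (by tauto)]; decide
    · have := hoff d hd
      by_cases h1 : μ d.fst = d.snd
      · rw [if_neg hd, if_pos h1, if_pos (by tauto)]; decide
      · rw [if_neg hd, if_neg h1, if_neg (by tauto)]; decide
  obtain ⟨π, hπ⟩ := m.exists_runsAlong hG hμ p1 p2
  obtain ⟨π', hπ'⟩ := m.exists_runsAlong hG hμ' p1' p2'
  rw [← hπ.sign_eq hμ.1 p2, ← hπ'.sign_eq hμ'.1 p2']
  set C := Set.range f with hC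
  -- the vertices that are left along the third edge
  have third : ∀ v ∈ C, ∃ t : G.Dart, t.fst = v ∧ ¬ OnCycle f t.edge ∧
      ∀ u, G.Adj v u → ¬ OnCycle f s(v, u) → u = t.snd := by
    rintro _ ⟨i, rfl⟩
    obtain ⟨j, hj⟩ := h.seq.exists_succ i
    rw [hj]
    obtain ⟨q, p, t, -, -, ht1, ht, hqc, hpc, hall, -⟩ :=
      m.darts_on_cycle hG h.seq hN (h.adj hμ hμ') j
    refine ⟨t, ht1, ht, fun u hu hon => ?_⟩
    rcases hall ⟨(_, u), hu⟩ rfl with h' | h' | h'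
    · have h'' : s(f (j + 1), u) = q.edge := congrArg SimpleGraph.Dart.edge h'
      exact absurd (h'' ▸ hqc) hon
    · have h'' : s(f (j + 1), u) = p.edge := congrArg SimpleGraph.Dart.edge h'
      exact absurd (h'' ▸ hpc) hon
    · exact congrArg (fun d : G.Dart => d.snd) h'
  set S : Set (Fin n) := {v | v ∈ C ∧ ¬ OnCycle f s(v, π v)} with hS
  set S' : Set (Fin n) := {v | v ∈ C ∧ ¬ OnCycle f s(v, π' v)} with hS'
  have hnotS : ∀ v ∈ C, v ∉ S → OnCycle f s(v, π v) := fun v hv hs => by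
    by_contra hcon; exact hs ⟨hv, hcon⟩
  have hnotS' : ∀ v ∈ C, v ∉ S' → OnCycle f s(v, π' v) := fun v hv hs => by
    by_contra hcon; exact hs ⟨hv, hcon⟩
  have hmemC : ∀ v ∈ C, μ v ∈ C ∧ μ' v ∈ C := fun v hv => by
    refine ⟨OnCycle.mem_range (v := v) ?_, OnCycle.mem_range (v := v) ?_⟩ <;>
      rw [Sym2.eq_swap, (h.onCycle_iff hμ hμ' hv _).1]
    · exact Or.inl rfl
    · exact Or.inr rfl
  have hout : ∀ v, v ∉ C ∨ v ∈ S → ¬ OnCycle f s(v, π v) := fun v hv hon' =>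
    hv.elim (fun h => h (OnCycle.mem_range hon')) fun h => h.2 hon'
  have hsym := h.shift
  have hrange : Set.range (fun i => f (i + 1)) = C := by
    ext v
    constructor
    · rintro ⟨i, rfl⟩; exact ⟨i + 1, rfl⟩
    · rintro ⟨i, rfl⟩
      obtain ⟨j, hj⟩ := h.seq.exists_succ i
      exact ⟨j, hj.symm⟩
  have hon2 : ∀ e, OnCycle (fun i => f (i + 1)) e ↔ OnCycle f e := by
    intro e
    constructor
    · rintro ⟨i, hi⟩; exact ⟨i + 1, hi⟩
    · rintro ⟨i, hi⟩
      obtain ⟨j, hj⟩ := h.seq.exists_succ i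
      exact ⟨j, by rw [hi, hj, h.seq.succ_congr hj]⟩
  -- `switch_sign` is stated with classical decidability of equality; only the instance changes.
  have hsign : ∀ τ : Perm (Fin n), sign τ =
      (@sign (Fin n) (fun a b => Classical.propDecidable (a = b)) _) τ := fun τ => by congr!
  rw [hsign, hsign]
  refine switch_sign h.seq hμ.1 hμ'.1 h.even h.odd (C := C) (S := S) (S' := S') (D := D) rfl
    (fun v hv => hv.1) (fun v hv => hv.1) ?_ ?_ ?_ ?_ ?_ ?_ ?_ ?_ ?_ ?_
  · intro v hv
    have ho := hout v hv
    refine ⟨c4 ⟨(v, π v), hπ.adj v⟩ ho, fun hs => ?_⟩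
    obtain ⟨t, -, -, ht⟩ := third _ hs.1
    -- If the run entered `π v` and left it off the cycle, it would both times use the only third
    -- edge there, in opposite directions.
    have e1 := ht _ (hπ.adj (π v)) hs.2
    have e2 := ht v (hπ.adj v).symm (by rwa [Sym2.eq_swap])
    have d1 := hπ.dichotomy hμ.1 p2 (hπ.adj v) (hπ.ne v)
    rcases d1 with d1 | d1
    · exact d1.2 (e1.trans e2.symm)
    · exact d1.1 rfl
  · intro v hv hs
    exact (h.sources hμ hμ' p2 hπ hv).1 (hnotS v hv hs)
  · intro v hv
    have := (h.sources hμ hμ' p2 hπ hv).2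
    have hm := (hmemC v hv).2
    constructor
    · intro h1 h2; exact h2.2 (this.1 h1.2)
    · intro h1; exact ⟨hm, this.2 (hnotS v hv h1)⟩
  · intro v hv hs
    have := (hsym.sources hμ' hμ p2' hπ' (hrange ▸ hv)).1
    rw [hon2] at this
    exact this (hnotS' v hv hs)
  · intro v hv
    have := (hsym.sources hμ' hμ p2' hπ' (hrange ▸ hv)).2
    rw [hon2, hon2] at this
    have hm := (hmemC v hv).1
    constructor
    · intro h1 h2; exact h2.2 (this.1 h1.2)
    · intro h1; exact ⟨hm, this.2 (hnotS' v hv h1)⟩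
  all_goals
    -- A run leaves the cycle at `v` exactly if the dart along the third edge has colour `1`. So
    -- adding `χ` to the colouring exchanges leaving and arriving on the side `D` and changes
    -- nothing elsewhere.
    have hSt : ∀ v ∈ C, ∀ t : G.Dart, t.fst = v → ¬ OnCycle f t.edge →
        (∀ u, G.Adj v u → ¬ OnCycle f s(v, u) → u = t.snd) →
        (v ∈ S ↔ ψ t = 1) ∧ (v ∈ S' ↔ ψ' t = 1) := by
      intro v hv t ht1 ht htu
      have hnm : μ t.fst ≠ t.snd ∧ μ' t.fst ≠ t.snd := by
        have : ¬ OnCycle f s(t.fst, t.snd) := ht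
        rw [(h.onCycle_iff hμ hμ' (ht1 ▸ hv) _).1, not_or] at this
        exact ⟨fun h => this.1 h.symm, fun h => this.2 h.symm⟩
      constructor
      · constructor
        · intro hs
          exact hπ.eq_one t (by rw [ht1]; exact htu _ (hπ.adj v) hs.2)
        · intro h1
          have := hπ.apply_eq t h1 hnm.1
          rw [ht1] at this
          refine ⟨hv, ?_⟩
          rw [this, ← ht1]; exact ht
      · constructor
        · intro hs
          exact hπ'.eq_one t (by rw [ht1]; exact htu _ (hπ'.adj v) hs.2)
        · intro h1
          have := hπ'.apply_eq t h1 hnm.2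
          rw [ht1] at this
          refine ⟨hv, ?_⟩
          rw [this, ← ht1]; exact ht
  · intro v hv hD
    obtain ⟨t, ht1, ht, htu⟩ := third v hv
    obtain ⟨e1, e2⟩ := hSt v hv t ht1 ht htu
    have hχ : χ t = 0 := (zmod_two_cases _).resolve_right fun h1 => hD (ht1 ▸ (c3 t ht).1 h1)
    rw [e1, e2, hψ']
    simp only [hχ, add_zero]
  · intro v hv hD
    obtain ⟨t, ht1, ht, htu⟩ := third v hv
    obtain ⟨e1, e2⟩ := hSt v hv t ht1 ht htu
    have hχ : χ t = 1 := (c3 t ht).2 (ht1 ▸ hD)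
    rw [e1, e2, hψ']
    simp only [hχ]
    have : ∀ a : ZMod 2, a + 1 = 1 ↔ ¬ a = 1 := by decide
    exact this _
  · intro v hv hD
    have ho := hout v hv
    set d : G.Dart := ⟨(v, π v), hπ.adj v⟩
    have hχ : χ d = 0 := (zmod_two_cases _).resolve_right fun h1 => hD ((c3 d ho).1 h1)
    have h1 : ψ' d = 1 := by
      rw [hψ']; simp only [hχ, add_zero]; exact hπ.eq_one d rfl
    exact hπ'.apply_eq d h1 fun h' => hπ.ne v ((hoff d ho).1 h')
  · intro v hv hD
    have ho := hout v hv
    set d : G.Dart := ⟨(v, π v), hπ.adj v⟩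
    have hχ : χ d = 1 := (c3 d ho).2 hD
    have h1 : ψ' d = 0 := by
      rw [hψ']; simp only [hχ, hπ.eq_one d rfl]; decide
    have hne : μ' d.fst ≠ d.snd := fun h' => hπ.ne v ((hoff d ho).1 h')
    have h2 := p2' d
    rw [if_neg hne, h1, zero_add] at h2
    exact hπ'.apply_eq d.symm h2 fun h' => hne (by
      have h3 : μ' d.snd = d.fst := h'
      rw [← h3, hμ'.1])
  -- `LeftAt` at index `i` is about the vertex `f (i + 1)`, so the vertex `f i` has the index `i + 2
  -- * k - 1`, modulo the length.
  · have : ∀ i, f i ∈ D ↔ m.LeftAt f (i + 2 * k - 1) := fun i => by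
      rw [← c5, ← h.seq.periodic i]
      have := h.seq.pos
      rw [show i + 2 * k - 1 + 1 = i + 2 * k by omega]
    simp only [this]
    exact hbal

end CoverSwitch

end UDet

end


noncomputable section

namespace UDet

/-! ## Cyclic sequences as walks -/

section CycleWalk

open Equiv Equiv.Perm
open scoped Classical

variable {n : ℕ} {G : SimpleGraph (Fin n)} {f : ℕ → Fin n} {N : ℕ}

/-- The walk along a sequence of adjacent vertices. -/
def seqWalk (hadj : ∀ i, G.Adj (f i) (f (i + 1))) : ∀ N, G.Walk (f 0) (f N)
  | 0 => SimpleGraph.Walk.nil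
  | N + 1 => (seqWalk hadj N).concat (hadj N)

theorem support_seqWalk (hadj : ∀ i, G.Adj (f i) (f (i + 1))) (N : ℕ) :
    (seqWalk hadj N).support = (List.range (N + 1)).map f := by
  induction N with
  | zero => rfl
  | succ N ih =>
    rw [seqWalk, SimpleGraph.Walk.support_concat, ih, List.range_succ (n := N + 1), List.map_append]
    simp

theorem darts_seqWalk (hadj : ∀ i, G.Adj (f i) (f (i + 1))) (N : ℕ) :
    (seqWalk hadj N).darts = (List.range N).map fun i => ⟨(f i, f (i + 1)), hadj i⟩ := by
  induction N with
  | zero => rfl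
  | succ N ih =>
    rw [seqWalk, SimpleGraph.Walk.darts_concat, ih, List.range_succ, List.map_append]
    simp

/-- The closed walk along a cyclic sequence of adjacent vertices. -/
def IsCyclicSeq.walk (hf : IsCyclicSeq f N) (hadj : ∀ i, G.Adj (f i) (f (i + 1))) :
    G.Walk (f 0) (f 0) :=
  (seqWalk hadj N).copy rfl (by rw [← hf.periodic 0, zero_add])

theorem IsCyclicSeq.support_walk (hf : IsCyclicSeq f N) (hadj : ∀ i, G.Adj (f i) (f (i + 1))) :
    (hf.walk hadj).support = (List.range (N + 1)).map f := by
  rw [walk, SimpleGraph.Walk.support_copy, support_seqWalk]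

theorem IsCyclicSeq.darts_walk (hf : IsCyclicSeq f N) (hadj : ∀ i, G.Adj (f i) (f (i + 1))) :
    (hf.walk hadj).darts = (List.range N).map fun i => ⟨(f i, f (i + 1)), hadj i⟩ := by
  rw [walk, SimpleGraph.Walk.darts_copy, darts_seqWalk]

theorem IsCyclicSeq.length_walk (hf : IsCyclicSeq f N) (hadj : ∀ i, G.Adj (f i) (f (i + 1))) :
    (hf.walk hadj).length = N := by
  rw [← SimpleGraph.Walk.length_darts, hf.darts_walk]
  simp

theorem IsCyclicSeq.mem_support_walk (hf : IsCyclicSeq f N)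
    (hadj : ∀ i, G.Adj (f i) (f (i + 1))) (v : Fin n) :
    v ∈ (hf.walk hadj).support ↔ v ∈ Set.range f := by
  rw [hf.support_walk]
  simp only [List.mem_map, List.mem_range]
  constructor
  · rintro ⟨i, -, rfl⟩
    exact ⟨i, rfl⟩
  · intro h
    obtain ⟨i, hi, rfl⟩ := hf.exists_lt h
    exact ⟨i, by omega, rfl⟩

theorem IsCyclicSeq.getVert_walk (hf : IsCyclicSeq f N) (hadj : ∀ i, G.Adj (f i) (f (i + 1)))
    {i : ℕ} (hi : i ≤ N) : (hf.walk hadj).getVert i = f i := by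
  rw [SimpleGraph.Walk.getVert_eq_support_getElem _ (by rw [hf.length_walk]; exact hi)]
  simp [hf.support_walk]

theorem IsCyclicSeq.isCycle_walk (hf : IsCyclicSeq f N) (hN : 3 ≤ N)
    (hadj : ∀ i, G.Adj (f i) (f (i + 1))) : (hf.walk hadj).IsCycle := by
  rw [SimpleGraph.Walk.isCycle_def, SimpleGraph.Walk.isTrail_def]
  refine ⟨?_, ?_, ?_⟩
  · rw [SimpleGraph.Walk.edges, hf.darts_walk, List.map_map, List.nodup_map_iff_inj_on List.nodup_range]
    intro i hi j hj h
    rw [List.mem_range] at hi hj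
    simp only [Function.comp_apply, SimpleGraph.Dart.edge_mk, Sym2.eq_iff] at h
    rcases h with ⟨h, -⟩ | ⟨h1, h2⟩
    · exact hf.inj i hi j hj h
    · refine absurd ?_ (hf.ne_add_two hN j)
      rw [← h2]
      exact (hf.succ_congr h1).symm
  · intro h
    have := hf.length_walk hadj
    rw [h] at this
    simp at this
    omega
  · rw [hf.support_walk, List.range_succ_eq_map, List.map_cons, List.tail_cons, List.map_map,
      List.nodup_map_iff_inj_on List.nodup_range]
    intro i hi j hj h
    rw [List.mem_range] at hi hj
    exact hf.inj i hi j hj (hf.pred_congr h)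

/-- The index `i + N - 1` is the cyclic predecessor of `i` without a case distinction at `i = 0`. -/
theorem IsCyclicSeq.isLeft_walk (hf : IsCyclicSeq f N) (hadj : ∀ i, G.Adj (f i) (f (i + 1)))
    (m : PlanarEmbedding G) {i : ℕ} (hi : i < N) :
    m.IsLeft (hf.walk hadj) i ↔ m.LeftAt f (i + N - 1) := by
  rw [PlanarEmbedding.IsLeft, PlanarEmbedding.LeftAt, hf.length_walk, hf.getVert_walk hadj hi.le,
    hf.getVert_walk hadj (by omega), hf.getVert_walk hadj (Nat.mod_lt _ hf.pos).le, hf.apply_mod,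
    show i + N - 1 + 1 = i + N by omega, show i + N - 1 + 2 = i + 1 + N by omega, hf.periodic,
    hf.periodic]

theorem IsCyclicSeq.tension_walk (hf : IsCyclicSeq f N) (hadj : ∀ i, G.Adj (f i) (f (i + 1)))
    (m : PlanarEmbedding G) : m.tension (hf.walk hadj) = 0 ↔
    ((Finset.range N).filter fun i => Even i ∧ m.LeftAt f (i + N - 1)).card =
      ((Finset.range N).filter fun i => Odd i ∧ m.LeftAt f (i + N - 1)).card := by
  rw [PlanarEmbedding.tension, abs_eq_zero, sub_eq_zero, Nat.cast_inj, hf.length_walk]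
  have h : ∀ Q : ℕ → Prop, (Finset.range N).filter (fun i => Q i ∧ m.IsLeft (hf.walk hadj) i) =
      (Finset.range N).filter fun i => Q i ∧ m.LeftAt f (i + N - 1) := fun Q =>
    Finset.filter_congr fun i hi => and_congr_right fun _ =>
      hf.isLeft_walk hadj m (Finset.mem_range.1 hi)
  have h1 := h Even
  have h2 := h Odd
  refine ⟨fun h => ?_, fun h => ?_⟩
  · convert h using 2
    · convert h1.symm
    · convert h2.symm
  · convert h using 2
    · convert h1
    · convert h2

theorem IsCyclicSeq.forward_walk (hf : IsCyclicSeq f N) (hadj : ∀ i, G.Adj (f i) (f (i + 1)))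
    (o : EdgeOrientation G) : o.forward (hf.walk hadj) =
      ((Finset.range N).filter fun i => o.dir (f i) (f (i + 1))).card := by
  rw [EdgeOrientation.forward, hf.darts_walk, List.countP_map]
  clear hf
  induction N with
  | zero => rfl
  | succ N ih =>
    rw [List.range_succ, List.countP_append, ih, Finset.range_add_one, Finset.filter_insert]
    by_cases h : o.dir (f N) (f (N + 1)) <;> simp [h]

end CycleWalk

end UDet

end


noncomputable section

namespace UDet

/-! ## Signs of matchings under a semi-Pfaffian orientation -/

section Switching

open Equiv Equiv.Perm
open scoped Classical

variable {n : ℕ} {G : SimpleGraph (Fin n)}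

theorem EdgeOrientation.dir_swap (o : EdgeOrientation G) {u v : Fin n} (h : G.Adj u v) :
    o.dir v u ↔ ¬ o.dir u v := by
  refine ⟨o.asymm v u, fun h' => ?_⟩
  exact ((o.adj_iff u v).1 h).resolve_left h'

theorem EdgeOrientation.forward_add_reverse (o : EdgeOrientation G) {u v : Fin n} (p : G.Walk u v) :
    o.forward p + o.forward p.reverse = p.length := by
  rw [forward, forward, SimpleGraph.Walk.darts_reverse, List.countP_reverse, List.countP_map,
    ← SimpleGraph.Walk.length_darts,
    List.length_eq_countP_add_countP (fun d : G.Dart => decide (o.dir d.fst d.snd))]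
  congr 1
  refine List.countP_congr fun d _ => ?_
  simpa using o.dir_swap d.adj

theorem EdgeOrientation.oddlyOriented_iff (o : EdgeOrientation G) {v : Fin n} (p : G.Walk v v)
    (hp : Even p.length) : o.OddlyOriented p ↔ Odd (o.forward p) := by
  rw [← o.forward_add_reverse p] at hp
  exact ⟨fun h => h.1, fun h => ⟨h, (Nat.even_add'.1 hp).1 h⟩⟩

/-- The signs of the edges. -/
def signAdj (o : EdgeOrientation G) : Matrix (Fin n) (Fin n) ℤ := skewAdj o fun _ => 1

theorem isAlt_skewAdj {R : Type*} [Ring R] (o : EdgeOrientation G) (w : Sym2 (Fin n) → R) :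
    (∀ x y, skewAdj o w x y = - skewAdj o w y x) ∧ ∀ x, skewAdj o w x x = 0 := by
  refine ⟨fun x y => ?_, fun x => ?_⟩
  · simp only [skewAdj, Matrix.of_apply]
    by_cases h1 : o.dir x y
    · rw [if_pos h1, if_neg (o.asymm _ _ h1), if_pos h1, neg_neg, Sym2.eq_swap]
    · by_cases h2 : o.dir y x
      · rw [if_neg h1, if_pos h2, if_pos h2, Sym2.eq_swap]
      · rw [if_neg h1, if_neg h2, if_neg h2, if_neg h1, neg_zero]
  · have : ¬ o.dir x x := fun h => o.asymm _ _ h h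
    simp [skewAdj, this]

theorem isAlt_signAdj (o : EdgeOrientation G) : IsAlt (signAdj o) := isAlt_skewAdj o _

theorem signAdj_sq (o : EdgeOrientation G) {u v : Fin n} (h : G.Adj u v) :
    signAdj o u v * signAdj o u v = 1 := by
  simp only [signAdj, skewAdj, Matrix.of_apply]
  by_cases h1 : o.dir u v
  · simp [h1]
  · simp [h1, (o.dir_swap h).2 h1]

theorem signAdj_eq (o : EdgeOrientation G) {u v : Fin n} (h : G.Adj u v) :
    signAdj o u v = if o.dir u v then 1 else -1 := by
  simp only [signAdj, skewAdj, Matrix.of_apply]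
  by_cases h1 : o.dir u v
  · simp [h1]
  · simp [h1, (o.dir_swap h).2 h1]

theorem prod_pairs (h : Even n) {R : Type*} [CommMonoid R] (σ : Perm (Fin n)) (t : Fin n → R) :
    ∏ k : Fin (n / 2), (t (σ (pairPos n (k, false))) * t (σ (pairPos n (k, true)))) = ∏ v, t v := by
  rw [← Equiv.prod_comp ((pairEquiv h).trans σ) t, Fintype.prod_prod_type]
  refine Finset.prod_congr rfl fun k _ => ?_
  rw [Fintype.prod_bool, mul_comm]
  rfl

theorem pfTerm_sq (o : EdgeOrientation G) (h : Even n) {μ : Perm (Fin n)} (hμ : IsMatchingOf G μ) :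
    pfTerm h (signAdj o) μ * pfTerm h (signAdj o) μ = 1 := by
  obtain ⟨σ, -, hσ⟩ := exists_listing h hμ.isMatchingPerm
  rw [← hσ, pfTerm_eq h (isAlt_signAdj o), listTerm, mul_mul_mul_comm, ← Finset.prod_mul_distrib,
    Finset.prod_eq_one, mul_one]
  · simp only [Int.cast_id]
    rw [← Units.val_mul, Int.units_mul_self, Units.val_one]
  · intro k _
    refine signAdj_sq o ?_
    have : σ (pairPos n (k, true)) = μ (σ (pairPos n (k, false))) := by
      rw [← hσ, Perm.mul_apply, Perm.mul_apply, perm_inv_apply, stdMatching_pairPos]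
      rfl
    rw [this]
    exact hμ.2 _

variable {f : ℕ → Fin n} {k : ℕ} {μ μ' : Perm (Fin n)}

/-- The rotation `γ` of the cycle by one step conjugates `μ` to `μ'`. Hence `γ * σ` lists `μ'` if
`σ` lists `μ`. The minus sign is the sign of `γ`, a cycle of even length, and the remaining product
runs once over all edges of the cycle. -/
theorem IsSwitch.pfTerm_switch (o : EdgeOrientation G) (hn : Even n) (h : IsSwitch f k μ μ')
    (hμ : IsMatchingOf G μ) (hμ' : IsMatchingOf G μ') :
    pfTerm hn (signAdj o) μ * pfTerm hn (signAdj o) μ' =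
      - (-1) ^ ((Finset.range (2 * k)).filter fun i => o.dir (f i) (f (i + 1))).card := by
  obtain ⟨γ, g1, g2, g3⟩ := h.seq.exists_rotation
  have g3' : sign γ = -1 := by
    have hs : ∀ τ : Perm (Fin n), sign τ =
        (@sign (Fin n) (fun a b => Classical.propDecidable (a = b)) _) τ := fun τ => by congr!
    rw [hs, g3]
    exact Odd.neg_one_pow ⟨k - 1, by have := h.two_le; omega⟩
  obtain ⟨σ, -, hσ⟩ := exists_listing hn hμ.isMatchingPerm
  have hadj := h.adj hμ hμ'
  have hconj : ∀ v, γ (μ v) = μ' (γ v) := by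
    intro v
    by_cases hv : v ∈ Set.range f
    · obtain ⟨i, rfl⟩ := hv
      rw [g1]
      obtain ⟨j, rfl | rfl⟩ := Nat.even_or_odd' i
      · rw [h.even, g1, h.odd]
      · rw [← h.even, hμ.1, g1, show 2 * j + 1 + 1 = 2 * j + 2 by ring, ← h.odd, hμ'.1]
    · have : μ v ∉ Set.range f := by
        rintro ⟨i, hi⟩
        refine hv ?_
        obtain ⟨j, rfl | rfl⟩ := Nat.even_or_odd' i
        · exact ⟨2 * j + 1, by rw [← h.even, hi, hμ.1]⟩
        · exact ⟨2 * j, by rw [← hμ.1 (f (2 * j)), h.even, hi, hμ.1]⟩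
      rw [g2 _ hv, g2 _ this, h.agree v hv]
  have hσ' : (γ * σ) * stdMatching hn * (γ * σ)⁻¹ = μ' := by
    rw [_root_.mul_inv_rev, show γ * σ * stdMatching hn * (σ⁻¹ * γ⁻¹) =
      γ * (σ * stdMatching hn * σ⁻¹) * γ⁻¹ by group, hσ]
    ext v : 1
    rw [Perm.mul_apply, Perm.mul_apply, hconj, perm_apply_inv]
  set t : Fin n → ℤ := fun v => if v ∈ Set.range f then signAdj o v (γ v) else 1 with ht
  have hlist : ∀ k, σ (pairPos n (k, true)) = μ (σ (pairPos n (k, false))) := fun k => by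
    rw [← hσ, Perm.mul_apply, Perm.mul_apply, perm_inv_apply, stdMatching_pairPos]
    rfl
  have htf : ∀ i, t (f i) = signAdj o (f i) (f (i + 1)) := fun i => by
    rw [ht]
    simp only [Set.mem_range, exists_apply_eq_apply, if_true, g1]
  -- If `x` is at an odd position, both entries are traversed backwards and the two changes of sign
  -- cancel. Off the cycle both factors are the same entry, whose square is `1`.
  have hpair : ∀ x, signAdj o x (μ x) * signAdj o (γ x) (γ (μ x)) = t x * t (μ x) := by
    intro x
    by_cases hx : x ∈ Set.range f
    · obtain ⟨i, rfl⟩ := hx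
      obtain ⟨j, rfl | rfl⟩ := Nat.even_or_odd' i
      · rw [h.even, g1, g1, htf, htf]
      · have : μ (f (2 * j + 1)) = f (2 * j) := by rw [← h.even, hμ.1]
        rw [this, g1, g1, htf, htf, (isAlt_signAdj o).1 (f (2 * j + 1)) (f (2 * j)),
          (isAlt_signAdj o).1 (f (2 * j + 1 + 1)) (f (2 * j + 1))]
        ring
    · have hx' : μ x ∉ Set.range f := fun hx' => by
        obtain ⟨i, hi⟩ := hx'
        refine hx ?_
        obtain ⟨j, rfl | rfl⟩ := Nat.even_or_odd' i
        · exact ⟨2 * j + 1, by rw [← h.even, hi, hμ.1]⟩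
        · exact ⟨2 * j, by rw [← hμ.1 (f (2 * j)), h.even, hi, hμ.1]⟩
      rw [g2 _ hx, g2 _ hx', signAdj_sq o (hμ.2 x), ht]
      simp only [if_neg hx, if_neg hx', mul_one]
  have hprod : ∏ v, t v = ∏ i ∈ Finset.range (2 * k), signAdj o (f i) (f (i + 1)) := by
    rw [ht, ← Finset.prod_filter]
    symm
    refine Finset.prod_bij (fun i _ => f i) ?_ ?_ ?_ ?_
    · intro i _
      simp
    · intro i hi j hj hij
      exact h.seq.inj i (Finset.mem_range.1 hi) j (Finset.mem_range.1 hj) hij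
    · intro v hv
      obtain ⟨i, hi, rfl⟩ := h.seq.exists_lt (Finset.mem_filter.1 hv).2
      exact ⟨i, Finset.mem_range.2 hi, rfl⟩
    · intro i _
      rw [g1]
  have hcard : ∏ i ∈ Finset.range (2 * k), signAdj o (f i) (f (i + 1)) =
      (-1) ^ ((Finset.range (2 * k)).filter fun i => o.dir (f i) (f (i + 1))).card := by
    rw [Finset.prod_congr rfl fun i _ => signAdj_eq o (hadj i), Finset.prod_ite,
      Finset.prod_const_one, one_mul, Finset.prod_const]
    -- The product counts the backward edges; as there are `2 * k` edges in all, the forward ones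
    -- have the same parity.
    have := Finset.card_filter_add_card_filter_not (s := Finset.range (2 * k))
      (fun i => o.dir (f i) (f (i + 1)))
    rw [Finset.card_range] at this
    refine neg_one_pow_congr ?_
    have h2 := even_two_mul k
    rw [← this, Nat.even_add] at h2
    exact h2.symm
  rw [← hcard, ← hprod, ← prod_pairs hn σ t]
  conv_lhs => rw [← hσ, ← hσ', pfTerm_eq hn (isAlt_signAdj o), pfTerm_eq hn (isAlt_signAdj o)]
  rw [listTerm, listTerm, Perm.sign_mul, g3', mul_mul_mul_comm, ← Finset.prod_mul_distrib]
  have hs : (sign σ : ℤ) * sign σ = 1 := by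
    rw [← Units.val_mul, Int.units_mul_self, Units.val_one]
  have hs' : (((sign σ : ℤˣ) : ℤ) : ℤ) * (((-1 * sign σ : ℤˣ) : ℤ) : ℤ) = -1 := by
    push_cast
    linear_combination - hs
  simp only [Int.cast_id]
  rw [hs', neg_one_mul, neg_inj]
  refine Finset.prod_congr rfl fun k _ => ?_
  rw [hlist, ← hpair, Perm.mul_apply, Perm.mul_apply, hlist]

/-- The matching `μ` itself matches the vertices off the cycle with each other. -/
theorem IsSwitch.isCentral (h : IsSwitch f k μ μ') (hμ : IsMatchingOf G μ)
    (hμ' : IsMatchingOf G μ') : IsCentral (h.seq.walk (h.adj hμ hμ')) := by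
  have hoff : ∀ v, v ∉ Set.range f → μ v ∉ Set.range f := by
    rintro v hv ⟨i, hi⟩
    refine hv ?_
    obtain ⟨j, rfl | rfl⟩ := Nat.even_or_odd' i
    · exact ⟨2 * j + 1, by rw [← h.even, hi, hμ.1]⟩
    · exact ⟨2 * j, by rw [← hμ.1 (f (2 * j)), h.even, hi, hμ.1]⟩
  refine ⟨{ verts := Set.univ
            Adj := fun u v => μ u.1 = v.1
            adj_sub := fun {u v} huv => ?_
            edge_vert := fun _ => Set.mem_univ _
            symm := ⟨fun u v huv => ?_⟩ }, ?_, fun _ => Set.mem_univ _⟩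
  · rw [SimpleGraph.comap_adj]
    simpa [← huv] using hμ.2 u.1
  · rw [← huv, hμ.1]
  · intro v _
    have hv : μ v.1 ∈ {u | u ∉ (h.seq.walk (h.adj hμ hμ')).support} := by
      have := v.2
      simp only [Set.mem_ofPred_eq, h.seq.mem_support_walk] at this ⊢
      exact hoff _ this
    exact ⟨⟨μ v.1, hv⟩, rfl, fun w hw => Subtype.ext (Eq.symm (show μ v.1 = w.1 from hw))⟩

/-- The word `μ (μ' μ) ^ i` is a palindrome of odd length, hence conjugate to its middle letter,
which has no fixed point. -/
theorem ne_apply_pow_of_involutive {V : Type*} {μ μ' : Perm V} (hμ : IsMatchingPerm μ)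
    (hμ' : IsMatchingPerm μ') (i : ℕ) : ∀ v, v ≠ μ (((μ' * μ) ^ i) v) := by
  induction i using Nat.strong_induction_on with
  | _ i ih =>
    match i, ih with
    | 0, _ => exact fun v h => hμ.2 v h.symm
    | 1, _ =>
      intro v h
      rw [pow_one, Perm.mul_apply] at h
      exact hμ'.2 (μ v) (μ.injective (by rw [hμ.1, ← h]))
    | i + 2, ih =>
      intro v h
      refine ih i (by omega) ((μ' * μ) v) ?_
      rw [← Perm.mul_apply _ (μ' * μ), ← pow_succ]
      conv_lhs => rw [h, pow_succ']
      simp only [Perm.mul_apply, hμ.1, hμ'.1]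

/-- Switch only the component of `v₀` in the symmetric difference of the two matchings. The even
positions of the cycle are the orbit of `v₀` under `μ' * μ`. On the cycle `μ''` is the target `μ'`,
so strictly fewer disagreements with the target remain. -/
theorem exists_isSwitch (hμ : IsMatchingOf G μ) (hμ' : IsMatchingOf G μ') {v₀ : Fin n}
    (hne : μ v₀ ≠ μ' v₀) : ∃ (μ'' : Perm (Fin n)) (f : ℕ → Fin n) (k : ℕ), IsMatchingOf G μ'' ∧
      IsSwitch f k μ μ'' ∧ (∀ v, μ v = μ' v → μ'' v = μ' v) ∧ μ'' v₀ = μ' v₀ := by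
  set τ : Perm (Fin n) := μ' * μ with hτ
  set k := Function.minimalPeriod τ v₀ with hk
  have hper : (τ ^ k) v₀ = v₀ := by
    rw [← Perm.iterate_eq_pow]
    exact Function.iterate_minimalPeriod
  have hpos : 0 < k := Function.minimalPeriod_pos_of_mem_periodicPts
    (Function.mem_periodicPts.2 ⟨orderOf τ, orderOf_pos τ, by
      rw [Function.IsPeriodicPt, Function.IsFixedPt, Perm.iterate_eq_pow, pow_orderOf_eq_one]; rfl⟩)
  have htwo : 2 ≤ k := by
    by_contra hlt
    have : k = 1 := by omega
    rw [this, pow_one, hτ, Perm.mul_apply] at hper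
    exact hne (by rw [← hμ'.1 (μ v₀), hper])
  set f : ℕ → Fin n := fun i => if Even i then (τ ^ (i / 2)) v₀ else μ ((τ ^ (i / 2)) v₀) with hf
  have f0 : ∀ i, f (2 * i) = (τ ^ i) v₀ := fun i => by
    simp [hf]
  have f1 : ∀ i, f (2 * i + 1) = μ ((τ ^ i) v₀) := fun i => by
    have : ¬ Even (2 * i + 1) := by simp
    simp only [hf, if_neg this]
    rw [show (2 * i + 1) / 2 = i by omega]
  have hinj : ∀ i < k, ∀ j < k, (τ ^ i) v₀ = (τ ^ j) v₀ → i = j := fun i hi j hj h =>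
    Function.iterate_injOn_Iio_minimalPeriod hi hj (by simpa only [Perm.iterate_eq_pow] using h)
  -- Even and odd positions never coincide, so the closed sequence of length `2 * k` has no
  -- repetitions.
  have hmix : ∀ i j, (τ ^ i) v₀ ≠ μ ((τ ^ j) v₀) := by
    have key : ∀ i j, i ≤ j → (τ ^ i) v₀ ≠ μ ((τ ^ j) v₀) := fun i j hij h => by
      obtain ⟨m, rfl⟩ := Nat.exists_eq_add_of_le hij
      rw [add_comm, pow_add, Perm.mul_apply] at h
      exact ne_apply_pow_of_involutive hμ.isMatchingPerm hμ'.isMatchingPerm m _ h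
    intro i j h
    rcases le_total i j with hij | hij
    · exact key i j hij h
    · exact key j i hij (by rw [h, hμ.1])
  have hseq : IsCyclicSeq f (2 * k) := by
    refine ⟨by omega, fun i => ?_, fun i hi j hj h => ?_⟩
    · obtain ⟨j, rfl | rfl⟩ := Nat.even_or_odd' i
      · rw [← mul_add, f0, f0, pow_add, Perm.mul_apply, hper]
      · rw [show 2 * j + 1 + 2 * k = 2 * (j + k) + 1 by ring, f1, f1, pow_add, Perm.mul_apply, hper]
    · obtain ⟨i', rfl | rfl⟩ := Nat.even_or_odd' i <;> obtain ⟨j', rfl | rfl⟩ := Nat.even_or_odd' j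
      · rw [f0, f0] at h
        rw [hinj i' (by omega) j' (by omega) h]
      · rw [f0, f1] at h
        exact absurd h (hmix _ _)
      · rw [f0, f1] at h
        exact absurd h.symm (hmix _ _)
      · rw [f1, f1] at h
        rw [hinj i' (by omega) j' (by omega) (μ.injective h)]
  have heven : ∀ i, μ (f (2 * i)) = f (2 * i + 1) := fun i => by rw [f0, f1]
  have hodd : ∀ i, μ' (f (2 * i + 1)) = f (2 * i + 2) := fun i => by
    rw [f1, show 2 * i + 2 = 2 * (i + 1) by ring, f0, pow_succ', Perm.mul_apply, hτ, Perm.mul_apply]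
  have hr : ∀ v, v ∈ Set.range f → μ v ∈ Set.range f := by
    rintro _ ⟨i, rfl⟩
    obtain ⟨j, rfl | rfl⟩ := Nat.even_or_odd' i
    · exact ⟨_, (heven j).symm⟩
    · exact ⟨2 * j, by rw [← heven, hμ.1]⟩
  have hr' : ∀ v, v ∈ Set.range f → μ' v ∈ Set.range f := by
    rintro _ ⟨i, rfl⟩
    obtain ⟨l, hl⟩ := hseq.exists_succ i
    rw [hl]
    obtain ⟨j, rfl | rfl⟩ := Nat.even_or_odd' l
    · exact ⟨_, (hodd j).symm⟩
    · exact ⟨2 * j + 1, by rw [show 2 * j + 1 + 1 = 2 * j + 2 by ring, ← hodd, hμ'.1]⟩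
  have hinv : Function.Involutive fun v => if v ∈ Set.range f then μ' v else μ v := by
    intro v
    by_cases hv : v ∈ Set.range f
    · simp only [if_pos hv, if_pos (hr' v hv), hμ'.1]
    · have : μ v ∉ Set.range f := fun h => hv (by simpa [hμ.1] using hr _ h)
      simp only [if_neg hv, if_neg this, hμ.1]
  refine ⟨hinv.toPerm, f, k, ⟨hinv, fun v => ?_⟩, ⟨hseq, htwo, heven, fun i => ?_, fun v hv => ?_⟩,
    fun v hv => ?_, ?_⟩
  · change G.Adj v (if v ∈ Set.range f then μ' v else μ v)
    split_ifs
    · exact hμ'.2 v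
    · exact hμ.2 v
  · change (if f (2 * i + 1) ∈ Set.range f then _ else _) = _
    rw [if_pos ⟨_, rfl⟩, hodd]
  · change (if v ∈ Set.range f then _ else _) = _
    rw [if_neg hv]
  · change (if v ∈ Set.range f then _ else _) = _
    rw [hv, ite_self]
  · change (if v₀ ∈ Set.range f then _ else _) = _
    rw [if_pos ⟨0, by simpa using f0 0⟩]

/-- The signs of the cycle covers and of the terms of the Pfaffian change in the same way. -/
theorem sign_cover_mul_pfTerm (m : PlanarEmbedding G) (o : EdgeOrientation G) (hG : IsCubic G)
    (ho : o.IsSemiPfaffian) (hm : m.WithoutTension) (hn : Even n) (hμ : IsMatchingOf G μ)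
    (hμ' : IsMatchingOf G μ') :
    (-1) ^ (n + numComponents (coverOf G μ)) * pfTerm hn (signAdj o) μ =
      (-1) ^ (n + numComponents (coverOf G μ')) * pfTerm hn (signAdj o) μ' := by
  -- Induction on the number of vertices where the matchings disagree.
  induction hd : (Finset.univ.filter fun v => μ v ≠ μ' v).card using Nat.strong_induction_on
    generalizing μ with
  | _ d ih =>
    by_cases heq : μ = μ'
    · rw [heq]
    obtain ⟨v₀, hv₀⟩ : ∃ v, μ v ≠ μ' v := by
      by_contra h
      push Not at h
      exact heq (Equiv.ext h)
    obtain ⟨μ'', f, k, hμ'', hsw, hagree, hv⟩ := exists_isSwitch hμ hμ' hv₀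
    rw [← ih _ ?_ hμ'' rfl]
    · have hN : 3 ≤ 2 * k := by have := hsw.two_le; omega
      have hadj := hsw.adj hμ hμ''
      have hcyc := hsw.seq.isCycle_walk hN hadj
      have hcen := hsw.isCentral hμ hμ''
      have hlen := hsw.seq.length_walk hadj
      have h1 := hsw.numComponents_switch m hG hμ hμ''
        ((hsw.seq.tension_walk hadj m).1 (hm _ _ hcyc (by rw [hlen]; exact even_two_mul k) hcen))
      have h2 := hsw.pfTerm_switch o hn hμ hμ''
      have h3 := ho _ _ hcyc hcen k hlen
      rw [o.oddlyOriented_iff _ (by rw [hlen]; exact even_two_mul k), hsw.seq.forward_walk] at h3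
      -- The semi-Pfaffian condition for the central switching cycle: the number of forward edges
      -- has the parity of `k`.
      have h4 : (-1 : ℤ) ^ ((Finset.range (2 * k)).filter fun i => o.dir (f i) (f (i + 1))).card =
          (-1) ^ k := by
        refine neg_one_pow_congr ?_
        rw [← Nat.not_odd_iff_even, ← Nat.not_odd_iff_even]
        exact not_congr h3
      rw [h4] at h2
      have h1' := congrArg Units.val h1
      push_cast at h1'
      have h5 := pfTerm_sq o hn hμ''
      have h6 : ((-1 : ℤ) ^ (n + numComponents (coverOf G μ''))) *
        (-1) ^ (n + numComponents (coverOf G μ'')) = 1 := by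
        rw [← pow_add, Even.neg_one_pow ⟨_, rfl⟩]
      have h7 : ((-1 : ℤ) ^ k) * (-1) ^ k = 1 := by rw [← pow_add, Even.neg_one_pow ⟨_, rfl⟩]
      generalize (-1 : ℤ) ^ (n + numComponents (coverOf G μ)) = s at *
      generalize (-1 : ℤ) ^ (n + numComponents (coverOf G μ'')) = s'' at *
      generalize pfTerm hn (signAdj o) μ = p at *
      generalize pfTerm hn (signAdj o) μ'' = p'' at *
      rw [pow_succ] at h1'
      generalize (-1 : ℤ) ^ k = e at *
      have e1 : s = -e * s'' := by linear_combination s'' * h1' - s * h6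
      have e2 : p = -e * p'' := by linear_combination p'' * h2 - p * h5
      rw [e1, e2]
      linear_combination s'' * p'' * h7
    · rw [← hd]
      refine Finset.card_lt_card (Finset.ssubset_iff_of_subset ?_ |>.2 ⟨v₀, by simpa using hv₀, by simpa using hv⟩)
      intro v
      simp only [Finset.mem_filter, Finset.mem_univ, true_and]
      exact fun h h' => h (hagree v h')

end Switching

end UDet

end


noncomputable section

namespace UDet

/-! ## The formula for the undirected determinant -/

section Formula

open Equiv Equiv.Perm
open scoped Classical

variable {n : ℕ} {G : SimpleGraph (Fin n)}

theorem card_filter_mem {c : Finset (Sym2 (Fin n))} (v : Fin n) :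
    (c.filter fun e => v ∈ e).card = (Finset.univ.filter fun u => s(v, u) ∈ c).card := by
  symm
  refine Finset.card_bij (fun u _ => s(v, u)) ?_ ?_ ?_
  · intro u hu
    simp only [Finset.mem_filter, Finset.mem_univ, true_and] at hu ⊢
    exact ⟨hu, Sym2.mem_mk_left _ _⟩
  · intro u _ u' _ h
    exact Sym2.congr_right.1 h
  · intro e he
    simp only [Finset.mem_filter] at he
    obtain ⟨u, rfl⟩ := Sym2.mem_iff_exists.1 he.2
    exact ⟨u, by simpa using he.1, rfl⟩

theorem IsCubic.card_neighbors (hG : IsCubic G) (v : Fin n) :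
    (Finset.univ.filter fun u => G.Adj v u).card = 3 := by
  rw [← hG v, Set.ncard_eq_toFinset_card']
  congr 1
  ext u
  simp

theorem coverOf_mem_cycleCovers (hG : IsCubic G) {μ : Perm (Fin n)} (hμ : IsMatchingOf G μ) :
    coverOf G μ ∈ cycleCovers G := by
  rw [cycleCovers, Finset.mem_filter, Finset.mem_powerset]
  refine ⟨Finset.filter_subset _ _, fun v => ?_⟩
  rw [card_filter_mem]
  have h1 : (Finset.univ.filter fun u => s(v, u) ∈ coverOf G μ) =
      (Finset.univ.filter fun u => G.Adj v u).erase (μ v) := by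
    ext u
    simp only [Finset.mem_filter, Finset.mem_univ, true_and, Finset.mem_erase, mem_coverOf hμ.1]
    rw [and_comm, ne_comm]
  rw [h1, Finset.card_erase_of_mem (by simpa using hμ.2 v), hG.card_neighbors]

/-- At each vertex a cover uses two of the three edges; the remaining ones form the matching. -/
theorem exists_coverOf_eq (hG : IsCubic G) {c : Finset (Sym2 (Fin n))} (hc : c ∈ cycleCovers G) :
    ∃ μ : Perm (Fin n), IsMatchingOf G μ ∧ coverOf G μ = c := by
  rw [cycleCovers, Finset.mem_filter, Finset.mem_powerset] at hc
  obtain ⟨hsub, hdeg⟩ := hc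
  have hadj : ∀ {u v}, s(u, v) ∈ c → G.Adj u v := fun h => mem_edges.1 (hsub h)
  have key : ∀ v, ∃ u, (Finset.univ.filter fun u => G.Adj v u ∧ s(v, u) ∉ c) = {u} := fun v => by
    rw [← Finset.card_eq_one]
    have h1 := hdeg v
    rw [card_filter_mem] at h1
    have h2 := Finset.card_filter_add_card_filter_not
      (s := Finset.univ.filter fun u => G.Adj v u) fun u => s(v, u) ∈ c
    rw [hG.card_neighbors, Finset.filter_filter, Finset.filter_filter] at h2
    have h3 : (Finset.univ.filter fun u => G.Adj v u ∧ s(v, u) ∈ c) =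
        Finset.univ.filter fun u => s(v, u) ∈ c :=
      Finset.filter_congr fun u _ => and_iff_right_of_imp hadj
    rw [h3, h1] at h2
    omega
  choose g hg using key
  have hg' : ∀ v u, (G.Adj v u ∧ s(v, u) ∉ c) ↔ u = g v := fun v u => by
    rw [← Finset.mem_singleton, ← hg v]
    simp
  have hinv : Function.Involutive g := fun v => by
    obtain ⟨h1, h2⟩ := (hg' v (g v)).2 rfl
    exact ((hg' (g v) v).1 ⟨h1.symm, by rwa [Sym2.eq_swap]⟩).symm
  have hμ : IsMatchingOf G hinv.toPerm := ⟨hinv, fun v => ((hg' v (g v)).2 rfl).1⟩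
  refine ⟨hinv.toPerm, hμ, ?_⟩
  ext e
  induction e with | _ u v
  rw [mem_coverOf hμ.1]
  constructor
  · rintro ⟨h1, h2⟩
    by_contra h3
    exact h2 ((hg' u v).1 ⟨h1, h3⟩).symm
  · intro h
    exact ⟨hadj h, fun h' => ((hg' u v).2 (Eq.symm h')).2 h⟩

theorem coverOf_injective {μ μ' : Perm (Fin n)} (hμ : IsMatchingOf G μ) (hμ' : IsMatchingOf G μ')
    (h : coverOf G μ = coverOf G μ') : μ = μ' := by
  ext v : 1
  by_contra hne
  have := (mem_coverOf (G := G) hμ'.1).2 ⟨hμ.2 v, Ne.symm hne⟩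
  rw [← h, mem_coverOf hμ.1] at this
  exact this.2 rfl

theorem udet_eq_sum_matchings {F : Type*} [CommRing F] (hG : IsCubic G) (w : Sym2 (Fin n) → F) :
    udet G w = ∑ μ : Perm (Fin n) with IsMatchingOf G μ,
      (-1) ^ (n + numComponents (coverOf G μ)) * ∏ e ∈ coverOf G μ, w e := by
  rw [udet, Finset.mul_sum]
  symm
  refine Finset.sum_bij (fun μ _ => coverOf G μ) ?_ ?_ ?_ ?_
  · intro μ hμ
    exact coverOf_mem_cycleCovers hG (Finset.mem_filter.1 hμ).2
  · intro μ hμ μ' hμ' h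
    exact coverOf_injective (Finset.mem_filter.1 hμ).2 (Finset.mem_filter.1 hμ').2 h
  · intro c hc
    obtain ⟨μ, hμ, rfl⟩ := exists_coverOf_eq hG hc
    exact ⟨μ, by simpa using hμ, rfl⟩
  · intro μ _
    rw [pow_add, mul_assoc]

theorem IsMatchingPerm.even_card {μ : Perm (Fin n)} (hμ : IsMatchingPerm μ) : Even n := by
  have h1 : μ ^ 2 = 1 := by
    ext v : 1
    rw [pow_two, Perm.mul_apply, hμ.1]
    rfl
  have h2 := two_dvd_card_support h1
  have h3 : μ.support = Finset.univ := by
    ext v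
    simpa using hμ.2 v
  rw [h3, Finset.card_univ, Fintype.card_fin] at h2
  exact even_iff_two_dvd.2 h2

theorem udet_of_odd {F : Type*} [CommRing F] (hG : IsCubic G) (w : Sym2 (Fin n) → F)
    (hn : ¬ Even n) : udet G w = 0 := by
  rw [udet_eq_sum_matchings hG]
  refine Finset.sum_eq_zero fun μ hμ => ?_
  simp only [Finset.mem_filter, Finset.mem_univ, true_and] at hμ
  exact absurd hμ.isMatchingPerm.even_card hn

variable {F : Type*} [Field F]

theorem skewAdj_inv_apply (o : EdgeOrientation G) (w : Sym2 (Fin n) → F) (hw : NonzeroWeights G w)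
    (x y : Fin n) :
    entrywiseInv (skewAdj o w) x y = (signAdj o x y : F) * (w s(x, y))⁻¹ := by
  by_cases h1 : o.dir x y
  · have h : w s(x, y) ≠ 0 := hw _ ((o.adj_iff x y).2 (Or.inl h1))
    simp [entrywiseInv, skewAdj, signAdj, h1, h]
  · by_cases h2 : o.dir y x
    · have h : w s(x, y) ≠ 0 := hw _ ((o.adj_iff x y).2 (Or.inr h2))
      simp [entrywiseInv, skewAdj, signAdj, h1, h2, h, inv_neg]
    · simp [entrywiseInv, skewAdj, signAdj, h1, h2]

theorem isAlt_entrywiseInv (o : EdgeOrientation G) (w : Sym2 (Fin n) → F)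
    (hw : NonzeroWeights G w) : IsAlt (entrywiseInv (skewAdj o w)) := by
  refine ⟨fun x y => ?_, fun x => ?_⟩
  · rw [skewAdj_inv_apply o w hw, skewAdj_inv_apply o w hw, (isAlt_signAdj o).1 x y, Sym2.eq_swap]
    push_cast
    ring
  · rw [skewAdj_inv_apply o w hw, (isAlt_signAdj o).2]
    simp

theorem signAdj_ne_zero_iff (o : EdgeOrientation G) (x y : Fin n) :
    signAdj o x y ≠ 0 ↔ G.Adj x y := by
  rw [o.adj_iff]
  by_cases h1 : o.dir x y
  · simp [signAdj, skewAdj, h1]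
  · by_cases h2 : o.dir y x <;> simp [signAdj, skewAdj, h1, h2]

theorem pfTerm_of_not_isMatchingOf {R : Type*} [CommRing R] (hn : Even n)
    {A : Matrix (Fin n) (Fin n) R} (hA : IsAlt A) (hAG : ∀ x y, ¬ G.Adj x y → A x y = 0)
    {μ : Perm (Fin n)} (hμ : IsMatchingPerm μ) (hG : ¬ IsMatchingOf G μ) : pfTerm hn A μ = 0 := by
  obtain ⟨σ, -, hσ⟩ := exists_listing hn hμ
  have hnot : ∃ v, ¬ G.Adj v (μ v) := by
    by_contra h
    push Not at h
    exact hG ⟨hμ.1, h⟩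
  obtain ⟨v, hv⟩ := hnot
  obtain ⟨⟨k, b⟩, hk⟩ := (pairEquiv hn).surjective (σ⁻¹ v)
  rw [pairEquiv_apply] at hk
  have hx : σ (pairPos n (k, b)) = v := by rw [hk, perm_apply_inv]
  have hy : σ (pairPos n (k, !b)) = μ v := by
    rw [← hσ, Perm.mul_apply, Perm.mul_apply, ← hx, perm_inv_apply, stdMatching_pairPos]
  rw [← hσ, pfTerm_eq hn hA, listTerm]
  refine mul_eq_zero_of_right _ (Finset.prod_eq_zero (Finset.mem_univ k) (hAG _ _ ?_))
  cases b
  · rw [hx]; rw [Bool.not_false] at hy; rw [hy]; exact hv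
  · rw [hx]
    rw [Bool.not_true] at hy
    rw [hy, SimpleGraph.adj_comm]
    exact hv

theorem prod_cover_mul_prod_matching {R : Type*} [CommMonoid R] (hn : Even n)
    (w : Sym2 (Fin n) → R) {μ σ : Perm (Fin n)} (hμ : IsMatchingOf G μ)
    (hσ : σ * stdMatching hn * σ⁻¹ = μ) :
    (∏ e ∈ coverOf G μ, w e) *
      ∏ k : Fin (n / 2), w s(σ (pairPos n (k, false)), σ (pairPos n (k, true))) =
      weightProd G w := by
  have hlist : ∀ k b, σ (pairPos n (k, !b)) = μ (σ (pairPos n (k, b))) := fun k b => by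
    rw [← hσ, Perm.mul_apply, Perm.mul_apply, perm_inv_apply, stdMatching_pairPos]
  rw [weightProd, ← Finset.prod_filter_mul_prod_filter_not (edges G) fun e => ¬ ∃ v, e = s(v, μ v)]
  congr 1
  refine Finset.prod_bij (fun k _ => s(σ (pairPos n (k, false)), σ (pairPos n (k, true))))
    ?_ ?_ ?_ fun _ _ => rfl
  · intro k _
    rw [Finset.mem_filter, mem_edges, SimpleGraph.mem_edgeSet, not_not]
    have := hlist k false
    rw [Bool.not_false] at this
    rw [this]
    exact ⟨hμ.2 _, _, rfl⟩
  · intro k _ l _ h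
    rw [Sym2.eq_iff] at h
    rcases h with ⟨h, -⟩ | ⟨h, -⟩
    · exact congrArg Prod.fst (pairPos_injective n (σ.injective h))
    · exact congrArg Prod.fst (pairPos_injective n (σ.injective h))
  · intro e he
    rw [Finset.mem_filter, not_not] at he
    obtain ⟨v, rfl⟩ := he.2
    obtain ⟨⟨k, b⟩, hk⟩ := (pairEquiv hn).surjective (σ⁻¹ v)
    rw [pairEquiv_apply] at hk
    have hx : σ (pairPos n (k, b)) = v := by rw [hk, perm_apply_inv]
    have hy := hlist k b
    rw [hx] at hy
    refine ⟨k, Finset.mem_univ _, ?_⟩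
    cases b
    · rw [hx, ← hy]; rfl
    · rw [hx, ← hy, Sym2.eq_swap]; rfl

/-- The inverse weights on the matching cancel against the total weight and leave the weight of the
cover; this is the reason for inverting the entries. -/
theorem weightProd_mul_pfTerm (o : EdgeOrientation G) (w : Sym2 (Fin n) → F)
    (hw : NonzeroWeights G w) (hn : Even n) {μ : Perm (Fin n)} (hμ : IsMatchingOf G μ) :
    weightProd G w * pfTerm hn (entrywiseInv (skewAdj o w)) μ =
      ((pfTerm hn (signAdj o) μ : ℤ) : F) * ∏ e ∈ coverOf G μ, w e := by
  obtain ⟨σ, -, hσ⟩ := exists_listing hn hμ.isMatchingPerm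
  rw [← prod_cover_mul_prod_matching hn w hμ hσ]
  nth_rw 2 [← hσ]
  nth_rw 2 [← hσ]
  rw [pfTerm_eq hn (isAlt_signAdj o), pfTerm_eq hn (isAlt_entrywiseInv o w hw), listTerm, listTerm]
  simp only [skewAdj_inv_apply o w hw, Finset.prod_mul_distrib, Finset.prod_inv_distrib]
  have hne : ∏ k : Fin (n / 2), w s(σ (pairPos n (k, false)), σ (pairPos n (k, true))) ≠ 0 := by
    refine Finset.prod_ne_zero_iff.2 fun k _ => hw _ ?_
    have : σ (pairPos n (k, true)) = μ (σ (pairPos n (k, false))) := by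
      rw [← hσ, Perm.mul_apply, Perm.mul_apply, perm_inv_apply, stdMatching_pairPos]
      rfl
    rw [this]
    exact hμ.2 _
  push_cast
  field_simp

/-- Every cycle cover contributes to the undirected determinant what the complementary matching
contributes to the Pfaffian, up to a common sign. -/
theorem exists_sign_terms (m : PlanarEmbedding G) (o : EdgeOrientation G) (hG : IsCubic G)
    (ho : o.IsSemiPfaffian) (hm : m.WithoutTension) (hn : Even n) (w : Sym2 (Fin n) → F)
    (hw : NonzeroWeights G w) : ∃ ε : F, (ε = 1 ∨ ε = -1) ∧
      (∀ μ, IsMatchingOf G μ → (-1) ^ (n + numComponents (coverOf G μ)) * ∏ e ∈ coverOf G μ, w e =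
        ε * (weightProd G w * pfTerm hn (entrywiseInv (skewAdj o w)) μ)) ∧
      udet G w = ε * (weightProd G w * pfaffian (entrywiseInv (skewAdj o w))) := by
  suffices h : ∃ ε : F, (ε = 1 ∨ ε = -1) ∧
      ∀ μ, IsMatchingOf G μ → (-1) ^ (n + numComponents (coverOf G μ)) * ∏ e ∈ coverOf G μ, w e =
        ε * (weightProd G w * pfTerm hn (entrywiseInv (skewAdj o w)) μ) by
    obtain ⟨ε, h1, h2⟩ := h
    refine ⟨ε, h1, h2, ?_⟩
    rw [udet_eq_sum_matchings hG, pfaffian_eq_sum hn (isAlt_entrywiseInv o w hw), Finset.mul_sum,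
      Finset.mul_sum, Finset.sum_congr rfl fun μ hμ => h2 μ (Finset.mem_filter.1 hμ).2]
    refine Finset.sum_subset ?_ ?_
    · intro μ hμ
      simp only [Finset.mem_filter, Finset.mem_univ, true_and] at hμ ⊢
      exact hμ.isMatchingPerm
    · intro μ hμ hμ'
      simp only [Finset.mem_filter, Finset.mem_univ, true_and] at hμ hμ'
      rw [pfTerm_of_not_isMatchingOf hn (isAlt_entrywiseInv o w hw) (G := G) ?_ hμ hμ', mul_zero,
        mul_zero]
      intro x y hxy
      rw [skewAdj_inv_apply o w hw, not_not.1 (mt (signAdj_ne_zero_iff o x y).1 hxy)]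
      simp
  by_cases hex : ∃ μ, IsMatchingOf G μ
  · obtain ⟨μ₀, hμ₀⟩ := hex
    -- The common sign is read off at a reference matching; without any perfect matching every
    -- choice will do.
    refine ⟨(((-1) ^ (n + numComponents (coverOf G μ₀)) * (pfTerm hn (signAdj o) μ₀) : ℤ) : F),
      ?_, fun μ hμ => ?_⟩
    · have hsq := pfTerm_sq o hn hμ₀
      have h1 := neg_one_pow_eq_or ℤ (n + numComponents (coverOf G μ₀))
      have h2 := mul_self_eq_one_iff.1 hsq
      rcases h1 with h1 | h1 <;> rcases h2 with h2 | h2 <;> rw [h1, h2] <;> simp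
    · rw [sign_cover_mul_pfTerm m o hG ho hm hn hμ₀ hμ, weightProd_mul_pfTerm o w hw hn hμ,
        ← mul_assoc, ← Int.cast_mul, mul_assoc, pfTerm_sq o hn hμ, mul_one]
      push_cast
      rfl
  · exact ⟨1, Or.inl rfl, fun μ hμ => absurd ⟨μ, hμ⟩ hex⟩

theorem udet_eq_pfaffian (m : PlanarEmbedding G) (o : EdgeOrientation G) (hG : IsCubic G)
    (ho : o.IsSemiPfaffian) (hm : m.WithoutTension) (w : Sym2 (Fin n) → F)
    (hw : NonzeroWeights G w) :
    udet G w = weightProd G w * pfaffian (entrywiseInv (skewAdj o w)) ∨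
      udet G w = -(weightProd G w * pfaffian (entrywiseInv (skewAdj o w))) := by
  by_cases hn : Even n
  · obtain ⟨ε, rfl | rfl, -, h⟩ := exists_sign_terms m o hG ho hm hn w hw
    · exact Or.inl (by rw [h, one_mul])
    · exact Or.inr (by rw [h, neg_one_mul])
  · left
    rw [udet_of_odd hG w hn, pfaffian, if_neg hn, mul_zero]

end Formula

end UDet

end


noncomputable section

namespace UDet

/-! ## Bipartite graphs -/

section Bipartite

open scoped Classical

variable {n : ℕ} {G : SimpleGraph (Fin n)}

/-- If every vertex is a source or a sink, forward and backward edges alternate along any walk,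
beginning with a forward edge exactly at a source. -/
theorem EdgeOrientation.forward_of_sources (o : EdgeOrientation G)
    (ho : ∀ u v x, o.dir u v → ¬ o.dir v x) {u v : Fin n} (p : G.Walk u v) :
    o.forward p = if ∃ x, o.dir u x then (p.length + 1) / 2 else p.length / 2 := by
  induction p with
  | nil => simp [EdgeOrientation.forward]
  | @cons u w v h p ih =>
    have h1 : o.forward (SimpleGraph.Walk.cons h p) = o.forward p + if o.dir u w then 1 else 0 := by
      rw [EdgeOrientation.forward, EdgeOrientation.forward, SimpleGraph.Walk.darts_cons,
        List.countP_cons]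
      simp
    rw [h1, ih, SimpleGraph.Walk.length_cons]
    rcases (o.adj_iff u w).1 h with h2 | h2
    · have hw : ¬ ∃ x, o.dir w x := fun ⟨x, hx⟩ => ho u w x h2 hx
      rw [if_neg hw, if_pos h2, if_pos ⟨w, h2⟩]
      omega
    · have hu : ¬ ∃ x, o.dir u x := fun ⟨x, hx⟩ => ho w u x h2 hx
      rw [if_pos ⟨u, h2⟩, if_neg (o.asymm _ _ h2), if_neg hu]
      omega

/-- An orientation in which every vertex is a source or a sink is semi-Pfaffian. -/
theorem EdgeOrientation.isSemiPfaffian_of_sources (o : EdgeOrientation G)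
    (ho : ∀ u v x, o.dir u v → ¬ o.dir v x) : o.IsSemiPfaffian := by
  intro v p _ _ k hk
  rw [o.oddlyOriented_iff p (by rw [hk]; exact even_two_mul k), o.forward_of_sources ho, hk]
  split_ifs
  · rw [show (2 * k + 1) / 2 = k by omega]
  · rw [show 2 * k / 2 = k by omega]

theorem IsCentral.exists_partner {v : Fin n} {p : G.Walk v v} (hp : IsCentral p) :
    ∃ g : Fin n → Fin n, ∀ u, u ∉ p.support → g u ∉ p.support ∧ g (g u) = u ∧ G.Adj u (g u) := by
  obtain ⟨M, hM, hspan⟩ := hp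
  choose h h1 h2 using fun u : {u | u ∉ p.support} => hM (hspan u)
  refine ⟨fun u => if hu : u ∉ p.support then (h ⟨u, hu⟩).1 else u, fun u hu => ?_⟩
  have e : (if hu : u ∉ p.support then (h ⟨u, hu⟩).1 else u) = (h ⟨u, hu⟩).1 := dif_pos hu
  simp only [e]
  have hu' : (h ⟨u, hu⟩).1 ∉ p.support := (h ⟨u, hu⟩).2
  refine ⟨hu', ?_, M.adj_sub (h1 ⟨u, hu⟩)⟩
  rw [dif_pos hu']
  exact congrArg Subtype.val (h2 (h ⟨u, hu⟩) ⟨u, hu⟩ (h1 ⟨u, hu⟩).symm).symm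

theorem SimpleGraph.Walk.IsCycle.isCyclicSeq {v : Fin n} {p : G.Walk v v} (hp : p.IsCycle) :
    IsCyclicSeq (fun i => p.getVert (i % p.length)) p.length ∧
      (∀ i, G.Adj (p.getVert (i % p.length)) (p.getVert ((i + 1) % p.length))) ∧
      (∀ i ≤ p.length, p.getVert (i % p.length) = p.getVert i) ∧
      ∀ u, u ∈ p.support ↔ u ∈ Set.range fun i => p.getVert (i % p.length) := by
  have hN := hp.three_le_length
  have hle : ∀ i ≤ p.length, p.getVert (i % p.length) = p.getVert i := fun i hi => by
    rcases hi.lt_or_eq with hi | rfl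
    · rw [Nat.mod_eq_of_lt hi]
    · rw [Nat.mod_self, p.getVert_zero, p.getVert_length]
  refine ⟨⟨by omega, fun i => by simp, fun i hi j hj h => ?_⟩, fun i => ?_, hle, fun u => ?_⟩
  · simp only [Nat.mod_eq_of_lt hi, Nat.mod_eq_of_lt hj] at h
    exact hp.getVert_injOn' (by simp only [Set.mem_ofPred_eq]; omega)
      (by simp only [Set.mem_ofPred_eq]; omega) h
  · have h1 : i % p.length < p.length := Nat.mod_lt _ (by omega)
    have h2 := p.adj_getVert_succ h1
    rwa [← hle (i % p.length + 1) (by omega), Nat.mod_add_mod] at h2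
  · rw [SimpleGraph.Walk.mem_support_iff_exists_getVert]
    constructor
    · rintro ⟨i, rfl, hi⟩
      exact ⟨i, hle i hi⟩
    · rintro ⟨i, rfl⟩
      exact ⟨i % p.length, rfl, (Nat.mod_lt _ (by omega)).le⟩

theorem PlanarEmbedding.card_off_darts (m : PlanarEmbedding G) (hG : IsCubic G) {f : ℕ → Fin n}
    {N : ℕ} (hf : IsCyclicSeq f N) (hN : 3 ≤ N) (hadj : ∀ i, G.Adj (f i) (f (i + 1))) (v : Fin n) :
    (Finset.univ.filter fun d : G.Dart => d.fst = v ∧ ¬ OnCycle f d.edge).card =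
      if v ∈ Set.range f then 1 else 3 := by
  split_ifs with hv
  · obtain ⟨i, rfl⟩ := hv
    obtain ⟨j, hj⟩ := hf.exists_succ i
    rw [hj]
    obtain ⟨q, p, t, -, -, ht, htc, hqc, hpc, hall, -⟩ := m.darts_on_cycle hG hf hN hadj j
    rw [Finset.card_eq_one]
    refine ⟨t, ?_⟩
    ext e
    simp only [Finset.mem_filter, Finset.mem_univ, true_and, Finset.mem_singleton]
    constructor
    · rintro ⟨h1, h2⟩
      rcases hall e h1 with rfl | rfl | rfl
      · exact absurd hqc h2
      · exact absurd hpc h2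
      · rfl
    · rintro rfl
      exact ⟨ht, htc⟩
  · rw [← card_darts_at hG v]
    congr 1
    refine Finset.filter_congr fun d _ => and_iff_left_of_imp ?_
    rintro rfl h
    exact hv (OnCycle.mem_range (v := d.snd) h)

/-- Sum the colour sign of the tail over all darts off the cycle on one side. Reversal of darts
shows that the sum is zero. Vertices off the cycle contribute three times their signs, and these
cancel since the matching of the complement pairs opposite colours and stays on the side. Vertices
of the cycle contribute their signs once, and these alternate along the cycle, so their sum is the
tension up to sign. -/
theorem PlanarEmbedding.withoutTension_of_coloring (m : PlanarEmbedding G) (hG : IsCubic G)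
    (s : Fin n → ℤ) (hs : ∀ v, s v * s v = 1) (hsG : ∀ u v, G.Adj u v → s v = - s u) :
    m.WithoutTension := by
  intro v p hp heven hcen
  obtain ⟨hf, hadj, hle, hsupp⟩ := SimpleGraph.Walk.IsCycle.isCyclicSeq hp
  obtain ⟨g, hg⟩ := hcen.exists_partner
  have hN := hp.three_le_length
  set N := p.length with hNdef
  set f : ℕ → Fin n := fun i => p.getVert (i % N) with hfdef
  have hadj : ∀ i, G.Adj (f i) (f (i + 1)) := hadj
  obtain ⟨-, D, -, -, -, c4, c5⟩ := m.exists_sides hG hf hN hadj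
  have hleft : ∀ i < N, (m.IsLeft p i ↔ f i ∈ D) := fun i hi => by
    have h1 : f i = f (i + N - 1 + 1) := by
      rw [show i + N - 1 + 1 = i + N by omega, hf.periodic]
    have h2 : f (i + 1) = f (i + N - 1 + 2) := by
      rw [show i + N - 1 + 2 = i + 1 + N by omega, hf.periodic]
    rw [h1, c5, PlanarEmbedding.LeftAt, ← h1, ← h2, PlanarEmbedding.IsLeft, ← hle i hi.le,
      ← hle (i + 1) hi]
  -- An edge off the cycle has both ends on the same side, and its ends have opposite colours.
  have hsum1 : ∑ d : G.Dart with ¬ OnCycle f d.edge ∧ d.fst ∈ D, s d.fst = 0 := by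
    refine Finset.sum_involution (fun d _ => d.symm) ?_ ?_ ?_ ?_
    · intro d _
      rw [show d.symm.fst = d.snd from rfl, hsG _ _ d.adj]
      ring
    · intro d _ _
      exact d.symm_ne
    · intro d hd
      simp only [Finset.mem_filter, Finset.mem_univ, true_and] at hd ⊢
      rw [SimpleGraph.Dart.edge_symm]
      exact ⟨hd.1, (c4 d hd.1).2 hd.2⟩
    · intro d _
      exact d.symm_symm
  have hsum2 : ∑ d : G.Dart with ¬ OnCycle f d.edge ∧ d.fst ∈ D, s d.fst =
      ∑ v with v ∈ D, (if v ∈ Set.range f then 1 else 3) * s v := by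
    rw [← Finset.sum_fiberwise_of_maps_to (t := Finset.univ.filter fun v => v ∈ D)
      (g := fun d : G.Dart => d.fst) fun d hd => by simpa using (Finset.mem_filter.1 hd).2.2]
    refine Finset.sum_congr rfl fun v hv => ?_
    have h1 := m.card_off_darts hG hf hN hadj v
    rw [Finset.filter_filter, Finset.sum_congr rfl (g := fun _ => s v), Finset.sum_const, nsmul_eq_mul]
    · congr 1
      have h2 : (Finset.univ.filter fun d : G.Dart => (¬ OnCycle f d.edge ∧ d.fst ∈ D) ∧ d.fst = v) =
          Finset.univ.filter fun d : G.Dart => d.fst = v ∧ ¬ OnCycle f d.edge := by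
        refine Finset.filter_congr fun d _ => ?_
        constructor
        · exact fun h => ⟨h.2, h.1.1⟩
        · rintro ⟨rfl, h⟩
          exact ⟨⟨h, (Finset.mem_filter.1 hv).2⟩, rfl⟩
      rw [h2, h1]
      split_ifs <;> rfl
    · intro d hd
      rw [(Finset.mem_filter.1 hd).2.2]
  -- Centrality is used here: the partners in the perfect matching off the cycle are on the same
  -- side.
  have hsum3 : ∑ v with v ∈ D ∧ v ∉ Set.range f, s v = 0 := by
    have hg' : ∀ v ∉ Set.range f, g v ∉ Set.range f ∧ g (g v) = v ∧ G.Adj v (g v) := fun v hv => by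
      have := hg v (by rwa [hsupp])
      rwa [hsupp] at this
    have hmem : ∀ v ∈ Finset.univ.filter (fun v => v ∈ D ∧ v ∉ Set.range f), v ∈ D ∧ v ∉ Set.range f :=
      fun v hv => (Finset.mem_filter.1 hv).2
    refine Finset.sum_involution (fun v _ => g v) ?_ ?_ ?_ ?_
    · intro v hv
      rw [hsG _ _ (hg' v (hmem v hv).2).2.2]
      ring
    · intro v hv _
      exact (hg' v (hmem v hv).2).2.2.ne'
    · intro v hv
      obtain ⟨h1, h2⟩ := hmem v hv
      obtain ⟨h3, -, h4⟩ := hg' v h2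
      refine Finset.mem_filter.2 ⟨Finset.mem_univ _, ?_, h3⟩
      exact (c4 ⟨(v, g v), h4⟩ fun h => h2 (OnCycle.mem_range h)).2 h1
    · intro v hv
      exact (hg' v (hmem v hv).2).2.1
  have hsum4 : ∑ v with v ∈ D ∧ v ∈ Set.range f, s v = 0 := by
    rw [hsum2, ← Finset.sum_filter_add_sum_filter_not _ (fun v => v ∈ Set.range f),
      Finset.filter_filter, Finset.filter_filter,
      Finset.sum_congr rfl (g := s) fun v hv => by rw [if_pos (Finset.mem_filter.1 hv).2.2, one_mul],
      Finset.sum_congr (s₁ := Finset.univ.filter fun v => v ∈ D ∧ v ∉ Set.range f) rfl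
        (g := fun v => 3 * s v) fun v hv => by rw [if_neg (Finset.mem_filter.1 hv).2.2],
      ← Finset.mul_sum, hsum3, mul_zero, add_zero] at hsum1
    exact hsum1
  have hsf : ∀ i, s (f i) = (-1) ^ i * s (f 0) := fun i => by
    induction i with
    | zero => simp
    | succ i ih =>
      rw [hsG _ _ (hadj i), ih]
      ring
  have hsum5 : ∑ i ∈ Finset.range N with f i ∈ D, (-1 : ℤ) ^ i = 0 := by
    have h1 : ∑ v with v ∈ D ∧ v ∈ Set.range f, s v = ∑ i ∈ Finset.range N with f i ∈ D, s (f i) := by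
      symm
      refine Finset.sum_bij (fun i _ => f i) ?_ ?_ ?_ fun _ _ => rfl
      · intro i hi
        exact Finset.mem_filter.2 ⟨Finset.mem_univ _, (Finset.mem_filter.1 hi).2, i, rfl⟩
      · intro i hi j hj h
        exact hf.inj i (Finset.mem_range.1 (Finset.mem_filter.1 hi).1) j
          (Finset.mem_range.1 (Finset.mem_filter.1 hj).1) h
      · intro v hv
        obtain ⟨i, hi, rfl⟩ := hf.exists_lt (Finset.mem_filter.1 hv).2.2
        exact ⟨i, Finset.mem_filter.2 ⟨Finset.mem_range.2 hi, (Finset.mem_filter.1 hv).2.1⟩, rfl⟩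
    rw [hsum4, Finset.sum_congr rfl fun i _ => hsf i, ← Finset.sum_mul] at h1
    have h2 := congrArg (· * s (f 0)) h1
    simp only [zero_mul, mul_assoc, hs, mul_one] at h2
    exact h2.symm
  rw [PlanarEmbedding.tension, abs_eq_zero]
  have hcount : ∀ Q : ℕ → Prop, ((Finset.range N).filter fun i => Q i ∧ m.IsLeft p i) =
      ((Finset.range N).filter fun i => f i ∈ D).filter Q := fun Q => by
    rw [Finset.filter_filter]
    refine Finset.filter_congr fun i hi => ?_
    rw [and_comm, hleft i (Finset.mem_range.1 hi)]
  rw [← hsum5, ← Finset.sum_filter_add_sum_filter_not _ (fun i => Even i),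
    Finset.sum_congr rfl (g := fun _ => 1) fun i hi => (Finset.mem_filter.1 hi).2.neg_one_pow,
    Finset.sum_congr (s₁ := Finset.filter _ _) rfl (g := fun _ => -1) fun i hi =>
      (Nat.not_even_iff_odd.1 (Finset.mem_filter.1 hi).2).neg_one_pow]
  simp only [Finset.sum_const, nsmul_eq_mul, mul_one, mul_neg, Nat.not_even_iff_odd,
    ← sub_eq_add_neg]
  have h1 := hcount Even
  have h2 := hcount Odd
  congr 3
  · convert h1
  · convert h2

theorem bipartite_semiPfaffian (m : PlanarEmbedding G) (hG : IsCubic G) (hb : G.IsBipartite) :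
    (∃ o : EdgeOrientation G, o.IsSemiPfaffian) ∧ m.WithoutTension := by
  obtain ⟨c⟩ := hb
  refine ⟨⟨⟨fun u v => G.Adj u v ∧ c u = 0, fun u v => ?_, fun u v h h' => ?_⟩, ?_⟩, ?_⟩
  · have hv : G.Adj u v → c u = 0 ∨ c v = 0 := fun h => by
      have := c.valid h
      omega
    rw [G.adj_comm v u]
    tauto
  · exact c.valid h.1 (by rw [h.2, h'.2])
  · refine EdgeOrientation.isSemiPfaffian_of_sources _ fun u v x h h' => c.valid h.1 ?_
    rw [h.2, h'.2]
  · refine m.withoutTension_of_coloring hG (fun v => if c v = 0 then 1 else -1) (fun v => ?_)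
      fun u v h => ?_
    · split_ifs <;> rfl
    · have := c.valid h
      by_cases hu : c u = 0
      · rw [if_pos hu, if_neg fun h' => this (by rw [hu, h'])]
      · rw [if_neg hu, if_pos (by omega)]
        rfl

end Bipartite

end UDet

end


noncomputable section

namespace UDet

/-! ## Determinants without divisions -/

section Bird

open Equiv Equiv.Perm

variable {n : ℕ} {R : Type*} [CommRing R]

/-- The auxiliary matrix of Bird's algorithm. -/
def birdAux (X : Matrix (Fin n) (Fin n) R) : Matrix (Fin n) (Fin n) R :=
  Matrix.of fun i l => if i < l then X i l else if i = l then - ∑ r ∈ Finset.Ioi i, X r r else 0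

/-- The iterates of Bird's algorithm. -/
def bird (A : Matrix (Fin n) (Fin n) R) : ℕ → Matrix (Fin n) (Fin n) R
  | 0 => A
  | k + 1 => birdAux (bird A k) * A

/-- The minor of `A` with rows `insert i S` and columns `insert j S`, as a matrix of full size. -/
def minorMatrix (A : Matrix (Fin n) (Fin n) R) (S : Finset (Fin n)) (i j : Fin n) :
    Matrix (Fin n) (Fin n) R :=
  Matrix.of fun x y => if x ∈ insert i S then A x (if y = i then j else y) else if x = y then 1 else 0

/-- In the Leibniz formula only permutations that send the column `i` to the row `x` contribute, so
the other entries of column `i` are irrelevant. -/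
theorem det_eq_of_row_eq_single {M M' : Matrix (Fin n) (Fin n) R} {x i : Fin n}
    (h : M x = Pi.single i 1) (h' : M' x = Pi.single i 1)
    (hM : ∀ y z, y ≠ x → z ≠ i → M y z = M' y z) : M.det = M'.det := by
  rw [Matrix.det_apply, Matrix.det_apply]
  refine Finset.sum_congr rfl fun σ _ => congrArg _ ?_
  by_cases hσ : σ i = x
  · refine Finset.prod_congr rfl fun z _ => ?_
    by_cases hz : z = i
    · rw [hz, hσ, h, h']
    · exact hM _ _ (fun h => hz (σ.injective (h.trans hσ.symm))) hz
  · have hne : σ⁻¹ x ≠ i := fun h => hσ (by rw [← h, perm_apply_inv])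
    rw [Finset.prod_eq_zero (Finset.mem_univ (σ⁻¹ x)), Finset.prod_eq_zero (Finset.mem_univ (σ⁻¹ x))]
    · rw [perm_apply_inv, h', Pi.single_eq_of_ne hne]
    · rw [perm_apply_inv, h, Pi.single_eq_of_ne hne]

theorem det_minorMatrix_eq_zero (A : Matrix (Fin n) (Fin n) R) {S : Finset (Fin n)} {i l : Fin n}
    (hi : i ∉ S) (hl : l ∈ S) : (minorMatrix A S i l).det = 0 := by
  have hne : l ≠ i := fun h => hi (h ▸ hl)
  refine Matrix.det_zero_of_column_eq hne fun x => ?_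
  simp only [minorMatrix, Matrix.of_apply, if_neg hne, if_true]
  split_ifs with h1 h2 h3 h3
  · rfl
  · exact absurd (by rw [h2]; exact Finset.mem_insert_of_mem hl) h1
  · exact absurd (by rw [h2]; exact Finset.mem_insert_of_mem hl) h1
  · exact absurd (by rw [h3]; exact Finset.mem_insert_self _ _) h1
  · rfl

/-- Laplace expansion along column `i`, which holds column `j` of the original matrix. In the
cofactor of a row `l ∈ S` the column `l` has to take the place of column `i`, and this transposition
is the source of the minus sign. -/
theorem det_minorMatrix (A : Matrix (Fin n) (Fin n) R) {S : Finset (Fin n)} {i : Fin n}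
    (hi : i ∉ S) (j : Fin n) : (minorMatrix A S i j).det =
      A i j * (Matrix.of fun x y => if x ∈ S then A x y else if x = y then 1 else 0).det -
        ∑ l ∈ S, A l j * (minorMatrix A (S.erase l) i l).det := by
  rw [Matrix.det_eq_sum_mul_adjugate_col _ i,
    ← Finset.sum_subset (Finset.subset_univ (insert i S)), Finset.sum_insert hi, sub_eq_add_neg,
    ← Finset.sum_neg_distrib]
  · congr 1
    · rw [Matrix.adjugate_apply]
      congr 1
      · simp [minorMatrix]
      · refine det_eq_of_row_eq_single (x := i) (i := i) (Matrix.updateRow_self) ?_ fun y z hy hz => ?_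
        · ext y
          simp [hi, Pi.single_apply, eq_comm]
        · rw [Matrix.updateRow_ne hy]
          simp [minorMatrix, hy, hz]
    · refine Finset.sum_congr rfl fun l hl => ?_
      have hne : l ≠ i := fun h => hi (h ▸ hl)
      rw [Matrix.adjugate_apply, ← mul_neg]
      congr 1
      · simp [minorMatrix, hl]
      · have h1 := Matrix.det_permute' (swap i l) (minorMatrix A (S.erase l) i l)
        rw [sign_swap hne.symm] at h1
        simp only [Units.val_neg, Units.val_one, Int.cast_neg, Int.cast_one, neg_one_mul] at h1
        rw [← h1]
        refine det_eq_of_row_eq_single (x := l) (i := i) (Matrix.updateRow_self) ?_ fun y z hy hz => ?_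
        · ext y
          rw [Matrix.submatrix_apply]
          simp only [minorMatrix, Matrix.of_apply, Finset.mem_insert, Finset.mem_erase, ne_eq,
            not_true_eq_false, false_and, or_false, hne, if_false, id, Pi.single_apply]
          refine if_congr ?_ rfl rfl
          constructor
          · intro h
            rw [← swap_apply_self i l y, ← h, swap_apply_right]
          · rintro rfl
            rw [swap_apply_left]
        · rw [Matrix.updateRow_ne hy, Matrix.submatrix_apply]
          by_cases hzl : z = l
          · subst hzl
            rw [swap_apply_right]
            simp [minorMatrix, hy, hz]
            by_cases h2 : y = i <;> simp [h2]
          · rw [swap_apply_of_ne_of_ne hz hzl]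
            simp [minorMatrix, hy, hz]
  · intro x _ hx
    have h1 : x ≠ i := fun h => hx (h ▸ Finset.mem_insert_self _ _)
    rw [minorMatrix, Matrix.of_apply, if_neg hx, if_neg h1, zero_mul]

/-- The iterates collect sums of minors: the rows are `i` together with `k` larger indices, the
columns the same with `j` in place of `i`. Passing to `k + 1` is the Laplace expansion
`det_minorMatrix`, with the principal minors supplied by the diagonal sums and the other cofactors
by the entries above the diagonal. -/
theorem bird_eq (A : Matrix (Fin n) (Fin n) R) (k : ℕ) (i j : Fin n) : bird A k i j =
    (-1) ^ k * ∑ S ∈ Finset.powersetCard k (Finset.Ioi i), (minorMatrix A S i j).det := by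
  induction k generalizing i j with
  | zero =>
    have h := det_minorMatrix A (Finset.notMem_empty i) j
    have h1 : (Matrix.of fun x y : Fin n =>
        if x ∈ (∅ : Finset (Fin n)) then A x y else if x = y then 1 else 0).det = 1 := by
      conv_rhs => rw [← Matrix.det_one (n := Fin n) (R := R)]
      congr 1
    rw [h1] at h
    simp [bird, h]
  | succ k ih =>
    set P : Finset (Fin n) → R := fun T =>
      (Matrix.of fun x y => if x ∈ T then A x y else if x = y then 1 else 0).det with hP
    have hnot : ∀ {m} {S : Finset (Fin n)} {i : Fin n}, S ∈ Finset.powersetCard m (Finset.Ioi i) →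
        i ∉ S := fun hS h => by
      have := (Finset.mem_powersetCard.1 hS).1 h
      simp at this
    -- A set of `k + 1` indices is a least index together with `k` larger ones.
    have hdiag : ∑ r ∈ Finset.Ioi i, bird A k r r =
        (-1) ^ k * ∑ T ∈ Finset.powersetCard (k + 1) (Finset.Ioi i), P T := by
      rw [Finset.sum_congr rfl fun r _ => ih r r, ← Finset.mul_sum, Finset.sum_sigma']
      congr 1
      refine Finset.sum_bij (fun x _ => insert x.1 x.2) ?_ ?_ ?_ ?_
      · rintro ⟨r, S⟩ h
        rw [Finset.mem_sigma] at h
        obtain ⟨h1, h2⟩ := h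
        have h3 := hnot h2
        rw [Finset.mem_powersetCard] at h2 ⊢
        refine ⟨Finset.insert_subset h1 (h2.1.trans ?_), ?_⟩
        · exact Finset.Ioi_subset_Ioi (Finset.mem_Ioi.1 h1).le
        · rw [Finset.card_insert_of_notMem h3, h2.2]
      · rintro ⟨r, S⟩ h ⟨r', S'⟩ h' heq
        rw [Finset.mem_sigma] at h h'
        have h3 := hnot h.2
        have h3' := hnot h'.2
        have hS : ∀ x ∈ S, r < x := fun x hx => Finset.mem_Ioi.1 ((Finset.mem_powersetCard.1 h.2).1 hx)
        have hS' : ∀ x ∈ S', r' < x := fun x hx => Finset.mem_Ioi.1 ((Finset.mem_powersetCard.1 h'.2).1 hx)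
        simp only at heq h3 h3'
        have hr : r = r' := by
          have h4 : r ∈ insert r' S' := heq ▸ Finset.mem_insert_self _ _
          have h5 : r' ∈ insert r S := heq ▸ Finset.mem_insert_self _ _
          rcases Finset.mem_insert.1 h4 with h4 | h4
          · exact h4
          rcases Finset.mem_insert.1 h5 with h5 | h5
          · exact h5.symm
          exact absurd (hS _ h5) (hS' _ h4).asymm
        subst hr
        have : S = S' := by
          rw [← Finset.erase_insert h3, heq, Finset.erase_insert h3']
        rw [this]
      · intro T hT
        rw [Finset.mem_powersetCard] at hT
        have hne : T.Nonempty := Finset.card_pos.1 (by omega)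
        refine ⟨⟨T.min' hne, T.erase (T.min' hne)⟩, ?_, Finset.insert_erase (T.min'_mem hne)⟩
        rw [Finset.mem_sigma, Finset.mem_powersetCard]
        refine ⟨hT.1 (T.min'_mem hne), fun x hx => ?_, ?_⟩
        · rw [Finset.mem_Ioi]
          exact Finset.min'_lt_of_mem_erase_min' _ _ hx
        · rw [Finset.card_erase_of_mem (T.min'_mem hne), hT.2]
          rfl
      · rintro ⟨r, S⟩ _
        rw [hP]
        congr 1
        ext x y
        simp only [minorMatrix, Matrix.of_apply]
        by_cases hy : y = r
        · rw [if_pos hy, hy]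
        · rw [if_neg hy]
    -- Sets that already contain `l` give a repeated column, hence zero; the others arise by
    -- removing `l` from a set of `k + 1` indices.
    have hoff : ∀ l ∈ Finset.Ioi i, bird A k i l = (-1) ^ k *
        ∑ S ∈ Finset.powersetCard (k + 1) (Finset.Ioi i) with l ∈ S,
          (minorMatrix A (S.erase l) i l).det := by
      intro l hl
      rw [ih]
      congr 1
      rw [← Finset.sum_filter_add_sum_filter_not _ (fun S => l ∈ S), Finset.sum_eq_zero (s := Finset.filter _ _),
        zero_add]
      · symm
        refine Finset.sum_bij (fun S _ => S.erase l) ?_ ?_ ?_ fun _ _ => rfl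
        · intro S hS
          rw [Finset.mem_filter, Finset.mem_powersetCard] at hS ⊢
          refine ⟨⟨(Finset.erase_subset _ _).trans hS.1.1, ?_⟩, Finset.notMem_erase _ _⟩
          rw [Finset.card_erase_of_mem hS.2, hS.1.2]
          rfl
        · intro S hS S' hS' h
          rw [← Finset.insert_erase (Finset.mem_filter.1 hS).2, h,
            Finset.insert_erase (Finset.mem_filter.1 hS').2]
        · intro S hS
          rw [Finset.mem_filter, Finset.mem_powersetCard] at hS
          refine ⟨insert l S, ?_, Finset.erase_insert hS.2⟩
          rw [Finset.mem_filter, Finset.mem_powersetCard, Finset.card_insert_of_notMem hS.2, hS.1.2]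
          exact ⟨⟨Finset.insert_subset hl hS.1.1, rfl⟩, Finset.mem_insert_self _ _⟩
      · intro S hS
        rw [Finset.mem_filter] at hS
        exact det_minorMatrix_eq_zero A (hnot hS.1) hS.2
    have hstep : bird A (k + 1) i j = ∑ l ∈ Finset.Ioi i, bird A k i l * A l j -
        (∑ r ∈ Finset.Ioi i, bird A k r r) * A i j := by
      rw [bird, Matrix.mul_apply, ← Finset.sum_subset (Finset.subset_univ (insert i (Finset.Ioi i))),
        Finset.sum_insert (by simp), sub_eq_neg_add]
      · congr 1
        · simp [birdAux]
        · refine Finset.sum_congr rfl fun l hl => ?_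
          rw [birdAux, Matrix.of_apply, if_pos (Finset.mem_Ioi.1 hl)]
      · intro l _ hl
        rw [Finset.mem_insert, Finset.mem_Ioi, not_or] at hl
        rw [birdAux, Matrix.of_apply, if_neg hl.2, if_neg (Ne.symm hl.1), zero_mul]
    rw [hstep, hdiag, Finset.sum_congr rfl fun l hl => by rw [hoff l hl],
      Finset.sum_congr (s₁ := Finset.powersetCard (k + 1) _) rfl
        fun S hS => det_minorMatrix A (hnot hS) j, Finset.sum_sub_distrib, ← Finset.mul_sum, pow_succ]
    have hswap : ∑ S ∈ Finset.powersetCard (k + 1) (Finset.Ioi i), ∑ l ∈ S,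
        A l j * (minorMatrix A (S.erase l) i l).det = ∑ l ∈ Finset.Ioi i,
        A l j * ∑ S ∈ Finset.powersetCard (k + 1) (Finset.Ioi i) with l ∈ S,
          (minorMatrix A (S.erase l) i l).det := by
      simp only [Finset.mul_sum]
      refine Finset.sum_comm' fun S l => ?_
      rw [Finset.mem_filter]
      constructor
      · rintro ⟨h1, h2⟩
        exact ⟨⟨h1, h2⟩, (Finset.mem_powersetCard.1 h1).1 h2⟩
      · rintro ⟨⟨h1, h2⟩, -⟩
        exact ⟨h1, h2⟩
    rw [hswap]
    have hmul : ∑ l ∈ Finset.Ioi i, (-1) ^ k *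
        (∑ S ∈ Finset.powersetCard (k + 1) (Finset.Ioi i) with l ∈ S,
          (minorMatrix A (S.erase l) i l).det) * A l j = (-1) ^ k * ∑ l ∈ Finset.Ioi i,
        A l j * ∑ S ∈ Finset.powersetCard (k + 1) (Finset.Ioi i) with l ∈ S,
          (minorMatrix A (S.erase l) i l).det := by
      rw [Finset.mul_sum]
      exact Finset.sum_congr rfl fun l _ => by ring
    rw [hmul]
    ring

/-- Bird's division free determinant. -/
theorem bird_det (A : Matrix (Fin n) (Fin n) R) (hn : 0 < n) :
    bird A (n - 1) ⟨0, hn⟩ ⟨0, hn⟩ = (-1) ^ (n - 1) * A.det := by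
  have hcard : (Finset.Ioi (⟨0, hn⟩ : Fin n)).card = n - 1 := by
    rw [Fin.card_Ioi]
    simp
  rw [bird_eq]
  congr 1
  conv_lhs => rw [← hcard, Finset.powersetCard_self, Finset.sum_singleton]
  congr 1
  ext x y
  have hx : x ∈ insert (⟨0, hn⟩ : Fin n) (Finset.Ioi ⟨0, hn⟩) := by
    rw [Finset.mem_insert, Finset.mem_Ioi]
    rcases Nat.eq_zero_or_pos x.1 with h | h
    · exact Or.inl (Fin.ext h)
    · exact Or.inr h
  simp only [minorMatrix, Matrix.of_apply, if_pos hx]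
  by_cases hy : y = ⟨0, hn⟩
  · rw [if_pos hy, hy]
  · rw [if_neg hy]

end Bird

end UDet

end


noncomputable section

namespace UDet

/-! ## Reasoning about programs -/

section Machine

open scoped Classical

/-- The state of a machine without the clock. -/
structure Core (F : Type*) where
  reg : ℕ → ℕ
  mem : ℕ → ℕ
  freg : ℕ → F
  fmem : ℕ → F

variable {F : Type*}

/-- Forget the clock. -/
def State.core (s : State F) : Core F := ⟨s.reg, s.mem, s.freg, s.fmem⟩

/-- Write `x` to the natural number register `a`. -/
def Core.setN (c : Core F) (a x : ℕ) : Core F := { c with reg := Function.update c.reg a x }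

/-- Write `x` to the field register `a`. -/
def Core.setF (c : Core F) (a : ℕ) (x : F) : Core F := { c with freg := Function.update c.freg a x }

/-- Write `x` to the cell `a` of the memory. -/
def Core.storeN (c : Core F) (a x : ℕ) : Core F := { c with mem := Function.update c.mem a x }

/-- Write `x` to the cell `a` of the field memory. -/
def Core.storeF (c : Core F) (a : ℕ) (x : F) : Core F :=
  { c with fmem := Function.update c.fmem a x }

variable [Field F]

/-- A sufficient condition for `Q` after the execution of a program, with all loops of length at
most `m` and all field elements that occur in the set `V`. -/
def wp (m : ℕ) (V : F → Prop) : Prog → (Core F → Prop) → Core F → Prop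
  | .const a k, Q, c => Q (c.setN a k)
  | .add a b d, Q, c => Q (c.setN a (c.reg b + c.reg d))
  | .sub a b d, Q, c => Q (c.setN a (c.reg b - c.reg d))
  | .load a b, Q, c => Q (c.setN a (c.mem (c.reg b)))
  | .store a b, Q, c => Q (c.storeN (c.reg a) (c.reg b))
  | .fone a, Q, c => V 1 ∧ Q (c.setF a 1)
  | .fadd a b d, Q, c => V (c.freg b) ∧ V (c.freg d) ∧ V (c.freg b + c.freg d) ∧
      Q (c.setF a (c.freg b + c.freg d))
  | .fsub a b d, Q, c => V (c.freg b) ∧ V (c.freg d) ∧ V (c.freg b - c.freg d) ∧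
      Q (c.setF a (c.freg b - c.freg d))
  | .fmul a b d, Q, c => V (c.freg b) ∧ V (c.freg d) ∧ V (c.freg b * c.freg d) ∧
      Q (c.setF a (c.freg b * c.freg d))
  | .fdiv a b d, Q, c => V (c.freg b) ∧ V (c.freg d) ∧ V (c.freg b / c.freg d) ∧
      Q (c.setF a (c.freg b / c.freg d))
  | .fload a b, Q, c => V (c.fmem (c.reg b)) ∧ Q (c.setF a (c.fmem (c.reg b)))
  | .fstore a b, Q, c => V (c.freg b) ∧ Q (c.storeF (c.reg a) (c.freg b))
  | .seq p q, Q, c => wp m V p (wp m V q Q) c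
  | .ifZero a p q, Q, c => (c.reg a = 0 → wp m V p Q c) ∧ (c.reg a ≠ 0 → wp m V q Q c)
  | .fifZero a p q, Q, c => V (c.freg a) ∧ (c.freg a = 0 → wp m V p Q c) ∧
      (c.freg a ≠ 0 → wp m V q Q c)
  | .loop a p, Q, c => c.reg a ≤ m ∧ (wp m V p)^[c.reg a] Q c

/-- A bound for the number of steps when all loops have length at most `X`. -/
def steps : Prog → Polynomial ℕ
  | .seq p q => steps p + steps q
  | .ifZero _ p q => 1 + steps p + steps q
  | .fifZero _ p q => 1 + steps p + steps q
  | .loop _ p => 1 + Polynomial.X * (1 + steps p)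
  | _ => 1

/-- An instruction handles at most three field elements, so each counted step costs at most `1 + 3 *
B`. Correctness and running time thus follow from the same verification, in which `V` only has to
bound the sizes. -/
theorem wp_sound {m : ℕ} {V : F → Prop} {size : F → ℕ} {B : ℕ} (hV : ∀ x, V x → size x ≤ B)
    (p : Prog) (Q : Core F → Prop) (s : State F) (h : wp m V p Q s.core) :
    Q (p.run size s).core ∧
      (p.run size s).time ≤ s.time + (steps p).eval m * (1 + 3 * B) := by
  induction p generalizing Q s with
  | seq p q ihp ihq =>
    obtain ⟨h1, h2⟩ := ihp _ _ h
    obtain ⟨h3, h4⟩ := ihq _ _ h1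
    refine ⟨h3, h4.trans ?_⟩
    rw [steps, Polynomial.eval_add, add_mul]
    omega
  | ifZero a p q ihp ihq =>
    rw [Prog.run]
    have hs : (steps (.ifZero a p q)).eval m * (1 + 3 * B) = (1 + 3 * B) +
        (steps p).eval m * (1 + 3 * B) + (steps q).eval m * (1 + 3 * B) := by
      simp only [steps, Polynomial.eval_add, Polynomial.eval_one]
      ring
    rw [hs]
    split_ifs with ha
    · obtain ⟨h1, h2⟩ := ihp Q (s.tick 1) (h.1 ha)
      refine ⟨h1, h2.trans ?_⟩
      simp only [State.tick]
      omega
    · obtain ⟨h1, h2⟩ := ihq Q (s.tick 1) (h.2 ha)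
      refine ⟨h1, h2.trans ?_⟩
      simp only [State.tick]
      omega
  | fifZero a p q ihp ihq =>
    rw [Prog.run]
    have hs : (steps (.fifZero a p q)).eval m * (1 + 3 * B) = (1 + 3 * B) +
        (steps p).eval m * (1 + 3 * B) + (steps q).eval m * (1 + 3 * B) := by
      simp only [steps, Polynomial.eval_add, Polynomial.eval_one]
      ring
    rw [hs]
    have hB := hV _ h.1
    simp only [State.core] at hB
    split_ifs with ha
    · obtain ⟨h1, h2⟩ := ihp Q (s.tick (1 + size (s.freg a))) (h.2.1 ha)
      refine ⟨h1, h2.trans ?_⟩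
      simp only [State.tick]
      omega
    · obtain ⟨h1, h2⟩ := ihq Q (s.tick (1 + size (s.freg a))) (h.2.2 ha)
      refine ⟨h1, h2.trans ?_⟩
      simp only [State.tick]
      omega
  | loop a p ih =>
    obtain ⟨ha, h⟩ := h
    have key : ∀ k (s : State F), (wp m V p)^[k] Q s.core →
        Q ((fun t => p.run size (t.tick 1))^[k] s).core ∧
        ((fun t => p.run size (t.tick 1))^[k] s).time ≤
          s.time + k * ((1 + (steps p).eval m) * (1 + 3 * B)) := by
      intro k
      induction k with
      | zero => exact fun s h => ⟨h, by simp⟩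
      | succ k ihk =>
        intro s h
        rw [Function.iterate_succ_apply'] at h
        obtain ⟨h1, h2⟩ := ih _ (s.tick 1) h
        obtain ⟨h3, h4⟩ := ihk _ h1
        rw [Function.iterate_succ_apply]
        refine ⟨h3, h4.trans ?_⟩
        have h5 : (s.tick 1).time = s.time + 1 := rfl
        rw [h5] at h2
        rw [add_mul k, one_mul, add_mul 1, one_mul]
        omega
    obtain ⟨h1, h2⟩ := key _ (s.tick 1) h
    rw [Prog.run]
    refine ⟨h1, h2.trans ?_⟩
    have h5 : (s.tick 1).time = s.time + 1 := rfl
    have h6 : s.reg a * ((1 + (steps p).eval m) * (1 + 3 * B)) ≤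
        m * ((1 + (steps p).eval m) * (1 + 3 * B)) := Nat.mul_le_mul_right _ ha
    have h7 : (steps (.loop a p)).eval m * (1 + 3 * B) = (1 + 3 * B) +
        m * ((1 + (steps p).eval m) * (1 + 3 * B)) := by
      simp only [steps, Polynomial.eval_add, Polynomial.eval_one, Polynomial.eval_mul,
        Polynomial.eval_X]
      ring
    rw [h5, h7]
    change _ + s.reg a * _ ≤ _
    omega
  | fone a =>
    have h1 := hV _ h.1
    exact ⟨h.2, by simp only [Prog.run, State.tick, State.setF, steps, Polynomial.eval_one]; omega⟩
  | fadd a b d | fsub a b d | fmul a b d | fdiv a b d =>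
    have h1 := hV _ h.1
    have h2 := hV _ h.2.1
    have h3 := hV _ h.2.2.1
    simp only [State.core] at h1 h2 h3
    exact ⟨h.2.2.2, by simp only [Prog.run, State.tick, State.setF, steps, Polynomial.eval_one]; omega⟩
  | fload a b =>
    have h1 := hV _ h.1
    simp only [State.core] at h1
    exact ⟨h.2, by simp only [Prog.run, State.tick, State.setF, steps, Polynomial.eval_one]; omega⟩
  | fstore a b =>
    have h1 := hV _ h.1
    simp only [State.core] at h1
    exact ⟨h.2, by simp only [Prog.run, State.tick, steps, Polynomial.eval_one]; omega⟩
  | _ => exact ⟨h, by simp only [Prog.run, State.tick, State.setN, steps, Polynomial.eval_one]; omega⟩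

theorem iterate_mono {α : Type*} {T : (α → Prop) → α → Prop}
    (hT : ∀ Q Q' : α → Prop, (∀ c, Q c → Q' c) → ∀ c, T Q c → T Q' c) {Q Q' : α → Prop}
    (h : ∀ c, Q c → Q' c) (k : ℕ) : ∀ c, T^[k] Q c → T^[k] Q' c := by
  induction k with
  | zero => exact h
  | succ k ih =>
    intro c hc
    rw [Function.iterate_succ_apply'] at hc ⊢
    exact hT _ _ ih c hc

variable {m : ℕ} {V : F → Prop}

theorem wp_mono {p : Prog} {Q Q' : Core F → Prop} (h : ∀ c, Q c → Q' c) :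
    ∀ c, wp m V p Q c → wp m V p Q' c := by
  induction p generalizing Q Q' with
  | seq p q ihp ihq => exact ihp (ihq h)
  | ifZero a p q ihp ihq => exact fun c hc => ⟨fun ha => ihp h _ (hc.1 ha), fun ha => ihq h _ (hc.2 ha)⟩
  | fifZero a p q ihp ihq =>
    exact fun c hc => ⟨hc.1, fun ha => ihp h _ (hc.2.1 ha), fun ha => ihq h _ (hc.2.2 ha)⟩
  | loop a p ih => exact fun c hc => ⟨hc.1, iterate_mono (fun _ _ => ih) h _ _ hc.2⟩
  | fone | fload | fstore => exact fun c hc => ⟨hc.1, h _ hc.2⟩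
  | fadd | fsub | fmul | fdiv => exact fun c hc => ⟨hc.1, hc.2.1, hc.2.2.1, h _ hc.2.2.2⟩
  | _ => exact fun c hc => h _ hc

/-- The program may write to the register `r`. -/
def Prog.writesN : Prog → ℕ → Bool
  | .const a _, r | .add a _ _, r | .sub a _ _, r | .load a _, r => a == r
  | .seq p q, r | .ifZero _ p q, r | .fifZero _ p q, r => p.writesN r || q.writesN r
  | .loop _ p, r => p.writesN r
  | _, _ => false

/-- The program may write to the field register `r`. -/
def Prog.writesF : Prog → ℕ → Bool
  | .fone a, r | .fadd a _ _, r | .fsub a _ _, r | .fmul a _ _, r | .fdiv a _ _, r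
  | .fload a _, r => a == r
  | .seq p q, r | .ifZero _ p q, r | .fifZero _ p q, r => p.writesF r || q.writesF r
  | .loop _ p, r => p.writesF r
  | _, _ => false

/-- The program may write to the memory. -/
def Prog.storesN : Prog → Bool
  | .store _ _ => true
  | .seq p q | .ifZero _ p q | .fifZero _ p q => p.storesN || q.storesN
  | .loop _ p => p.storesN
  | _ => false

/-- The program may write to the field memory. -/
def Prog.storesF : Prog → Bool
  | .fstore _ _ => true
  | .seq p q | .ifZero _ p q | .fifZero _ p q => p.storesF || q.storesF
  | .loop _ p => p.storesF
  | _ => false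

/-- What the program cannot write to is unchanged. -/
structure Frame (p : Prog) (c c' : Core F) : Prop where
  reg : ∀ r, p.writesN r = false → c'.reg r = c.reg r
  freg : ∀ r, p.writesF r = false → c'.freg r = c.freg r
  mem : p.storesN = false → c'.mem = c.mem
  fmem : p.storesF = false → c'.fmem = c.fmem

theorem Frame.refl (p : Prog) (c : Core F) : Frame p c c :=
  ⟨fun _ _ => rfl, fun _ _ => rfl, fun _ => rfl, fun _ => rfl⟩

end Machine

end UDet

end


noncomputable section

namespace UDet

/-! ### Proof rules for frames, loops and matrices in memory. -/

section Rules

open scoped Classical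

variable {F : Type*} [Field F] {m : ℕ} {V : F → Prop}

@[simp] theorem Core.reg_setN (c : Core F) (a x b : ℕ) :
    (c.setN a x).reg b = if b = a then x else c.reg b := Function.update_apply _ _ _ _

@[simp] theorem Core.freg_setN (c : Core F) (a x : ℕ) : (c.setN a x).freg = c.freg := rfl

@[simp] theorem Core.fmem_setN (c : Core F) (a x : ℕ) : (c.setN a x).fmem = c.fmem := rfl

@[simp] theorem Core.mem_setN (c : Core F) (a x : ℕ) : (c.setN a x).mem = c.mem := rfl

@[simp] theorem Core.reg_setF (c : Core F) (a : ℕ) (x : F) : (c.setF a x).reg = c.reg := rfl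

@[simp] theorem Core.fmem_setF (c : Core F) (a : ℕ) (x : F) : (c.setF a x).fmem = c.fmem := rfl

@[simp] theorem Core.mem_setF (c : Core F) (a : ℕ) (x : F) : (c.setF a x).mem = c.mem := rfl

@[simp] theorem Core.freg_setF (c : Core F) (a : ℕ) (x : F) (b : ℕ) :
    (c.setF a x).freg b = if b = a then x else c.freg b := Function.update_apply _ _ _ _

theorem Frame.trans {p q r : Prog} {c c' c'' : Core F} (h : Frame p c c') (h' : Frame q c' c'')
    (hN : ∀ a, r.writesN a = false → p.writesN a = false ∧ q.writesN a = false)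
    (hF : ∀ a, r.writesF a = false → p.writesF a = false ∧ q.writesF a = false)
    (hsN : r.storesN = false → p.storesN = false ∧ q.storesN = false)
    (hsF : r.storesF = false → p.storesF = false ∧ q.storesF = false) : Frame r c c'' :=
  ⟨fun a ha => (h'.reg a (hN a ha).2).trans (h.reg a (hN a ha).1),
    fun a ha => (h'.freg a (hF a ha).2).trans (h.freg a (hF a ha).1),
    fun ha => (h'.mem (hsN ha).2).trans (h.mem (hsN ha).1),
    fun ha => (h'.fmem (hsF ha).2).trans (h.fmem (hsF ha).1)⟩

theorem Frame.mono {p r : Prog} {c c' : Core F} (h : Frame p c c')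
    (hN : ∀ a, r.writesN a = false → p.writesN a = false)
    (hF : ∀ a, r.writesF a = false → p.writesF a = false)
    (hsN : r.storesN = false → p.storesN = false)
    (hsF : r.storesF = false → p.storesF = false) : Frame r c c' :=
  h.trans (Frame.refl p c') (fun a ha => ⟨hN a ha, hN a ha⟩) (fun a ha => ⟨hF a ha, hF a ha⟩)
    (fun ha => ⟨hsN ha, hsN ha⟩) (fun ha => ⟨hsF ha, hsF ha⟩)

/-- The postcondition may assume that whatever the text of the program cannot write to is unchanged,
so invariants need only speak of what does change. -/
theorem wp_frame {p : Prog} {Q : Core F → Prop} {c : Core F}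
    (h : wp m V p (fun c' => Frame p c c' → Q c') c) : wp m V p Q c := by
  induction p generalizing Q c with
  | seq p q ihp ihq =>
    refine ihp (wp_mono (fun c1 h1 hf => ihq (wp_mono (fun c2 h2 hf' => h2 ?_) _ h1)) _ h)
    exact hf.trans hf' (fun _ ha => Bool.or_eq_false_iff.1 ha) (fun _ ha => Bool.or_eq_false_iff.1 ha)
      (fun ha => Bool.or_eq_false_iff.1 ha) (fun ha => Bool.or_eq_false_iff.1 ha)
  | ifZero a p q ihp ihq =>
    refine ⟨fun ha => ihp (wp_mono (fun c1 h1 hf => h1 ?_) _ (h.1 ha)),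
      fun ha => ihq (wp_mono (fun c1 h1 hf => h1 ?_) _ (h.2 ha))⟩
    · exact hf.mono (fun _ ha => (Bool.or_eq_false_iff.1 ha).1) (fun _ ha => (Bool.or_eq_false_iff.1 ha).1)
        (fun ha => (Bool.or_eq_false_iff.1 ha).1) (fun ha => (Bool.or_eq_false_iff.1 ha).1)
    · exact hf.mono (fun _ ha => (Bool.or_eq_false_iff.1 ha).2) (fun _ ha => (Bool.or_eq_false_iff.1 ha).2)
        (fun ha => (Bool.or_eq_false_iff.1 ha).2) (fun ha => (Bool.or_eq_false_iff.1 ha).2)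
  | fifZero a p q ihp ihq =>
    refine ⟨h.1, fun ha => ihp (wp_mono (fun c1 h1 hf => h1 ?_) _ (h.2.1 ha)),
      fun ha => ihq (wp_mono (fun c1 h1 hf => h1 ?_) _ (h.2.2 ha))⟩
    · exact hf.mono (fun _ ha => (Bool.or_eq_false_iff.1 ha).1) (fun _ ha => (Bool.or_eq_false_iff.1 ha).1)
        (fun ha => (Bool.or_eq_false_iff.1 ha).1) (fun ha => (Bool.or_eq_false_iff.1 ha).1)
    · exact hf.mono (fun _ ha => (Bool.or_eq_false_iff.1 ha).2) (fun _ ha => (Bool.or_eq_false_iff.1 ha).2)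
        (fun ha => (Bool.or_eq_false_iff.1 ha).2) (fun ha => (Bool.or_eq_false_iff.1 ha).2)
  | loop a p ih =>
    refine ⟨h.1, ?_⟩
    have key : ∀ k c1, Frame p c c1 → (wp m V p)^[k] (fun c' => Frame p c c' → Q c') c1 →
        (wp m V p)^[k] Q c1 := by
      intro k
      induction k with
      | zero => exact fun c1 hf h => h hf
      | succ k ihk =>
        intro c1 hf h
        rw [Function.iterate_succ_apply'] at h ⊢
        refine ih (wp_mono (fun c2 h2 => ?_) _ h)
        intro hf'
        refine ihk c2 ?_ h2
        exact hf.trans hf' (fun _ ha => ⟨ha, ha⟩) (fun _ ha => ⟨ha, ha⟩) (fun ha => ⟨ha, ha⟩)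
          (fun ha => ⟨ha, ha⟩)
    exact key _ c (Frame.refl p c) (iterate_mono (fun _ _ => wp_mono)
      (fun c1 h1 hf => h1 ⟨hf.1, hf.2, hf.3, hf.4⟩) _ _ h.2)
  | fone a =>
    refine ⟨h.1, h.2 ⟨fun _ _ => rfl, fun r hr => ?_, fun _ => rfl, fun _ => rfl⟩⟩
    exact Function.update_of_ne (Ne.symm (beq_eq_false_iff_ne.1 hr)) _ _
  | fload a b =>
    refine ⟨h.1, h.2 ⟨fun _ _ => rfl, fun r hr => ?_, fun _ => rfl, fun _ => rfl⟩⟩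
    exact Function.update_of_ne (Ne.symm (beq_eq_false_iff_ne.1 hr)) _ _
  | fadd a b d | fsub a b d | fmul a b d | fdiv a b d =>
    refine ⟨h.1, h.2.1, h.2.2.1, h.2.2.2 ⟨fun _ _ => rfl, fun r hr => ?_, fun _ => rfl, fun _ => rfl⟩⟩
    exact Function.update_of_ne (Ne.symm (beq_eq_false_iff_ne.1 hr)) _ _
  | fstore a b =>
    exact ⟨h.1, h.2 ⟨fun _ _ => rfl, fun _ _ => rfl, fun _ => rfl, fun h => by simp [Prog.storesF] at h⟩⟩
  | store a b =>
    exact h ⟨fun _ _ => rfl, fun _ _ => rfl, fun h => by simp [Prog.storesN] at h, fun _ => rfl⟩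
  | const | add | sub | load =>
    refine h ⟨fun r hr => ?_, fun _ _ => rfl, fun _ => rfl, fun _ => rfl⟩
    exact Function.update_of_ne (Ne.symm (beq_eq_false_iff_ne.1 hr)) _ _

/-- `for v := 0, 1, …` as many times as register `r` tells; register `1` holds `1`. -/
def forLoop (v r : ℕ) (p : Prog) : Prog := .seq (.const v 0) (.loop r (.seq p (.add v v 1)))

/-- The body is verified up to the increment of the counter, which is why the invariant is required
in the state with `v` already set to `k + 1`. The condition `hv` is syntactic and can be decided by
evaluation for concrete programs. -/
theorem wp_forLoop {v r : ℕ} {p : Prog} {Q : Core F → Prop} {c : Core F} {N : ℕ}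
    (I : ℕ → Core F → Prop) (hN : c.reg r = N) (hm : N ≤ m) (h1 : c.reg 1 = 1)
    (hv : (p.writesN v || p.writesN 1 || v == r || v == 1) = false)
    (h0 : I 0 (c.setN v 0))
    (hs : ∀ k < N, ∀ c', Frame (forLoop v r p) c c' → c'.reg v = k → I k c' →
      wp m V p (fun c'' => I (k + 1) (c''.setN v (k + 1))) c')
    (hQ : ∀ c', Frame (forLoop v r p) c c' → I N c' → Q c') : wp m V (forLoop v r p) Q c := by
  simp only [Bool.or_eq_false_iff, beq_eq_false_iff_ne] at hv
  obtain ⟨⟨⟨hv1, hv2⟩, hv3⟩, hv4⟩ := hv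
  have hw1 : (forLoop v r p).writesN 1 = false := by simp [forLoop, Prog.writesN, hv2, hv4]
  change _ ≤ m ∧ (wp m V (.seq p (.add v v 1)))^[(c.setN v 0).reg r] Q (c.setN v 0)
  have hr : (c.setN v 0).reg r = N := by
    rw [← hN]
    exact Function.update_of_ne (Ne.symm hv3) _ _
  rw [hr]
  refine ⟨hm, ?_⟩
  have key : ∀ j k c', j + k = N → Frame (forLoop v r p) c c' → c'.reg v = k → I k c' →
      (wp m V (.seq p (.add v v 1)))^[j] Q c' := by
    intro j
    induction j with
    | zero =>
      intro k c' hk hf hvk hI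
      rw [zero_add] at hk
      exact hQ c' hf (hk ▸ hI)
    | succ j ih =>
      intro k c' hk hf hvk hI
      rw [Function.iterate_succ_apply']
      refine wp_frame (p := p) (wp_mono (fun c'' h hf' => ?_) _ (hs k (by omega) c' hf hvk hI))
      have e1 : c''.reg v = k := (hf'.reg v hv1).trans hvk
      have e2 : c''.reg 1 = 1 := (hf'.reg 1 hv2).trans ((hf.reg 1 hw1).trans h1)
      change (wp m V (.seq p (.add v v 1)))^[j] Q (c''.setN v (c''.reg v + c''.reg 1))
      rw [e1, e2]
      refine ih (k + 1) _ (by omega) ?_ (Function.update_self _ _ _) h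
      have hf'' : Frame (.add v v 1) c'' (c''.setN v (k + 1)) :=
        ⟨fun a ha => Function.update_of_ne (Ne.symm (beq_eq_false_iff_ne.1 ha)) _ _,
          fun _ _ => rfl, fun _ => rfl, fun _ => rfl⟩
      refine (hf.trans hf' (r := forLoop v r p) (fun a ha => ⟨ha, ?_⟩) (fun a ha => ⟨ha, ?_⟩)
        (fun ha => ⟨ha, ?_⟩) (fun ha => ⟨ha, ?_⟩)).trans hf'' (fun a ha => ⟨ha, ?_⟩)
          (fun a ha => ⟨ha, ?_⟩) (fun ha => ⟨ha, ?_⟩) (fun ha => ⟨ha, ?_⟩)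
      all_goals simp only [forLoop, Prog.writesN, Prog.writesF, Prog.storesN, Prog.storesF,
        Bool.or_eq_false_iff] at ha ⊢
      all_goals tauto
  refine key N 0 _ (by omega) ⟨fun a ha => ?_, fun _ _ => rfl, fun _ => rfl, fun _ => rfl⟩
    (Function.update_self _ _ _) h0
  refine Function.update_of_ne ?_ _ _
  simp only [forLoop, Prog.writesN, Bool.or_eq_false_iff, beq_eq_false_iff_ne] at ha
  exact Ne.symm ha.1

/-- Register `20` gets the address of the entry `(i, j)` of the matrix with the given base. -/
def address (base i j : ℕ) : Prog :=
  .seq (.const 20 0) (.seq (.add 20 20 base) (.seq (.loop i (.add 20 20 0)) (.add 20 20 j)))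

/-- The machine has no multiplication of natural numbers; the product with `n` is obtained by adding
register `0` repeatedly. -/
theorem wp_address {base i j : ℕ} {Q : Core F → Prop} {c : Core F} (hi : c.reg i ≤ m)
    (hne : (base == 20 || i == 20 || j == 20) = false)
    (h : Q (c.setN 20 (c.reg base + c.reg i * c.reg 0 + c.reg j))) :
    wp m V (address base i j) Q c := by
  simp only [Bool.or_eq_false_iff, beq_eq_false_iff_ne] at hne
  obtain ⟨⟨hb, hi'⟩, hj⟩ := hne
  have set_set : ∀ (c : Core F) a x y, (c.setN a x).setN a y = c.setN a y := fun c a x y => by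
    simp [Core.setN]
  have set_reg : ∀ (c : Core F) x a, a ≠ 20 → (c.setN 20 x).reg a = c.reg a := fun c x a ha =>
    Function.update_of_ne ha _ _
  have set_self : ∀ (c : Core F) x, (c.setN 20 x).reg 20 = x := fun c x => by
    rw [Core.reg_setN, if_pos rfl]
  simp only [address, wp, set_set, set_self, set_reg _ _ _ hb, set_reg _ _ _ hi', zero_add]
  refine ⟨hi, ?_⟩
  have key : ∀ k x, (fun (Q : Core F → Prop) (c : Core F) => Q (c.setN 20 (c.reg 20 + c.reg 0)))^[k]
      (fun c => Q (c.setN 20 (c.reg 20 + c.reg j))) (c.setN 20 x) ↔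
      Q (c.setN 20 (x + k * c.reg 0 + c.reg j)) := by
    intro k
    induction k with
    | zero => intro x; simp [set_set, hj]
    | succ k ih =>
      intro x
      rw [Function.iterate_succ_apply', set_set, set_self, set_reg _ _ 0 (by norm_num), ih,
        show x + c.reg 0 + k * c.reg 0 = x + (k + 1) * c.reg 0 by ring]
  exact (key _ _).2 h

/-- Field register `d` gets the entry `(i, j)` of the matrix with the given base. -/
def getF (d base i j : ℕ) : Prog := .seq (address base i j) (.fload d 20)

/-- The entry `(i, j)` of the matrix with the given base gets the content of field register `d`. -/
def putF (base i j d : ℕ) : Prog := .seq (address base i j) (.fstore 20 d)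

/-- The address of the entry `(i, j)` of the matrix number `b`. -/
def cell (n b i j : ℕ) : ℕ := b * (n * n) + i * n + j

theorem cell_lt {n b i j : ℕ} (hi : i < n) (hj : j < n) : cell n b i j < (b + 1) * (n * n) := by
  have h1 : (i + 1) * n ≤ n * n := Nat.mul_le_mul_right n hi
  simp only [cell, add_mul, one_mul] at *
  omega

theorem cell_injective {n b b' i i' j j' : ℕ} (hi : i < n) (hi' : i' < n) (hj : j < n)
    (hj' : j' < n) (h : cell n b i j = cell n b' i' j') : b = b' ∧ i = i' ∧ j = j' := by
  have hb : b = b' := by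
    have h1 : ∀ b i j, i < n → j < n → cell n b i j / (n * n) = b := fun b i j hi hj => by
      have hpos : 0 < n * n := Nat.mul_pos (by omega) (by omega)
      refine Nat.div_eq_of_lt_le ?_ (cell_lt hi hj)
      simp only [cell]
      omega
    rw [← h1 b i j hi hj, h, h1 b' i' j' hi' hj']
  subst hb
  have h2 : i * n + j = i' * n + j' := by simp only [cell] at h; omega
  have hii : i = i' := by
    have h1 : ∀ i j, j < n → (i * n + j) / n = i := fun i j hj =>
      Nat.div_eq_of_lt_le (by omega) (by rw [add_mul]; omega)
    rw [← h1 i j hj, h2, h1 i' j' hj']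
  subst hii
  exact ⟨rfl, rfl, by omega⟩

/-- The registers that hold parameters: the number of vertices `n`, the constant `1`, the bases of
the matrices, and `n - 1`; field register `9` holds `0`. -/
structure Env (n : ℕ) (c : Core F) : Prop where
  size : c.reg 0 = n
  one : c.reg 1 = 1
  base : ∀ b < 5, c.reg (2 + b) = b * (n * n)
  pred : c.reg 7 = n - 1
  zero : c.freg 9 = 0

/-- The program does not change the parameters. -/
def Prog.keepsEnv (p : Prog) : Bool :=
  !(p.writesN 0 || p.writesN 1 || p.writesN 2 || p.writesN 3 || p.writesN 4 || p.writesN 5 ||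
    p.writesN 6 || p.writesN 7 || p.writesF 9)

theorem Env.of_frame {n : ℕ} {c c' : Core F} (h : Env n c) {p : Prog} (hf : Frame p c c')
    (hp : p.keepsEnv = true) : Env n c' := by
  simp only [Prog.keepsEnv, Bool.not_eq_true', Bool.or_eq_false_iff] at hp
  obtain ⟨⟨⟨⟨⟨⟨⟨⟨h0, h1⟩, h2⟩, h3⟩, h4⟩, h5⟩, h6⟩, h7⟩, h9⟩ := hp
  refine ⟨(hf.reg 0 h0).trans h.size, (hf.reg 1 h1).trans h.one, fun b hb => ?_,
    (hf.reg 7 h7).trans h.pred, (hf.freg 9 h9).trans h.zero⟩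
  rw [← h.base b hb]
  interval_cases b
  exacts [hf.reg _ h2, hf.reg _ h3, hf.reg _ h4, hf.reg _ h5, hf.reg _ h6]

theorem Env.setN {n : ℕ} {c : Core F} (h : Env n c) {a : ℕ} (ha : 8 ≤ a) (x : ℕ) :
    Env n (c.setN a x) :=
  have hne : ∀ b < 8, (c.setN a x).reg b = c.reg b := fun b hb =>
    Function.update_of_ne (by omega) _ _
  ⟨(hne 0 (by omega)).trans h.size, (hne 1 (by omega)).trans h.one,
    fun b hb => (hne (2 + b) (by omega)).trans (h.base b hb), (hne 7 (by omega)).trans h.pred, h.zero⟩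

theorem Env.setF {n : ℕ} {c : Core F} (h : Env n c) {a : ℕ} (ha : a ≠ 9) (x : F) :
    Env n (c.setF a x) :=
  ⟨h.size, h.one, h.base, h.pred, (Function.update_of_ne ha.symm _ _).trans h.zero⟩

/-- Matrix number `b` in the memory is `M`. -/
def Holds (n b : ℕ) (M : Matrix (Fin n) (Fin n) F) (c : Core F) : Prop :=
  ∀ i j : Fin n, c.fmem (cell n b i j) = M i j

theorem wp_getF {n b : ℕ} {d i j : ℕ} {Q : Core F → Prop} {c : Core F} (hc : Env n c) (hb : b < 5)
    (hne : (i == 20 || j == 20) = false) {x y : Fin n} (hx : c.reg i = x) (hy : c.reg j = y)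
    {a : F} (ha : c.fmem (cell n b x y) = a) (hV : V a) (h : Q ((c.setN 20 (cell n b x y)).setF d a)) :
    wp n V (getF d (2 + b) i j) Q c := by
  refine wp_address (by rw [hx]; exact x.2.le) ?_ ?_
  · simp only [Bool.or_eq_false_iff] at hne ⊢
    exact ⟨⟨by rw [beq_eq_false_iff_ne]; omega, hne.1⟩, hne.2⟩
  · have e : c.reg (2 + b) + c.reg i * c.reg 0 + c.reg j = cell n b x y := by
      rw [hc.base b hb, hx, hy, hc.size, cell]
    rw [e]
    have e2 : (c.setN 20 (cell n b x y)).fmem ((c.setN 20 (cell n b x y)).reg 20) = a := by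
      rw [← ha]
      rw [Core.reg_setN, if_pos rfl]
      rfl
    change V _ ∧ Q (Core.setF _ d _)
    rw [e2]
    exact ⟨hV, h⟩

theorem wp_putF {n b : ℕ} {d i j : ℕ} {Q : Core F → Prop} {c : Core F} (hc : Env n c) (hb : b < 5)
    (hne : (i == 20 || j == 20) = false) {x y : Fin n} (hx : c.reg i = x) (hy : c.reg j = y)
    (hV : V (c.freg d)) (h : Q ((c.setN 20 (cell n b x y)).storeF (cell n b x y) (c.freg d))) :
    wp n V (putF (2 + b) i j d) Q c := by
  refine wp_address (by rw [hx]; exact x.2.le) ?_ ?_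
  · simp only [Bool.or_eq_false_iff] at hne ⊢
    exact ⟨⟨by rw [beq_eq_false_iff_ne]; omega, hne.1⟩, hne.2⟩
  · have e : c.reg (2 + b) + c.reg i * c.reg 0 + c.reg j = cell n b x y := by
      rw [hc.base b hb, hx, hy, hc.size, cell]
    rw [e]
    refine ⟨hV, ?_⟩
    have e2 : (c.setN 20 (cell n b x y)).reg 20 = cell n b x y := by
      rw [Core.reg_setN, if_pos rfl]
    rw [e2]
    exact h

/-- For all `i, j < n` (registers `10` and `11`), the entry `(i, j)` of matrix number `b` gets the
value of field register `1` after the execution of `p`. -/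
def fill (b : ℕ) (p : Prog) : Prog := forLoop 10 0 (forLoop 11 0 (.seq p (putF (2 + b) 10 11 1)))

/-- When the entry `(i, j)` is computed, its own cell still has its initial content. Therefore a
matrix may be overwritten in place if each new entry depends only on the old entry at the same
position. -/
theorem wp_fill {n b : ℕ} {p : Prog} {Q : Core F → Prop} {c : Core F} (hc : Env n c) (hb : b < 5)
    (hp : (p.writesN 10 || p.writesN 11 || p.storesF || !p.keepsEnv) = false)
    (M : Matrix (Fin n) (Fin n) F)
    (hs : ∀ i j : Fin n, ∀ c', Frame (fill b p) c c' → Env n c' → c'.reg 10 = i → c'.reg 11 = j →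
      (∀ b' M', b' ≠ b → Holds n b' M' c → Holds n b' M' c') →
      c'.fmem (cell n b i j) = c.fmem (cell n b i j) →
      wp n V p (fun c'' => c''.freg 1 = M i j ∧ V (M i j)) c')
    (hQ : ∀ c', Frame (fill b p) c c' → Env n c' → Holds n b M c' →
      (∀ b' M', b' ≠ b → Holds n b' M' c → Holds n b' M' c') → Q c') : wp n V (fill b p) Q c := by
  simp only [Bool.or_eq_false_iff, Bool.not_eq_false'] at hp
  obtain ⟨⟨⟨hp10, hp11⟩, hpF⟩, hpE⟩ := hp
  have hE := hpE
  simp only [Prog.keepsEnv, Bool.not_eq_true', Bool.or_eq_false_iff] at hE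
  obtain ⟨⟨⟨⟨⟨⟨⟨⟨h0, h1⟩, h2⟩, h3⟩, h4⟩, h5⟩, h6⟩, h7⟩, h9⟩ := hE
  have hE1 : (forLoop 11 0 (.seq p (putF (2 + b) 10 11 1))).keepsEnv = true := by
    simp [Prog.keepsEnv, forLoop, putF, address, Prog.writesN, Prog.writesF, *]
  have hE2 : (fill b p).keepsEnv = true := by
    simp [Prog.keepsEnv, fill, forLoop, putF, address, Prog.writesN, Prog.writesF, *]
  have w10 : (forLoop 11 0 (.seq p (putF (2 + b) 10 11 1))).writesN 10 = false := by
    simp [forLoop, putF, address, Prog.writesN, *]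
  -- In the order of addresses the first `t` cells of the matrix are finished; all the other cells
  -- are as at the beginning.
  set J : ℕ → Core F → Prop := fun t c' =>
    (∀ i j : Fin n, (i : ℕ) * n + j < t → c'.fmem (cell n b i j) = M i j) ∧
    (∀ b' (i j : Fin n), b' ≠ b ∨ t ≤ (i : ℕ) * n + j →
      c'.fmem (cell n b' i j) = c.fmem (cell n b' i j)) with hJ
  refine wp_forLoop (fun k c' => J (k * n) c') hc.size le_rfl hc.one ?_ ?_ ?_ ?_
  · simp [forLoop, putF, address, Prog.writesN, *]
  · refine ⟨fun i j h => ?_, fun _ _ _ _ => rfl⟩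
    simp at h
  · intro i hi c1 hf1 hr1 hJ1
    have hf1' : Frame (fill b p) c c1 := hf1
    have hc1 := hc.of_frame hf1' hE2
    refine wp_forLoop (fun k c' => J (i * n + k) c') hc1.size le_rfl hc1.one ?_ hJ1 ?_ ?_
    · simp [putF, address, Prog.writesN, *]
    · intro j hj c2 hf2 hr2 hJ2
      have hc2 := hc1.of_frame hf2 hE1
      have hr10 : c2.reg 10 = i := (hf2.reg 10 w10).trans hr1
      have hf2' : Frame (fill b p) c c2 := hf1'.trans hf2 (fun a ha => ⟨ha, by
          simp only [fill, forLoop, Prog.writesN, Bool.or_eq_false_iff] at ha ⊢; tauto⟩)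
        (fun a ha => ⟨ha, by
          simp only [fill, forLoop, Prog.writesF, Bool.or_eq_false_iff] at ha ⊢; tauto⟩)
        (fun ha => ⟨ha, by
          simp only [fill, forLoop, Prog.storesN, Bool.or_eq_false_iff] at ha ⊢; tauto⟩)
        (fun ha => ⟨ha, by
          simp only [fill, forLoop, Prog.storesF, Bool.or_eq_false_iff] at ha ⊢; tauto⟩)
      refine wp_frame (p := p) (wp_mono (fun c3 h3 hf3 => ?_) _
        (hs ⟨i, hi⟩ ⟨j, hj⟩ c2 hf2' hc2 hr10 hr2
          (fun b' M' hb' h i' j' => (hJ2.2 b' i' j' (Or.inl hb')).trans (h i' j'))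
          (hJ2.2 b ⟨i, hi⟩ ⟨j, hj⟩ (Or.inr le_rfl))))
      · have hc3 := hc2.of_frame hf3 hpE
        refine wp_putF (x := ⟨i, hi⟩) (y := ⟨j, hj⟩) hc3 hb rfl ((hf3.reg 10 hp10).trans hr10)
          ((hf3.reg 11 hp11).trans hr2) (by rw [h3.1]; exact h3.2) ?_
        have hmem : c3.fmem = c2.fmem := hf3.fmem hpF
        have hval : ∀ x, (((c3.setN 20 (cell n b i j)).storeF (cell n b i j) (c3.freg 1)).setN 11
            (j + 1)).fmem x = if x = cell n b i j then M ⟨i, hi⟩ ⟨j, hj⟩ else c2.fmem x := fun x => by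
          simp only [Core.setN, Core.storeF, Function.update_apply, h3.1, hmem]
        refine ⟨fun i' j' h => ?_, fun b' i' j' h => ?_⟩
        · rw [hval]
          split_ifs with he
          · obtain ⟨-, e1, e2⟩ := cell_injective i'.2 hi j'.2 hj he
            have e1 : i' = ⟨i, hi⟩ := Fin.ext e1
            have e2 : j' = ⟨j, hj⟩ := Fin.ext e2
            rw [e1, e2]
          · refine hJ2.1 i' j' ?_
            rcases Nat.lt_succ_iff_lt_or_eq.1 (show (i' : ℕ) * n + j' < (i * n + j) + 1 by omega) with h | h
            · exact h
            · refine absurd ?_ he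
              simp only [cell]
              omega
        · rw [hval, if_neg]
          · exact hJ2.2 b' i' j' (by omega)
          · intro he
            obtain ⟨e0, e1, e2⟩ := cell_injective i'.2 hi j'.2 hj he
            rw [e1, e2] at h
            rcases h with h | h
            · exact h e0
            · omega
    · intro c2 _ hJ2
      have : i * n + n = (i + 1) * n := by ring
      rw [this] at hJ2
      exact hJ2
  · intro c' hf hJ'
    refine hQ c' hf (hc.of_frame hf hE2) (fun i j => hJ'.1 i j ?_) fun b' M' hb' h i j => ?_
    · have := cell_lt (b := 0) i.2 j.2
      simpa [cell] using this
    · rw [← h i j]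
      exact hJ'.2 b' i j (Or.inl hb')

end Rules

end UDet

end


noncomputable section

namespace UDet

/-! ### Branching, sizes of field elements, and the program for Bird's determinant. -/

section Programs

open scoped Classical

variable {F : Type*} [Field F] {n : ℕ} {V : F → Prop}

theorem Holds.congr {b : ℕ} {M : Matrix (Fin n) (Fin n) F} {c c' : Core F} (h : Holds n b M c)
    (hc : c'.fmem = c.fmem) : Holds n b M c' := fun i j => by rw [hc, h]

/-- Do nothing. -/
def skip : Prog := .const 21 0

/-- Branch according to whether registers `a` and `b` are equal. -/
def ifEq (a b : ℕ) (p q : Prog) : Prog :=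
  .seq (.sub 21 a b) (.seq (.sub 22 b a) (.seq (.add 21 21 22) (.ifZero 21 p q)))

/-- Branch according to whether register `a` is less than register `b`. -/
def ifLt (a b : ℕ) (p q : Prog) : Prog := .seq (.sub 21 b a) (.ifZero 21 q p)

theorem wp_ifEq {a b : ℕ} {p q : Prog} {Q : Core F → Prop} {c : Core F} {x y : ℕ}
    (hx : c.reg a = x) (hy : c.reg b = y) (hne : (a == 21 || b == 21) = false)
    (h1 : x = y → ∀ s t, wp n V p Q ((c.setN 22 s).setN 21 t))
    (h2 : x ≠ y → ∀ s t, wp n V q Q ((c.setN 22 s).setN 21 t)) : wp n V (ifEq a b p q) Q c := by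
  simp only [Bool.or_eq_false_iff, beq_eq_false_iff_ne] at hne
  have e : ∀ x y z, ((c.setN 21 x).setN 22 y).setN 21 z = (c.setN 22 y).setN 21 z := fun x y z => by
    simp only [Core.setN]
    congr 1
    rw [Function.update_comm (by norm_num : (21 : ℕ) ≠ 22), Function.update_idem]
  simp only [ifEq, wp, e, Core.reg_setN, if_neg hne.1, if_neg hne.2, hx, hy, if_true]
  refine ⟨fun h => h1 ?_ _ _, fun h => h2 ?_ _ _⟩
  · norm_num at h; omega
  · norm_num at h; omega

theorem wp_ifLt {a b : ℕ} {p q : Prog} {Q : Core F → Prop} {c : Core F} {x y : ℕ}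
    (hx : c.reg a = x) (hy : c.reg b = y)
    (h1 : x < y → ∀ t, wp n V p Q (c.setN 21 t))
    (h2 : ¬ x < y → ∀ t, wp n V q Q (c.setN 21 t)) : wp n V (ifLt a b p q) Q c := by
  simp only [ifLt, wp, Core.reg_setN, hx, hy, if_true]
  exact ⟨fun h => h2 (by omega) _, fun h => h1 (by omega) _⟩

/-- A bound on the size of field elements in terms of numbers of additions and of factors, that
survives additions of elements with the same number of factors; `L` counts in addition
multiplications and divisions by such elements. -/
structure Grading (n : ℕ) (V : F → Prop) where
  H : ℕ → ℕ → F → Prop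
  L : ℕ → F → Prop
  zero : ∀ {c a}, H c a 0
  add : ∀ {c c' a x y}, H c a x → H c' a y → H (c + c') a (x + y)
  neg : ∀ {c a x}, H c a x → H c a (0 - x)
  mul : ∀ {c c' a x y}, H c a x → H c' 1 y → H (c * c') (a + 1) (x * y)
  mono : ∀ {c c' a x}, c ≤ c' → H c a x → H c' a x
  val : ∀ {c a x}, H c a x → c ≤ (2 * n) ^ n → a ≤ n → V x
  L_zero : L 0 0
  L_one : L 0 1
  L_mono : ∀ {t t' x}, t ≤ t' → L t x → L t' x
  L_neg : ∀ {t x}, L t x → L t (0 - x)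
  L_mul : ∀ {c a t x y}, L t x → H c a y → c ≤ (2 * n) ^ n → a ≤ n → L (t + 1) (x * y)
  L_div : ∀ {c a t x y}, L t x → H c a y → c ≤ (2 * n) ^ n → a ≤ n → L (t + 1) (x / y)
  L_val : ∀ {t x}, L t x → t ≤ 3 * (n * n) → V x

theorem Grading.V_zero (g : Grading n V) : V 0 := g.L_val g.L_zero (by omega)

theorem Grading.V_one (g : Grading n V) : V 1 := g.L_val g.L_one (by omega)

/-- Partial sums. -/
def psum (f : Fin n → F) (t : ℕ) : F := ∑ l : Fin n, if (l : ℕ) < t then f l else 0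

theorem psum_zero (f : Fin n → F) : psum f 0 = 0 := by simp [psum]

theorem psum_top (f : Fin n → F) : psum f n = ∑ l, f l := by simp [psum]

theorem psum_succ (f : Fin n → F) {t : ℕ} (ht : t < n) : psum f (t + 1) = psum f t + f ⟨t, ht⟩ := by
  rw [psum, psum, ← Finset.sum_erase_add _ _ (Finset.mem_univ (⟨t, ht⟩ : Fin n)),
    ← Finset.sum_erase_add _ _ (Finset.mem_univ (⟨t, ht⟩ : Fin n))]
  simp only [lt_add_iff_pos_right, zero_lt_one, if_true, lt_irrefl, if_false, add_zero]
  congr 1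
  refine Finset.sum_congr rfl fun l hl => if_congr ?_ rfl rfl
  have : (l : ℕ) ≠ t := fun h => (Finset.mem_erase.1 hl).1 (Fin.ext h)
  omega

theorem Grading.psum (g : Grading n V) {f : Fin n → F} {c a : ℕ} (hf : ∀ l, g.H c a (f l)) {t : ℕ}
    (ht : t ≤ n) : g.H (t * c) a (psum f t) := by
  induction t with
  | zero => rw [psum_zero]; exact g.zero
  | succ t ih =>
    rw [psum_succ f ht, add_mul, one_mul]
    exact g.add (ih (by omega)) (hf _)

/-- The recursion in the order in which the program evaluates it, with truncated sums over all
indices so that each loop runs `n` times. -/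
theorem bird_succ_apply (A : Matrix (Fin n) (Fin n) F) (k : ℕ) (i j : Fin n) : bird A (k + 1) i j =
    (0 - psum (fun r => if i < r then bird A k r r else 0) n) * A i j +
      psum (fun l => (if i < l then bird A k i l else 0) * A l j) n := by
  rw [bird, Matrix.mul_apply, psum_top, psum_top,
    ← Finset.add_sum_erase _ _ (Finset.mem_univ i), zero_sub]
  congr 1
  · simp [birdAux, Finset.sum_ite, Finset.filter_lt_eq_Ioi]
  · rw [← Finset.add_sum_erase _ _ (Finset.mem_univ i), if_neg (lt_irrefl i), zero_mul, zero_add]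
    refine Finset.sum_congr rfl fun l hl => ?_
    have hne := (Finset.mem_erase.1 hl).1
    simp [birdAux, hne.symm]

theorem Grading.bird_trace (g : Grading n V) {B : Matrix (Fin n) (Fin n) F} {c a : ℕ}
    (hB : ∀ i j, g.H c a (B i j)) (i : Fin n) {t : ℕ} (ht : t ≤ n) :
    g.H (n * c) a (UDet.psum (fun r => if i < r then B r r else 0) t) := by
  refine g.mono (Nat.mul_le_mul_right _ ht) (g.psum (fun r => ?_) ht)
  split_ifs
  · exact hB r r
  · exact g.zero

theorem Grading.bird_row (g : Grading n V) {A B : Matrix (Fin n) (Fin n) F} {c a : ℕ}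
    (hA : ∀ i j, g.H 1 1 (A i j)) (hB : ∀ i j, g.H c a (B i j)) (i j : Fin n) {t : ℕ} (ht : t ≤ n) :
    g.H (n * c) (a + 1) (UDet.psum (fun l => (if i < l then B i l else 0) * A l j) t) := by
  refine g.mono (Nat.mul_le_mul_right _ ht) (g.psum (fun l => ?_) ht)
  rw [← mul_one c]
  refine g.mul ?_ (hA l j)
  split_ifs
  · exact hB i l
  · exact g.zero

/-- An entry of the next iterate is a sum of at most `n` products from the diagonal and `n` from the
row, each with one more factor; so a step multiplies the number of terms by `2 * n`. -/
theorem Grading.bird (g : Grading n V) {A : Matrix (Fin n) (Fin n) F} (hA : ∀ i j, g.H 1 1 (A i j))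
    (k : ℕ) (i j : Fin n) : g.H ((2 * n) ^ k) (k + 1) (bird A k i j) := by
  induction k generalizing i j with
  | zero => simpa [UDet.bird] using hA i j
  | succ k ih =>
    rw [bird_succ_apply, show (2 * n) ^ (k + 1) = n * (2 * n) ^ k * 1 + n * (2 * n) ^ k by ring]
    exact g.add (g.mul (g.neg (g.bird_trace ih i le_rfl)) (hA i j)) (g.bird_row hA ih i j le_rfl)

/-- Copy matrix number `s` to matrix number `d`. -/
def copy (s d : ℕ) : Prog := fill d (getF 1 (2 + s) 10 11)

theorem wp_copy {s d : ℕ} {Q : Core F → Prop} {c : Core F} (hc : Env n c) (hs : s < 5) (hd : d < 5)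
    (hsd : s ≠ d) {M : Matrix (Fin n) (Fin n) F} (hM : Holds n s M c) (hV : ∀ i j, V (M i j))
    (hQ : ∀ c', Frame (copy s d) c c' → Env n c' → Holds n d M c' →
      (∀ b' M', b' ≠ d → Holds n b' M' c → Holds n b' M' c') → Q c') : wp n V (copy s d) Q c := by
  refine wp_fill hc hd rfl M (fun i j c1 _ hc1 hi hj hh _ => ?_) hQ
  refine wp_getF hc1 hs rfl hi hj (hh s M hsd hM i j) (hV i j) ⟨?_, hV i j⟩
  simp

/-- The entry of the next iterate of Bird's algorithm for matrix number `s`. -/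
def birdEntry (s : ℕ) : Prog :=
  .seq (.fadd 1 9 9) (.seq
    (forLoop 12 0 (ifLt 10 12 (.seq (getF 2 (2 + 3) 12 12) (.fadd 1 1 2)) skip))
    (.seq (.fsub 1 9 1) (.seq (getF 2 (2 + s) 10 11) (.seq (.fmul 1 1 2)
      (forLoop 12 0 (ifLt 10 12 (.seq (getF 2 (2 + 3) 10 12) (.seq (getF 3 (2 + s) 12 11)
        (.seq (.fmul 2 2 3) (.fadd 1 1 2)))) skip))))))

theorem wp_birdEntry (g : Grading n V) {A : Matrix (Fin n) (Fin n) F} (hA : ∀ i j, g.H 1 1 (A i j))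
    {k s : ℕ} (hk : k + 2 ≤ n) (hs : s < 5) {c : Core F} (hc : Env n c) {i j : Fin n}
    (hi : c.reg 10 = i) (hj : c.reg 11 = j) (hF : Holds n 3 (bird A k) c) (hS : Holds n s A c) :
    wp n V (birdEntry s) (fun c' => c'.freg 1 = bird A (k + 1) i j ∧ V (bird A (k + 1) i j)) c := by
  have hB := g.bird hA k
  have hpow : (2 * n) ^ (k + 1) ≤ (2 * n) ^ n := Nat.pow_le_pow_right (by omega) (by omega)
  have hle : n * (2 * n) ^ k ≤ (2 * n) ^ (k + 1) := by
    rw [pow_succ, mul_comm]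
    exact Nat.mul_le_mul_left _ (by omega)
  have hle' : n * (2 * n) ^ k + n * (2 * n) ^ k = (2 * n) ^ (k + 1) := by ring
  have VB : ∀ i j, V (bird A k i j) := fun i j => g.val (hB i j)
    ((Nat.pow_le_pow_right (by omega) (by omega)).trans hpow) (by omega)
  have VA : ∀ i j, V (A i j) := fun i j => g.val (hA i j) (Nat.one_le_pow _ _ (by omega)) (by omega)
  set T : ℕ → F := psum (fun r => if i < r then bird A k r r else 0) with hT
  set R : ℕ → F := psum (fun l => (if i < l then bird A k i l else 0) * A l j) with hR
  have VT : ∀ t ≤ n, V (T t) := fun t ht => g.val (g.bird_trace hB i ht) (hle.trans hpow) (by omega)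
  have HT := g.mul (g.neg (g.bird_trace hB i le_rfl)) (hA i j)
  rw [mul_one] at HT
  have VR : ∀ t ≤ n, V ((0 - T n) * A i j + R t) := fun t ht =>
    g.val (g.add HT (g.bird_row hA hB i j ht)) (hle'.le.trans hpow) (by omega)
  have V0 := g.V_zero
  simp only [birdEntry, wp, hc.zero, add_zero]
  refine ⟨V0, V0, V0, ?_⟩
  refine wp_forLoop (fun t c' => c'.freg 1 = T t) hc.size le_rfl hc.one rfl
    (by simp [hT, psum_zero]) (fun t ht c1 f1 r1 h1 => ?_) fun c1 f1 h1 => ?_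
  · have hc1 := (hc.setF (by norm_num : 1 ≠ 9) 0).of_frame f1 rfl
    have hi1 : c1.reg 10 = i := (f1.reg 10 rfl).trans hi
    have e := psum_succ (fun r => if i < r then bird A k r r else 0) ht
    rw [← hT] at e
    refine wp_ifLt hi1 r1 (fun hlt x => ?_) fun hlt x => ?_
    · rw [if_pos (show i < ⟨t, ht⟩ from hlt)] at e
      refine wp_getF (x := ⟨t, ht⟩) (y := ⟨t, ht⟩) (hc1.setN (by norm_num) _) (by norm_num) rfl (by simp [r1]) (by simp [r1])
        ((hF.congr (f1.fmem rfl)) _ _) (VB _ _) ?_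
      simp [wp, h1, ← e, VT t ht.le, VT (t + 1) ht, VB]
    · rw [if_neg (show ¬ i < ⟨t, ht⟩ from hlt), add_zero] at e
      simp [skip, wp, h1, e]
  · have hc1 := (hc.setF (by norm_num : 1 ≠ 9) 0).of_frame f1 rfl
    simp only [hc1.zero, h1]
    refine ⟨V0, VT n le_rfl, g.val (g.neg (g.bird_trace hB i le_rfl)) (hle.trans hpow) (by omega), ?_⟩
    refine wp_getF (hc1.setF (by norm_num) _) hs rfl ((f1.reg 10 rfl).trans hi) ((f1.reg 11 rfl).trans hj)
      ((hS.congr (f1.fmem rfl)) _ _) (VA _ _) ?_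
    simp only [Core.freg_setF, Core.freg_setN, if_true, if_neg (by norm_num : ¬ 1 = 2)]
    refine ⟨g.val (g.neg (g.bird_trace hB i le_rfl)) (hle.trans hpow) (by omega), VA i j,
      g.val HT (hle.trans hpow) (by omega), ?_⟩
    have hc1' := ((hc1.setF (by norm_num : 1 ≠ 9) (0 - T n)).setN (by norm_num : 8 ≤ 20)
      (cell n s i j)).setF (by norm_num : 2 ≠ 9) (A i j) |>.setF (by norm_num : 1 ≠ 9)
        ((0 - T n) * A i j)
    refine wp_forLoop (fun t c' => c'.freg 1 = (0 - T n) * A i j + R t) hc1'.size le_rfl hc1'.one rfl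
      (by simp [hR, psum_zero]) (fun t ht c2 f2 r2 h2 => ?_) fun c2 f2 h2 => ?_
    · have hc2 := hc1'.of_frame f2 rfl
      have hi2 : c2.reg 10 = i := (f2.reg 10 rfl).trans ((f1.reg 10 rfl).trans hi)
      have hj2 : c2.reg 11 = j := (f2.reg 11 rfl).trans ((f1.reg 11 rfl).trans hj)
      have hm2 : c2.fmem = c.fmem := (f2.fmem rfl).trans (f1.fmem rfl)
      have e := psum_succ (fun l => (if i < l then bird A k i l else 0) * A l j) ht
      rw [← hR] at e
      refine wp_ifLt hi2 r2 (fun hlt x => ?_) fun hlt x => ?_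
      · rw [if_pos (show i < ⟨t, ht⟩ from hlt)] at e
        have hV := VR (t + 1) ht
        have hterm := g.mul (hB i ⟨t, ht⟩) (hA ⟨t, ht⟩ j)
        rw [mul_one] at hterm
        have hV' := g.val hterm ((Nat.pow_le_pow_right (by omega) (by omega)).trans hpow) (by omega)
        rw [e, ← add_assoc] at hV ⊢
        refine wp_getF (x := i) (y := ⟨t, ht⟩) (hc2.setN (by norm_num) _) (by norm_num) rfl
          (by simp [hi2]) (by simp [r2]) (hF.congr hm2 _ _) (VB _ _) ?_
        refine wp_getF (x := ⟨t, ht⟩) (y := j) (((hc2.setN (by norm_num) _).setN (by norm_num) _).setF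
          (by norm_num) _) hs rfl (by simp [r2]) (by simp [hj2]) (hS.congr hm2 _ _) (VA _ _) ?_
        simp [-zero_sub, wp, h2, VB, VA, hV', VR t ht.le, hV]
      · rw [if_neg (show ¬ i < ⟨t, ht⟩ from hlt), zero_mul, add_zero] at e
        simp [skip, wp, h2, e]
    · rw [h2, bird_succ_apply]
      exact ⟨rfl, VR n le_rfl⟩

/-- Matrix number `3` becomes the last iterate of Bird's algorithm for matrix number `s`. -/
def birdProg (s : ℕ) : Prog :=
  .seq (copy s 3) (forLoop 13 7 (.seq (fill 4 (birdEntry s)) (copy 4 3)))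

/-- The next iterate is built in matrix number `4`, because all of the old one is still needed, and
then copied back to number `3`. -/
theorem wp_birdProg (g : Grading n V) (hn : 0 < n) {A : Matrix (Fin n) (Fin n) F}
    (hA : ∀ i j, g.H 1 1 (A i j)) {s : ℕ} (hs : s < 3) {c : Core F} {Q : Core F → Prop}
    (hc : Env n c) (hS : Holds n s A c)
    (hQ : ∀ c', Frame (birdProg s) c c' → Env n c' → Holds n 3 (bird A (n - 1)) c' →
      (∀ b M, b < 3 → Holds n b M c → Holds n b M c') → Q c') : wp n V (birdProg s) Q c := by
  have VB : ∀ k < n, ∀ i j, V (bird A k i j) := fun k hk i j =>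
    g.val (g.bird hA k i j) (Nat.pow_le_pow_right (by omega) (by omega)) (by omega)
  refine wp_frame (wp_copy hc (by omega) (by norm_num) (by omega) hS (VB 0 hn)
    fun c1 f1 hc1 h1 hh1 => ?_)
  refine wp_forLoop (fun k c' => Holds n 3 (bird A k) c' ∧
    ∀ b M, b < 3 → Holds n b M c → Holds n b M c') hc1.pred (by omega) hc1.one rfl
    ⟨h1, fun b M hb h => hh1 b M (by omega) h⟩ (fun k hk c2 f2 r2 h2 => ?_)
    fun c2 f2 h2 f => hQ c2 f (hc1.of_frame f2 rfl) h2.1 h2.2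
  have hc2 := hc1.of_frame f2 rfl
  refine wp_fill hc2 (by norm_num) rfl (bird A (k + 1)) (fun i j c3 f3 hc3 hi hj hh3 _ => ?_)
    fun c3 f3 hc3 h3 hh3 => ?_
  · exact wp_birdEntry g hA (by omega) (by omega) hc3 hi hj (hh3 3 _ (by norm_num) h2.1)
      (hh3 s _ (by omega) (h2.2 s A hs hS))
  · refine wp_copy hc3 (by norm_num) (by norm_num) (by norm_num) h3 (VB (k + 1) (by omega))
      fun c4 f4 hc4 h4 hh4 => ⟨h4, fun b M hb h => ?_⟩
    exact hh4 b M (by omega) (hh3 b M (by omega) (h2.2 b M hb h))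

end Programs

end UDet

end


noncomputable section

namespace UDet

/-! ## Reduction of an alternating matrix to a matching -/

section Reduction

open Equiv Equiv.Perm
open scoped Classical

variable {n : ℕ} {F : Type*} [Field F]

/-- Delete the entries of row `i` outside of column `j`. -/
def keepRow (A : Matrix (Fin n) (Fin n) F) (i j : Fin n) : Matrix (Fin n) (Fin n) F :=
  Matrix.of fun x y => if x = i then if y = j then A x y else 0 else A x y

/-- Delete the entries of row `i` outside of column `j`, and the entries of column `i` outside of
row `j`. -/
def keepEntry (A : Matrix (Fin n) (Fin n) F) (i j : Fin n) : Matrix (Fin n) (Fin n) F :=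
  Matrix.of fun x y => if x = i then if y = j then A x y else 0
    else if y = i then if x = j then A x y else 0 else A x y

theorem keepRow_eq (A : Matrix (Fin n) (Fin n) F) (i j : Fin n) :
    keepRow A i j = A.updateRow i (Pi.single j (A i j)) := by
  ext x y
  by_cases hx : x = i
  · subst hx
    by_cases hy : y = j <;> simp [keepRow, hy]
  · simp [keepRow, hx]

theorem keepEntry_eq {A : Matrix (Fin n) (Fin n) F} (hA : IsAlt A) (i j : Fin n) :
    keepEntry A i j = setRow A i (Pi.single j (A i j)) := by
  ext x y
  by_cases hx : x = i <;> by_cases hy : y = i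
  · subst hx hy
    simp [keepEntry, setRow, hA.2]
  · subst hx
    by_cases hyj : y = j <;> simp [keepEntry, setRow, hy, hyj]
    rintro rfl
    exact absurd hyj hy
  · subst hy
    by_cases hxj : x = j
    · subst hxj
      simp [keepEntry, setRow, hx, hA.1 x y]
    · simp [keepEntry, setRow, hx, hxj]
  · simp [keepEntry, setRow, hx, hy]

/-- By linearity in row `i`, the determinant is the sum of those with a single entry kept in that
row. -/
theorem det_eq_zero_of_keepRow {A : Matrix (Fin n) (Fin n) F} (i : Fin n)
    (h : ∀ j, (keepRow A i j).det = 0) : A.det = 0 := by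
  rw [Matrix.det_eq_sum_mul_adjugate_row A i]
  refine Finset.sum_eq_zero fun j _ => ?_
  rw [Matrix.adjugate_apply, ← Matrix.det_updateRow_smul, ← h j, keepRow_eq]
  congr 2
  ext y
  by_cases hy : y = j
  · subst hy; simp
  · simp [hy]

/-- The state of the reduction, when the first `k` rows and in row `k` the first `j` columns have
been dealt with. -/
structure Reduced (A₀ : Matrix (Fin n) (Fin n) F) (k j : ℕ) (r : F)
    (A : Matrix (Fin n) (Fin n) F) : Prop where
  sub : ∀ x y, A x y = A₀ x y ∨ A x y = 0
  zero : A₀.det = 0 → r = 0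
  alt : A₀.det ≠ 0 → IsAlt A
  det_ne : A₀.det ≠ 0 → A.det ≠ 0
  pf : A₀.det ≠ 0 → pfaffian A₀ = r * pfaffian A
  rows : A₀.det ≠ 0 → ∀ x : Fin n, (x : ℕ) < k → ∃ y, ∀ z, z ≠ y → A x z = 0
  row : A₀.det ≠ 0 → ∀ x : Fin n, (x : ℕ) = k → (∃ y, ∀ z, z ≠ y → A x z = 0) ∨
    ∀ y : Fin n, (y : ℕ) < j → (keepRow A x y).det = 0

variable {A₀ A : Matrix (Fin n) (Fin n) F} {k j : ℕ} {r : F}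

/-- For a singular matrix the factor starts as `0`, the correct result because the Pfaffian
vanishes; the later steps then only have to preserve it. -/
theorem Reduced.start (hA : IsAlt A₀) : Reduced A₀ 0 0 (if A₀.det = 0 then 0 else 1) A₀ where
  sub := fun _ _ => Or.inl rfl
  zero := fun h => if_pos h
  alt := fun _ => hA
  det_ne := id
  pf := fun h => by rw [if_neg h, one_mul]
  rows := fun _ x hx => absurd hx (by omega)
  row := fun _ x _ => Or.inr fun y hy => absurd hy (by omega)

/-- A nonsingular matrix has a column for which the determinant with a single kept entry is nonzero,
so some entry of the row has been kept by the end of the row. -/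
theorem Reduced.next_row (h : Reduced A₀ k n r A) : Reduced A₀ (k + 1) 0 r A where
  sub := h.sub
  zero := h.zero
  alt := h.alt
  det_ne := h.det_ne
  pf := h.pf
  rows := fun h0 x hx => by
    rcases Nat.lt_succ_iff_lt_or_eq.1 hx with hx | hx
    · exact h.rows h0 x hx
    · refine (h.row h0 x hx).resolve_right fun h' => h.det_ne h0 ?_
      exact det_eq_zero_of_keepRow x fun y => h' y y.2
  row := fun _ x _ => Or.inr fun y hy => absurd hy (by omega)

theorem Reduced.skip (h : Reduced A₀ k j r A) (hk : k < n) (hj : j < n)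
    (hd : (keepRow A ⟨k, hk⟩ ⟨j, hj⟩).det = 0) : Reduced A₀ k (j + 1) r A where
  sub := h.sub
  zero := h.zero
  alt := h.alt
  det_ne := h.det_ne
  pf := h.pf
  rows := h.rows
  row := fun h0 x hx => (h.row h0 x hx).imp id fun h' y hy => by
    rcases Nat.lt_succ_iff_lt_or_eq.1 hy with hy | hy
    · exact h' y hy
    · have e1 : x = ⟨k, hk⟩ := Fin.ext hx
      have e2 : y = ⟨j, hj⟩ := Fin.ext hy
      rw [e1, e2, hd]

theorem keepEntry_sub (A : Matrix (Fin n) (Fin n) F) (i j x y : Fin n) :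
    keepEntry A i j x y = A x y ∨ keepEntry A i j x y = 0 := by
  simp only [keepEntry, Matrix.of_apply]
  split_ifs <;> simp

/-- By `setRow_pfaffian_det` the Pfaffian is multiplied by the quotient of the two determinants,
whose inverse enters the factor, and the new determinant is a nonzero square divided by the old one.
-/
theorem Reduced.keep (h : Reduced A₀ k j r A) (hn : Even n) (hk : k < n) (hj : j < n)
    (hd : (keepRow A ⟨k, hk⟩ ⟨j, hj⟩).det ≠ 0) :
    Reduced A₀ k (j + 1) (r * A.det / (keepRow A ⟨k, hk⟩ ⟨j, hj⟩).det)
      (keepEntry A ⟨k, hk⟩ ⟨j, hj⟩) where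
  sub := fun x y => by
    rcases keepEntry_sub A ⟨k, hk⟩ ⟨j, hj⟩ x y with h' | h'
    · rw [h']; exact h.sub x y
    · exact Or.inr h'
  zero := fun h0 => by rw [h.zero h0, zero_mul, zero_div]
  alt := fun h0 => by
    rw [keepEntry_eq (h.alt h0)]
    exact (h.alt h0).setRow _ _
  det_ne := fun h0 h' => by
    have h1 := (setRow_pfaffian_det hn (h.alt h0) (h.det_ne h0) ⟨k, hk⟩
      (Pi.single ⟨j, hj⟩ (A ⟨k, hk⟩ ⟨j, hj⟩))).2
    rw [← keepEntry_eq (h.alt h0), h', zero_mul, ← keepRow_eq] at h1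
    exact hd (pow_eq_zero_iff (two_ne_zero) |>.1 h1.symm)
  pf := fun h0 => by
    have h1 := (setRow_pfaffian_det hn (h.alt h0) (h.det_ne h0) ⟨k, hk⟩
      (Pi.single ⟨j, hj⟩ (A ⟨k, hk⟩ ⟨j, hj⟩))).1
    rw [← keepEntry_eq (h.alt h0), ← keepRow_eq] at h1
    rw [h.pf h0, div_mul_eq_mul_div, eq_div_iff hd]
    linear_combination - r * h1
  rows := fun h0 x hx => by
    obtain ⟨y, hy⟩ := h.rows h0 x hx
    refine ⟨y, fun z hz => ?_⟩
    rcases keepEntry_sub A ⟨k, hk⟩ ⟨j, hj⟩ x z with h' | h'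
    · rw [h', hy z hz]
    · exact h'
  row := fun h0 x hx => Or.inl ⟨⟨j, hj⟩, fun z hz => by
    have e1 : x = ⟨k, hk⟩ := Fin.ext hx
    simp [keepEntry, e1, hz]⟩

/-- At the end of the reduction only the entries of a matching remain. -/
theorem Reduced.exists_matching (h : Reduced A₀ n 0 r A) (h0 : A₀.det ≠ 0) :
    ∃ μ : Perm (Fin n), IsMatchingPerm μ ∧ ∀ x y, A x y ≠ 0 ↔ μ x = y := by
  choose g hg using fun x : Fin n => h.rows h0 x x.2
  have hA := h.alt h0
  have hne : ∀ x, A x (g x) ≠ 0 := fun x hx => h.det_ne h0 <|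
    Matrix.det_eq_zero_of_row_eq_zero x fun y => by
      by_cases hy : y = g x
      · rw [hy, hx]
      · exact hg x y hy
  have hiff : ∀ x y, A x y ≠ 0 ↔ g x = y := fun x y => by
    constructor
    · intro h'
      by_contra hy
      exact h' (hg x y (Ne.symm hy))
    · rintro rfl
      exact hne x
  have hinv : Function.Involutive g := fun x => by
    rw [← hiff, hA.1, neg_ne_zero]
    exact hne x
  refine ⟨hinv.toPerm, ⟨hinv, fun x hx => ?_⟩, hiff⟩
  have := hne x
  rw [show g x = x from hx, hA.2] at this
  exact this rfl

/-- Only `μ` is supported on the nonzero entries, and its entries have not been altered by the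
reduction. -/
theorem pfaffian_eq_pfTerm (hn : Even n) (hA : IsAlt A) (hA₀ : IsAlt A₀) {μ : Perm (Fin n)}
    (hμ : IsMatchingPerm μ) (hA1 : ∀ x y, A x y ≠ 0 ↔ μ x = y) (hsub : ∀ x y, A x y = A₀ x y ∨ A x y = 0) :
    pfaffian A = pfTerm hn A₀ μ := by
  rw [pfaffian_eq_sum hn hA, Finset.sum_eq_single μ]
  · obtain ⟨σ, -, hσ⟩ := exists_listing hn hμ
    rw [← hσ, pfTerm_eq hn hA, pfTerm_eq hn hA₀, listTerm, listTerm]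
    congr 1
    refine Finset.prod_congr rfl fun k _ => (hsub _ _).resolve_right ?_
    rw [← ne_eq, hA1, ← hσ, Perm.mul_apply, Perm.mul_apply, perm_inv_apply, stdMatching_pairPos]
    rfl
  · intro μ' hμ' hne
    obtain ⟨v, hv⟩ : ∃ v, μ' v ≠ μ v := by
      by_contra h
      push Not at h
      exact hne (Equiv.ext h)
    have hμ'' : IsMatchingPerm μ' := (Finset.mem_filter.1 hμ').2
    refine pfTerm_of_not_isMatchingOf (G := SimpleGraph.fromRel fun x y => μ x = y) hn hA ?_ hμ'' ?_
    · intro x y hxy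
      by_contra h
      refine hxy ?_
      rw [SimpleGraph.fromRel_adj]
      have := (hA1 x y).1 h
      refine ⟨?_, Or.inl this⟩
      rintro rfl
      exact hμ.2 x this
    · intro h
      have := h.2 v
      rw [SimpleGraph.fromRel_adj] at this
      rcases this.2 with h' | h'
      · exact hv h'.symm
      · exact hv (by rw [← hμ.1 (μ' v), h'])
  · intro h
    exact absurd (by simpa using hμ) h

variable {G : SimpleGraph (Fin n)}

theorem IsCubic.even (hG : IsCubic G) : Even n := by
  have h := G.sum_degrees_eq_twice_card_edges
  have h1 : ∀ v, G.degree v = 3 := fun v => by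
    rw [← hG.card_neighbors v, ← SimpleGraph.card_neighborFinset_eq_degree]
    congr 1
    ext u
    simp
  simp only [h1, Finset.sum_const, Finset.card_univ, Fintype.card_fin, smul_eq_mul] at h
  rw [Nat.even_iff]
  omega

/-- The undirected determinant from the outcome of the reduction. -/
theorem Reduced.udet_eq (m : PlanarEmbedding G) (o : EdgeOrientation G) (hG : IsCubic G)
    (ho : o.IsSemiPfaffian) (hm : m.WithoutTension) (w : Sym2 (Fin n) → F)
    (hw : NonzeroWeights G w) (h : Reduced (entrywiseInv (skewAdj o w)) n 0 r A) :
    (r = 0 ∧ udet G w = 0) ∨ ∃ μ : Perm (Fin n), IsMatchingOf G μ ∧ (∀ x y, A x y ≠ 0 ↔ μ x = y) ∧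
      udet G w = r * ((-1) ^ numComponents (coverOf G μ) * ∏ e ∈ coverOf G μ, w e) := by
  have hn := hG.even
  have hA₀ := isAlt_entrywiseInv o w hw
  obtain ⟨ε, -, h1, h2⟩ := exists_sign_terms m o hG ho hm hn w hw
  by_cases h0 : (entrywiseInv (skewAdj o w)).det = 0
  · left
    rw [h2, pfaffian_eq_zero_of_det_eq_zero hn hA₀ h0, mul_zero, mul_zero]
    exact ⟨h.zero h0, rfl⟩
  · right
    obtain ⟨μ, hμ, hA1⟩ := h.exists_matching h0
    have hμG : IsMatchingOf G μ := by
      refine ⟨hμ.1, fun v => ?_⟩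
      rw [← signAdj_ne_zero_iff o]
      intro h'
      have h3 := (hA1 v (μ v)).2 rfl
      rw [(h.sub v (μ v)).resolve_right h3, skewAdj_inv_apply o w hw, h'] at h3
      simp at h3
    refine ⟨μ, hμG, hA1, ?_⟩
    have h4 := h1 μ hμG
    rw [pow_add, hn.neg_one_pow, one_mul] at h4
    rw [h4, h2, h.pf h0, pfaffian_eq_pfTerm hn (h.alt h0) hA₀ hμ hA1 h.sub]
    ring

end Reduction

end UDet

end


noncomputable section

namespace UDet

/-! ### The program for the reduction to a matching. -/

section Elimination

open scoped Classical

variable {F : Type*} [Field F] {n : ℕ} {V : F → Prop}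

/-- Copy an entry of matrix number `1` to field register `1` if it is not in row `i` (register `14`),
or in column `j` (register `15`). -/
def rowEntry : Prog :=
  ifEq 10 14 (ifEq 11 15 (getF 1 (2 + 1) 10 11) (.fadd 1 9 9)) (getF 1 (2 + 1) 10 11)

/-- The same, for row `i` and column `i` simultaneously. -/
def crossEntry : Prog :=
  ifEq 10 14 (ifEq 11 15 (getF 1 (2 + 1) 10 11) (.fadd 1 9 9))
    (ifEq 11 14 (ifEq 10 15 (getF 1 (2 + 1) 10 11) (.fadd 1 9 9)) (getF 1 (2 + 1) 10 11))

theorem wp_rowEntry {A : Matrix (Fin n) (Fin n) F} (hV : ∀ i j, V (A i j)) (V0 : V 0) {c : Core F}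
    (hc : Env n c) {i j x y : Fin n} (hx : c.reg 10 = x) (hy : c.reg 11 = y) (hi : c.reg 14 = i)
    (hj : c.reg 15 = j) (hA : c.fmem (cell n 1 x y) = A x y) :
    wp n V rowEntry (fun c' => c'.freg 1 = keepRow A i j x y ∧ V (keepRow A i j x y)) c := by
  refine wp_ifEq hx hi rfl (fun h1 s t => wp_ifEq (x := y) (y := j) (by simp [hy]) (by simp [hj]) rfl
    (fun h2 s t => ?_) fun h2 s t => ?_) fun h1 s t => ?_
  · refine wp_getF (x := x) (y := y) (((hc.setN (by norm_num) _).setN (by norm_num) _).setN (by norm_num) _ |>.setN (by norm_num) _)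
      (by norm_num) rfl (by simp [hx]) (by simp [hy]) hA (hV _ _) ?_
    simp [keepRow, Fin.ext_iff, h1, h2, hV]
  · simp [wp, keepRow, Fin.ext_iff, h1, h2, hc.zero, V0]
  · refine wp_getF (x := x) (y := y) ((hc.setN (by norm_num) _).setN (by norm_num) _)
      (by norm_num) rfl (by simp [hx]) (by simp [hy]) hA (hV _ _) ?_
    simp [keepRow, Fin.ext_iff, h1, hV]

theorem wp_crossEntry {A : Matrix (Fin n) (Fin n) F} (hV : ∀ i j, V (A i j)) (V0 : V 0) {c : Core F}
    (hc : Env n c) {i j x y : Fin n} (hx : c.reg 10 = x) (hy : c.reg 11 = y) (hi : c.reg 14 = i)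
    (hj : c.reg 15 = j) (hA : c.fmem (cell n 1 x y) = A x y) :
    wp n V crossEntry (fun c' => c'.freg 1 = keepEntry A i j x y ∧ V (keepEntry A i j x y)) c := by
  refine wp_ifEq hx hi rfl (fun h1 s t => wp_ifEq (x := y) (y := j) (by simp [hy]) (by simp [hj]) rfl
    (fun h2 s t => ?_) fun h2 s t => ?_) fun h1 s t => wp_ifEq (x := y) (y := i) (by simp [hy])
    (by simp [hi]) rfl (fun h2 s t => wp_ifEq (x := x) (y := j) (by simp [hx]) (by simp [hj]) rfl
      (fun h3 s t => ?_) fun h3 s t => ?_) fun h2 s t => ?_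
  · refine wp_getF (x := x) (y := y) (((hc.setN (by norm_num) _).setN (by norm_num) _).setN (by norm_num) _ |>.setN (by norm_num) _)
      (by norm_num) rfl (by simp [hx]) (by simp [hy]) hA (hV _ _) ?_
    simp [keepEntry, Fin.ext_iff, h1, h2, hV]
  · simp [wp, keepEntry, Fin.ext_iff, h1, h2, hc.zero, V0]
  · refine wp_getF (x := x) (y := y) ((((hc.setN (by norm_num) _).setN (by norm_num) _).setN (by norm_num) _ |>.setN (by norm_num) _).setN (by norm_num) _ |>.setN (by norm_num) _)
      (by norm_num) rfl (by simp [hx]) (by simp [hy]) hA (hV _ _) ?_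
    have e : keepEntry A i j x y = A x y := by
      simp only [keepEntry, Matrix.of_apply, Fin.ext_iff, if_neg h1, if_pos h2, if_pos h3]
    rw [e]
    simp [hV]
  · simp [wp, keepEntry, Fin.ext_iff, h1, h2, h3, hc.zero, V0]
  · refine wp_getF (x := x) (y := y) (((hc.setN (by norm_num) _).setN (by norm_num) _).setN (by norm_num) _ |>.setN (by norm_num) _)
      (by norm_num) rfl (by simp [hx]) (by simp [hy]) hA (hV _ _) ?_
    simp [keepEntry, Fin.ext_iff, h1, h2, hV]

/-- One step of the elimination, for `i` in register `14` and `j` in register `15`. -/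
def elimStep : Prog :=
  .seq (birdProg 1) (.seq (.fload 4 5) (.seq (fill 2 rowEntry) (.seq (birdProg 2) (.seq (.fload 5 5)
    (.fifZero 5 skip (.seq (.fmul 6 6 4) (.seq (.fdiv 6 6 5) (fill 1 crossEntry))))))))

/-- The invariant of the elimination. -/
def ElimInv (g : Grading n V) (A₀ W : Matrix (Fin n) (Fin n) F) (k j : ℕ) (c : Core F) : Prop :=
  ∃ A, Reduced A₀ k j (c.freg 6) A ∧ Holds n 1 A c ∧ g.L (2 * (k * n + j)) (c.freg 6) ∧ Holds n 0 W c

theorem Grading.V_bird (g : Grading n V) (hn : 0 < n) {A : Matrix (Fin n) (Fin n) F}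
    (hA : ∀ i j, g.H 1 1 (A i j)) (i j : Fin n) : V (UDet.bird A (n - 1) i j) :=
  g.val (g.bird hA (n - 1) i j) (Nat.pow_le_pow_right (by omega) (by omega)) (by omega)

/-- Each step computes two determinants with Bird's algorithm and multiplies the factor by their
quotient, or changes nothing if the second one vanishes. This adds at most two to the count in
`g.L`, hence the `2 * (k * n + j)` of the invariant. -/
theorem wp_elimStep (g : Grading n V) (hn : 0 < n) (hev : Even n) {A₀ W : Matrix (Fin n) (Fin n) F}
    (hA₀ : ∀ i j, g.H 1 1 (A₀ i j)) {k j : ℕ} (hk : k < n) (hj : j < n) {c : Core F} (hc : Env n c)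
    (h14 : c.reg 14 = k) (h15 : c.reg 15 = j) (h : ElimInv g A₀ W k j c) :
    wp n V elimStep (ElimInv g A₀ W k (j + 1)) c := by
  obtain ⟨A, hred, hA1, hL, hW⟩ := h
  have V0 := g.V_zero
  have hcell : cell n 3 0 0 = 3 * (n * n) := by simp [cell]
  have hpow : (2 * n) ^ (n - 1) ≤ (2 * n) ^ n := Nat.pow_le_pow_right (by omega) (by omega)
  have HA : ∀ x y, g.H 1 1 (A x y) := fun x y => by
    rcases hred.sub x y with h | h <;> rw [h]
    exacts [hA₀ x y, g.zero]
  have VA : ∀ x y, V (A x y) := fun x y => g.val (HA x y) (Nat.one_le_pow _ _ (by omega)) (by omega)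
  set N := keepRow A ⟨k, hk⟩ ⟨j, hj⟩ with hN
  have HN : ∀ x y, g.H 1 1 (N x y) := fun x y => by
    simp only [hN, keepRow, Matrix.of_apply]
    split_ifs
    exacts [HA x y, g.zero, HA x y]
  set z : Fin n := ⟨0, hn⟩ with hz
  have hdA := bird_det A hn
  have hdN := bird_det N hn
  have VdA := g.V_bird hn HA z z
  have VdN := g.V_bird hn HN z z
  have hsg : (-1 : F) ^ (n - 1) ≠ 0 := pow_ne_zero _ (by simp)
  have hlast : ∀ x y, g.H ((2 * n) ^ (n - 1)) (n - 1 + 1) (bird A (n - 1) x y) := g.bird HA (n - 1)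
  have hlastN : ∀ x y, g.H ((2 * n) ^ (n - 1)) (n - 1 + 1) (bird N (n - 1) x y) := g.bird HN (n - 1)
  have hbound : k * n + j < n * n := by simpa [cell] using cell_lt (b := 0) hk hj
  refine wp_birdProg g hn HA (by norm_num) hc hA1 fun c1 f1 hc1 h31 hh1 => ?_
  -- Register `5` holds the base of matrix number `3`, the address of its entry `(0, 0)`, where
  -- Bird's algorithm leaves the determinant up to sign.
  have e1 : c1.fmem (c1.reg 5) = bird A (n - 1) z z := by
    rw [hc1.base 3 (by norm_num), ← hcell]
    exact h31 z z
  simp only [wp, e1]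
  refine ⟨VdA, ?_⟩
  refine wp_fill (hc1.setF (by norm_num) _) (by norm_num) rfl N
    (fun x y c2 f2 hc2 hx hy hh2 _ => ?_) fun c2 f2 hc2 h22 hh2 => ?_
  · exact wp_rowEntry VA V0 hc2 hx hy ((f2.reg 14 rfl).trans ((f1.reg 14 rfl).trans h14))
      ((f2.reg 15 rfl).trans ((f1.reg 15 rfl).trans h15))
      (hh2 1 A (by norm_num) (hh1 1 A (by norm_num) hA1) x y)
  refine wp_birdProg g hn HN (by norm_num) hc2 h22 fun c3 f3 hc3 h33 hh3 => ?_
  have e3 : c3.fmem (c3.reg 5) = bird N (n - 1) z z := by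
    rw [hc3.base 3 (by norm_num), ← hcell]
    exact h33 z z
  have r4 : c3.freg 4 = bird A (n - 1) z z := by
    rw [f3.freg 4 rfl, f2.freg 4 rfl]
    simp
  have r6 : c3.freg 6 = c.freg 6 := by
    rw [f3.freg 6 rfl, f2.freg 6 rfl, ← f1.freg 6 rfl]
    simp
  have r14 : c3.reg 14 = k := (f3.reg 14 rfl).trans ((f2.reg 14 rfl).trans ((f1.reg 14 rfl).trans h14))
  have r15 : c3.reg 15 = j := (f3.reg 15 rfl).trans ((f2.reg 15 rfl).trans ((f1.reg 15 rfl).trans h15))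
  have m1 : Holds n 1 A c3 := hh3 1 A (by norm_num) (hh2 1 A (by norm_num) (hh1 1 A (by norm_num) hA1))
  have m0 : Holds n 0 W c3 := hh3 0 W (by norm_num) (hh2 0 W (by norm_num) (hh1 0 W (by norm_num) hW))
  simp only [e3, Core.freg_setF, if_true]
  refine ⟨VdN, VdN, fun h0 => ?_, fun h0 => ?_⟩
  · have hd : N.det = 0 := by
      rw [hdN] at h0
      exact (mul_eq_zero.1 h0).resolve_left hsg
    refine ⟨A, ?_, m1, g.L_mono (t := 2 * (k * n + j)) (by omega) ?_, m0⟩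
    · simpa [r6] using hred.skip hk hj hd
    · simpa [r6] using hL
  · have hd : N.det ≠ 0 := by
      rw [hdN] at h0
      exact fun h => h0 (by rw [h, mul_zero])
    have hL1 := g.L_mul hL (hlast z z) hpow (by omega)
    have hL2 := g.L_div hL1 (hlastN z z) hpow (by omega)
    have Vr := g.L_val hL (by omega)
    have Vr1 := g.L_val hL1 (by omega)
    have Vr2 := g.L_val hL2 (by omega)
    simp only [r4, r6, if_neg (by norm_num : ¬ 6 = 5), if_neg (by norm_num : ¬ 4 = 5),
      if_neg (by norm_num : ¬ 5 = 6)]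
    refine ⟨Vr, VdA, Vr1, Vr1, VdN, Vr2, ?_⟩
    refine wp_fill (((hc3.setF (by norm_num) _).setF (by norm_num) _).setF (by norm_num) _)
      (by norm_num) rfl (keepEntry A ⟨k, hk⟩ ⟨j, hj⟩)
      (fun x y c4 f4 hc4 hx hy _ hown => ?_) fun c4 f4 hc4 h41 hh4 => ?_
    · exact wp_crossEntry VA V0 hc4 hx hy ((f4.reg 14 rfl).trans r14) ((f4.reg 15 rfl).trans r15)
        (hown.trans (m1 x y))
    · have r6' : c4.freg 6 = c.freg 6 * bird A (n - 1) z z / bird N (n - 1) z z := by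
        rw [f4.freg 6 rfl]
        simp
      refine ⟨_, ?_, h41, ?_, hh4 0 W (by norm_num) m0⟩
      -- Both determinants carry the same sign `(-1) ^ (n - 1)`, which cancels in the quotient.
      · have e : c.freg 6 * A.det / N.det = c4.freg 6 := by
          rw [r6', hdA, hdN, mul_left_comm, mul_div_mul_left _ _ hsg]
        rw [← e]
        exact hred.keep hev hk hj hd
      · rw [r6']
        exact g.L_mono (by omega) hL2

/-- Reduce the matrix number `1`; the factor is collected in field register `6`. -/
def elimProg : Prog :=
  .seq (birdProg 1) (.seq (.fload 4 5) (.seq (.fifZero 4 (.fadd 6 9 9) (.fone 6))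
    (forLoop 14 0 (forLoop 15 0 elimStep))))

theorem wp_elimProg (g : Grading n V) (hn : 0 < n) (hev : Even n) {A₀ W : Matrix (Fin n) (Fin n) F}
    (hA₀ : ∀ i j, g.H 1 1 (A₀ i j)) (halt : IsAlt A₀) {c : Core F} {Q : Core F → Prop} (hc : Env n c)
    (h1 : Holds n 1 A₀ c) (hW : Holds n 0 W c)
    (hQ : ∀ c', Env n c' → ElimInv g A₀ W n 0 c' → Q c') : wp n V elimProg Q c := by
  have V0 := g.V_zero
  have hcell : cell n 3 0 0 = 3 * (n * n) := by simp [cell]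
  set z : Fin n := ⟨0, hn⟩ with hz
  have hdA := bird_det A₀ hn
  have VdA := g.V_bird hn hA₀ z z
  have hsg : (-1 : F) ^ (n - 1) ≠ 0 := pow_ne_zero _ (by simp)
  refine wp_birdProg g hn hA₀ (by norm_num) hc h1 fun c1 f1 hc1 h31 hh1 => ?_
  have e1 : c1.fmem (c1.reg 5) = bird A₀ (n - 1) z z := by
    rw [hc1.base 3 (by norm_num), ← hcell]
    exact h31 z z
  -- The two outcomes of the initial test differ only in the initial factor.
  have key : ∀ r, r = (if A₀.det = 0 then 0 else 1) → ∀ c2, Env n c2 → c2.fmem = c1.fmem →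
      c2.freg 6 = r → wp n V (forLoop 14 0 (forLoop 15 0 elimStep)) Q c2 := by
    intro r hr c2 hc2 hm2 hr2
    have m0 : Holds n 0 W c2 := (hh1 0 W (by norm_num) hW).congr hm2
    have m1 : Holds n 1 A₀ c2 := (hh1 1 A₀ (by norm_num) h1).congr hm2
    refine wp_forLoop (fun k c' => ElimInv g A₀ W k 0 c') hc2.size le_rfl hc2.one rfl ?_
      (fun k hk c3 f3 r3 h3 => ?_) fun c3 f3 h3 => hQ c3 (hc2.of_frame f3 rfl) h3
    · refine ⟨A₀, ?_, m1, ?_, m0⟩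
      · simp only [Core.freg_setN, hr2, hr]
        exact Reduced.start halt
      · simp only [Core.freg_setN, hr2, hr]
        split_ifs
        exacts [g.L_mono (by omega) g.L_zero, g.L_mono (by omega) g.L_one]
    · have hc3 := hc2.of_frame f3 rfl
      refine wp_forLoop (fun j c' => ElimInv g A₀ W k j c') hc3.size le_rfl hc3.one rfl h3
        (fun j hj c4 f4 r4 h4 => ?_) fun c4 f4 h4 => ?_
      · exact wp_elimStep g hn hev hA₀ hk hj (hc3.of_frame f4 rfl) ((f4.reg 14 rfl).trans r3) r4 h4
      · obtain ⟨A, a1, a2, a3, a4⟩ := h4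
        exact ⟨A, a1.next_row, a2, by rw [add_mul, one_mul, add_zero]; exact a3, a4⟩
  simp only [wp, e1, Core.freg_setF, if_true]
  refine ⟨VdA, VdA, fun h0 => ?_, fun h0 => ?_⟩
  · have h9 : c1.freg 9 = 0 := hc1.zero
    simp only [h9, add_zero, if_neg (by norm_num : ¬ 9 = 4)]
    refine ⟨V0, V0, V0, key 0 ?_ _ ((hc1.setF (by norm_num) _).setF (by norm_num) _) rfl (by simp)⟩
    rw [hdA] at h0
    rw [if_pos ((mul_eq_zero.1 h0).resolve_left hsg)]
  · refine ⟨g.V_one, key 1 ?_ _ ((hc1.setF (by norm_num) _).setF (by norm_num) _) rfl (by simp)⟩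
    rw [hdA] at h0
    rw [if_neg fun h => h0 (by rw [h, mul_zero])]

end Elimination

end UDet

end


noncomputable section

namespace UDet

/-! ### Reflexive and transitive closure, and counting components. -/

section Closure

open scoped Classical

variable {F : Type*} [Field F] {n : ℕ} {V : F → Prop}

/-- There is a path of length at most `k`. -/
def reach (X : Fin n → Fin n → Prop) : ℕ → Fin n → Fin n → Prop
  | 0 => fun i j => i = j
  | k + 1 => fun i j => reach X k i j ∨ ∃ l, reach X k i l ∧ X l j

/-- The matrix with entries `0` and `1` of a relation. -/
def indicator (F : Type*) [Field F] (R : Fin n → Fin n → Prop) : Matrix (Fin n) (Fin n) F :=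
  Matrix.of fun i j => if R i j then 1 else 0

theorem indicator_eq_zero (R : Fin n → Fin n → Prop) (i j : Fin n) :
    indicator F R i j = 0 ↔ ¬ R i j := by
  simp [indicator]

theorem Grading.V_indicator (g : Grading n V) (R : Fin n → Fin n → Prop) (i j : Fin n) :
    V (indicator F R i j) := by
  simp only [indicator, Matrix.of_apply]
  split_ifs
  exacts [g.V_one, g.V_zero]

theorem Grading.V_ite (g : Grading n V) (P : Prop) [Decidable P] : V (if P then 1 else 0) := by
  split_ifs
  exacts [g.V_one, g.V_zero]

theorem exists_lt_succ_iff {t : ℕ} (ht : t < n) (P : Fin n → Prop) :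
    (∃ l : Fin n, (l : ℕ) < t + 1 ∧ P l) ↔ (∃ l : Fin n, (l : ℕ) < t ∧ P l) ∨ P ⟨t, ht⟩ := by
  constructor
  · rintro ⟨l, h1, h2⟩
    rcases Nat.lt_succ_iff_lt_or_eq.1 h1 with h | h
    · exact Or.inl ⟨l, h, h2⟩
    · right
      rwa [show (⟨t, ht⟩ : Fin n) = l from Fin.ext h.symm]
  · rintro (⟨l, h1, h2⟩ | h)
    · exact ⟨l, by omega, h2⟩
    · exact ⟨⟨t, ht⟩, by simp, h⟩

/-- The entry of matrix number `3`, or `1` if there is a path via matrix number `2`. -/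
def closureEntry : Prog :=
  .seq (getF 1 (2 + 3) 10 11) (forLoop 12 0 (.seq (getF 2 (2 + 3) 10 12) (.fifZero 2 skip
    (.seq (getF 2 (2 + 2) 12 11) (.fifZero 2 skip (.fone 1))))))

/-- Matrix number `3` becomes the reflexive and transitive closure of matrix number `2`. -/
def closureProg : Prog :=
  .seq (fill 3 (ifEq 10 11 (.fone 1) (.fadd 1 9 9)))
    (forLoop 13 0 (.seq (fill 4 closureEntry) (copy 4 3)))

theorem wp_closureEntry (g : Grading n V) {X R : Fin n → Fin n → Prop}
    {M : Matrix (Fin n) (Fin n) F} (hM : ∀ i j, M i j ≠ 0 ↔ X i j) (hV : ∀ i j, V (M i j)) {c : Core F}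
    (hc : Env n c) {i j : Fin n} (hi : c.reg 10 = i) (hj : c.reg 11 = j)
    (h2 : Holds n 2 M c) (h3 : Holds n 3 (indicator F R) c) :
    wp n V closureEntry (fun c' => c'.freg 1 = indicator F (fun i j => R i j ∨ ∃ l, R i l ∧ X l j) i j ∧
      V (indicator F (fun i j => R i j ∨ ∃ l, R i l ∧ X l j) i j)) c := by
  refine wp_getF hc (by norm_num) rfl hi hj (h3 i j) (g.V_indicator _ _ _) ?_
  have hc1 := (hc.setN (by norm_num : 8 ≤ 20) (cell n 3 i j)).setF (by norm_num : 1 ≠ 9) (indicator F R i j)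
  refine wp_forLoop (fun t c' => c'.freg 1 =
    if R i j ∨ ∃ l : Fin n, (l : ℕ) < t ∧ (R i l ∧ X l j) then 1 else 0) hc1.size le_rfl hc1.one rfl
    (by simp [indicator]) (fun t ht c2 f2 r2 e2 => ?_) fun c2 f2 e2 => ?_
  · have hc2 := hc1.of_frame f2 rfl
    have hi2 : c2.reg 10 = i := (f2.reg 10 rfl).trans hi
    have hj2 : c2.reg 11 = j := (f2.reg 11 rfl).trans hj
    have hm2 : c2.fmem = c.fmem := f2.fmem rfl
    simp only [exists_lt_succ_iff ht, ← or_assoc]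
    refine wp_getF (x := i) (y := ⟨t, ht⟩) hc2 (by norm_num) rfl hi2 r2 (h3.congr hm2 _ _)
      (g.V_indicator _ _ _) ?_
    simp only [wp, Core.freg_setF, if_true]
    refine ⟨g.V_indicator _ _ _, fun h => ?_, fun h => ?_⟩
    · rw [indicator_eq_zero] at h
      simp [skip, wp, h, e2]
    · rw [ne_eq, indicator_eq_zero, not_not] at h
      refine wp_getF (x := ⟨t, ht⟩) (y := j) ((hc2.setN (by norm_num) _).setF (by norm_num) _)
        (by norm_num) rfl (by simp [r2]) (by simp [hj2]) (h2.congr hm2 _ _) (hV _ _) ?_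
      simp only [Core.freg_setF, if_true]
      refine ⟨hV _ _, fun h' => ?_, fun h' => ?_⟩
      · have : ¬ X ⟨t, ht⟩ j := by rwa [← hM, not_not]
        simp [skip, wp, this, e2]
      · have : X ⟨t, ht⟩ j := (hM _ _).1 h'
        simp [this, h, g.V_one]
  · rw [e2]
    refine ⟨?_, g.V_indicator _ _ _⟩
    simp [indicator]

/-- Each of `n` rounds allows paths that are longer by one edge. -/
theorem wp_closureProg (g : Grading n V) {X : Fin n → Fin n → Prop}
    {M : Matrix (Fin n) (Fin n) F} (hM : ∀ i j, M i j ≠ 0 ↔ X i j) (hV : ∀ i j, V (M i j)) {c : Core F}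
    {Q : Core F → Prop} (hc : Env n c) (h2 : Holds n 2 M c)
    (hQ : ∀ c', Frame closureProg c c' → Env n c' → Holds n 3 (indicator F (reach X n)) c' →
      (∀ b M, b < 3 → Holds n b M c → Holds n b M c') → Q c') : wp n V closureProg Q c := by
  refine wp_frame (wp_fill hc (by norm_num) rfl (indicator F (reach X 0)) (fun i j c1 f1 hc1 hi hj hh1 _ => ?_)
    fun c1 f1 hc1 h31 hh1 => ?_)
  · refine wp_ifEq hi hj rfl (fun h s t => ?_) fun h s t => ?_
    · have h : i = j := Fin.ext h
      simp [wp, g.V_one, indicator, reach, h]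
    · have h : i ≠ j := fun h' => h (congrArg Fin.val h')
      simp [wp, g.V_zero, indicator, reach, h, hc1.zero]
  · refine wp_forLoop (fun k c' => Holds n 3 (indicator F (reach X k)) c' ∧
      ∀ b M, b < 3 → Holds n b M c → Holds n b M c') hc1.size le_rfl hc1.one rfl
      ⟨h31, fun b M hb h => hh1 b M (by omega) h⟩ (fun k hk c2 f2 r2 e2 => ?_)
      fun c2 f2 e2 f => hQ c2 f (hc1.of_frame f2 rfl) e2.1 e2.2
    refine wp_fill (hc1.of_frame f2 rfl) (by norm_num) rfl (indicator F (reach X (k + 1)))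
      (fun i j c3 f3 hc3 hi hj hh3 _ => ?_) fun c3 f3 hc3 h3 hh3 => ?_
    · exact wp_closureEntry g hM hV hc3 hi hj (hh3 2 _ (by norm_num) (e2.2 2 M (by norm_num) h2))
        (hh3 3 _ (by norm_num) e2.1)
    · refine wp_copy hc3 (by norm_num) (by norm_num) (by norm_num) h3 (g.V_indicator _)
        fun c4 f4 hc4 h4 hh4 => ⟨h4, fun b M hb h => ?_⟩
      exact hh4 b M (by omega) (hh3 b M (by omega) (e2.2 b M hb h))

theorem reach_iff (H : SimpleGraph (Fin n)) (k : ℕ) (i j : Fin n) :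
    reach H.Adj k i j ↔ ∃ p : H.Walk i j, p.length ≤ k := by
  induction k generalizing i j with
  | zero =>
    constructor
    · rintro rfl
      exact ⟨.nil, by simp⟩
    · rintro ⟨p, hp⟩
      exact SimpleGraph.Walk.eq_of_length_eq_zero (p := p) (by omega)
  | succ k ih =>
    constructor
    · rintro (h | ⟨l, h, hl⟩)
      · obtain ⟨p, hp⟩ := (ih i j).1 h
        exact ⟨p, by omega⟩
      · obtain ⟨p, hp⟩ := (ih i l).1 h
        exact ⟨p.concat hl, by rw [SimpleGraph.Walk.length_concat]; omega⟩
    · rintro ⟨p, hp⟩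
      rcases Nat.lt_or_ge k p.length with h | h
      · right
        have hnil : ¬ p.Nil := by
          rw [← SimpleGraph.Walk.length_eq_zero_iff]
          omega
        refine ⟨p.penultimate, (ih _ _).2 ⟨p.dropLast, ?_⟩, p.adj_penultimate hnil⟩
        rw [SimpleGraph.Walk.length_dropLast]
        omega
      · exact Or.inl ((ih i j).2 ⟨p, h⟩)

/-- A walk can be shortened to a path, and a path has fewer than `n` edges. -/
theorem reach_iff_reachable (H : SimpleGraph (Fin n)) (i j : Fin n) :
    reach H.Adj n i j ↔ H.Reachable i j := by
  rw [reach_iff]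
  constructor
  · rintro ⟨p, -⟩
    exact ⟨p⟩
  · rintro ⟨p⟩
    refine ⟨p.bypass, ?_⟩
    have := (p.bypass_isPath).length_lt
    rw [Fintype.card_fin] at this
    omega

/-- Partial products. -/
def pprod (f : Fin n → F) (t : ℕ) : F := ∏ l : Fin n, if (l : ℕ) < t then f l else 1

theorem pprod_zero (f : Fin n → F) : pprod f 0 = 1 := by simp [pprod]

theorem pprod_top (f : Fin n → F) : pprod f n = ∏ l, f l := by simp [pprod]

theorem pprod_succ (f : Fin n → F) {t : ℕ} (ht : t < n) :
    pprod f (t + 1) = pprod f t * f ⟨t, ht⟩ := by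
  rw [pprod, pprod, ← Finset.prod_erase_mul _ _ (Finset.mem_univ (⟨t, ht⟩ : Fin n)),
    ← Finset.prod_erase_mul _ _ (Finset.mem_univ (⟨t, ht⟩ : Fin n))]
  simp only [lt_add_iff_pos_right, zero_lt_one, if_true, lt_irrefl, if_false, mul_one]
  congr 1
  refine Finset.prod_congr rfl fun l hl => if_congr ?_ rfl rfl
  have : (l : ℕ) ≠ t := fun h => (Finset.mem_erase.1 hl).1 (Fin.ext h)
  omega

/-- The components are counted by their least vertices. -/
theorem prod_leaders (H : SimpleGraph (Fin n)) :
    ∏ v : Fin n, (if ∃ u, u < v ∧ H.Reachable u v then 1 else -1 : F) =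
      (-1) ^ Nat.card H.ConnectedComponent := by
  have h1 : ∏ v : Fin n, (if ∃ u, u < v ∧ H.Reachable u v then 1 else -1 : F) =
      (-1) ^ (Finset.univ.filter fun v : Fin n => ¬ ∃ u, u < v ∧ H.Reachable u v).card := by
    rw [Finset.prod_ite, Finset.prod_const_one, one_mul, Finset.prod_const]
  rw [h1, Nat.card_eq_fintype_card, ← Finset.card_univ]
  congr 1
  refine Finset.card_bij (fun v _ => H.connectedComponentMk v) (fun _ _ => Finset.mem_univ _) ?_ ?_
  · intro u hu v hv h
    simp only [Finset.mem_filter, Finset.mem_univ, true_and, not_exists, not_and] at hu hv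
    have hr : H.Reachable u v := SimpleGraph.ConnectedComponent.exact h
    rcases lt_trichotomy u v with h | h | h
    · exact absurd hr (hv u h)
    · exact h
    · exact absurd hr.symm (hu v h)
  · intro C _
    have hne : (Finset.univ.filter fun v => H.connectedComponentMk v = C).Nonempty := by
      obtain ⟨v, rfl⟩ := C.exists_rep
      exact ⟨v, by simp; rfl⟩
    refine ⟨Finset.min' _ hne, ?_, (Finset.mem_filter.1 (Finset.min'_mem _ hne)).2⟩
    simp only [Finset.mem_filter, Finset.mem_univ, true_and, not_exists, not_and]
    intro u hu hr
    refine absurd (Finset.min'_le _ u ?_) (not_le.2 hu)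
    rw [Finset.mem_filter]
    refine ⟨Finset.mem_univ _, ?_⟩
    rw [← (Finset.mem_filter.1 (Finset.min'_mem _ hne)).2]
    exact SimpleGraph.ConnectedComponent.sound hr

theorem prod_sym2_eq {R : Type*} [CommMonoid R] (c : Finset (Sym2 (Fin n))) (hc : ∀ v, s(v, v) ∉ c)
    (w : Sym2 (Fin n) → R) :
    ∏ x : Fin n, ∏ y : Fin n, (if x < y ∧ s(x, y) ∈ c then w s(x, y) else 1) = ∏ e ∈ c, w e := by
  rw [← Finset.prod_product', ← Finset.prod_filter]
  refine Finset.prod_bij (fun x _ => s(x.1, x.2)) ?_ ?_ ?_ fun _ _ => rfl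
  · intro x hx
    exact (Finset.mem_filter.1 hx).2.2
  · intro x hx y hy h
    have h1 := (Finset.mem_filter.1 hx).2.1
    have h2 := (Finset.mem_filter.1 hy).2.1
    rw [Sym2.eq_iff] at h
    rcases h with ⟨h3, h4⟩ | ⟨h3, h4⟩
    · exact Prod.ext h3 h4
    · rw [h3, h4] at h1
      exact absurd h1 h2.asymm
  · intro e he
    induction e with | _ x y
    rcases lt_trichotomy x y with h | rfl | h
    · exact ⟨(x, y), by simp [h, he], rfl⟩
    · exact absurd he (hc x)
    · exact ⟨(y, x), by simp [h, Sym2.eq_swap, he], Sym2.eq_swap⟩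

end Closure

end UDet

end


noncomputable section

namespace UDet

/-! ### Evaluation of a single cycle cover, and the common main program. -/

section Evaluation

open scoped Classical

variable {F : Type*} [Field F] {n : ℕ} {V : F → Prop}

/-- Field register `6` is multiplied by `-1` for each index that is least in its class for the
relation in matrix number `3`. -/
def leaders : Prog :=
  forLoop 10 0 (.seq (.fadd 1 9 9) (.seq
    (forLoop 11 0 (ifLt 11 10 (.seq (getF 2 (2 + 3) 11 10) (.fifZero 2 skip (.fone 1))) skip))
    (.fifZero 1 (.fsub 6 9 6) skip)))

theorem wp_leaders (g : Grading n V) {R : Fin n → Fin n → Prop} {r : F} {T : ℕ}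
    (hT : T ≤ 3 * (n * n)) {c : Core F} {Q : Core F → Prop} (hc : Env n c)
    (h3 : Holds n 3 (indicator F R) c) (hr : c.freg 6 = r) (hL : g.L T r)
    (hQ : ∀ c', Frame leaders c c' → Env n c' →
      c'.freg 6 = r * ∏ v : Fin n, (if ∃ u, u < v ∧ R u v then 1 else -1) → g.L T (c'.freg 6) → Q c') :
    wp n V leaders Q c := by
  set f : Fin n → F := fun v => if ∃ u, u < v ∧ R u v then 1 else -1 with hf
  refine wp_forLoop (fun k c' => c'.freg 6 = r * pprod f k ∧ g.L T (c'.freg 6)) hc.size le_rfl hc.one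
    rfl (by simp [pprod_zero, hr, hL]) (fun k hk c1 f1 r1 h1 => ?_) fun c1 f1 h1 => ?_
  · have hc1 := hc.of_frame f1 rfl
    set i : Fin n := ⟨k, hk⟩ with hi
    simp only [wp, hc1.zero, add_zero]
    refine ⟨g.V_zero, g.V_zero, g.V_zero, ?_⟩
    have hc1' := hc1.setF (by norm_num : 1 ≠ 9) 0
    refine wp_forLoop (fun t c' => c'.freg 1 =
      if ∃ l : Fin n, (l : ℕ) < t ∧ (l < i ∧ R l i) then 1 else 0) hc1'.size le_rfl hc1'.one rfl
      (by simp) (fun t ht c2 f2 r2 e2 => ?_) fun c2 f2 e2 => ?_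
    · have hc2 := hc1'.of_frame f2 rfl
      have r10 : c2.reg 10 = i := (f2.reg 10 rfl).trans r1
      have hm2 : c2.fmem = c.fmem := (f2.fmem rfl).trans (f1.fmem rfl)
      simp only [exists_lt_succ_iff ht]
      refine wp_ifLt r2 r10 (fun hlt x => ?_) fun hlt x => ?_
      · have hlt' : (⟨t, ht⟩ : Fin n) < i := hlt
        refine wp_getF (x := ⟨t, ht⟩) (y := i) (hc2.setN (by norm_num) _) (by norm_num) rfl
          (by simp [r2]) (by simp [r10]) (h3.congr hm2 _ _) (g.V_indicator _ _ _) ?_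
        simp only [wp, Core.freg_setF, if_true]
        refine ⟨g.V_indicator _ _ _, fun h => ?_, fun h => ?_⟩
        · rw [indicator_eq_zero] at h
          simp [skip, wp, h, e2]
        · rw [ne_eq, indicator_eq_zero, not_not] at h
          simp [h, hlt', g.V_one]
      · have hlt' : ¬ (⟨t, ht⟩ : Fin n) < i := hlt
        simp [skip, wp, e2, hlt']
    · have r6 : c2.freg 6 = c1.freg 6 := by
        rw [f2.freg 6 rfl]
        simp
      have hv : c2.freg 1 = if ∃ u, u < i ∧ R u i then 1 else 0 := by
        rw [e2]
        simp
      have e := pprod_succ f hk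
      simp only [hv]
      refine ⟨g.V_ite _, fun h0 => ?_, fun h0 => ?_⟩
      · have hno : ¬ ∃ u, u < i ∧ R u i := fun h => by simp [h] at h0
        have hfi : f ⟨k, hk⟩ = -1 := by simp only [hf, ← hi, if_neg hno]
        have h9 : c2.freg 9 = 0 := (hc1'.of_frame f2 rfl).zero
        simp only [h9, r6]
        have hL1 := g.L_neg h1.2
        refine ⟨g.V_zero, g.L_val h1.2 hT, g.L_val hL1 hT, ?_, ?_⟩
        · simp only [Core.freg_setN, Core.freg_setF, if_true]
          rw [e, hfi, h1.1]
          ring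
        · simpa only [Core.freg_setN, Core.freg_setF, if_true] using hL1
      · have hyes : ∃ u, u < i ∧ R u i := by
          by_contra h
          simp [h] at h0
        have hfi : f ⟨k, hk⟩ = 1 := by simp only [hf, ← hi, if_pos hyes]
        simp only [skip, wp, Core.freg_setN, r6]
        rw [e, hfi, mul_one]
        exact h1
  · refine hQ c1 f1 (hc.of_frame f1 rfl) ?_ h1.2
    rw [h1.1, pprod_top]

/-- Field register `6` is multiplied by the entries of matrix number `0` above the diagonal, at the
nonzero entries of matrix number `2`. -/
def productProg : Prog :=
  forLoop 10 0 (forLoop 11 0 (ifLt 10 11 (.seq (getF 2 (2 + 2) 10 11)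
    (.fifZero 2 skip (.seq (getF 2 (2 + 0) 10 11) (.fmul 6 6 2)))) skip))

/-- The elimination leaves a value counted by `2 * (n * n)`, and each of the `n * n` positions
contributes at most one more factor; this explains the `3 * (n * n)` in `Grading`. -/
theorem wp_productProg (g : Grading n V) {X : Fin n → Fin n → Prop} {W : Matrix (Fin n) (Fin n) F}
    (hW : ∀ i j, g.H 1 1 (W i j)) {r : F} {c : Core F} {Q : Core F → Prop} (hc : Env n c)
    (h2 : Holds n 2 (indicator F X) c) (h0 : Holds n 0 W c) (hr : c.freg 6 = r)
    (hL : g.L (2 * (n * n)) r)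
    (hQ : ∀ c', Frame productProg c c' → Env n c' →
      c'.freg 6 = r * ∏ x : Fin n, ∏ y : Fin n, (if x < y ∧ X x y then W x y else 1) →
      V (c'.freg 6) → Q c') :
    wp n V productProg Q c := by
  set f : Fin n → Fin n → F := fun x y => if x < y ∧ X x y then W x y else 1 with hf
  refine wp_forLoop (fun k c' => c'.freg 6 = r * pprod (fun x => ∏ y, f x y) k ∧
    g.L (2 * (n * n) + k * n) (c'.freg 6)) hc.size le_rfl hc.one rfl
    (by simp [pprod_zero, hr, hL]) (fun k hk c1 f1 r1 h1 => ?_) fun c1 f1 h1 => ?_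
  · have hc1 := hc.of_frame f1 rfl
    set i : Fin n := ⟨k, hk⟩ with hi
    refine wp_forLoop (fun t c' => c'.freg 6 = r * pprod (fun x => ∏ y, f x y) k * pprod (f i) t ∧
      g.L (2 * (n * n) + (k * n + t)) (c'.freg 6)) hc1.size le_rfl hc1.one rfl
      ?_ (fun t ht c2 f2 r2 e2 => ?_) fun c2 f2 e2 => ?_
    · rw [pprod_zero, mul_one, add_zero]
      exact h1
    · have hc2 := hc1.of_frame f2 rfl
      have r10 : c2.reg 10 = i := (f2.reg 10 rfl).trans r1
      have hm2 : c2.fmem = c.fmem := (f2.fmem rfl).trans (f1.fmem rfl)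
      have e := pprod_succ (f i) ht
      set j : Fin n := ⟨t, ht⟩ with hj
      have hbound : k * n + t < n * n := by simpa [cell] using cell_lt (b := 0) hk ht
      have hmono : ∀ {x}, g.L (2 * (n * n) + (k * n + t)) x → g.L (2 * (n * n) + (k * n + (t + 1))) x :=
        fun h => g.L_mono (by omega) h
      refine wp_ifLt r10 r2 (fun hlt x => ?_) fun hlt x => ?_
      · have hlt' : i < j := hlt
        refine wp_getF (x := i) (y := j) (hc2.setN (by norm_num) _) (by norm_num) rfl
          (by simp [r10]) (by simp [r2, hj]) (h2.congr hm2 _ _) (g.V_indicator _ _ _) ?_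
        simp only [wp, Core.freg_setF, if_true]
        refine ⟨g.V_indicator _ _ _, fun h => ?_, fun h => ?_⟩
        · rw [indicator_eq_zero] at h
          have hfi : f i j = 1 := by simp [hf, h]
          simp only [skip, wp, Core.freg_setN, Core.freg_setF, e, hfi, mul_one]
          exact ⟨e2.1, hmono e2.2⟩
        · rw [ne_eq, indicator_eq_zero, not_not] at h
          have hfi : f i j = W i j := by simp [hf, h, hlt']
          have hpos : 1 ≤ (2 * n) ^ n := Nat.one_le_pow _ _ (by omega)
          have hL1 := g.L_mul e2.2 (hW i j) hpos (by omega)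
          refine wp_getF (x := i) (y := j) (((hc2.setN (by norm_num) _).setN (by norm_num) _).setF
            (by norm_num) _) (by norm_num) rfl (by simp [r10]) (by simp [r2, hj]) (h0.congr hm2 _ _)
            (g.val (hW i j) hpos (by omega)) ?_
          simp only [Core.freg_setN, Core.freg_setF, if_true, if_neg (by norm_num : ¬ 6 = 2)]
          refine ⟨g.L_val e2.2 (by omega), g.val (hW i j) hpos (by omega), g.L_val hL1 (by omega), ?_, hL1⟩
          rw [e, hfi, e2.1]
          ring
      · have hlt' : ¬ i < j := hlt
        have hfi : f i j = 1 := by simp [hf, hlt']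
        simp only [skip, wp, Core.freg_setN, e, hfi, mul_one]
        exact ⟨e2.1, hmono e2.2⟩
    · rw [pprod_succ _ hk, ← mul_assoc, add_mul, one_mul, ← pprod_top (f i)]
      exact e2
  · refine hQ c1 f1 (hc.of_frame f1 rfl) ?_ (g.L_val h1.2 (by omega))
    rw [h1.1, pprod_top]

/-- Whether the entry of matrix number `0` is nonzero, and that of matrix number `1` is zero. -/
def coverEntry : Prog :=
  .seq (getF 1 (2 + 0) 10 11) (.fifZero 1 skip (.seq (getF 2 (2 + 1) 10 11)
    (.fifZero 2 (.fone 1) (.fadd 1 9 9))))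

/-- Field register `0` gets the signed weight of the cycle cover that consists of the positions where
matrix number `0` is not zero, and matrix number `1` is zero, times field register `6`. -/
def evalCover : Prog :=
  .seq (fill 2 coverEntry) (.seq closureProg (.seq leaders (.seq productProg (.fadd 0 6 9))))

theorem wp_evalCover (g : Grading n V) (hn : 0 < n) {W A : Matrix (Fin n) (Fin n) F}
    (hW : ∀ i j, g.H 1 1 (W i j)) (hA : ∀ i j, g.H 1 1 (A i j)) {X : Fin n → Fin n → Prop}
    (hX : ∀ x y, X x y ↔ W x y ≠ 0 ∧ A x y = 0) {c : Core F}
    {Q : Core F → Prop} (hc : Env n c) (h0 : Holds n 0 W c) (h1 : Holds n 1 A c)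
    (hL : g.L (2 * (n * n)) (c.freg 6))
    (hQ : ∀ c', c'.freg 0 = c.freg 6 * (∏ v : Fin n, (if ∃ u, u < v ∧ reach X n u v then 1 else -1)) *
      (∏ x : Fin n, ∏ y : Fin n, (if x < y ∧ X x y then W x y else 1)) → Q c') :
    wp n V evalCover Q c := by
  have hpos : 1 ≤ (2 * n) ^ n := Nat.one_le_pow _ _ (by omega)
  have VW : ∀ x y, V (W x y) := fun x y => g.val (hW x y) hpos (by omega)
  have VA : ∀ x y, V (A x y) := fun x y => g.val (hA x y) hpos (by omega)
  refine wp_fill hc (by norm_num) rfl (indicator F X) (fun i j c1 f1 hc1 hi hj hh1 _ => ?_)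
    fun c1 f1 hc1 h12 hh1 => ?_
  · refine wp_getF hc1 (by norm_num) rfl hi hj (hh1 0 W (by norm_num) h0 i j) (VW _ _) ?_
    simp only [wp, Core.freg_setF, if_true]
    refine ⟨VW _ _, fun h => ?_, fun h => ?_⟩
    · simp [skip, wp, indicator, hX, h, g.V_zero]
    · refine wp_getF (x := i) (y := j) ((hc1.setN (by norm_num) _).setF (by norm_num) _) (by norm_num)
        rfl (by simp [hi]) (by simp [hj]) (hh1 1 A (by norm_num) h1 i j) (VA _ _) ?_
      simp only [Core.freg_setF, if_true]
      refine ⟨VA _ _, fun h' => ?_, fun h' => ?_⟩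
      · simp [indicator, hX, h, h', g.V_one]
      · simp [indicator, hX, h', g.V_zero, hc1.zero]
  refine wp_closureProg g (X := X) (fun i j => (not_congr (indicator_eq_zero X i j)).trans not_not)
    (g.V_indicator X) hc1 h12 fun c2 f2 hc2 h23 hh2 => ?_
  refine wp_leaders g (r := c.freg 6) (by omega) hc2 h23 ?_ hL fun c3 f3 hc3 e3 L3 => ?_
  · rw [f2.freg 6 rfl, f1.freg 6 rfl]
  refine wp_productProg g hW hc3 ((hh2 2 _ (by norm_num) h12).congr (f3.fmem rfl))
    ((hh2 0 _ (by norm_num) (hh1 0 _ (by norm_num) h0)).congr (f3.fmem rfl)) e3 (e3 ▸ L3)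
    fun c4 f4 hc4 e4 V4 => ?_
  simp only [wp, hc4.zero, add_zero]
  exact ⟨V4, g.V_zero, V4, hQ _ (by simpa using e4)⟩

variable {G : SimpleGraph (Fin n)}

/-- The matrix of the weights. -/
def weightMatrix (G : SimpleGraph (Fin n)) (w : Sym2 (Fin n) → F) : Matrix (Fin n) (Fin n) F :=
  Matrix.of fun i j => if G.Adj i j then w s(i, j) else 0

/-- Field register `0` gets the undirected determinant, given the weights in matrix number `0`, and the
inverse skew symmetric matrix in matrix number `1`. -/
def mainProg : Prog := .seq elimProg evalCover

/-- After the reduction the nonzero entries of matrix number `1` form one perfect matching. The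
cover to be evaluated consists of the edges at which that matrix vanishes. -/
theorem wp_mainProg (g : Grading n V) (hn : 0 < n) (m : PlanarEmbedding G) (o : EdgeOrientation G)
    (hG : IsCubic G) (ho : o.IsSemiPfaffian) (hm : m.WithoutTension) {w : Sym2 (Fin n) → F}
    (hw : NonzeroWeights G w) (hW : ∀ i j, g.H 1 1 (weightMatrix G w i j))
    (hA : ∀ i j, g.H 1 1 (entrywiseInv (skewAdj o w) i j)) {c : Core F} (hc : Env n c)
    (h0 : Holds n 0 (weightMatrix G w) c) (h1 : Holds n 1 (entrywiseInv (skewAdj o w)) c) :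
    wp n V mainProg (fun c' => c'.freg 0 = udet G w) c := by
  refine wp_elimProg g hn hG.even hA (isAlt_entrywiseInv o w hw) hc h1 h0 fun c1 hc1 h => ?_
  obtain ⟨A, hred, hA1, hL, hW0⟩ := h
  have HA : ∀ x y, g.H 1 1 (A x y) := fun x y => by
    rcases hred.sub x y with h | h <;> rw [h]
    exacts [hA x y, g.zero]
  refine wp_evalCover g hn hW HA (fun x y => Iff.rfl) hc1 hW0 hA1 (by simpa using hL) fun c2 e => ?_
  rw [e]
  rcases hred.udet_eq m o hG ho hm w hw with ⟨hr, hu⟩ | ⟨μ, hμ, hAμ, hu⟩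
  · rw [hr, hu, zero_mul, zero_mul]
  · have hX : ∀ x y, (weightMatrix G w x y ≠ 0 ∧ A x y = 0) ↔ s(x, y) ∈ coverOf G μ := fun x y => by
      rw [mem_coverOf hμ.1, ne_eq (μ x), ← hAμ x y, not_not]
      refine and_congr_left fun _ => ?_
      by_cases h : G.Adj x y
      · simpa [weightMatrix, h] using hw _ h
      · simp [weightMatrix, h]
    have hXH : (fun x y => weightMatrix G w x y ≠ 0 ∧ A x y = 0) =
        (SimpleGraph.fromEdgeSet (coverOf G μ : Set (Sym2 (Fin n)))).Adj := by
      ext x y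
      rw [hX, SimpleGraph.fromEdgeSet_adj, Finset.mem_coe, mem_coverOf hμ.1]
      exact ⟨fun h => ⟨h, h.1.ne⟩, fun h => h.1⟩
    rw [hu, mul_assoc, numComponents, ← prod_leaders,
      ← prod_sym2_eq _ (fun v h => ((mem_coverOf hμ.1).1 h).1.ne rfl)]
    congr 2
    · refine Finset.prod_congr rfl fun v _ => ?_
      simp only [hXH, reach_iff_reachable]
      split_ifs
      all_goals rfl
    · refine Finset.prod_congr rfl fun x _ => Finset.prod_congr rfl fun y _ => ?_
      refine ite_congr (propext (and_congr_right fun _ => hX x y)) (fun h => ?_) fun _ => rfl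
      rw [weightMatrix, Matrix.of_apply, if_pos ((mem_coverOf hμ.1).1 h.2).1]

end Evaluation

end UDet

end


noncomputable section

namespace UDet

/-! ### Reading the input, and the algorithm for a given orientation. -/

section Input

open scoped Classical

variable {F : Type*} [Field F] {n : ℕ} {V : F → Prop} {G : SimpleGraph (Fin n)}

/-- Compute the parameters. -/
def setup : Prog :=
  .seq (.const 1 1) (.seq (.const 2 0) (.seq (.const 3 0) (.seq (.loop 0 (.add 3 3 0))
    (.seq (.add 4 3 3) (.seq (.add 5 4 3) (.seq (.add 6 5 3) (.sub 7 0 1)))))))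

/-- The square `n * n` is found by `n` additions, and its multiples, the bases of the matrices, by
further additions. -/
theorem wp_setup {c : Core F} {Q : Core F → Prop} (hn : c.reg 0 = n) (h9 : c.freg 9 = 0)
    (h : ∀ c', Env n c' → c'.mem = c.mem → c'.fmem = c.fmem → Q c') : wp n V setup Q c := by
  have key : ∀ k x (c : Core F) (Q : Core F → Prop), c.reg 3 = x → Q (c.setN 3 (x + k * c.reg 0)) →
      (fun (Q : Core F → Prop) (c : Core F) => Q (c.setN 3 (c.reg 3 + c.reg 0)))^[k] Q c := by
    intro k
    induction k with
    | zero =>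
      intro x c Q hx hQ
      have : c.setN 3 (x + 0 * c.reg 0) = c := by
        rw [zero_mul, add_zero, ← hx, Core.setN, Function.update_eq_self]
      rwa [this] at hQ
    | succ k ih =>
      intro x c Q hx hQ
      rw [Function.iterate_succ_apply']
      refine ih (x + c.reg 0) _ Q (by simp [hx]) ?_
      have : (c.setN 3 (c.reg 3 + c.reg 0)).setN 3
          (x + c.reg 0 + k * (c.setN 3 (c.reg 3 + c.reg 0)).reg 0) = c.setN 3 (x + (k + 1) * c.reg 0) := by
        simp only [Core.setN, Function.update_idem]
        congr 2
        rw [Function.update_of_ne (by norm_num)]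
        ring
      rwa [this]
  simp only [setup, wp]
  refine ⟨by simp [hn], key _ 0 _ _ (by simp) ?_⟩
  refine h _ ⟨by simp [hn], by simp, fun b hb => ?_, by simp [hn], h9⟩ rfl rfl
  interval_cases b <;> simp [hn] <;> ring

theorem input_holds (G : SimpleGraph (Fin n)) (r : Fin n → Fin n → Prop) (w : Sym2 (Fin n) → F) :
    Holds n 0 (weightMatrix G w) (input G r w).core := by
  intro i j
  change ∑ i' : Fin n, ∑ j' : Fin n, (if cell n 0 i j = i' * n + j' ∧ G.Adj i' j' then _ else _) = _
  have he : ∀ i' j' : Fin n, cell n 0 i j = i' * n + j' ↔ i' = i ∧ j' = j := fun i' j' => by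
    constructor
    · intro h
      obtain ⟨-, h1, h2⟩ := cell_injective (b := 0) (b' := 0) i.2 i'.2 j.2 j'.2 (by rw [h]; simp [cell])
      exact ⟨Fin.ext h1.symm, Fin.ext h2.symm⟩
    · rintro ⟨rfl, rfl⟩
      simp [cell]
  simp only [he]
  rw [Finset.sum_eq_single i, Finset.sum_eq_single j]
  · simp [weightMatrix]
  · intro j' _ h
    simp [h]
  · simp
  · intro i' _ h
    simp [h]
  · simp

theorem input_mem (G : SimpleGraph (Fin n)) (r : Fin n → Fin n → Prop) (w : Sym2 (Fin n) → F)
    (i j : Fin n) : (input G r w).core.mem (cell n 0 i j) = if r i j then 1 else 0 := by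
  change (if ∃ i' j' : Fin n, cell n 0 i j = i' * n + j' ∧ r i' j' then 1 else 0) = _
  refine if_congr ⟨?_, fun h => ⟨i, j, by simp [cell], h⟩⟩ rfl rfl
  rintro ⟨i', j', h, hr⟩
  obtain ⟨-, h1, h2⟩ := cell_injective (b := 0) (b' := 0) i.2 i'.2 j.2 j'.2 (by rw [h]; simp [cell])
  rwa [Fin.ext h1, Fin.ext h2]

/-- The entry of the inverse skew symmetric matrix, when `p` finds the sign. -/
def inverseEntry (p : Prog) : Prog :=
  .seq (getF 1 (2 + 0) 10 11) (.fifZero 1 skip (.seq (.fone 2) (.seq (.fdiv 1 2 1) p)))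

/-- The entries of the inverse skew symmetric matrix, by the direction of the edge. -/
theorem entrywiseInv_eq_ite (o : EdgeOrientation G) {w : Sym2 (Fin n) → F} (hw : NonzeroWeights G w)
    (x y : Fin n) : entrywiseInv (skewAdj o w) x y =
      if G.Adj x y then (if o.dir x y then (w s(x, y))⁻¹ else 0 - (w s(x, y))⁻¹) else 0 := by
  rw [skewAdj_inv_apply o w hw]
  split_ifs with h1 h2
  · rw [signAdj_eq o h1, if_pos h2]
    simp
  · rw [signAdj_eq o h1, if_neg h2]
    simp
  · have : signAdj o x y = 0 := by
      by_contra h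
      exact h1 ((signAdj_ne_zero_iff o x y).1 h)
    simp [this]

theorem wp_inverseEntry (g : Grading n V) (o : EdgeOrientation G) {w : Sym2 (Fin n) → F}
    (hw : NonzeroWeights G w) (hW : ∀ e ∈ G.edgeSet, g.H 1 1 (w e))
    (hI : ∀ e ∈ G.edgeSet, g.H 1 1 (w e)⁻¹) {p : Prog} {c : Core F} (hc : Env n c) {i j : Fin n}
    (hi : c.reg 10 = i) (hj : c.reg 11 = j) (h0 : Holds n 0 (weightMatrix G w) c)
    (hp : G.Adj i j → ∀ c', Env n c' → c'.reg 10 = i → c'.reg 11 = j → c'.mem = c.mem →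
      c'.fmem = c.fmem → c'.freg 1 = (w s(i, j))⁻¹ → wp n V p (fun c'' =>
        c''.freg 1 = if o.dir i j then (w s(i, j))⁻¹ else 0 - (w s(i, j))⁻¹) c') :
    wp n V (inverseEntry p) (fun c' => c'.freg 1 = entrywiseInv (skewAdj o w) i j ∧
      V (entrywiseInv (skewAdj o w) i j)) c := by
  have hn := i.pos
  have hpos : 1 ≤ (2 * n) ^ n := Nat.one_le_pow _ _ (by omega)
  rw [entrywiseInv_eq_ite o hw]
  by_cases h : G.Adj i j
  · have HW := hW s(i, j) h
    have HI := hI s(i, j) h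
    have e : weightMatrix G w i j = w s(i, j) := by simp [weightMatrix, h]
    have VW := g.val HW hpos hn
    have VI := g.val HI hpos hn
    refine wp_getF hc (by norm_num) rfl hi hj ((h0 i j).trans e) VW ?_
    simp only [wp, Core.freg_setF, if_true, if_pos h, if_neg (by norm_num : ¬ 1 = 2)]
    refine ⟨VW, fun h' => absurd h' (hw _ h), fun _ => ⟨g.V_one, g.V_one, VW, ?_, ?_⟩⟩
    · rwa [one_div]
    · have hV : V (if o.dir i j then (w s(i, j))⁻¹ else 0 - (w s(i, j))⁻¹) := by
        split_ifs
        exacts [VI, g.val (g.neg HI) hpos hn]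
      refine wp_mono (fun c'' h'' => ⟨h'', hV⟩) _ (hp h _ ((((hc.setN (by norm_num) _).setF
        (by norm_num) _).setF (by norm_num) _).setF (by norm_num) _) ?_ ?_ ?_ ?_ ?_)
      all_goals simp [hi, hj]
  · have e : weightMatrix G w i j = 0 := by simp [weightMatrix, h]
    refine wp_getF hc (by norm_num) rfl hi hj ((h0 i j).trans e) g.V_zero ?_
    simp [wp, skip, h, g.V_zero]

theorem H_weightMatrix (g : Grading n V) {w : Sym2 (Fin n) → F} (hW : ∀ e ∈ G.edgeSet, g.H 1 1 (w e))
    (i j : Fin n) : g.H 1 1 (weightMatrix G w i j) := by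
  simp only [weightMatrix, Matrix.of_apply]
  split_ifs with h
  exacts [hW _ h, g.zero]

theorem H_entrywiseInv (g : Grading n V) (o : EdgeOrientation G) {w : Sym2 (Fin n) → F}
    (hw : NonzeroWeights G w) (hI : ∀ e ∈ G.edgeSet, g.H 1 1 (w e)⁻¹) (i j : Fin n) :
    g.H 1 1 (entrywiseInv (skewAdj o w) i j) := by
  rw [entrywiseInv_eq_ite o hw]
  split_ifs with h
  exacts [hI _ h, g.neg (hI _ h), g.zero]

/-- Change the sign of field register `1` if the flag in the memory is not set. -/
def signByFlag : Prog :=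
  .seq (address 2 10 11) (.seq (.load 21 20) (.ifZero 21 (.fsub 1 9 1) skip))

theorem wp_signByFlag (V0 : V 0) {P : Prop} {x : F} (Vx : V x) (Vy : V (0 - x)) {c : Core F}
    (hc : Env n c) {i j : Fin n} (hi : c.reg 10 = i) (hj : c.reg 11 = j) (hx : c.freg 1 = x)
    (hm : c.mem (cell n 0 i j) = if P then 1 else 0) :
    wp n V signByFlag (fun c' => c'.freg 1 = if P then x else 0 - x) c := by
  refine wp_address (by rw [hi]; exact i.2.le) rfl ?_
  have e : c.reg 2 + c.reg 10 * c.reg 0 + c.reg 11 = cell n 0 i j := by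
    rw [hc.base 0 (by norm_num), hi, hj, hc.size, cell]
  simp only [wp, e, Core.reg_setN, Core.mem_setN, if_true, hm]
  split_ifs with h
  · simp [skip, wp, hx]
  · simp [-zero_sub, hx, hc.zero, V0, Vx, Vy]

/-- The empty graph is treated apart because there is no entry `(0, 0)` to hold a determinant; its
only cover is empty, with no components. -/
theorem udet_zero (G : SimpleGraph (Fin 0)) (w : Sym2 (Fin 0) → F) : udet G w = 1 := by
  have hcov : cycleCovers G = {∅} := by
    ext c
    rw [Finset.mem_singleton]
    constructor
    · intro _
      refine Finset.eq_empty_of_forall_notMem fun e => ?_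
      induction e with | _ x y
      exact x.elim0
    · rintro rfl
      rw [cycleCovers, Finset.mem_filter, Finset.mem_powerset]
      exact ⟨Finset.empty_subset _, fun v => v.elim0⟩
  have h : numComponents (∅ : Finset (Sym2 (Fin 0))) = 0 := by
    rw [numComponents, Nat.card_eq_zero]
    left
    refine ⟨fun C => ?_⟩
    obtain ⟨v, -⟩ := C.exists_rep
    exact v.elim0
  simp [udet, hcov, h]

/-- The algorithm for graphs that are given with a semi-Pfaffian orientation. -/
def orientedProg : Prog :=
  .ifZero 0 (.fone 0) (.seq setup (.seq (fill 1 (inverseEntry signByFlag)) mainProg))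

theorem wp_orientedProg (g : Grading n V) (m : PlanarEmbedding G) (o : EdgeOrientation G)
    (hG : IsCubic G) (ho : o.IsSemiPfaffian) (hm : m.WithoutTension) {w : Sym2 (Fin n) → F}
    (hw : NonzeroWeights G w) (hW : ∀ e ∈ G.edgeSet, g.H 1 1 (w e))
    (hI : ∀ e ∈ G.edgeSet, g.H 1 1 (w e)⁻¹) :
    wp n V orientedProg (fun c => c.freg 0 = udet G w) (input G o.dir w).core := by
  refine ⟨fun h => ?_, fun h => ?_⟩
  · obtain rfl : n = 0 := h
    exact ⟨g.V_one, by simp [udet_zero]⟩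
  · have hn : 0 < n := Nat.pos_of_ne_zero h
    have hpos : 1 ≤ (2 * n) ^ n := Nat.one_le_pow _ _ (by omega)
    refine wp_setup rfl rfl fun c1 hc1 hm1 hf1 => ?_
    have h0 := (input_holds G o.dir w).congr hf1
    refine wp_fill hc1 (by norm_num) rfl (entrywiseInv (skewAdj o w)) (fun i j c2 f2 hc2 hi hj hh2 _ => ?_)
      fun c2 f2 hc2 h1 hh2 => ?_
    · refine wp_inverseEntry g o hw hW hI hc2 hi hj (hh2 0 _ (by norm_num) h0)
        fun h c3 hc3 hi3 hj3 hm3 hf3 hx => ?_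
      refine wp_signByFlag g.V_zero (g.val (hI _ h) hpos hn) (g.val (g.neg (hI _ h)) hpos hn) hc3 hi3 hj3 hx ?_
      rw [hm3, f2.mem rfl, hm1, input_mem]
    · exact wp_mainProg g hn m o hG ho hm hw (H_weightMatrix g hW) (H_entrywiseInv g o hw hI) hc2
        (hh2 0 _ (by norm_num) h0) h1

end Input

end UDet

end


noncomputable section

namespace UDet

/-! ### The algorithm for bipartite graphs: finding an orientation. -/

section Bipartite

open scoped Classical

variable {F : Type*} [Field F] {n : ℕ} {V : F → Prop} {G : SimpleGraph (Fin n)}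

/-- There is a path of length two. -/
def TwoStep (G : SimpleGraph (Fin n)) (i j : Fin n) : Prop := ∃ l, G.Adj i l ∧ G.Adj l j

theorem reach_congr {X Y : Fin n → Fin n → Prop} (h : ∀ i j, i ≠ j → (X i j ↔ Y i j)) (k : ℕ) :
    reach X k = reach Y k := by
  induction k with
  | zero => rfl
  | succ k ih =>
    ext i j
    simp only [reach, ih]
    constructor
    all_goals
      rintro (h' | ⟨l, h1, h2⟩)
      · exact Or.inl h'
      · by_cases hl : l = j
        · exact Or.inl (hl ▸ h1)
        · exact Or.inr ⟨l, h1, by first | exact (h _ _ hl).1 h2 | exact (h _ _ hl).2 h2⟩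

/-- Loops of `X` do not matter for `reach`, so it is reachability in a simple graph, an equivalence
relation. -/
theorem reach_trans_right {X : Fin n → Fin n → Prop} (hX : ∀ i j, X i j → X j i) {u x y : Fin n}
    (h : X x y) : reach X n u x ↔ reach X n u y := by
  have key : ∀ i j, reach X n i j ↔ (SimpleGraph.fromRel X).Reachable i j := fun i j => by
    rw [← reach_iff_reachable, reach_congr (Y := (SimpleGraph.fromRel X).Adj)]
    intro i j hij
    rw [SimpleGraph.fromRel_adj]
    exact ⟨fun h => ⟨hij, Or.inl h⟩, fun h => h.2.elim id (hX _ _)⟩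
  rw [key, key]
  by_cases hxy : x = y
  · rw [hxy]
  · have ha : (SimpleGraph.fromRel X).Adj x y := (SimpleGraph.fromRel_adj _ _ _).2 ⟨hxy, Or.inl h⟩
    exact ⟨fun h => h.trans ha.reachable, fun h => h.trans ha.symm.reachable⟩

theorem reach_invariant {α : Type*} {X : Fin n → Fin n → Prop} (C : Fin n → α)
    (hC : ∀ i j, X i j → C i = C j) {k : ℕ} {i j : Fin n} (h : reach X k i j) : C i = C j := by
  induction k generalizing j with
  | zero => exact congrArg C h
  | succ k ih =>
    rcases h with h | ⟨l, h, hl⟩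
    · exact ih h
    · exact (ih h).trans (hC _ _ hl)

theorem reach_self (X : Fin n → Fin n → Prop) (k : ℕ) (i : Fin n) : reach X k i i := by
  induction k with
  | zero => rfl
  | succ k ih => exact Or.inl ih

/-- Of the indices less than `t` that have one of the properties `P` and `Q`, the last one has
property `P`. -/
def lastIn (P Q : Fin n → Prop) : ℕ → Prop
  | 0 => False
  | t + 1 => (∃ h : t < n, P ⟨t, h⟩) ∨ (¬ ∃ h : t < n, Q ⟨t, h⟩) ∧ lastIn P Q t

theorem lastIn_asymm {P Q : Fin n → Prop} (h : ∀ u, P u → ¬ Q u) (t : ℕ) (h1 : lastIn P Q t) :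
    ¬ lastIn Q P t := by
  induction t with
  | zero => exact h1.elim
  | succ t ih =>
    rintro (⟨h2, h3⟩ | ⟨h2, h3⟩)
    · rcases h1 with ⟨_, h4⟩ | ⟨h4, -⟩
      · exact h _ h4 h3
      · exact h4 ⟨h2, h3⟩
    · rcases h1 with h4 | ⟨-, h4⟩
      · exact h2 h4
      · exact ih h4 h3

theorem lastIn_total {P : Fin n → Prop} (Q : Fin n → Prop) {u : Fin n} (hu : P u) {t : ℕ}
    (ht : (u : ℕ) < t) : lastIn P Q t ∨ lastIn Q P t := by
  induction t with
  | zero => exact absurd ht (by omega)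
  | succ t ih =>
    by_cases hP : ∃ h : t < n, P ⟨t, h⟩
    · exact Or.inl (Or.inl hP)
    by_cases hQ : ∃ h : t < n, Q ⟨t, h⟩
    · exact Or.inr (Or.inl hQ)
    have hne : (u : ℕ) ≠ t := fun h => hP ⟨h ▸ u.2, by
      rwa [show (⟨t, h ▸ u.2⟩ : Fin n) = u from Fin.ext h.symm]⟩
    rcases ih (by omega) with h | h
    · exact Or.inl (Or.inr ⟨hQ, h⟩)
    · exact Or.inr (Or.inr ⟨hP, h⟩)

/-- The vertices that are connected with `v` by paths of even length. -/
def evenClass (G : SimpleGraph (Fin n)) (v : Fin n) (u : Fin n) : Prop := reach (TwoStep G) n u v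

/-- Two steps preserve the colour in any 2-colouring, while adjacent vertices have different
colours. -/
theorem evenClass_disjoint (hb : G.IsBipartite) {a b : Fin n} (h : G.Adj a b) (u : Fin n)
    (ha : evenClass G a u) : ¬ evenClass G b u := by
  obtain ⟨C⟩ := hb
  intro hb
  have hC : ∀ i j, TwoStep G i j → C i = C j := by
    rintro i j ⟨l, h1, h2⟩
    have h3 := C.valid h1
    have h4 := C.valid h2
    omega
  exact C.valid h ((reach_invariant C hC ha).symm.trans (reach_invariant C hC hb))

theorem evenClass_eq {u v x : Fin n} (h : G.Adj u v) (h' : G.Adj v x) :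
    evenClass G u = evenClass G x := by
  ext y
  exact reach_trans_right (fun i j ⟨l, h1, h2⟩ => ⟨l, h2.symm, h1.symm⟩) ⟨v, h, h'⟩

/-- The orientation of a bipartite graph such that all vertices are sources or sinks; in each component,
the largest vertex is a source. -/
def bipartiteOrientation (G : SimpleGraph (Fin n)) (hb : G.IsBipartite) : EdgeOrientation G where
  dir a b := G.Adj a b ∧ lastIn (evenClass G a) (evenClass G b) n
  adj_iff a b := by
    constructor
    · intro h
      rcases lastIn_total (P := evenClass G a) (evenClass G b) (reach_self (TwoStep G) n a) a.2 with h' | h'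
      · exact Or.inl ⟨h, h'⟩
      · exact Or.inr ⟨h.symm, h'⟩
    · rintro (h | h)
      · exact h.1
      · exact h.1.symm
  asymm a b h h' := lastIn_asymm (evenClass_disjoint hb h.1) n h.2 h'.2

/-- If there were directed edges `u → v → x`, the classes of `u` and `x` would coincide, and the
last vertex of the two classes would belong both to that of `u` and to that of `v`. -/
theorem bipartiteOrientation_isSemiPfaffian (hb : G.IsBipartite) :
    (bipartiteOrientation G hb).IsSemiPfaffian := by
  refine EdgeOrientation.isSemiPfaffian_of_sources _ fun u v x h h' => ?_
  refine lastIn_asymm (evenClass_disjoint hb h.1) n h.2 ?_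
  rw [evenClass_eq h.1 h'.1]
  exact h'.2

/-- Whether there is a path of length two. -/
def twoStepEntry : Prog :=
  .seq (.fadd 1 9 9) (forLoop 12 0 (.seq (getF 2 (2 + 0) 10 12) (.fifZero 2 skip
    (.seq (getF 2 (2 + 0) 12 11) (.fifZero 2 skip (.fone 1))))))

theorem weightMatrix_eq_zero {w : Sym2 (Fin n) → F} (hw : NonzeroWeights G w) (i j : Fin n) :
    weightMatrix G w i j = 0 ↔ ¬ G.Adj i j := by
  by_cases h : G.Adj i j
  · simpa [weightMatrix, h] using hw _ h
  · simp [weightMatrix, h]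

theorem wp_twoStepEntry (g : Grading n V) {w : Sym2 (Fin n) → F} (hw : NonzeroWeights G w)
    (hV : ∀ i j, V (weightMatrix G w i j)) {c : Core F}
    (hc : Env n c) {i j : Fin n} (hi : c.reg 10 = i) (hj : c.reg 11 = j)
    (h0 : Holds n 0 (weightMatrix G w) c) :
    wp n V twoStepEntry (fun c' => c'.freg 1 = indicator F (TwoStep G) i j ∧
      V (indicator F (TwoStep G) i j)) c := by
  simp only [twoStepEntry, wp, hc.zero, add_zero]
  refine ⟨g.V_zero, g.V_zero, g.V_zero, ?_⟩
  have hc1 := hc.setF (by norm_num : 1 ≠ 9) 0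
  refine wp_forLoop (fun t c' => c'.freg 1 =
    if ∃ l : Fin n, (l : ℕ) < t ∧ (G.Adj i l ∧ G.Adj l j) then 1 else 0) hc1.size le_rfl hc1.one rfl
    (by simp) (fun t ht c2 f2 r2 e2 => ?_) fun c2 f2 e2 => ?_
  · have hc2 := hc1.of_frame f2 rfl
    have hi2 : c2.reg 10 = i := (f2.reg 10 rfl).trans hi
    have hj2 : c2.reg 11 = j := (f2.reg 11 rfl).trans hj
    have hm2 : c2.fmem = c.fmem := f2.fmem rfl
    simp only [exists_lt_succ_iff ht]
    refine wp_getF (x := i) (y := ⟨t, ht⟩) hc2 (by norm_num) rfl hi2 r2 (h0.congr hm2 _ _) (hV _ _) ?_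
    simp only [wp, Core.freg_setF, if_true]
    refine ⟨hV _ _, fun h => ?_, fun h => ?_⟩
    · rw [weightMatrix_eq_zero hw] at h
      simp [skip, wp, h, e2]
    · rw [ne_eq, weightMatrix_eq_zero hw, not_not] at h
      refine wp_getF (x := ⟨t, ht⟩) (y := j) ((hc2.setN (by norm_num) _).setF (by norm_num) _)
        (by norm_num) rfl (by simp [r2]) (by simp [hj2]) (h0.congr hm2 _ _) (hV _ _) ?_
      simp only [Core.freg_setF, if_true]
      refine ⟨hV _ _, fun h' => ?_, fun h' => ?_⟩
      · rw [weightMatrix_eq_zero hw] at h'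
        simp [skip, wp, h', e2]
      · rw [ne_eq, weightMatrix_eq_zero hw, not_not] at h'
        simp [h, h', g.V_one]
  · rw [e2]
    refine ⟨?_, g.V_indicator _ _ _⟩
    simp only [Fin.is_lt, true_and, indicator, Matrix.of_apply]
    exact if_congr Iff.rfl rfl rfl

/-- Change the sign of field register `1` unless the last vertex that belongs to the class of one of the
ends belongs to that of the first one. -/
def signByClass : Prog :=
  .seq (.fadd 3 9 9) (.seq (forLoop 12 0 (.seq (getF 2 (2 + 3) 12 10) (.fifZero 2
    (.seq (getF 2 (2 + 3) 12 11) (.fifZero 2 skip (.fadd 3 9 9))) (.fone 3))))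
    (.fifZero 3 (.fsub 1 9 1) skip))

theorem wp_signByClass (g : Grading n V) {x : F} (Vx : V x) (Vy : V (0 - x)) {c : Core F}
    (hc : Env n c) {i j : Fin n} (hi : c.reg 10 = i) (hj : c.reg 11 = j) (hx : c.freg 1 = x)
    (h3 : Holds n 3 (indicator F (reach (TwoStep G) n)) c) :
    wp n V signByClass (fun c' => c'.freg 1 =
      if lastIn (evenClass G i) (evenClass G j) n then x else 0 - x) c := by
  simp only [signByClass, wp, hc.zero, add_zero]
  refine ⟨g.V_zero, g.V_zero, g.V_zero, ?_⟩
  have hc1 := hc.setF (by norm_num : 3 ≠ 9) 0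
  -- Later vertices override earlier ones, and vertices in neither class leave the flag alone; this
  -- is the recursion of `lastIn`.
  refine wp_forLoop (fun t c' => c'.freg 3 =
    if lastIn (evenClass G i) (evenClass G j) t then 1 else 0) hc1.size le_rfl hc1.one rfl
    (by simp [lastIn]) (fun t ht c2 f2 r2 e2 => ?_) fun c2 f2 e2 => ?_
  · have hc2 := hc1.of_frame f2 rfl
    have hi2 : c2.reg 10 = i := (f2.reg 10 rfl).trans hi
    have hj2 : c2.reg 11 = j := (f2.reg 11 rfl).trans hj
    have hm2 : c2.fmem = c.fmem := f2.fmem rfl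
    simp only [lastIn, ht, exists_true_left]
    refine wp_getF (x := ⟨t, ht⟩) (y := i) hc2 (by norm_num) rfl r2 hi2 (h3.congr hm2 _ _)
      (g.V_indicator _ _ _) ?_
    simp only [wp, Core.freg_setF, if_true]
    refine ⟨g.V_indicator _ _ _, fun h => ?_, fun h => ?_⟩
    · rw [indicator_eq_zero] at h
      have h : ¬ evenClass G i ⟨t, ht⟩ := h
      refine wp_getF (x := ⟨t, ht⟩) (y := j) ((hc2.setN (by norm_num) _).setF (by norm_num) _)
        (by norm_num) rfl (by simp [r2]) (by simp [hj2]) (h3.congr hm2 _ _) (g.V_indicator _ _ _) ?_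
      simp only [Core.freg_setF, if_true]
      refine ⟨g.V_indicator _ _ _, fun h' => ?_, fun h' => ?_⟩
      · rw [indicator_eq_zero] at h'
        have h' : ¬ evenClass G j ⟨t, ht⟩ := h'
        simp [skip, wp, h, h', e2]
      · rw [ne_eq, indicator_eq_zero, not_not] at h'
        have h' : evenClass G j ⟨t, ht⟩ := h'
        simp [h, h', hc2.zero, g.V_zero]
    · rw [ne_eq, indicator_eq_zero, not_not] at h
      have h : evenClass G i ⟨t, ht⟩ := h
      simp [h, g.V_one]
  · have r1 : c2.freg 1 = x := (f2.freg 1 rfl).trans hx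
    have h9 : c2.freg 9 = 0 := (hc1.of_frame f2 rfl).zero
    simp only [e2, h9, r1]
    refine ⟨g.V_ite _, fun h => ?_, fun h => ?_⟩
    · have : ¬ lastIn (evenClass G i) (evenClass G j) n := fun h' => by simp [h'] at h
      simp [-zero_sub, this, g.V_zero, Vx, Vy]
    · have : lastIn (evenClass G i) (evenClass G j) n := by
        by_contra h'
        simp [h'] at h
      simp [skip, wp, this, r1]

/-- The algorithm for bipartite graphs. -/
def bipartiteProg : Prog :=
  .ifZero 0 (.fone 0) (.seq setup (.seq (fill 2 twoStepEntry) (.seq closureProg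
    (.seq (fill 1 (inverseEntry signByClass)) mainProg))))

theorem wp_bipartiteProg (g : Grading n V) (m : PlanarEmbedding G) (hG : IsCubic G)
    (hb : G.IsBipartite) (r : Fin n → Fin n → Prop) {w : Sym2 (Fin n) → F}
    (hw : NonzeroWeights G w) (hW : ∀ e ∈ G.edgeSet, g.H 1 1 (w e))
    (hI : ∀ e ∈ G.edgeSet, g.H 1 1 (w e)⁻¹) :
    wp n V bipartiteProg (fun c => c.freg 0 = udet G w) (input G r w).core := by
  refine ⟨fun h => ?_, fun h => ?_⟩
  · obtain rfl : n = 0 := h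
    exact ⟨g.V_one, by simp [udet_zero]⟩
  · have hn : 0 < n := Nat.pos_of_ne_zero h
    have hpos : 1 ≤ (2 * n) ^ n := Nat.one_le_pow _ _ (by omega)
    set o := bipartiteOrientation G hb with ho
    have HW := H_weightMatrix g hW
    refine wp_setup rfl rfl fun c1 hc1 hm1 hf1 => ?_
    have h0 := (input_holds G r w).congr hf1
    refine wp_fill hc1 (by norm_num) rfl (indicator F (TwoStep G)) (fun i j c2 f2 hc2 hi hj hh2 _ => ?_)
      fun c2 f2 hc2 h2 hh2 => ?_
    · exact wp_twoStepEntry g hw (fun i j => g.val (HW i j) hpos hn) hc2 hi hj (hh2 0 _ (by norm_num) h0)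
    refine wp_closureProg g (X := TwoStep G)
      (fun i j => (not_congr (indicator_eq_zero _ i j)).trans not_not)
      (g.V_indicator _) hc2 h2 fun c3 f3 hc3 h3 hh3 => ?_
    have h03 := hh3 0 _ (by norm_num) (hh2 0 _ (by norm_num) h0)
    refine wp_fill hc3 (by norm_num) rfl (entrywiseInv (skewAdj o w)) (fun i j c4 f4 hc4 hi hj hh4 _ => ?_)
      fun c4 f4 hc4 h1 hh4 => ?_
    · refine wp_inverseEntry g o hw hW hI hc4 hi hj (hh4 0 _ (by norm_num) h03)
        fun h c5 hc5 hi5 hj5 hm5 hf5 hx => ?_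
      refine wp_mono (fun c6 e6 => ?_) _ (wp_signByClass (G := G) g (g.val (hI _ h) hpos hn)
        (g.val (g.neg (hI _ h)) hpos hn) hc5 hi5 hj5 hx ((hh4 3 _ (by norm_num) h3).congr hf5))
      rw [e6]
      exact if_congr (and_iff_right h).symm rfl rfl
    · exact wp_mainProg g hn m o hG (bipartiteOrientation_isSemiPfaffian hb)
        (bipartite_semiPfaffian m hG hb).2 hw HW (H_entrywiseInv g o hw hI) hc4
        (hh4 0 _ (by norm_num) h03) h1

end Bipartite

end UDet

end


noncomputable section

namespace UDet

/-! ## Running times -/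

section Bounds

open scoped Classical

/-- Without any bound. -/
def Grading.trivial (F : Type*) [Field F] (n : ℕ) : Grading n (fun _ : F => True) where
  H _ _ _ := True
  L _ _ := True
  zero := True.intro
  add _ _ := True.intro
  neg _ := True.intro
  mul _ _ := True.intro
  mono _ _ := True.intro
  val _ _ _ := True.intro
  L_zero := True.intro
  L_one := True.intro
  L_mono _ _ := True.intro
  L_neg _ := True.intro
  L_mul _ _ _ _ := True.intro
  L_div _ _ _ _ := True.intro
  L_val _ _ := True.intro

/-- The rational number `x` is a quotient of integers of absolute value at most `2 ^ k`. -/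
def IsRatio (k : ℕ) (x : ℚ) : Prop :=
  ∃ (p : ℤ) (q : ℕ), 0 < q ∧ x = p / q ∧ p.natAbs ≤ 2 ^ k ∧ q ≤ 2 ^ k

theorem IsRatio.zero (k : ℕ) : IsRatio k 0 :=
  ⟨0, 1, one_pos, by simp, by simp, Nat.one_le_two_pow⟩

theorem IsRatio.one (k : ℕ) : IsRatio k 1 :=
  ⟨1, 1, one_pos, by simp, by simpa using Nat.one_le_two_pow, Nat.one_le_two_pow⟩

theorem IsRatio.neg {k : ℕ} {x : ℚ} (h : IsRatio k x) : IsRatio k (0 - x) := by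
  obtain ⟨p, q, hq, rfl, hp, hq'⟩ := h
  exact ⟨-p, q, hq, by push_cast; ring, by rwa [Int.natAbs_neg], hq'⟩

theorem IsRatio.mono {k l : ℕ} (hkl : k ≤ l) {x : ℚ} (h : IsRatio k x) : IsRatio l x := by
  obtain ⟨p, q, hq, rfl, hp, hq'⟩ := h
  have := Nat.pow_le_pow_right two_pos hkl
  exact ⟨p, q, hq, rfl, hp.trans this, hq'.trans this⟩

theorem IsRatio.mul {k l : ℕ} {x y : ℚ} (h : IsRatio k x) (h' : IsRatio l y) :
    IsRatio (k + l) (x * y) := by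
  obtain ⟨p, q, hq, rfl, hp, hq'⟩ := h
  obtain ⟨p', q', hq1, rfl, hp1, hq1'⟩ := h'
  refine ⟨p * p', q * q', Nat.mul_pos hq hq1, ?_, ?_, ?_⟩
  · push_cast
    rw [div_mul_div_comm]
  · rw [Int.natAbs_mul, pow_add]
    exact Nat.mul_le_mul hp hp1
  · rw [pow_add]
    exact Nat.mul_le_mul hq' hq1'

theorem IsRatio.inv {k : ℕ} {x : ℚ} (h : IsRatio k x) : IsRatio k x⁻¹ := by
  obtain ⟨p, q, hq, rfl, hp, hq'⟩ := h
  by_cases h0 : p = 0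
  · subst h0
    simpa using IsRatio.zero k
  -- The sign moves to the new numerator, since denominators are positive.
  · refine ⟨p.sign * q, p.natAbs, Int.natAbs_pos.2 h0, ?_, ?_, hp⟩
    · have h1 : (p : ℚ) = p.sign * (p.natAbs : ℚ) := by
        rw [← Int.cast_natCast, ← Int.cast_mul, Int.sign_mul_natAbs]
      have h2 : (p.natAbs : ℚ) ≠ 0 := by exact_mod_cast Int.natAbs_ne_zero.2 h0
      have h3 : (p.sign : ℚ) * p.sign = 1 := by
        rcases lt_or_gt_of_ne h0 with h | h
        · simp [Int.sign_eq_neg_one_of_neg h]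
        · simp [Int.sign_eq_one_of_pos h]
      have h4 : (p : ℚ) ≠ 0 := by exact_mod_cast h0
      rw [inv_div, div_eq_div_iff h4 h2]
      push_cast
      rw [h1]
      linear_combination (-(q : ℚ) * p.natAbs) * h3
    · rwa [Int.natAbs_mul, Int.natAbs_sign_of_ne_zero h0, one_mul, Int.natAbs_natCast]

/-- In lowest terms the numerator and the denominator divide those of any other representation. -/
theorem IsRatio.bitSize_le {k : ℕ} {x : ℚ} (h : IsRatio k x) : bitSize x ≤ 2 * (k + 1) := by
  obtain ⟨p, q, hq, rfl, hp, hq'⟩ := h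
  have e : (p : ℚ) / q = Rat.divInt p (q : ℤ) := by
    rw [Rat.divInt_eq_div]
    push_cast
    rfl
  have h1 : ((p : ℚ) / q).num.natAbs ≤ 2 ^ k := by
    by_cases h0 : p = 0
    · simp [h0]
    · refine (Nat.le_of_dvd (Int.natAbs_pos.2 h0) (Int.natAbs_dvd_natAbs.2 ?_)).trans hp
      rw [e]
      exact Rat.num_dvd _ (by exact_mod_cast hq.ne')
  have h2 : ((p : ℚ) / q).den ≤ 2 ^ k := by
    refine (Nat.le_of_dvd hq ?_).trans hq'
    rw [e]
    exact_mod_cast Rat.den_dvd p q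
  have hlt : 2 ^ k < 2 ^ (k + 1) := Nat.pow_lt_pow_right one_lt_two (Nat.lt_succ_self k)
  have h3 := Nat.size_le.2 (h1.trans_lt hlt)
  have h4 := Nat.size_le.2 (h2.trans_lt hlt)
  rw [bitSize]
  omega

/-- Fractions with denominator `D ^ a`, of absolute value at most `c * D ^ a`. -/
def IsFraction (D : ℕ) (c a : ℕ) (x : ℚ) : Prop :=
  (∃ z : ℤ, x * D ^ a = z) ∧ |x| ≤ c * D ^ a

/-- Here `c ≤ (2 * n) ^ n ≤ 2 ^ (n * (n + 1))` and `D ^ a ≤ 2 ^ (N * n)`. The power of `D` enters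
the numerator twice, from the bound and from clearing the denominator. -/
theorem IsFraction.isRatio {n N D c a : ℕ} (hD : 0 < D) (hDN : D ≤ 2 ^ N) {x : ℚ}
    (h : IsFraction D c a x) (hc : c ≤ (2 * n) ^ n) (ha : a ≤ n) :
    IsRatio (n * (n + 1) + 2 * (N * n)) x := by
  obtain ⟨⟨z, hz⟩, hx⟩ := h
  have hD' : (0 : ℚ) < D ^ a := pow_pos (by exact_mod_cast hD) _
  have h1 : D ^ a ≤ 2 ^ (N * n) := by
    refine (Nat.pow_le_pow_left hDN a).trans ?_
    rw [← pow_mul]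
    exact Nat.pow_le_pow_right two_pos (Nat.mul_le_mul_left _ ha)
  have h2 : c ≤ 2 ^ (n * (n + 1)) := by
    refine hc.trans ?_
    rw [mul_comm n, pow_mul]
    refine Nat.pow_le_pow_left ?_ n
    rw [pow_succ, mul_comm]
    exact Nat.mul_le_mul_right _ Nat.lt_two_pow_self.le
  refine ⟨z, D ^ a, pow_pos hD a, ?_, ?_, ?_⟩
  · rw [← hz]
    push_cast
    rw [mul_div_cancel_right₀ _ hD'.ne']
  · have h3 : |(z : ℚ)| ≤ ((c * D ^ a * D ^ a : ℕ) : ℚ) := by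
      rw [← hz, abs_mul, abs_of_pos hD']
      push_cast
      exact mul_le_mul_of_nonneg_right hx hD'.le
    have h4 : z.natAbs ≤ c * D ^ a * D ^ a := by
      rw [← Int.cast_abs, Int.abs_eq_natAbs] at h3
      exact_mod_cast h3
    refine h4.trans ?_
    rw [pow_add, mul_assoc, two_mul, pow_add]
    exact Nat.mul_le_mul h2 (Nat.mul_le_mul h1 h1)
  · exact h1.trans (Nat.pow_le_pow_right two_pos (by omega))

/-- A bound for the sizes of all rational numbers that occur, if the weights have total size `N`. -/
def sizeBound (n N : ℕ) : ℕ :=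
  2 * ((3 * (n * n) + 1) * (n * (n + 1) + 2 * (N * n)) + 1)

/-- Bounds for rational numbers. -/
def Grading.rat (n : ℕ) {N D : ℕ} (hD : 0 < D) (hDN : D ≤ 2 ^ N) :
    Grading n (fun x => bitSize x ≤ sizeBound n N) where
  H := IsFraction D
  L t x := IsRatio (t * (n * (n + 1) + 2 * (N * n))) x
  zero := ⟨⟨0, by simp⟩, by rw [abs_zero]; positivity⟩
  add := by
    rintro c c' a x y ⟨⟨z, hz⟩, hx⟩ ⟨⟨z', hz'⟩, hy⟩
    refine ⟨⟨z + z', by rw [add_mul, hz, hz']; push_cast; rfl⟩, (abs_add_le x y).trans ?_⟩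
    push_cast
    rw [add_mul]
    exact add_le_add hx hy
  neg := by
    rintro c a x ⟨⟨z, hz⟩, hx⟩
    exact ⟨⟨-z, by rw [zero_sub, neg_mul, hz]; push_cast; rfl⟩, by rwa [zero_sub, abs_neg]⟩
  mul := by
    rintro c c' a x y ⟨⟨z, hz⟩, hx⟩ ⟨⟨z', hz'⟩, hy⟩
    refine ⟨⟨z * z', ?_⟩, ?_⟩
    · push_cast
      rw [← hz, ← hz']
      ring
    · rw [abs_mul]
      refine (mul_le_mul hx hy (abs_nonneg _) (by positivity)).trans_eq ?_
      push_cast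
      ring
  mono := by
    rintro c c' a x hcc ⟨hz, hx⟩
    refine ⟨hz, hx.trans (mul_le_mul_of_nonneg_right (by exact_mod_cast hcc) (by positivity))⟩
  -- The `+ 1` in the factor `3 * (n * n) + 1` of `sizeBound` keeps that factor positive for all
  -- `n`, so that a single value is covered as well.
  val h hc ha := ((h.isRatio hD hDN hc ha).mono (Nat.le_mul_of_pos_left _ (Nat.succ_pos _))).bitSize_le
  L_zero := IsRatio.zero _
  L_one := IsRatio.one _
  L_mono ht h := h.mono (Nat.mul_le_mul_right _ ht)
  L_neg h := h.neg
  L_mul h h' hc ha := by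
    rw [add_mul, one_mul]
    exact h.mul (h'.isRatio hD hDN hc ha)
  L_div h h' hc ha := by
    rw [add_mul, one_mul, div_eq_mul_inv]
    exact h.mul (h'.isRatio hD hDN hc ha).inv
  L_val h ht := (h.mono (Nat.mul_le_mul_right _ (ht.trans (Nat.le_succ _)))).bitSize_le

theorem eval_le_eval (p : Polynomial ℕ) {a b : ℕ} (h : a ≤ b) : p.eval a ≤ p.eval b := by
  rw [Polynomial.eval_eq_sum, Polynomial.eval_eq_sum]
  exact Finset.sum_le_sum fun i _ => Nat.mul_le_mul_left _ (Nat.pow_le_pow_left h i)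

/-- A bound for the running time of a program. -/
def timeBound (P : Prog) : Polynomial ℕ :=
  open Polynomial in
  steps P * (1 + 3 * (2 * ((3 * (X * X) + 1) * (X * (X + 1) + 2 * (X * X)) + 1)))

theorem eval_timeBound (P : Prog) (a : ℕ) :
    (timeBound P).eval a = (steps P).eval a * (1 + 3 * sizeBound a a) := by
  simp [timeBound, sizeBound]

theorem sizeBound_le {n N m : ℕ} (hn : n ≤ m) (hN : N ≤ m) : sizeBound n N ≤ sizeBound m m := by
  unfold sizeBound
  gcongr

variable {n : ℕ} {G : SimpleGraph (Fin n)}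

/-- The product of the numerators and denominators of all weights is a common denominator for the
weights and also for their inverses, it bounds their absolute values, and its length is at most the
total length of the weights. -/
theorem size_weights (w : Sym2 (Fin n) → ℚ) (hw : NonzeroWeights G w) :
    ∃ D : ℕ, 0 < D ∧ D ≤ 2 ^ (∑ e ∈ edges G, bitSize (w e)) ∧
      ∀ e ∈ G.edgeSet, IsFraction D 1 1 (w e) ∧ IsFraction D 1 1 (w e)⁻¹ := by
  have hpos : ∀ e ∈ edges G, 0 < (w e).num.natAbs * (w e).den := fun e he =>
    Nat.mul_pos (Int.natAbs_pos.2 (Rat.num_ne_zero.2 (hw e (by simpa [edges] using he)))) (w e).den_pos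
  refine ⟨∏ e ∈ edges G, (w e).num.natAbs * (w e).den, Finset.prod_pos hpos, ?_, fun e he => ?_⟩
  · rw [← Finset.prod_pow_eq_pow_sum]
    refine Finset.prod_le_prod' fun e _ => ?_
    rw [bitSize, pow_add]
    exact Nat.mul_le_mul (Nat.lt_size_self _).le (Nat.lt_size_self _).le
  · have he' : e ∈ edges G := by simpa [edges] using he
    set D := ∏ e ∈ edges G, (w e).num.natAbs * (w e).den with hD
    have hdvd : (w e).num.natAbs * (w e).den ∣ D := Finset.dvd_prod_of_mem _ he'
    have hD0 : 0 < D := Finset.prod_pos hpos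
    obtain ⟨m, hm⟩ := hdvd
    have key : ∀ x : ℚ, x ≠ 0 → D = x.num.natAbs * x.den * m → IsFraction D 1 1 x := by
      intro x hx h
      have hden : (x.den : ℚ) ≠ 0 := by exact_mod_cast x.den_ne_zero
      refine ⟨⟨x.num * (x.num.natAbs * m : ℕ), ?_⟩, ?_⟩
      · rw [pow_one, h]
        simp only [Nat.cast_mul, Int.cast_mul, Int.cast_natCast]
        have h1 : x * x.den = x.num := Rat.mul_den_eq_num x
        linear_combination ((x.num.natAbs : ℚ) * m) * h1
      · have h1 : |x| ≤ (x.num.natAbs : ℚ) := by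
          have h2 : |x| * x.den = (x.num.natAbs : ℚ) := by
            have h3 := congrArg abs (Rat.mul_den_eq_num x)
            rw [abs_mul, Nat.abs_cast] at h3
            rw [h3, ← Int.cast_abs, Int.abs_eq_natAbs, Int.cast_natCast]
          rw [← h2]
          exact le_mul_of_one_le_right (abs_nonneg x) (by exact_mod_cast x.den_pos)
        refine h1.trans ?_
        rw [pow_one, Nat.cast_one, one_mul]
        have : x.num.natAbs ∣ D := ⟨x.den * m, by rw [h, mul_assoc]⟩
        exact_mod_cast Nat.le_of_dvd hD0 this
    refine ⟨key _ (hw e he) hm, key _ (inv_ne_zero (hw e he)) ?_⟩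
    rw [hm, Rat.den_inv_of_ne_zero (hw e he), Rat.num_inv, Int.natAbs_mul,
      Int.natAbs_sign_of_ne_zero (Rat.num_ne_zero.2 (hw e he)), one_mul, Int.natAbs_natCast,
      mul_comm (w e).den]

/-- A correct program is a polynomial time algorithm. -/
theorem computesUdetWithin_of_wp.{v} {P : Prog} {r : Fin n → Fin n → Prop}
    (h : ∀ (F : Type v) [Field F] (w : Sym2 (Fin n) → F), NonzeroWeights G w →
      wp n (fun _ => True) P (fun c => c.freg 0 = udet G w) (input G r w).core)
    (h' : ∀ (V : ℚ → Prop) (g : Grading n V) (w : Sym2 (Fin n) → ℚ), NonzeroWeights G w →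
      (∀ e ∈ G.edgeSet, g.H 1 1 (w e)) → (∀ e ∈ G.edgeSet, g.H 1 1 (w e)⁻¹) →
      wp n V P (fun c => c.freg 0 = udet G w) (input G r w).core) :
    ComputesUdetWithin.{v} P (timeBound P) G r := by
  refine ⟨fun F _ w hw => ?_, fun w hw => ?_⟩
  · obtain ⟨h1, h2⟩ := wp_sound (size := fun _ => 0) (B := 0) (fun _ _ => le_rfl) P _ _ (h F w hw)
    refine ⟨h1, h2.trans ?_⟩
    rw [eval_timeBound]
    change 0 + _ ≤ _
    rw [zero_add]
    exact Nat.mul_le_mul_left _ (by omega)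
  · obtain ⟨D, hD, hDN, hH⟩ := size_weights w hw
    obtain ⟨h1, h2⟩ := wp_sound (size := bitSize) (fun _ h => h) P _ _
      (h' _ (Grading.rat n hD hDN) w hw (fun e he => (hH e he).1) fun e he => (hH e he).2)
    refine ⟨h1, h2.trans ?_⟩
    rw [eval_timeBound]
    change 0 + _ ≤ _
    rw [zero_add]
    have := sizeBound_le (n := n) (N := ∑ e ∈ edges G, bitSize (w e)) (Nat.le_add_right _ _)
      (Nat.le_add_left _ _)
    exact Nat.mul_le_mul (eval_le_eval _ (Nat.le_add_right _ _)) (by omega)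

end Bounds

end UDet

end

theorem theorem6p6 :
    -- the formula for the undirected determinant
    (∀ (F : Type u) [Field F] (n : ℕ) (G : SimpleGraph (Fin n)) (w : Sym2 (Fin n) → F)
        (m : PlanarEmbedding G) (o : EdgeOrientation G),
      IsCubic G → NonzeroWeights G w → o.IsSemiPfaffian → m.WithoutTension →
        udet G w = weightProd G w * pfaffian (entrywiseInv (skewAdj o w)) ∨
        udet G w = -(weightProd G w * pfaffian (entrywiseInv (skewAdj o w)))) ∧
    -- polynomial time, given the weighted graph and a semi-Pfaffian orientation of it
    (∃ (P : Prog) (q : Polynomial ℕ), ∀ (n : ℕ) (G : SimpleGraph (Fin n))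
        (m : PlanarEmbedding G) (o : EdgeOrientation G),
      IsCubic G → o.IsSemiPfaffian → m.WithoutTension →
        ComputesUdetWithin.{u} P q G o.dir) ∧
    -- bipartite cubic planar graphs are examples of such graphs
    (∀ (n : ℕ) (G : SimpleGraph (Fin n)) (m : PlanarEmbedding G), IsCubic G → G.IsBipartite →
      (∃ o : EdgeOrientation G, o.IsSemiPfaffian) ∧ m.WithoutTension) ∧
    -- for them, polynomial time, given the weighted graph only
    (∃ (P : Prog) (q : Polynomial ℕ), ∀ (n : ℕ) (G : SimpleGraph (Fin n)),
      Nonempty (PlanarEmbedding G) → IsCubic G → G.IsBipartite →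
        ComputesUdetWithin.{u} P q G G.Adj) := by
  refine ⟨fun F _ n G w m o hG hw ho hm => udet_eq_pfaffian m o hG ho hm w hw,
    ⟨orientedProg, timeBound orientedProg, fun n G m o hG ho hm => ?_⟩,
    fun n G m hG hb => bipartite_semiPfaffian m hG hb,
    ⟨bipartiteProg, timeBound bipartiteProg, fun n G ⟨m⟩ hG hb => ?_⟩⟩
  -- One verification for all gradings serves twice: the trivial grading counts steps over any
  -- field, and the arbitrary one is specialized to sizes of rational numbers.
  · exact computesUdetWithin_of_wp
      (fun F _ w hw => wp_orientedProg (Grading.trivial F n) m o hG ho hm hw (fun _ _ => True.intro)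
        fun _ _ => True.intro)
      fun V g w hw hW hI => wp_orientedProg g m o hG ho hm hw hW hI
  · exact computesUdetWithin_of_wp
      (fun F _ w hw => wp_bipartiteProg (Grading.trivial F n) m hG hb _ hw (fun _ _ => True.intro)
        fun _ _ => True.intro)
      fun V g w hw hW hI => wp_bipartiteProg g m hG hb _ hw hW hI
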